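/- Let $n\ge 2$, let $(N,h)$ be a smooth $(n-1)$-dimensional Riemannian manifold without boundary, and let $(M,g)$ be a compact smooth $n$-dimensional Riemannian manifold with smooth boundary $\partial M$ which is a Riemannian submanifold of the product $(\mathbb R\times N,\ dx_1^2+h)$ (for instance an admissible manifold, where $N$ is the interior of a simple manifold). Let $x_1:M\to\mathbb R$ be the first coordinate, $e_1=\partial_{x_1}$, let $\nu$ be the outward unit normal of $\partial M$, and let $\partial M_\pm=\{x\in\partial M:\ \pm\langle\nu,e_1\rangle_g\ge 0\}$. Let $T>0$, $M_T=(0,T)\times M$ and $\Sigma_\pm=(0,T)\times\partial M_\pm$. Let $q\in L^\infty(M_T;\mathbb C)$ and let $A=\sum_j A_j\,dx^j$ be a complex-valued, time-dependent one-form on $M$ with $A\in L^\infty(M_T)$ whose weak divergence in the space variable, $\delta_gA=|g|^{-1/2}\sum_{j,k}\partial_{x_j}(|g|^{1/2}g^{jk}A_k)$, also belongs to $L^\infty(M_T)$. Set $$\mathcal L_{A,q}u=\partial_tu-\sum_{j,k=1}^n\frac1{\sqrt{|g|}}(\partial_{x_j}+iA_j)\Big(\sqrt{|g|}\,g^{jk}(\partial_{x_k}+iA_k)u\Big)+qu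 .$$ Then there is a constant $C>0$, depending only on $M,T,A,q$, such that for every $\beta\in(1/\sqrt3,1)$ there is $\lambda_0>0$ such that, for all $\lambda\ge\lambda_0$, with $\varphi(t,x)=\lambda^2\beta^2t+\lambda x_1$, every $u\in C^2([0,T]\times M;\mathbb C)$ with $u(0,x)=0$ for $x\in M$ and $u(t,x)=0$ for $(t,x)\in(0,T)\times\partial M$ satisfies $$\begin{aligned}&\lambda^2\|e^{-\varphi}u\|_{L^2(M_T)}^2+\|e^{-\varphi(T,\cdot)}\nabla_gu(T,\cdot)\|_{L^2(M)}^2+\|e^{-\varphi}\nabla_gu\|_{L^2(M_T)}^2+\lambda\int_{\Sigma_+}|e^{-\varphi}\partial_\nu u|^2\,\langle\nu,e_1\rangle_g\,dS_g\,dt\\&\le C\Big(\|e^{-\varphi}\mathcal L_{A,q}u\|_{L^2(M_T)}^2+\lambda^2C\,\|e^{-\varphi(T,\cdot)}u(T,\cdot)\|_{L^2(M)}^2+\lambda\int_{\Sigma_-}|e^{-\varphi}\partial_\nu u|^2\,|\langle\nu,e_1\rangle_g|\,dS_g\,dt\Big).\end{aligned}$$ -/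

import Mathlib

open Set MeasureTheory
open scoped Manifold ContDiff Bundle

noncomputable section

namespace CarlemanParabolic

/-- The Euclidean space `ℝ^k`. -/
abbrev Euc (k : ℕ) : Type := EuclideanSpace ℝ (Fin k)

/-- The `j`-th standard basis vector of `ℝ^k`. -/
def stdVec {k : ℕ} (j : Fin k) : Euc k := EuclideanSpace.single j (1 : ℝ)

/-- Smooth Riemannian metrics on a manifold of dimension `m + 1` with boundary
(modelled on the half space `{y | 0 ≤ y 0}`). -/
abbrev MetricBdry (m : ℕ) (M : Type*) [TopologicalSpace M]
    [ChartedSpace (EuclideanHalfSpace (m + 1)) M] [IsManifold (𝓡∂ (m + 1)) ∞ M] :=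
  Bundle.ContMDiffRiemannianMetric (𝓡∂ (m + 1)) ∞ (Euc (m + 1))
    (fun x : M => TangentSpace (𝓡∂ (m + 1)) x)

/-- Smooth Riemannian metrics on a manifold of dimension `m` without boundary. -/
abbrev MetricNoBdry (m : ℕ) (N : Type*) [TopologicalSpace N]
    [ChartedSpace (Euc m) N] [IsManifold (𝓡 m) ∞ N] :=
  Bundle.ContMDiffRiemannianMetric (𝓡 m) ∞ (Euc m) (fun y : N => TangentSpace (𝓡 m) y)

section

variable {m : ℕ} {M : Type*} [TopologicalSpace M] [ChartedSpace (EuclideanHalfSpace (m + 1)) M]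

/-- Complex covectors at `x`: real-linear maps `T_x M → ℂ`. -/
abbrev CCovector (x : M) : Type := TangentSpace (𝓡∂ (m + 1)) x →L[ℝ] ℂ

/-- The (exterior) derivative `d f_x : T_x M → ℂ` of a complex function `f` on `M`. -/
def dC (f : M → ℂ) (x : M) : CCovector (m := m) x := mfderiv (𝓡∂ (m + 1)) 𝓘(ℝ, ℂ) f x

/-- The derivative `d f_x : T_x M → ℝ` of a real function `f` on `M`. -/
def dR (f : M → ℝ) (x : M) : TangentSpace (𝓡∂ (m + 1)) x →L[ℝ] ℝ :=
  mfderiv (𝓡∂ (m + 1)) 𝓘(ℝ, ℝ) f x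

variable [IsManifold (𝓡∂ (m + 1)) ∞ M]

/-! ### Pointwise linear algebra of the metric

The tangent space at `x` is identified by Mathlib with `ℝ^(m+1)` through the preferred chart at
`x`; `stdVec j` is then the `j`-th coordinate vector of that chart at `x`. -/

/-- The matrix `(g_jk)` of the metric at `x`. -/
def gram (g : MetricBdry m M) (x : M) : Matrix (Fin (m + 1)) (Fin (m + 1)) ℝ :=
  Matrix.of fun j k => g.inner x (stdVec j) (stdVec k)

/-- The complex bilinear pairing `⟨α, β⟩_g = ∑ g^{jk} α_j β_k` of two complex covectors at `x`. -/
def cometric (g : MetricBdry m M) (x : M) (α β : CCovector (m := m) x) : ℂ :=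
  ∑ j, ∑ k, (((gram g x)⁻¹ j k : ℝ) : ℂ) * (α (stdVec j) * β (stdVec k))

/-- The squared norm `|α|_g² = ∑ g^{jk} α_j conj(α_k)` of a complex covector at `x`. In particular
`covNormSq g x (dC f x) = |∇_g f (x)|_g²`. -/
def covNormSq (g : MetricBdry m M) (x : M) (α : CCovector (m := m) x) : ℝ :=
  ∑ j, ∑ k, (gram g x)⁻¹ j k * (α (stdVec j) * (starRingEnd ℂ) (α (stdVec k))).re

/-- The outward unit normal at a boundary point `x`: in coordinates `y` for which `M = {y 0 ≥ 0}`
near `x`, it is `-∇_g y_0 / |∇_g y_0|_g`, that is `ν^j = - g^{0j} / √g^{00}`. -/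
def outwardNormal (g : MetricBdry m M) (x : M) : TangentSpace (𝓡∂ (m + 1)) x :=
  ((-(1 / √((gram g x)⁻¹ 0 0))) • ∑ j, (gram g x)⁻¹ 0 j • stdVec j : Euc (m + 1))

/-- The normal derivative `∂_ν f` of a complex function (meaningful at boundary points). -/
def normalDeriv (g : MetricBdry m M) (f : M → ℂ) (x : M) : ℂ :=
  dC (m := m) f x (outwardNormal g x)

/-- The normal derivative `∂_ν f` of a real function (meaningful at boundary points). -/
def normalDerivReal (g : MetricBdry m M) (f : M → ℝ) (x : M) : ℝ :=
  dR (m := m) f x (outwardNormal g x)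

/-! ### Local coordinates, volume, surface measure, Laplacian -/

/-- The `j`-th coordinate vector field of the chart around `p`, at the point with coordinates
`y`. -/
def coordVec (p : M) (y : Euc (m + 1)) (j : Fin (m + 1)) :
    TangentSpace (𝓡∂ (m + 1)) ((extChartAt (𝓡∂ (m + 1)) p).symm y) :=
  mfderivWithin 𝓘(ℝ, Euc (m + 1)) (𝓡∂ (m + 1)) (extChartAt (𝓡∂ (m + 1)) p).symm
    (range (𝓡∂ (m + 1))) y (stdVec j)

/-- The matrix `(g_jk (y))` of the metric in the coordinates `y` of the chart around `p`. -/
def chartGram (g : MetricBdry m M) (p : M) (y : Euc (m + 1)) :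
    Matrix (Fin (m + 1)) (Fin (m + 1)) ℝ :=
  Matrix.of fun j k =>
    g.inner ((extChartAt (𝓡∂ (m + 1)) p).symm y) (coordVec p y j) (coordVec p y k)

/-- The measure `√|g| dy` of the chart around `p`, transported to `M`: this is the Riemannian
volume restricted to the domain of the chart. -/
def chartVolume [MeasurableSpace M] (g : MetricBdry m M) (p : M) : Measure M :=
  Measure.map (extChartAt (𝓡∂ (m + 1)) p).symm
    ((volume.restrict (extChartAt (𝓡∂ (m + 1)) p).target).withDensity
      fun y => ENNReal.ofReal √(chartGram g p y).det)

/-- The Riemannian volume measure `dV_g`. The measures `chartVolume g p` agree on the overlaps of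
charts, and their supremum is the measure which restricts to each of them. -/
def volumeMeasure [MeasurableSpace M] (g : MetricBdry m M) : Measure M :=
  ⨆ p : M, chartVolume g p

/-- The point `(0, z)` of the boundary hyperplane of the half space. -/
def hyperplanePt (z : Euc m) : Euc (m + 1) :=
  WithLp.toLp 2 (Fin.cons (0 : ℝ) (fun i => z i) : Fin (m + 1) → ℝ)

/-- The surface measure `√(det (g_jk)_{j,k ≥ 1}) dz` of the boundary part of the chart around `p`,
transported to `M`. -/
def chartSurface [MeasurableSpace M] (g : MetricBdry m M) (p : M) : Measure M :=
  Measure.map (fun z : Euc m => (extChartAt (𝓡∂ (m + 1)) p).symm (hyperplanePt z))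
    ((volume.restrict {z : Euc m | hyperplanePt z ∈ (extChartAt (𝓡∂ (m + 1)) p).target}).withDensity
      fun z => ENNReal.ofReal
        √((chartGram g p (hyperplanePt z)).submatrix Fin.succ Fin.succ).det)

/-- The Riemannian surface measure `dS_g` of `∂M`, as a measure on `M` carried by `∂M`. -/
def surfaceMeasure [MeasurableSpace M] (g : MetricBdry m M) : Measure M :=
  ⨆ p : M, chartSurface g p

/-- The Laplace-Beltrami operator
`Δ_g f = |g|^{-1/2} ∑_j ∂_j (|g|^{1/2} ∑_k g^{jk} ∂_k f)`, computed at `x` in the chart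
around `x`. -/
def laplaceBeltrami (g : MetricBdry m M) (f : M → ℂ) (x : M) : ℂ :=
  let y₀ := extChartAt (𝓡∂ (m + 1)) x x
  let F : Euc (m + 1) → ℂ := fun y => f ((extChartAt (𝓡∂ (m + 1)) x).symm y)
  let S : Set (Euc (m + 1)) := range (𝓡∂ (m + 1))
  ((1 / √(chartGram g x y₀).det : ℝ) : ℂ) *
    ∑ j, fderivWithin ℝ
      (fun y => ((√(chartGram g x y).det : ℝ) : ℂ) *
        ∑ k, (((chartGram g x y)⁻¹ j k : ℝ) : ℂ) * fderivWithin ℝ F S y (stdVec k))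
      S y₀ (stdVec j)

/-! ### The cylinder `M_T = (0,T) × M` and the coefficients -/

/-- The measure `dt dV_g` on `M_T = (0,T) × M`. -/
def cylMeasure [MeasurableSpace M] (g : MetricBdry m M) (T : ℝ) : Measure (ℝ × M) :=
  ((volume : Measure ℝ).restrict (Ioo 0 T)).prod (volumeMeasure g)

/-- The part of `∂M` where `∂_ν x₁ ≥ 0`. -/
def bdryPlus (g : MetricBdry m M) (x₁ : M → ℝ) : Set M :=
  {x | x ∈ (𝓡∂ (m + 1)).boundary M ∧ 0 ≤ normalDerivReal g x₁ x}

/-- The part of `∂M` where `∂_ν x₁ ≤ 0`. -/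
def bdryMinus (g : MetricBdry m M) (x₁ : M → ℝ) : Set M :=
  {x | x ∈ (𝓡∂ (m + 1)).boundary M ∧ normalDerivReal g x₁ x ≤ 0}

/-- The measure `dS_g dt` on the lateral boundary piece `(0,T) × B`, for `B ⊆ ∂M`. -/
def lateralMeasure [MeasurableSpace M] (g : MetricBdry m M) (T : ℝ) (B : Set M) :
    Measure (ℝ × M) :=
  (volume.restrict (Ioo 0 T)).prod ((surfaceMeasure g).restrict B)

/-- `A` is a (complex, time-dependent) one-form on `M_T` of class `L^∞`: its components in every
chart are measurable and `|A|_g` is essentially bounded. -/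
structure IsLInftyOneForm [MeasurableSpace M] (g : MetricBdry m M) (T : ℝ)
    (A : ℝ → (x : M) → CCovector (m := m) x) : Prop where
  measurable : ∀ (p : M) (j : Fin (m + 1)), AEStronglyMeasurable
    (fun z : ℝ × Euc (m + 1) => A z.1 ((extChartAt (𝓡∂ (m + 1)) p).symm z.2) (coordVec p z.2 j))
    ((volume.restrict (Ioo 0 T)).prod (volume.restrict (extChartAt (𝓡∂ (m + 1)) p).target))
  bounded : ∃ K : ℝ, ∀ᵐ z ∂(cylMeasure g T), covNormSq g z.2 (A z.1 z.2) ≤ K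

/-- `D` is the weak divergence `δ_g A = |g|^{-1/2} ∑ ∂_j (|g|^{1/2} g^{jk} A_k)` (in the space
variable) of the one-form `A`:
`∫_{M_T} ⟨A, dψ⟩_g = - ∫_{M_T} D ψ` for all test functions `ψ ∈ C_c^∞((0,T) × int M)`. -/
def IsWeakDivergence [MeasurableSpace M] (g : MetricBdry m M) (T : ℝ)
    (A : ℝ → (x : M) → CCovector (m := m) x) (D : ℝ → M → ℂ) : Prop :=
  ∀ ψ : ℝ → M → ℂ,
    ContMDiff (𝓘(ℝ, ℝ).prod (𝓡∂ (m + 1))) 𝓘(ℝ, ℂ) ∞ (fun z : ℝ × M => ψ z.1 z.2) →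
    HasCompactSupport (fun z : ℝ × M => ψ z.1 z.2) →
    tsupport (fun z : ℝ × M => ψ z.1 z.2) ⊆ Ioo 0 T ×ˢ (𝓡∂ (m + 1)).interior M →
    ∫ z, cometric g z.2 (A z.1 z.2) (dC (m := m) (ψ z.1) z.2) ∂(cylMeasure g T) =
      -∫ z, D z.1 z.2 * ψ z.1 z.2 ∂(cylMeasure g T)

/-- The convection-diffusion operator
`L_{A,q} u = ∂_t u - |g|^{-1/2} ∑ (∂_j + i A_j) (|g|^{1/2} g^{jk} (∂_k + i A_k) u) + q u`
applied to a `C²` function `u`, where `D = δ_g A` is the (weak) divergence of `A`. Expanding the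
derivative of the product, it reads
`∂_t u - Δ_g u - 2 i ⟨A, du⟩_g - i (δ_g A) u + ⟨A, A⟩_g u + q u`. -/
def convDiff (g : MetricBdry m M) (A : ℝ → (x : M) → CCovector (m := m) x) (D q : ℝ → M → ℂ)
    (u : ℝ → M → ℂ) (t : ℝ) (x : M) : ℂ :=
  deriv (fun s => u s x) t - laplaceBeltrami g (u t) x
    - 2 * Complex.I * cometric g x (A t x) (dC (m := m) (u t) x)
    - Complex.I * D t x * u t x
    + cometric g x (A t x) (A t x) * u t x
    + q t x * u t x

/-- `x ↦ (x₁ x, x' x)` realises `(M, g)` as a Riemannian submanifold (of full dimension) of the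
product `ℝ × N` with the product metric `(dx₁)² + h`. -/
structure IsProductEmbedding {N : Type*} [TopologicalSpace N] [ChartedSpace (Euc m) N]
    [IsManifold (𝓡 m) ∞ N] (g : MetricBdry m M) (h : MetricNoBdry m N)
    (x₁ : M → ℝ) (x' : M → N) : Prop where
  smooth_fst : ContMDiff (𝓡∂ (m + 1)) 𝓘(ℝ, ℝ) ∞ x₁
  smooth_snd : ContMDiff (𝓡∂ (m + 1)) (𝓡 m) ∞ x'
  injective : Function.Injective fun x => (x₁ x, x' x)
  isometric : ∀ (x : M) (v w : TangentSpace (𝓡∂ (m + 1)) x),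
    g.inner x v w =
      dR x₁ x v * dR x₁ x w
      + h.inner (x' x) (mfderiv (𝓡∂ (m + 1)) (𝓡 m) x' x v) (mfderiv (𝓡∂ (m + 1)) (𝓡 m) x' x w)

/-- The factor `e^{-φ}` for the weight `φ(t,x) = λ² β² t + λ x₁`. -/
def expWeight (lam β : ℝ) (x₁ : M → ℝ) (t : ℝ) (x : M) : ℝ :=
  Real.exp (-(lam ^ 2 * β ^ 2 * t + lam * x₁ x))

end

end CarlemanParabolic

end

set_option linter.unusedSectionVars false

noncomputable section

namespace CarlemanParabolic

/-! The proof convexifies the weight. For a constant s chosen before lam, put a = lam²β², F = lam -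
s x₁ and ρ = exp(-(a t + lam x₁ - s x₁²/2)). If |x₁| ≤ B on the compact manifold, then ρ² lies
between e^{-2φ} and Θ e^{-2φ} with Θ = exp(s B²), so an estimate with weight ρ gives one with weight
e^{-φ} at the cost of a factor that does not depend on lam or β.

In the product metric, ∇x₁ is a unit field, divergence free and Killing. Put v = ρu and X = ⟨∇x₁,
∇v⟩. The first two facts give ρ(∂_t - Δ)u = S v + R v, where S v = -Δv + (a - F²)v is symmetric and
R v = ∂_t v - 2F X + s v is antisymmetric up to boundary terms. Expand the square of the sum and
integrate the cross term 2⟨Sv, Rv⟩ by parts. Its time part is the energy ∫ |∇v|² + (a - F²)v² at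
time T, because v vanishes at time 0 (`integral_commutator_time`). In its space part the Killing
property identifies 2⟨∇X, ∇v⟩ with the derivative of |∇v|² along ∇x₁, so no second derivative of v
survives. What remains is 4sX² + 4sF²v² in the interior and 2F(∂_ν v)²∂_ν x₁ on the boundary, where
the Dirichlet condition makes ∇v normal (`integral_commutator_space`). The interior terms are
proportional to s: positivity comes entirely from the convexification.

The term X² sees only one direction of the gradient. The full gradient comes from ∫ (vΔv + |∇v|²) =
0, used with factor s/8 and paid for by ‖Sv‖² (`conjugated_pointwise`). The outcome is a bound on
s∫(|∇v|² + lam²v²), which is turned back into a bound for u (`carleman_heat`) and added over real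
and imaginary parts (`carleman_heat_complex`).

The lower order part of the operator costs 2K∫ρ²(|∇u|² + |u|²), where K depends on the essential
bounds of the coefficients. The choice s = 128(2K + 1) absorbs it, so s, and with it Θ, is fixed
independently of lam. Taking lam large keeps F between lam/2 and 2lam, and the lateral integral is
then split by the sign of ∂_ν x₁ (`lateral_lower_bound`).

The rest is geometry. Pointwise objects are defined through the preferred chart at each point and
the measures as suprema of chart measures, so chart independence has to be proved. For the Laplacian
it follows from the Piola identity at interior points and by density at the boundary (`locLap_tau`);
for the measures, from change of variables (`volumeMeasure_restrict`, `surfaceMeasure_restrict`).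
Green's formula (`green`) follows from the divergence theorem on a half space and a partition of
unity. The three facts on x₁ are `gam_self_eq_one`, `lap_fst_eq_zero` and `gam_fst_gam`; they are
proved at interior points, which suffices because the boundary has volume zero. -/

/-- The coefficients of a smooth metric in a chart are smooth. -/
theorem contDiffOn_metric_chart {k : ℕ} {H : Type*} [TopologicalSpace H]
    {I : ModelWithCorners ℝ (Euc k) H} {X : Type*} [TopologicalSpace X] [ChartedSpace H X]
    [IsManifold I ∞ X]
    (g : Bundle.ContMDiffRiemannianMetric I ∞ (Euc k) (fun x : X => TangentSpace I x))
    (p : X) (a b : Euc k) :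
    ContDiffOn ℝ ∞ (fun y : Euc k => g.inner ((extChartAt I p).symm y)
      (mfderivWithin 𝓘(ℝ, Euc k) I (extChartAt I p).symm (range I) y a)
      (mfderivWithin 𝓘(ℝ, Euc k) I (extChartAt I p).symm (range I) y b)) (extChartAt I p).target := by
  rw [← contMDiffOn_iff_contDiffOn]
  have hsymm := contMDiffOn_extChartAt_symm (I := I) (n := ∞) p
  have hU : UniqueMDiffOn 𝓘(ℝ, Euc k) (extChartAt I p).target :=
    (uniqueDiffOn_extChartAt_target p).uniqueMDiffOn
  -- A coordinate field with constant components is the tangent map of the inverse chart applied to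
  -- a constant section, hence smooth along the inverse chart. The metric is then a smooth bundle
  -- map applied to two such sections.
  have key : ∀ a : Euc k, ContMDiffOn 𝓘(ℝ, Euc k) (I.prod 𝓘(ℝ, Euc k)) ∞
      (fun y : Euc k => (Bundle.TotalSpace.mk' (Euc k) ((extChartAt I p).symm y)
        (mfderivWithin 𝓘(ℝ, Euc k) I (extChartAt I p).symm (range I) y a) : TangentBundle I X))
      (extChartAt I p).target := by
    intro a
    have h1 := hsymm.contMDiffOn_tangentMapWithin (m := ∞) (by simp) hU
    have h2 : ContMDiff 𝓘(ℝ, Euc k) (𝓘(ℝ, Euc k).prod 𝓘(ℝ, Euc k)) ∞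
        (fun y : Euc k => (⟨y, a⟩ : TangentBundle 𝓘(ℝ, Euc k) (Euc k))) := by
      intro y
      rw [Bundle.contMDiffAt_totalSpace]
      refine ⟨contMDiff_id y, ?_⟩
      simpa using contMDiffAt_const
    have h3 := h1.comp h2.contMDiffOn (s := (extChartAt I p).target) (fun y hy => hy)
    refine h3.congr fun y hy => ?_
    simp only [Function.comp, tangentMapWithin]
    congr 1
    rw [(mdifferentiableWithinAt_extChartAt_symm hy).mfderivWithin_mono (hU y hy)
      (extChartAt_target_subset_range p)]
  have hg : ContMDiffOn 𝓘(ℝ, Euc k) (I.prod 𝓘(ℝ, Euc k →L[ℝ] Euc k →L[ℝ] ℝ)) ∞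
      (fun y : Euc k => Bundle.TotalSpace.mk' (Euc k →L[ℝ] Euc k →L[ℝ] ℝ)
        (E := fun x : X => TangentSpace I x →L[ℝ] TangentSpace I x →L[ℝ] ℝ)
        ((extChartAt I p).symm y) (g.inner ((extChartAt I p).symm y))) (extChartAt I p).target :=
    g.contMDiff.comp_contMDiffOn hsymm
  have := ContMDiffOn.clm_bundle_apply₂ (F₃ := ℝ) (E₃ := Bundle.Trivial X ℝ) hg (key a) (key b)
  intro y hy
  have h4 := this y hy
  rw [Bundle.contMDiffWithinAt_totalSpace] at h4
  simpa using h4.2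

/-! ### Linear algebra of frames and of the covector pairing -/

theorem stdVec_apply {k : ℕ} (i l : Fin k) : (stdVec i : Euc k) l = if i = l then 1 else 0 := by
  simp [stdVec, eq_comm]

theorem sum_smul_stdVec_apply {k : ℕ} (x : Fin k → ℝ) (l : Fin k) :
    (∑ i, x i • stdVec i : Euc k) l = x l := by
  simp [stdVec_apply]

theorem eq_sum_stdVec {k : ℕ} (v : Euc k) : v = ∑ i, v i • stdVec i := by
  ext l
  exact (sum_smul_stdVec_apply _ l).symm

/-- A bilinear form transforms under a linear change of frame. -/
theorem bilin_frame {k : ℕ} (B : Euc k →L[ℝ] Euc k →L[ℝ] ℝ) (L : Euc k →L[ℝ] Euc k) :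
    (Matrix.of fun i j => B (L (stdVec i)) (L (stdVec j))) =
      (Matrix.of fun i j => (L (stdVec j)) i).transpose * (Matrix.of fun i j => B (stdVec i) (stdVec j))
        * (Matrix.of fun i j => (L (stdVec j)) i) := by
  have hv := @eq_sum_stdVec k
  ext i j
  simp only [Matrix.of_apply, Matrix.mul_apply, Matrix.transpose_apply]
  conv_lhs => rw [hv (L (stdVec i)), hv (L (stdVec j))]
  simp only [map_sum, map_smul, sum_apply, smul_apply, smul_eq_mul,
    Finset.mul_sum, Finset.sum_mul]
  refine Finset.sum_congr rfl fun a _ => Finset.sum_congr rfl fun b _ => by ring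

theorem linform_frame {k : ℕ} (α : Euc k →L[ℝ] ℝ) (L : Euc k →L[ℝ] Euc k) :
    (fun j => α (L (stdVec j))) =
      (Matrix.of fun i j => (L (stdVec j)) i).transpose.mulVec (fun i => α (stdVec i)) := by
  have hv := @eq_sum_stdVec k
  ext j
  conv_lhs => rw [hv (L (stdVec j))]
  simp [Matrix.mulVec, dotProduct]

/-- The pairing of covectors defined by a metric matrix. -/
def coPair {k : ℕ} (G : Matrix (Fin k) (Fin k) ℝ) (a b : Fin k → ℝ) : ℝ :=
  a ⬝ᵥ (G⁻¹.mulVec b)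

/-- The inverse metric carries P⁻¹ on one side and its transpose on the other, and these cancel the
factors of the two covectors. This is the chart independence of ⟨df, dk⟩. -/
theorem coPair_frame {k : ℕ} (G P : Matrix (Fin k) (Fin k) ℝ) (hP : IsUnit P.det)
    (a b : Fin k → ℝ) :
    coPair (P.transpose * G * P) (P.transpose.mulVec a) (P.transpose.mulVec b) = coPair G a b := by
  have hPt : IsUnit P.transpose.det := by rwa [Matrix.det_transpose]
  unfold coPair
  rw [Matrix.mul_inv_rev, Matrix.mul_inv_rev, Matrix.mulVec_mulVec, Matrix.mul_assoc,
    Matrix.mul_assoc, Matrix.nonsing_inv_mul _ hPt, Matrix.mul_one, ← Matrix.mulVec_mulVec,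
    Matrix.mulVec_transpose, ← Matrix.dotProduct_mulVec, Matrix.mulVec_mulVec,
    Matrix.mul_nonsing_inv _ hP, Matrix.one_mulVec]

theorem isUnit_det_of_isInvertible {k : ℕ} (L : Euc k →L[ℝ] Euc k) (hL : L.IsInvertible) :
    IsUnit (Matrix.of fun i j => (L (stdVec j)) i).det := by
  obtain ⟨e, he⟩ := hL
  have hv := @eq_sum_stdVec k
  apply Matrix.isUnit_det_of_left_inverse (B := Matrix.of fun i j => (e.symm (stdVec j)) i)
  ext i j
  have h1 : e.symm (L (stdVec j)) = stdVec j := by rw [← he]; simp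
  have h2 := congrArg (fun v : Euc k => v i) h1
  rw [hv (L (stdVec j))] at h2
  simp only [map_sum, map_smul] at h2
  simp only [Matrix.mul_apply, Matrix.of_apply, Matrix.one_apply]
  rw [stdVec_apply] at h2
  simp only [eq_comm (a := i)]
  rw [← h2]
  simp [mul_comm]

theorem posDef_bilin {k : ℕ} (B : Euc k →L[ℝ] Euc k →L[ℝ] ℝ) (hs : ∀ v w, B v w = B w v)
    (hp : ∀ v, v ≠ 0 → 0 < B v v) : (Matrix.of fun i j => B (stdVec i) (stdVec j)).PosDef := by
  refine Matrix.PosDef.of_dotProduct_mulVec_pos ?_ ?_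
  · ext i j
    simp [hs (stdVec i)]
  · intro x hx
    have h1 := hp (∑ i, x i • stdVec i) (by
      intro h0
      apply hx
      ext l
      have := congrArg (fun v : Euc k => v l) h0
      rwa [sum_smul_stdVec_apply] at this)
    convert! h1 using 1
    simp only [map_sum, map_smul, sum_apply, smul_apply, smul_eq_mul,
      dotProduct, Matrix.mulVec, Matrix.of_apply, Finset.mul_sum, star_trivial]
    refine Finset.sum_comm.trans (Finset.sum_congr rfl fun a _ => Finset.sum_congr rfl fun b _ => ?_)
    rw [hs]; ring

/-! ### Tensors in charts and their behaviour under coordinate changes -/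

section chartCalculus

variable {m : ℕ} {M : Type*} [TopologicalSpace M] [ChartedSpace (EuclideanHalfSpace (m + 1)) M]

/-- The partial derivative `∂_j F` within the half space. -/
def pd (F : Euc (m + 1) → ℝ) (y : Euc (m + 1)) (j : Fin (m + 1)) : ℝ :=
  fderivWithin ℝ F (range (𝓡∂ (m + 1))) y (stdVec j)

/-- The representation of a function on `M` in the chart around `p`. -/
def rep {V : Type*} (p : M) (f : M → V) (y : Euc (m + 1)) : V :=
  f ((extChartAt (𝓡∂ (m + 1)) p).symm y)

/-- The `j`-th component of `√|G| G⁻¹ dF`. -/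
def flux (G : Euc (m + 1) → Matrix (Fin (m + 1)) (Fin (m + 1)) ℝ) (F : Euc (m + 1) → ℝ)
    (j : Fin (m + 1)) (y : Euc (m + 1)) : ℝ :=
  √(G y).det * ((G y)⁻¹.mulVec (pd F y)) j

/-- The Laplacian of `F` in coordinates with metric matrix `G`. -/
def locLap (G : Euc (m + 1) → Matrix (Fin (m + 1)) (Fin (m + 1)) ℝ) (F : Euc (m + 1) → ℝ)
    (y : Euc (m + 1)) : ℝ :=
  1 / √(G y).det * ∑ j, pd (flux G F j) y j

theorem uniqueDiffOn_halfSpace : UniqueDiffOn ℝ (range (𝓡∂ (m + 1))) := (𝓡∂ (m + 1)).uniqueDiffOn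

variable [IsManifold (𝓡∂ (m + 1)) ∞ M]

instance isManifoldOne : IsManifold (𝓡∂ (m + 1)) 1 M := IsManifold.of_le (n := ∞) (by simp)

/-- The pairing `⟨df, dk⟩_g` of the differentials of two real functions. -/
def gam (g : MetricBdry m M) (f k : M → ℝ) (x : M) : ℝ :=
  coPair (gram g x) (fun j => dR f x (stdVec j)) (fun j => dR k x (stdVec j))

/-- The Laplace-Beltrami operator on real functions. -/
def lap (g : MetricBdry m M) (f : M → ℝ) (x : M) : ℝ :=
  locLap (chartGram g x) (rep x f) (extChartAt (𝓡∂ (m + 1)) x x)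

/-- The matrix of the coordinate frame of the chart around `p`. -/
def frm (p : M) (y : Euc (m + 1)) : Matrix (Fin (m + 1)) (Fin (m + 1)) ℝ :=
  Matrix.of fun i j => @WithLp.ofLp 2 (Fin (m + 1) → ℝ) (coordVec p y j) i

theorem isUnit_frm {p : M} {y : Euc (m + 1)} (hy : y ∈ (extChartAt (𝓡∂ (m + 1)) p).target) :
    IsUnit (frm p y).det :=
  isUnit_det_of_isInvertible _ (isInvertible_mfderivWithin_extChartAt_symm hy)

/-- Links the two descriptions of the metric: `gram` uses the preferred chart of the point itself,
`chartGram` a fixed chart around `p`. The frame matrix `frm` passes from one to the other. -/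
theorem chartGram_eq_frm (g : MetricBdry m M) (p : M) (y : Euc (m + 1)) :
    chartGram g p y =
      (frm p y).transpose * gram g ((extChartAt (𝓡∂ (m + 1)) p).symm y) * frm p y :=
  bilin_frame (g.inner ((extChartAt (𝓡∂ (m + 1)) p).symm y))
    (mfderivWithin 𝓘(ℝ, Euc (m + 1)) (𝓡∂ (m + 1)) (extChartAt (𝓡∂ (m + 1)) p).symm
      (range (𝓡∂ (m + 1))) y)

theorem gram_posDef (g : MetricBdry m M) (x : M) : (gram g x).PosDef :=
  posDef_bilin (g.inner x) (g.symm x) (g.pos x)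

theorem chartGram_posDef (g : MetricBdry m M) {p : M} {y : Euc (m + 1)}
    (hy : y ∈ (extChartAt (𝓡∂ (m + 1)) p).target) : (chartGram g p y).PosDef := by
  rw [chartGram_eq_frm]
  have h := (gram_posDef g ((extChartAt (𝓡∂ (m + 1)) p).symm y)).conjTranspose_mul_mul_same
    (B := frm p y) (Matrix.mulVec_injective_of_isUnit
      ((Matrix.isUnit_iff_isUnit_det _).2 (isUnit_frm hy)))
  simpa using h

theorem chartGram_det_pos (g : MetricBdry m M) {p : M} {y : Euc (m + 1)}
    (hy : y ∈ (extChartAt (𝓡∂ (m + 1)) p).target) : 0 < (chartGram g p y).det :=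
  (chartGram_posDef g hy).det_pos

theorem mfderivWithin_comp_symm {V : Type*} [NormedAddCommGroup V] [NormedSpace ℝ V] {f : M → V}
    {p : M} {y : Euc (m + 1)}
    (hy : y ∈ (extChartAt (𝓡∂ (m + 1)) p).target)
    (hf : MDifferentiableAt (𝓡∂ (m + 1)) 𝓘(ℝ, V) f ((extChartAt (𝓡∂ (m + 1)) p).symm y))
    (j : Fin (m + 1)) :
    mfderiv (𝓡∂ (m + 1)) 𝓘(ℝ, V) f ((extChartAt (𝓡∂ (m + 1)) p).symm y) (coordVec p y j) =
      fderivWithin ℝ (rep p f) (range (𝓡∂ (m + 1))) y (stdVec j) := by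
  have hU : UniqueMDiffWithinAt 𝓘(ℝ, Euc (m + 1)) (range (𝓡∂ (m + 1))) y :=
    (uniqueDiffOn_halfSpace y (extChartAt_target_subset_range p hy)).uniqueMDiffWithinAt
  have h := mfderiv_comp_mfderivWithin y hf (mdifferentiableWithinAt_extChartAt_symm hy) hU
  rw [mfderivWithin_eq_fderivWithin] at h
  exact (congrArg (fun L : Euc (m + 1) →L[ℝ] V => L (stdVec j)) h).symm

theorem pd_rep {f : M → ℝ} {p : M} {y : Euc (m + 1)}
    (hy : y ∈ (extChartAt (𝓡∂ (m + 1)) p).target)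
    (hf : MDifferentiableAt (𝓡∂ (m + 1)) 𝓘(ℝ, ℝ) f ((extChartAt (𝓡∂ (m + 1)) p).symm y)) :
    pd (rep p f) y = (frm p y).transpose.mulVec
      fun j => dR f ((extChartAt (𝓡∂ (m + 1)) p).symm y) (stdVec j) := by
  have h := linform_frame (k := m + 1) (dR f ((extChartAt (𝓡∂ (m + 1)) p).symm y))
    (mfderivWithin 𝓘(ℝ, Euc (m + 1)) (𝓡∂ (m + 1)) (extChartAt (𝓡∂ (m + 1)) p).symm
      (range (𝓡∂ (m + 1))) y)
  refine Eq.trans ?_ h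
  funext j
  exact (mfderivWithin_comp_symm hy hf j).symm

/-- The metric and both differentials are read through the same invertible frame, so `coPair_frame`
applies. -/
theorem gam_chart (g : MetricBdry m M) {f k : M → ℝ} {p : M} {y : Euc (m + 1)}
    (hy : y ∈ (extChartAt (𝓡∂ (m + 1)) p).target)
    (hf : MDifferentiableAt (𝓡∂ (m + 1)) 𝓘(ℝ, ℝ) f ((extChartAt (𝓡∂ (m + 1)) p).symm y))
    (hk : MDifferentiableAt (𝓡∂ (m + 1)) 𝓘(ℝ, ℝ) k ((extChartAt (𝓡∂ (m + 1)) p).symm y)) :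
    gam g f k ((extChartAt (𝓡∂ (m + 1)) p).symm y) =
      coPair (chartGram g p y) (pd (rep p f) y) (pd (rep p k) y) := by
  rw [pd_rep hy hf, pd_rep hy hk, chartGram_eq_frm, coPair_frame _ _ (isUnit_frm hy), gam]

/-- The tangent space at `x` is by construction the model space of the preferred chart at `x`, so
the inverse of that chart has the identity as its derivative at the centre. -/
theorem frm_self (x : M) : frm x (extChartAt (𝓡∂ (m + 1)) x x) = 1 := by
  have h := mfderivWithin_range_extChartAt_symm (I := 𝓡∂ (m + 1)) (x := x)
  ext i j
  have h2 := congrArg (fun L : Euc (m + 1) →L[ℝ] Euc (m + 1) => (L (stdVec j)) i) h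
  refine Eq.trans h2 ?_
  change (stdVec j : Euc (m + 1)) i = _
  rw [stdVec_apply, Matrix.one_apply]
  simp [eq_comm]

/-- The coordinate change between the charts around `p` and `q`. -/
def tau (p q : M) (y : Euc (m + 1)) : Euc (m + 1) :=
  extChartAt (𝓡∂ (m + 1)) q ((extChartAt (𝓡∂ (m + 1)) p).symm y)

/-- The Jacobian matrix of the coordinate change. -/
def tmat (p q : M) (y : Euc (m + 1)) : Matrix (Fin (m + 1)) (Fin (m + 1)) ℝ :=
  Matrix.of fun i j => (fderivWithin ℝ (tau p q) (range (𝓡∂ (m + 1))) y (stdVec j)) i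

/-- The domain of the coordinate change. -/
def overlap (p q : M) : Set (Euc (m + 1)) :=
  (extChartAt (𝓡∂ (m + 1)) p).target ∩
    (extChartAt (𝓡∂ (m + 1)) p).symm ⁻¹' (extChartAt (𝓡∂ (m + 1)) q).source

/-- Openness is relative to the half space: at points of the bounding hyperplane the overlap is not
a neighbourhood in the full space. This is why derivatives are taken within the half space
throughout. -/
theorem overlap_mem_nhdsWithin {p q : M} {y : Euc (m + 1)} (hy : y ∈ overlap p q) :
    overlap p q ∈ nhdsWithin y (range (𝓡∂ (m + 1))) := by
  refine Filter.inter_mem (extChartAt_target_mem_nhdsWithin_of_mem hy.1) ?_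
  have h1 : ContinuousWithinAt (extChartAt (𝓡∂ (m + 1)) p).symm (range (𝓡∂ (m + 1))) y :=
    (continuousAt_extChartAt_symm'' hy.1).continuousWithinAt
  exact h1 ((isOpen_extChartAt_source q).mem_nhds hy.2)

theorem tau_mem_overlap {p q : M} {y : Euc (m + 1)} (hy : y ∈ overlap p q) :
    tau p q y ∈ overlap q p := by
  refine ⟨(extChartAt (𝓡∂ (m + 1)) q).map_source hy.2, ?_⟩
  simp only [mem_preimage, tau]
  rw [(extChartAt (𝓡∂ (m + 1)) q).left_inv hy.2]
  exact (extChartAt (𝓡∂ (m + 1)) p).map_target hy.1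

theorem symm_tau {p q : M} {y : Euc (m + 1)} (hy : y ∈ overlap p q) :
    (extChartAt (𝓡∂ (m + 1)) q).symm (tau p q y) = (extChartAt (𝓡∂ (m + 1)) p).symm y :=
  (extChartAt (𝓡∂ (m + 1)) q).left_inv hy.2

theorem tau_tau {p q : M} {y : Euc (m + 1)} (hy : y ∈ overlap p q) :
    tau q p (tau p q y) = y := by
  rw [tau, symm_tau hy]
  exact (extChartAt (𝓡∂ (m + 1)) p).right_inv hy.1

theorem contDiffWithinAt_tau {p q : M} {y : Euc (m + 1)} (hy : y ∈ overlap p q) :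
    ContDiffWithinAt ℝ ∞ (tau p q) (range (𝓡∂ (m + 1))) y := by
  rw [← contMDiffWithinAt_iff_contDiffWithinAt]
  have h1 : ContMDiffAt (𝓡∂ (m + 1)) 𝓘(ℝ, Euc (m + 1)) ∞ (extChartAt (𝓡∂ (m + 1)) q)
      ((extChartAt (𝓡∂ (m + 1)) p).symm y) :=
    contMDiffAt_extChartAt' (by rw [← extChartAt_source (𝓡∂ (m + 1))]; exact hy.2)
  exact h1.comp_contMDiffWithinAt y (contMDiffWithinAt_extChartAt_symm_range p hy.1)

theorem differentiableWithinAt_tau {p q : M} {y : Euc (m + 1)} (hy : y ∈ overlap p q) :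
    DifferentiableWithinAt ℝ (tau p q) (range (𝓡∂ (m + 1))) y :=
  (contDiffWithinAt_tau hy).differentiableWithinAt (by simp)

theorem mapsTo_tau (p q : M) : MapsTo (tau p q) univ (range (𝓡∂ (m + 1))) := by
  intro y _
  simp [tau, extChartAt]

/-- Chain rule: near `y`, the inverse chart at `p` is the inverse chart at `q` after the coordinate
change. -/
theorem frm_eq_mul_tmat {p q : M} {y : Euc (m + 1)} (hy : y ∈ overlap p q) :
    frm p y = frm q (tau p q y) * tmat p q y := by
  have hU : UniqueMDiffWithinAt 𝓘(ℝ, Euc (m + 1)) (range (𝓡∂ (m + 1))) y :=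
    (uniqueDiffOn_halfSpace y (extChartAt_target_subset_range p hy.1)).uniqueMDiffWithinAt
  have h := mfderivWithin_comp y
    (mdifferentiableWithinAt_extChartAt_symm (tau_mem_overlap hy).1)
    (differentiableWithinAt_tau hy).mdifferentiableWithinAt
    (fun z _ => mapsTo_tau p q (mem_univ z)) hU
  have h2 : mfderivWithin 𝓘(ℝ, Euc (m + 1)) (𝓡∂ (m + 1))
      ((extChartAt (𝓡∂ (m + 1)) q).symm ∘ tau p q) (range (𝓡∂ (m + 1))) y =
      mfderivWithin 𝓘(ℝ, Euc (m + 1)) (𝓡∂ (m + 1))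
      (extChartAt (𝓡∂ (m + 1)) p).symm (range (𝓡∂ (m + 1))) y := by
    apply Filter.EventuallyEq.mfderivWithin_eq
    · filter_upwards [overlap_mem_nhdsWithin hy] with z hz using symm_tau hz
    · exact symm_tau hy
  rw [h2, mfderivWithin_eq_fderivWithin] at h
  ext i j
  have h3 := congrArg (fun L : Euc (m + 1) →L[ℝ] Euc (m + 1) => (L (stdVec j)) i) h
  refine Eq.trans h3 ?_
  set w : Euc (m + 1) := fderivWithin ℝ (tau p q) (range (𝓡∂ (m + 1))) y (stdVec j) with hw
  set L : Euc (m + 1) →L[ℝ] Euc (m + 1) := mfderivWithin 𝓘(ℝ, Euc (m + 1)) (𝓡∂ (m + 1))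
      (extChartAt (𝓡∂ (m + 1)) q).symm (range (𝓡∂ (m + 1))) (tau p q y) with hL
  have h4 : L w = ∑ l, w l • L (stdVec l) := by
    conv_lhs => rw [eq_sum_stdVec w]
    simp
  have h5 : (frm q (tau p q y) * tmat p q y) i j = ∑ l, (L (stdVec l)) i * w l := by
    rw [Matrix.mul_apply]; rfl
  rw [h5]
  change (L w) i = _
  rw [h4]
  simp [mul_comm]

theorem isUnit_tmat {p q : M} {y : Euc (m + 1)} (hy : y ∈ overlap p q) :
    IsUnit (tmat p q y).det := by
  have h := isUnit_frm hy.1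
  rw [frm_eq_mul_tmat hy, Matrix.det_mul] at h
  exact isUnit_of_mul_isUnit_right h

theorem chartGram_tau (g : MetricBdry m M) {p q : M} {y : Euc (m + 1)} (hy : y ∈ overlap p q) :
    chartGram g p y = (tmat p q y).transpose * chartGram g q (tau p q y) * tmat p q y := by
  rw [chartGram_eq_frm, chartGram_eq_frm, frm_eq_mul_tmat hy, symm_tau hy, Matrix.transpose_mul]
  simp only [Matrix.mul_assoc]

theorem contDiffOn_chartGram (g : MetricBdry m M) (p : M) (i j : Fin (m + 1)) :
    ContDiffOn ℝ ∞ (fun y => chartGram g p y i j) (extChartAt (𝓡∂ (m + 1)) p).target :=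
  contDiffOn_metric_chart g p (stdVec i) (stdVec j)

end chartCalculus

/-! ### Smooth dependence of determinants and inverses -/

section matrixSmooth

variable {E : Type*} [NormedAddCommGroup E] [NormedSpace ℝ E] {k : ℕ} {n : WithTop ℕ∞} {s : Set E}
  {G : E → Matrix (Fin k) (Fin k) ℝ}

theorem ContDiffOn.matrix_det (hG : ∀ i j, ContDiffOn ℝ n (fun y => G y i j) s) :
    ContDiffOn ℝ n (fun y => (G y).det) s := by
  simp only [Matrix.det_apply]
  refine ContDiffOn.sum fun σ _ => ContDiffOn.const_smul _ (contDiffOn_prod fun i _ => hG _ _)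

/-- Cramer's rule: each entry is a quotient of determinants, hence smooth where the denominator does
not vanish. -/
theorem ContDiffOn.matrix_inv (hG : ∀ i j, ContDiffOn ℝ n (fun y => G y i j) s)
    (h0 : ∀ y ∈ s, (G y).det ≠ 0) (i j : Fin k) :
    ContDiffOn ℝ n (fun y => (G y)⁻¹ i j) s := by
  have h1 : ∀ y, (G y)⁻¹ i j = ((G y).det)⁻¹ * ((G y).updateRow j (Pi.single i 1)).det := by
    intro y
    rw [Matrix.inv_def, Ring.inverse_eq_inv', Matrix.smul_apply, Matrix.adjugate_apply, smul_eq_mul]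
  simp only [h1]
  refine ((ContDiffOn.matrix_det hG).inv h0).mul (ContDiffOn.matrix_det fun a b => ?_)
  by_cases ha : a = j
  · subst ha
    simpa using contDiffOn_const
  · simpa [Matrix.updateRow_apply, ha] using hG a b

theorem ContDiffOn.matrix_sqrt_det (hG : ∀ i j, ContDiffOn ℝ n (fun y => G y i j) s)
    (h0 : ∀ y ∈ s, (G y).det ≠ 0) : ContDiffOn ℝ n (fun y => √(G y).det) s :=
  (ContDiffOn.matrix_det hG).sqrt h0

end matrixSmooth

/-! ### Regularity on the cylinder, tested in charts -/

section jointRegularity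

variable {m : ℕ} {M : Type*} [TopologicalSpace M] [ChartedSpace (EuclideanHalfSpace (m + 1)) M]

variable (m) in
/-- The domain `[0,T] × φ_p(U_p)` of a chart of the cylinder. -/
def cdom (T : ℝ) (p : M) : Set (ℝ × Euc (m + 1)) :=
  Icc 0 T ×ˢ (extChartAt (𝓡∂ (m + 1)) p).target

variable (m) in
/-- `f` is `C^k` in the charts of `M`. -/
def CReg (k : WithTop ℕ∞) (f : M → ℝ) : Prop :=
  ∀ p : M, ContDiffOn ℝ k (rep p f) (extChartAt (𝓡∂ (m + 1)) p).target

variable (m) in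
/-- `u` is `C^k` in the charts of `[0,T] × M`. -/
def JReg (T : ℝ) (k : WithTop ℕ∞) (u : ℝ → M → ℝ) : Prop :=
  ∀ p : M, ContDiffOn ℝ k (fun z : ℝ × Euc (m + 1) => rep p (u z.1) z.2) (cdom m T p)

/-- The time derivative, one-sided at the end points. -/
def dtd (T : ℝ) (u : ℝ → M → ℝ) (t : ℝ) (x : M) : ℝ := derivWithin (fun s => u s x) (Icc 0 T) t

theorem uniqueDiffOn_target (p : M) :
    UniqueDiffOn ℝ (extChartAt (𝓡∂ (m + 1)) p).target := uniqueDiffOn_extChartAt_target p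

theorem uniqueDiffOn_cdom {T : ℝ} (hT : 0 < T) (p : M) : UniqueDiffOn ℝ (cdom m T p) :=
  (uniqueDiffOn_Icc hT).prod (uniqueDiffOn_target p)

/-- The target of a chart is relatively open in the half space, so both sets have the same germ at
`y`. -/
theorem pd_eq_target (p : M) (F : Euc (m + 1) → ℝ) {y : Euc (m + 1)}
    (hy : y ∈ (extChartAt (𝓡∂ (m + 1)) p).target) (j : Fin (m + 1)) :
    pd F y j = fderivWithin ℝ F (extChartAt (𝓡∂ (m + 1)) p).target y (stdVec j) := by
  have h := mem_nhdsWithin_iff_eventually.1 (extChartAt_target_mem_nhdsWithin_of_mem hy)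
  rw [pd, fderivWithin_congr_set (t := (extChartAt (𝓡∂ (m + 1)) p).target)]
  filter_upwards [h] with z hz
  exact propext ⟨hz, fun h' => extChartAt_target_subset_range p h'⟩

theorem pd_congr {p : M} {F K : Euc (m + 1) → ℝ}
    (h : EqOn F K (extChartAt (𝓡∂ (m + 1)) p).target) {y : Euc (m + 1)}
    (hy : y ∈ (extChartAt (𝓡∂ (m + 1)) p).target) : pd F y = pd K y := by
  funext j
  rw [pd_eq_target p F hy, pd_eq_target p K hy, fderivWithin_congr h (h hy)]

/-- A space derivative at frozen time is the joint derivative in a purely spatial direction.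
Regularity of space derivatives jointly in time and space then comes from that of the joint
derivative. -/
theorem pd_slice {T : ℝ} {p : M} {W : ℝ × Euc (m + 1) → ℝ} {z : ℝ × Euc (m + 1)}
    (hW : DifferentiableWithinAt ℝ W (cdom m T p) z) (hz : z ∈ cdom m T p) (j : Fin (m + 1)) :
    pd (fun y => W (z.1, y)) z.2 j = fderivWithin ℝ W (cdom m T p) z (0, stdVec j) := by
  rw [pd_eq_target p _ hz.2]
  have h1 : HasFDerivWithinAt (fun y : Euc (m + 1) => (z.1, y))
      (ContinuousLinearMap.inr ℝ ℝ (Euc (m + 1))) (extChartAt (𝓡∂ (m + 1)) p).target z.2 :=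
    (hasFDerivAt_prodMk_right z.1 z.2).hasFDerivWithinAt
  have h2 : HasFDerivWithinAt W (fderivWithin ℝ W (cdom m T p) z) (cdom m T p) (z.1, z.2) :=
    hW.hasFDerivWithinAt
  have h3 := h2.comp z.2 h1 (fun y hy => ⟨hz.1, hy⟩)
  have h4 := h3.fderivWithin (uniqueDiffOn_target p z.2 hz.2)
  simp only [Function.comp_def] at h4
  rw [h4]
  simp

theorem contDiffOn_pd_slice {T : ℝ} (hT : 0 < T) {p : M} {W : ℝ × Euc (m + 1) → ℝ}
    {k n : WithTop ℕ∞} (hkn : k + 1 ≤ n) (hW : ContDiffOn ℝ n W (cdom m T p)) (j : Fin (m + 1)) :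
    ContDiffOn ℝ k (fun z => pd (fun y => W (z.1, y)) z.2 j) (cdom m T p) := by
  have h1 := (hW.fderivWithin (uniqueDiffOn_cdom hT p) hkn).clm_apply
    (contDiffOn_const (c := ((0, stdVec j) : ℝ × Euc (m + 1))))
  refine h1.congr fun z hz => pd_slice ?_ hz j
  exact (hW z hz).differentiableWithinAt (by
    intro h0; subst h0; simp at hkn)

theorem derivWithin_slice {T : ℝ} {p : M} {W : ℝ × Euc (m + 1) → ℝ}
    {z : ℝ × Euc (m + 1)}
    (hW : DifferentiableWithinAt ℝ W (cdom m T p) z) (hz : z ∈ cdom m T p) :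
    HasDerivWithinAt (fun t => W (t, z.2)) (fderivWithin ℝ W (cdom m T p) z (1, 0)) (Icc 0 T) z.1 := by
  have h1 : HasFDerivWithinAt (fun t : ℝ => (t, z.2))
      (ContinuousLinearMap.inl ℝ ℝ (Euc (m + 1))) (Icc 0 T) z.1 :=
    (hasFDerivAt_prodMk_left z.1 z.2).hasFDerivWithinAt
  have h2 : HasFDerivWithinAt W (fderivWithin ℝ W (cdom m T p) z) (cdom m T p) (z.1, z.2) :=
    hW.hasFDerivWithinAt
  have h3 := (h2.comp z.1 h1 (t := cdom m T p)
    (fun y hy => (⟨hy, hz.2⟩ : (y, z.2) ∈ cdom m T p))).hasDerivWithinAt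
  simpa [Function.comp_def] using h3

theorem JReg.dtd {T : ℝ} (hT : 0 < T) {k n : WithTop ℕ∞} (hkn : k + 1 ≤ n) {u : ℝ → M → ℝ}
    (hu : JReg m T n u) : JReg m T k (dtd T u) := by
  intro p
  have h1 := ((hu p).fderivWithin (uniqueDiffOn_cdom hT p) hkn).clm_apply
    (contDiffOn_const (c := ((1, 0) : ℝ × Euc (m + 1))))
  refine h1.congr fun z hz => ?_
  have h2 := derivWithin_slice ((hu p z hz).differentiableWithinAt (by
    intro h0; subst h0; simp at hkn)) hz
  exact h2.derivWithin (uniqueDiffOn_Icc hT _ hz.1)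

theorem JReg.hasDerivWithinAt {T : ℝ} {n : WithTop ℕ∞} (hn : n ≠ 0) {u : ℝ → M → ℝ}
    (hu : JReg m T n u) {t : ℝ} (ht : t ∈ Icc 0 T) (x : M) :
    HasDerivWithinAt (fun s => u s x) (CarlemanParabolic.dtd T u t x) (Icc 0 T) t := by
  have hz : ((t, extChartAt (𝓡∂ (m + 1)) x x) : ℝ × Euc (m + 1)) ∈ cdom m T x :=
    ⟨ht, mem_extChartAt_target x⟩
  have h2 := derivWithin_slice ((hu x _ hz).differentiableWithinAt hn) hz
  simp only [rep, extChartAt_to_inv] at h2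
  exact h2.differentiableWithinAt.hasDerivWithinAt

theorem JReg.slice {T : ℝ} {n : WithTop ℕ∞} {u : ℝ → M → ℝ} (hu : JReg m T n u) {t : ℝ}
    (ht : t ∈ Icc 0 T) : CReg m n (u t) := by
  intro p
  exact (hu p).comp (contDiffOn_const.prodMk contDiffOn_id) (fun y hy => ⟨ht, hy⟩)

theorem CReg.jreg {n : WithTop ℕ∞} {f : M → ℝ} (hf : CReg m n f) (T : ℝ) :
    JReg m T n (fun _ => f) := by
  intro p
  exact (hf p).comp contDiffOn_snd (fun y hy => hy.2)

theorem JReg.of_le {T : ℝ} {k n : WithTop ℕ∞} (hkn : k ≤ n) {u : ℝ → M → ℝ} (hu : JReg m T n u) :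
    JReg m T k u := fun p => (hu p).of_le hkn

theorem CReg.of_le {k n : WithTop ℕ∞} (hkn : k ≤ n) {u : M → ℝ} (hu : CReg m n u) :
    CReg m k u := fun p => (hu p).of_le hkn

theorem JReg.mul {T : ℝ} {n : WithTop ℕ∞} {u v : ℝ → M → ℝ} (hu : JReg m T n u) (hv : JReg m T n v) :
    JReg m T n (fun t x => u t x * v t x) := fun p => (hu p).mul (hv p)

theorem CReg.add {n : WithTop ℕ∞} {u v : M → ℝ} (hu : CReg m n u) (hv : CReg m n v) :
    CReg m n (fun x => u x + v x) := fun p => (hu p).add (hv p)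

theorem CReg.mul {n : WithTop ℕ∞} {u v : M → ℝ} (hu : CReg m n u) (hv : CReg m n v) :
    CReg m n (fun x => u x * v x) := fun p => (hu p).mul (hv p)

theorem CReg.comp {n : WithTop ℕ∞} {u : M → ℝ} (hu : CReg m n u) {χ : ℝ → ℝ} (hχ : ContDiff ℝ n χ) :
    CReg m n (fun x => χ (u x)) := fun p => hχ.comp_contDiffOn (hu p)

theorem creg_const {n : WithTop ℕ∞} (c : ℝ) : CReg m (M := M) n (fun _ => c) :=
  fun _ => contDiffOn_const

variable [IsManifold (𝓡∂ (m + 1)) ∞ M]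

theorem CReg.contMDiff {n : WithTop ℕ∞} {f : M → ℝ} (hf : CReg m n f) [IsManifold (𝓡∂ (m + 1)) n M] :
    ContMDiff (𝓡∂ (m + 1)) 𝓘(ℝ, ℝ) n f := by
  intro x
  have h1 : ContMDiffWithinAt 𝓘(ℝ, Euc (m + 1)) 𝓘(ℝ, ℝ) n (rep x f)
      (extChartAt (𝓡∂ (m + 1)) x).target (extChartAt (𝓡∂ (m + 1)) x x) :=
    (hf x _ (mem_extChartAt_target x)).contMDiffWithinAt
  have h2 : ContMDiffAt (𝓡∂ (m + 1)) 𝓘(ℝ, Euc (m + 1)) n (extChartAt (𝓡∂ (m + 1)) x) x :=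
    contMDiffAt_extChartAt
  have h3 := h1.comp_of_eq (x := x) (s := (extChartAt (𝓡∂ (m + 1)) x).source) h2.contMDiffWithinAt
    (fun z hz => (extChartAt (𝓡∂ (m + 1)) x).map_source hz) rfl
  have h4 := h3.contMDiffAt (extChartAt_source_mem_nhds x)
  refine h4.congr_of_eventuallyEq ?_
  filter_upwards [extChartAt_source_mem_nhds (I := 𝓡∂ (m + 1)) x] with z hz
  simp only [Function.comp, rep]
  rw [(extChartAt (𝓡∂ (m + 1)) x).left_inv hz]

theorem CReg.mdifferentiableAt {n : WithTop ℕ∞} (hn : 1 ≤ n) {f : M → ℝ} (hf : CReg m n f) (x : M) :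
    MDifferentiableAt (𝓡∂ (m + 1)) 𝓘(ℝ, ℝ) f x :=
  ((hf.of_le hn).contMDiff x).mdifferentiableAt (by simp)

theorem creg_of_contMDiff {n : WithTop ℕ∞} [IsManifold (𝓡∂ (m + 1)) n M] {f : M → ℝ}
    (hf : ContMDiff (𝓡∂ (m + 1)) 𝓘(ℝ, ℝ) n f) :
    CReg m n f := by
  intro p
  rw [← contMDiffOn_iff_contDiffOn]
  exact hf.comp_contMDiffOn (contMDiffOn_extChartAt_symm p)

theorem jreg_of_contMDiffOn {T : ℝ} {n : WithTop ℕ∞} [IsManifold (𝓡∂ (m + 1)) n M] {u : ℝ → M → ℝ}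
    (hu : ContMDiffOn (𝓘(ℝ, ℝ).prod (𝓡∂ (m + 1))) 𝓘(ℝ, ℝ) n (fun z : ℝ × M => u z.1 z.2)
          (Icc 0 T ×ˢ univ)) : JReg m T n u := by
  intro p
  rw [← contMDiffOn_iff_contDiffOn, modelWithCornersSelf_prod, ← chartedSpaceSelf_prod]
  have h1 : ContMDiffOn (𝓘(ℝ, ℝ).prod 𝓘(ℝ, Euc (m + 1))) (𝓘(ℝ, ℝ).prod (𝓡∂ (m + 1))) n
      (fun z : ℝ × Euc (m + 1) => (z.1, (extChartAt (𝓡∂ (m + 1)) p).symm z.2)) (cdom m T p) :=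
    contMDiff_fst.contMDiffOn.prodMk
      ((contMDiffOn_extChartAt_symm p).comp contMDiff_snd.contMDiffOn (fun z hz => hz.2))
  exact hu.comp h1 (fun z hz => ⟨hz.1, mem_univ _⟩)

theorem JReg.continuousOn {T : ℝ} {n : WithTop ℕ∞} {u : ℝ → M → ℝ} (hu : JReg m T n u) :
    ContinuousOn (fun z : ℝ × M => u z.1 z.2) (Icc 0 T ×ˢ univ) := by
  intro z hz
  set φ := extChartAt (𝓡∂ (m + 1)) z.2 with hφ
  have h1 : ContinuousWithinAt (fun w : ℝ × Euc (m + 1) => rep z.2 (u w.1) w.2) (cdom m T z.2)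
      (z.1, φ z.2) := (hu z.2).continuousOn _ ⟨hz.1, mem_extChartAt_target _⟩
  have h2 : ContinuousWithinAt (fun w : ℝ × M => (w.1, φ w.2)) (Icc 0 T ×ˢ φ.source) z := by
    apply ContinuousAt.continuousWithinAt
    exact continuousAt_fst.prodMk ((continuousAt_extChartAt z.2).comp continuousAt_snd)
  have h3 := h1.comp_of_eq (x := z) h2 (fun w hw => ⟨hw.1, φ.map_source hw.2⟩) rfl
  have h4 : ContinuousWithinAt (fun w : ℝ × M => u w.1 w.2) (Icc 0 T ×ˢ φ.source) z := by
    refine h3.congr (fun w hw => ?_) ?_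
    · simp only [Function.comp, rep]
      rw [← hφ, φ.left_inv hw.2]
    · simp only [Function.comp, rep]
      rw [← hφ, φ.left_inv (mem_extChartAt_source _)]
  refine h4.mono_of_mem_nhdsWithin ?_
  rw [mem_nhdsWithin]
  refine ⟨univ ×ˢ φ.source, isOpen_univ.prod (isOpen_extChartAt_source _), ⟨mem_univ _, mem_extChartAt_source _⟩, ?_⟩
  rintro w ⟨⟨_, h⟩, h', _⟩
  exact ⟨h', h⟩

theorem CReg.continuous {n : WithTop ℕ∞} {f : M → ℝ} (hf : CReg m n f) : Continuous f := by
  -- A function on M is a time-independent function over the degenerate interval [0, 0].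
  have h := (hf.jreg 0).continuousOn
  have h2 : Continuous fun x : M => ((0 : ℝ), x) := by fun_prop
  exact h.comp_continuous h2 (fun x => by simp)

theorem contDiffOn_coPair {E : Type*} [NormedAddCommGroup E] [NormedSpace ℝ E] {k : ℕ}
    {n : WithTop ℕ∞} {s : Set E} {G : E → Matrix (Fin k) (Fin k) ℝ} {a b : E → Fin k → ℝ}
    (hG : ∀ i j, ContDiffOn ℝ n (fun y => G y i j) s) (h0 : ∀ y ∈ s, (G y).det ≠ 0)
    (ha : ∀ i, ContDiffOn ℝ n (fun y => a y i) s) (hb : ∀ i, ContDiffOn ℝ n (fun y => b y i) s) :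
    ContDiffOn ℝ n (fun y => coPair (G y) (a y) (b y)) s := by
  simp only [coPair, dotProduct, Matrix.mulVec]
  exact ContDiffOn.sum fun i _ => (ha i).mul <| ContDiffOn.sum fun j _ =>
    (ContDiffOn.matrix_inv hG h0 i j).mul (hb j)

theorem contDiffOn_chartGram_cdom (g : MetricBdry m M) (T : ℝ) (p : M) {n : WithTop ℕ∞}
    (hn : n ≤ ∞) (i j : Fin (m + 1)) :
    ContDiffOn ℝ n (fun z : ℝ × Euc (m + 1) => chartGram g p z.2 i j) (cdom m T p) :=
  ((contDiffOn_chartGram g p i j).of_le hn).comp contDiffOn_snd (fun _ hz => hz.2)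

theorem JReg.gam {T : ℝ} (hT : 0 < T) (g : MetricBdry m M) {k n : WithTop ℕ∞} (hkn : k + 1 ≤ n)
    (hk : k ≤ ∞) {u v : ℝ → M → ℝ} (hu : JReg m T n u) (hv : JReg m T n v) :
    JReg m T k (fun t => gam g (u t) (v t)) := by
  intro p
  have h1 : (1 : WithTop ℕ∞) ≤ n := le_trans (by simp) hkn
  have h2 := contDiffOn_coPair (contDiffOn_chartGram_cdom g T p hk)
    (fun z hz => (chartGram_det_pos g hz.2).ne')
    (fun i => contDiffOn_pd_slice hT hkn (hu p) i) (fun i => contDiffOn_pd_slice hT hkn (hv p) i)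
  refine h2.congr fun z hz => ?_
  exact gam_chart g hz.2 ((hu.slice hz.1).mdifferentiableAt h1 _)
    ((hv.slice hz.1).mdifferentiableAt h1 _)

theorem CReg.gam (g : MetricBdry m M) {k n : WithTop ℕ∞} (hkn : k + 1 ≤ n)
    (hk : k ≤ ∞) {u v : M → ℝ} (hu : CReg m n u) (hv : CReg m n v) :
    CReg m k (CarlemanParabolic.gam g u v) :=
  (JReg.gam zero_lt_one g hkn hk (hu.jreg 1) (hv.jreg 1)).slice (t := 0) (by simp)

theorem contDiffOn_flux_slice {T : ℝ} (hT : 0 < T) (g : MetricBdry m M) {p : M}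
    {W : ℝ × Euc (m + 1) → ℝ} {k n : WithTop ℕ∞} (hkn : k + 1 ≤ n) (hk : k ≤ ∞)
    (hW : ContDiffOn ℝ n W (cdom m T p)) (j : Fin (m + 1)) :
    ContDiffOn ℝ k (fun z => flux (chartGram g p) (fun y => W (z.1, y)) j z.2) (cdom m T p) := by
  have h0 : ∀ z ∈ cdom m T p, (chartGram g p z.2).det ≠ 0 :=
    fun z hz => (chartGram_det_pos g hz.2).ne'
  simp only [flux, Matrix.mulVec, dotProduct]
  exact (ContDiffOn.matrix_sqrt_det (contDiffOn_chartGram_cdom g T p hk) h0).mul <|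
    ContDiffOn.sum fun i _ =>
      (ContDiffOn.matrix_inv (contDiffOn_chartGram_cdom g T p hk) h0 j i).mul
        (contDiffOn_pd_slice hT hkn hW i)

theorem contDiffOn_flux (g : MetricBdry m M) {p : M}
    {F : Euc (m + 1) → ℝ} {k n : WithTop ℕ∞} (hkn : k + 1 ≤ n) (hk : k ≤ ∞)
    (hF : ContDiffOn ℝ n F (extChartAt (𝓡∂ (m + 1)) p).target) (j : Fin (m + 1)) :
    ContDiffOn ℝ k (flux (chartGram g p) F j) (extChartAt (𝓡∂ (m + 1)) p).target := by
  have h := contDiffOn_flux_slice zero_lt_one g hkn hk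
    (W := fun z => F z.2) (p := p) (T := 1) (hF.comp contDiffOn_snd (fun _ hz => hz.2)) j
  have h2 := h.comp (f := fun y => ((0 : ℝ), y)) (s := (extChartAt (𝓡∂ (m + 1)) p).target)
    (contDiffOn_const.prodMk contDiffOn_id) (fun y hy => ⟨by simp, hy⟩)
  simpa only [Function.comp_def] using h2

theorem contDiffOn_locLap_slice {T : ℝ} (hT : 0 < T) (g : MetricBdry m M) {p : M}
    {W : ℝ × Euc (m + 1) → ℝ} {k n : WithTop ℕ∞} (hkn : k + 1 + 1 ≤ n) (hk : k + 1 ≤ ∞)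
    (hW : ContDiffOn ℝ n W (cdom m T p)) :
    ContDiffOn ℝ k (fun z => locLap (chartGram g p) (fun y => W (z.1, y)) z.2) (cdom m T p) := by
  have hk' : k ≤ ∞ := le_trans (by simp) hk
  have h0 : ∀ z ∈ cdom m T p, (chartGram g p z.2).det ≠ 0 :=
    fun z hz => (chartGram_det_pos g hz.2).ne'
  simp only [locLap, one_div]
  refine ContDiffOn.mul (ContDiffOn.inv (ContDiffOn.matrix_sqrt_det
    (contDiffOn_chartGram_cdom g T p hk') h0) fun z hz => ?_) (ContDiffOn.sum fun j _ => ?_)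
  · exact (Real.sqrt_pos.2 (chartGram_det_pos g hz.2)).ne'
  · exact contDiffOn_pd_slice hT le_rfl (contDiffOn_flux_slice hT g hkn hk hW j) j

end jointRegularity

/-! ### Jacobi's formula and the Piola identity -/

section piola

variable {k : ℕ}

/-- The Jacobian matrix of a map of `ℝ^k`. -/
def jac (τ : Euc k → Euc k) (y : Euc k) : Matrix (Fin k) (Fin k) ℝ :=
  Matrix.of fun i j => (fderiv ℝ τ y (stdVec j)) i

theorem contDiff_det {n : WithTop ℕ∞} :
    ContDiff ℝ n (fun A : Fin k → Fin k → ℝ => (Matrix.of A).det) := by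
  rw [← contDiffOn_univ]
  exact ContDiffOn.matrix_det (G := fun A : Fin k → Fin k → ℝ => Matrix.of A)
    (fun i j => by simpa using contDiffOn_univ.2 (by fun_prop))

theorem differentiableAt_det {E : Type*} [NormedAddCommGroup E] [NormedSpace ℝ E]
    {S : E → Matrix (Fin k) (Fin k) ℝ} {y₀ : E}
    (hS : ∀ i j, DifferentiableAt ℝ (fun y => S y i j) y₀) :
    DifferentiableAt ℝ (fun y => (S y).det) y₀ := by
  have h1 : DifferentiableAt ℝ (fun y => (fun i j => S y i j : Fin k → Fin k → ℝ)) y₀ :=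
    differentiableAt_pi.2 fun i => differentiableAt_pi.2 fun j => hS i j
  exact ((contDiff_det (n := 1)).differentiable (by simp) _).comp y₀ h1

/-- The identity matrix as a function of two indices. -/
def oneFun (k : ℕ) : Fin k → Fin k → ℝ := fun i j => (1 : Matrix (Fin k) (Fin k) ℝ) i j

theorem fderiv_det_one (B : Fin k → Fin k → ℝ) :
    fderiv ℝ (fun A : Fin k → Fin k → ℝ => (Matrix.of A).det) (oneFun k) B =
      (Matrix.of B).trace := by
  have hd : DifferentiableAt ℝ (fun A : Fin k → Fin k → ℝ => (Matrix.of A).det)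
      (oneFun k) := (contDiff_det (n := 1)).differentiable (by simp) _
  have h1 : HasDerivAt (fun r : ℝ => oneFun k + r • B) B 0 := by
    simpa using (((hasDerivAt_id (0 : ℝ)).smul_const B).const_add (oneFun k))
  have h2 : HasDerivAt (fun r : ℝ => (1 + r • (Matrix.of B)).det)
      (fderiv ℝ (fun A : Fin k → Fin k → ℝ => (Matrix.of A).det) (oneFun k) B) 0 := by
    have := HasFDerivAt.comp_hasDerivAt_of_eq (0 : ℝ) hd.hasFDerivAt h1
      (by simp : oneFun k = oneFun k + (0 : ℝ) • B)
    exact this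
  obtain ⟨c, hc⟩ : ∃ c : ℝ → ℝ, Differentiable ℝ c ∧
      ∀ r : ℝ, (1 + r • (Matrix.of B)).det = 1 + (Matrix.of B).trace * r + c r * r ^ 2 :=
    ⟨_, (Polynomial.differentiable _), fun r => Matrix.det_one_add_smul r (Matrix.of B)⟩
  have h3 : HasDerivAt (fun r : ℝ => (1 + r • (Matrix.of B)).det) (Matrix.of B).trace 0 := by
    have h4 : HasDerivAt (fun r : ℝ => 1 + (Matrix.of B).trace * r + c r * r ^ 2)
        (Matrix.of B).trace 0 := by
      have h5 := (hc.1 0).hasDerivAt.mul ((hasDerivAt_id (0 : ℝ)).pow 2)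
      have h6 := (((hasDerivAt_id (0 : ℝ)).const_mul (Matrix.of B).trace).const_add 1).add h5
      convert! h6 using 1
      simp
    refine h4.congr_of_eventuallyEq (Filter.Eventually.of_forall hc.2)
  exact h2.unique h3

theorem fderiv_det_of_eq_one {E : Type*} [NormedAddCommGroup E] [NormedSpace ℝ E]
    {S : E → Matrix (Fin k) (Fin k) ℝ} {y₀ : E} (h1 : S y₀ = 1)
    (hS : ∀ i j, DifferentiableAt ℝ (fun y => S y i j) y₀) (v : E) :
    fderiv ℝ (fun y => (S y).det) y₀ v = ∑ i, fderiv ℝ (fun y => S y i i) y₀ v := by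
  have hS' : HasFDerivAt (fun y => (fun i j => S y i j : Fin k → Fin k → ℝ))
      (ContinuousLinearMap.pi fun i => ContinuousLinearMap.pi fun j =>
        fderiv ℝ (fun y => S y i j) y₀) y₀ := by
    rw [hasFDerivAt_pi]
    intro i
    rw [hasFDerivAt_pi]
    intro j
    exact (hS i j).hasFDerivAt
  have hd : DifferentiableAt ℝ (fun A : Fin k → Fin k → ℝ => (Matrix.of A).det)
      (oneFun k) := (contDiff_det (n := 1)).differentiable (by simp) _
  have h1' : (fun i j => S y₀ i j : Fin k → Fin k → ℝ) = oneFun k := by rw [h1]; rfl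
  rw [← h1'] at hd
  have h2 := hd.hasFDerivAt.comp y₀ hS'
  have h3 : fderiv ℝ (fun y => (S y).det) y₀ = _ := h2.fderiv
  rw [h3, ContinuousLinearMap.comp_apply, h1', fderiv_det_one]
  simp [Matrix.trace]

theorem differentiableAt_adjugate {E : Type*} [NormedAddCommGroup E] [NormedSpace ℝ E]
    {S : E → Matrix (Fin k) (Fin k) ℝ} {y₀ : E}
    (hS : ∀ i j, DifferentiableAt ℝ (fun y => S y i j) y₀) (i j : Fin k) :
    DifferentiableAt ℝ (fun y => (S y).adjugate i j) y₀ := by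
  simp only [Matrix.adjugate_apply]
  refine differentiableAt_det fun a b => ?_
  by_cases ha : a = j
  · simp [ha]
  · simpa [Matrix.updateRow_apply, ha] using hS _ _

/-- Differentiate adj(S) S = det(S) 1 at a point where S = 1: the variation of the adjugate plus
that of S is the trace of the latter times the identity. -/
theorem fderiv_adjugate_of_eq_one {E : Type*} [NormedAddCommGroup E] [NormedSpace ℝ E]
    {S : E → Matrix (Fin k) (Fin k) ℝ} {y₀ : E} (h1 : S y₀ = 1)
    (hS : ∀ i j, DifferentiableAt ℝ (fun y => S y i j) y₀) (v : E) (j c : Fin k) :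
    fderiv ℝ (fun y => (S y).adjugate j c) y₀ v =
      (if j = c then ∑ i, fderiv ℝ (fun y => S y i i) y₀ v else 0) -
        fderiv ℝ (fun y => S y j c) y₀ v := by
  have hA := differentiableAt_adjugate hS
  have h2 : (fun y => ∑ l, (S y).adjugate j l * S y l c) =
      fun y => (S y).det * (1 : Matrix (Fin k) (Fin k) ℝ) j c := by
    funext y
    rw [← Matrix.mul_apply, Matrix.adjugate_mul]
    simp
  have hdet : DifferentiableAt ℝ (fun y => (S y).det) y₀ := differentiableAt_det hS
  have h3 : fderiv ℝ (fun y => ∑ l, (S y).adjugate j l * S y l c) y₀ v = fderiv ℝ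
      (fun y => (S y).det * (1 : Matrix (Fin k) (Fin k) ℝ) j c) y₀ v := by rw [h2]
  rw [fderiv_fun_sum (fun l _ => (hA j l).fun_mul (hS l c)), fderiv_mul_const hdet] at h3
  simp only [sum_apply, smul_apply, smul_eq_mul, fderiv_det_of_eq_one h1 hS] at h3
  have h4 : ∀ l, (fderiv ℝ (fun y => (S y).adjugate j l * S y l c) y₀) v =
      (if l = c then fderiv ℝ (fun y => (S y).adjugate j c) y₀ v else 0) +
      (if l = j then fderiv ℝ (fun y => S y j c) y₀ v else 0) := by
    intro l
    rw [fderiv_fun_mul (hA j l) (hS l c)]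
    simp only [h1, Matrix.adjugate_one, add_apply, smul_apply, smul_eq_mul, Matrix.one_apply]
    by_cases hl : l = c <;> by_cases hl' : l = j <;> simp [hl, hl', eq_comm]
    · subst hl'; subst hl; simp [add_comm]
    · subst hl; simp [Ne.symm hl']
    · subst hl'; simp [hl]
    · simp [Ne.symm hl']
  simp only [h4, Finset.sum_add_distrib, Finset.sum_ite_eq', Finset.mem_univ, if_true,
    Matrix.one_apply] at h3
  split_ifs at h3 ⊢ <;> linarith

theorem differentiableAt_jac {τ : Euc k → Euc k} {y₀ : Euc k} (hτ : ContDiffAt ℝ 2 τ y₀)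
    (i j : Fin k) : DifferentiableAt ℝ (fun y => jac τ y i j) y₀ := by
  have h1 : DifferentiableAt ℝ (fderiv ℝ τ) y₀ :=
    (hτ.fderiv_right (m := 1) (by norm_num)).differentiableAt (by simp)
  have h2 : DifferentiableAt ℝ (fun y => fderiv ℝ τ y (stdVec j)) y₀ :=
    h1.clm_apply (differentiableAt_const _)
  exact (differentiableAt_euclidean.1 h2) i

theorem fderiv_jac {τ : Euc k → Euc k} {y₀ : Euc k} (hτ : ContDiffAt ℝ 2 τ y₀)
    (i j l : Fin k) : fderiv ℝ (fun y => jac τ y i j) y₀ (stdVec l) =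
      (fderiv ℝ (fderiv ℝ τ) y₀ (stdVec l) (stdVec j)) i := by
  have h1 : DifferentiableAt ℝ (fderiv ℝ τ) y₀ :=
    (hτ.fderiv_right (m := 1) (by norm_num)).differentiableAt (by simp)
  have h2 := h1.hasFDerivAt.clm_apply (hasFDerivAt_const (stdVec j : Euc k) y₀)
  have h3 := (EuclideanSpace.proj (𝕜 := ℝ) i).hasFDerivAt.comp y₀ h2
  have h4 : fderiv ℝ (fun y => jac τ y i j) y₀ = _ := h3.fderiv
  rw [h4]
  simp

/-- The column index and the direction of differentiation are both partial derivatives of the same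
component of τ, and second derivatives are symmetric. -/
theorem fderiv_jac_symm {τ : Euc k → Euc k} {y₀ : Euc k} (hτ : ContDiffAt ℝ 2 τ y₀)
    (i j l : Fin k) : fderiv ℝ (fun y => jac τ y i j) y₀ (stdVec l) =
      fderiv ℝ (fun y => jac τ y i l) y₀ (stdVec j) := by
  rw [fderiv_jac hτ, fderiv_jac hτ, (hτ.isSymmSndFDerivAt (by simp)).eq]

/-- The Piola identity: the rows of the adjugate of a Jacobian matrix are divergence free. -/
theorem piola {τ : Euc k → Euc k} {y₀ : Euc k} (hτ : ContDiffAt ℝ 2 τ y₀)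
    (hdet : IsUnit (jac τ y₀).det) (a : Fin k) :
    ∑ j, fderiv ℝ (fun y => (jac τ y).adjugate j a) y₀ (stdVec j) = 0 := by
  set T₀ := jac τ y₀ with hT₀
  -- Multiplying on the left by the constant inverse of the Jacobian at y₀ reduces to S(y₀) = 1,
  -- where derivatives of the adjugate are explicit. Left multiplication mixes rows only, so the
  -- symmetry between column and direction is kept.
  set S : Euc k → Matrix (Fin k) (Fin k) ℝ := fun y => T₀⁻¹ * jac τ y with hS
  have hS1 : S y₀ = 1 := Matrix.nonsing_inv_mul _ hdet
  have hT : ∀ y, jac τ y = T₀ * S y := fun y => by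
    rw [hS, ← Matrix.mul_assoc, Matrix.mul_nonsing_inv _ hdet, Matrix.one_mul]
  have hSd : ∀ i j, DifferentiableAt ℝ (fun y => S y i j) y₀ := by
    intro i j
    simp only [hS, Matrix.mul_apply]
    exact DifferentiableAt.fun_sum fun l _ => (differentiableAt_jac hτ l j).const_mul _
  have hSs : ∀ i j l, fderiv ℝ (fun y => S y i j) y₀ (stdVec l) =
      fderiv ℝ (fun y => S y i l) y₀ (stdVec j) := by
    intro i j l
    simp only [hS, Matrix.mul_apply]
    rw [fderiv_fun_sum fun b _ => (differentiableAt_jac hτ b j).const_mul _,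
      fderiv_fun_sum fun b _ => (differentiableAt_jac hτ b l).const_mul _]
    simp only [sum_apply]
    refine Finset.sum_congr rfl fun b _ => ?_
    rw [fderiv_const_mul (differentiableAt_jac hτ b j),
      fderiv_const_mul (differentiableAt_jac hτ b l)]
    simp only [smul_apply, fderiv_jac_symm hτ b j l]
  have hA := differentiableAt_adjugate hSd
  -- The divergence is ∂_c tr S - ∑_j ∂_j S_jc, and the symmetry gives ∂_j S_jc = ∂_c S_jj.
  have key : ∀ c, ∑ j, fderiv ℝ (fun y => (S y).adjugate j c) y₀ (stdVec j) = 0 := by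
    intro c
    simp only [fderiv_adjugate_of_eq_one hS1 hSd, Finset.sum_sub_distrib]
    rw [Finset.sum_ite_eq' Finset.univ c, if_pos (Finset.mem_univ _), sub_eq_zero]
    exact Finset.sum_congr rfl fun i _ => hSs i i c
  have h1 : ∀ j, fderiv ℝ (fun y => (jac τ y).adjugate j a) y₀ (stdVec j) =
      ∑ c, fderiv ℝ (fun y => (S y).adjugate j c) y₀ (stdVec j) * T₀.adjugate c a := by
    intro j
    simp only [hT, Matrix.adjugate_mul_distrib, Matrix.mul_apply]
    rw [fderiv_fun_sum fun c _ => (hA j c).mul_const _]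
    simp only [sum_apply]
    refine Finset.sum_congr rfl fun c _ => ?_
    rw [fderiv_mul_const (hA j c)]
    simp [mul_comm]
  simp only [h1]
  rw [Finset.sum_comm]
  simp only [← Finset.sum_mul, key, zero_mul, Finset.sum_const_zero]

end piola

open scoped Topology

/-! ### Invariance of the Laplacian under diffeomorphisms -/

section pullback

variable {k : ℕ}

/-- The vector of partial derivatives. -/
def fgrad (F : Euc k → ℝ) (y : Euc k) (j : Fin k) : ℝ := fderiv ℝ F y (stdVec j)

/-- The `j`-th component of `√|G| G⁻¹ dF`, with unrestricted derivatives. -/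
def openFlux (G : Euc k → Matrix (Fin k) (Fin k) ℝ) (F : Euc k → ℝ) (j : Fin k) (y : Euc k) : ℝ :=
  √(G y).det * ((G y)⁻¹.mulVec (fgrad F y)) j

/-- The Laplacian in coordinates, with unrestricted derivatives. -/
def openLap (G : Euc k → Matrix (Fin k) (Fin k) ℝ) (F : Euc k → ℝ) (y : Euc k) : ℝ :=
  1 / √(G y).det * ∑ j, fgrad (openFlux G F j) y j

theorem fgrad_congr {F K : Euc k → ℝ} {y : Euc k} (h : F =ᶠ[𝓝 y] K) : fgrad F y = fgrad K y := by
  funext j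
  rw [fgrad, fgrad, h.fderiv_eq]

theorem openFlux_congr {G H : Euc k → Matrix (Fin k) (Fin k) ℝ} {F K : Euc k → ℝ} {y : Euc k}
    (hG : G =ᶠ[𝓝 y] H) (h : F =ᶠ[𝓝 y] K) (j : Fin k) :
    openFlux G F j =ᶠ[𝓝 y] openFlux H K j := by
  filter_upwards [hG, h.eventuallyEq_nhds] with z hz hz'
  rw [openFlux, openFlux, hz, fgrad_congr hz']

theorem openLap_congr {G H : Euc k → Matrix (Fin k) (Fin k) ℝ} {F K : Euc k → ℝ} {y : Euc k}
    (hG : G =ᶠ[𝓝 y] H) (h : F =ᶠ[𝓝 y] K) : openLap G F y = openLap H K y := by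
  rw [openLap, openLap, hG.eq_of_nhds]
  simp only [fgrad_congr (openFlux_congr hG h _)]

theorem fgrad_comp {τ : Euc k → Euc k} {F : Euc k → ℝ} {y : Euc k}
    (hτ : DifferentiableAt ℝ τ y) (hF : DifferentiableAt ℝ F (τ y)) :
    fgrad (fun z => F (τ z)) y = (jac τ y).transpose.mulVec (fgrad F (τ y)) := by
  refine Eq.trans ?_ (linform_frame (fderiv ℝ F (τ y)) (fderiv ℝ τ y))
  funext j
  have h : fderiv ℝ (fun z => F (τ z)) y = _ := (hF.hasFDerivAt.comp y hτ.hasFDerivAt).fderiv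
  rw [fgrad, h]
  rfl

/-- Raising an index turns a covector into a vector, which transforms by the inverse of the frame
change. -/
theorem inv_mulVec_frame (H T : Matrix (Fin k) (Fin k) ℝ) (hT : IsUnit T.det) (b : Fin k → ℝ) :
    (T.transpose * H * T)⁻¹.mulVec (T.transpose.mulVec b) = T⁻¹.mulVec (H⁻¹.mulVec b) := by
  have hPt : IsUnit T.transpose.det := by rwa [Matrix.det_transpose]
  rw [Matrix.mul_inv_rev, Matrix.mul_inv_rev, Matrix.mulVec_mulVec, Matrix.mul_assoc,
    Matrix.mul_assoc, Matrix.nonsing_inv_mul _ hPt, Matrix.mul_one, ← Matrix.mulVec_mulVec]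

/-- The Laplacian is invariant under changes of coordinates. -/
theorem openLap_pullback {τ : Euc k → Euc k} {y₀ : Euc k} (hτ : ContDiffAt ℝ 2 τ y₀)
    (hdet : IsUnit (jac τ y₀).det) {G H : Euc k → Matrix (Fin k) (Fin k) ℝ}
    (hG : ∀ᶠ y in 𝓝 y₀, G y = (jac τ y).transpose * H (τ y) * jac τ y)
    (hH : ∀ᶠ y in 𝓝 y₀, 0 < (H (τ y)).det) {F : Euc k → ℝ}
    (hF : ∀ᶠ y in 𝓝 y₀, DifferentiableAt ℝ F (τ y))
    (hX : ∀ a, DifferentiableAt ℝ (openFlux H F a) (τ y₀)) :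
    openLap G (fun y => F (τ y)) y₀ = openLap H F (τ y₀) := by
  set J : Euc k → ℝ := fun y => (jac τ y).det with hJ
  have hJd : ContinuousAt J y₀ := (differentiableAt_det (differentiableAt_jac hτ)).continuousAt
  have hJ0 : J y₀ ≠ 0 := hdet.ne_zero
  -- The number ε is the sign of the Jacobian determinant, constant near y₀. It removes the absolute
  -- value, so that the flux becomes a differentiable expression.
  obtain ⟨ε, hε⟩ : ∃ ε : ℝ, ∀ᶠ y in 𝓝 y₀, |J y| = ε * J y := by
    rcases lt_or_gt_of_ne hJ0 with h | h
    · refine ⟨-1, ?_⟩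
      filter_upwards [hJd.eventually_lt_const h] with y hy
      rw [abs_of_neg hy]; ring
    · refine ⟨1, ?_⟩
      filter_upwards [hJd.eventually_const_lt h] with y hy
      rw [abs_of_pos hy]; ring
  have hJne : ∀ᶠ y in 𝓝 y₀, J y ≠ 0 := hJd.eventually_ne hJ0
  have hτd : ∀ᶠ y in 𝓝 y₀, DifferentiableAt ℝ τ y := by
    filter_upwards [hτ.eventually (by simp)] with y hy using hy.differentiableAt (by simp)
  have hsqrt : ∀ᶠ y in 𝓝 y₀, √(G y).det = |J y| * √(H (τ y)).det := by
    filter_upwards [hG, hH] with y h1 h2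
    rw [h1, Matrix.det_mul, Matrix.det_mul, Matrix.det_transpose,
      show (jac τ y).det * (H (τ y)).det * (jac τ y).det = (J y) ^ 2 * (H (τ y)).det by
        simp only [hJ]; ring, Real.sqrt_mul (sq_nonneg _), Real.sqrt_sq_eq_abs]
  -- The density contributes |det J| and the raised index contributes J⁻¹ = adj(J)/det J. Up to the
  -- sign ε only the adjugate remains, which is the setting of the Piola identity.
  have hflux : ∀ j, openFlux G (fun y => F (τ y)) j =ᶠ[𝓝 y₀]
      fun y => ε * ∑ a, (jac τ y).adjugate j a * openFlux H F a (τ y) := by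
    intro j
    filter_upwards [hG, hH, hF, hJne, hτd, hsqrt, hε] with y h1 h2 h3 h4 h5 h6 h7
    have hu : IsUnit (jac τ y).det := isUnit_iff_ne_zero.2 h4
    rw [openFlux, h6, h1, fgrad_comp h5 h3, inv_mulVec_frame _ _ hu, Matrix.inv_def,
      Ring.inverse_eq_inv', h7]
    simp only [Matrix.smul_mulVec, Pi.smul_apply, smul_eq_mul, openFlux]
    have h9 : (jac τ y).adjugate.mulVec ((H (τ y))⁻¹.mulVec (fgrad F (τ y))) j =
        ∑ a, (jac τ y).adjugate j a * ((H (τ y))⁻¹.mulVec (fgrad F (τ y))) a := rfl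
    rw [h9]
    simp only [Finset.mul_sum]
    refine Finset.sum_congr rfl fun a _ => ?_
    have h8 : (jac τ y).det ≠ 0 := h4
    simp only [hJ]
    field_simp
  have hcomp : ∀ a, HasFDerivAt (fun y => openFlux H F a (τ y))
      ((fderiv ℝ (openFlux H F a) (τ y₀)).comp (fderiv ℝ τ y₀)) y₀ := fun a =>
    (hX a).hasFDerivAt.comp y₀ (hτ.differentiableAt (by simp)).hasFDerivAt
  have hadj := differentiableAt_adjugate (differentiableAt_jac hτ)
  have hchain : ∀ a j, fderiv ℝ (openFlux H F a) (τ y₀) (fderiv ℝ τ y₀ (stdVec j)) =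
      ∑ c, jac τ y₀ c j * fgrad (openFlux H F a) (τ y₀) c := by
    intro a j
    conv_lhs => rw [eq_sum_stdVec (fderiv ℝ τ y₀ (stdVec j))]
    simp [fgrad, jac]
  have hgrad : ∀ j, fgrad (openFlux G (fun y => F (τ y)) j) y₀ j =
      ε * ∑ a, (fderiv ℝ (fun y => (jac τ y).adjugate j a) y₀ (stdVec j) * openFlux H F a (τ y₀) +
        (jac τ y₀).adjugate j a * ∑ c, jac τ y₀ c j * fgrad (openFlux H F a) (τ y₀) c) := by
    intro j
    rw [fgrad, (hflux j).fderiv_eq, fderiv_const_mul, fderiv_fun_sum]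
    · simp only [smul_apply, sum_apply, smul_eq_mul]
      congr 1
      refine Finset.sum_congr rfl fun a _ => ?_
      rw [fderiv_fun_mul (hadj j a) (hcomp a).differentiableAt, (hcomp a).fderiv]
      simp only [add_apply, smul_apply, smul_eq_mul, ContinuousLinearMap.comp_apply, hchain]
      ring
    · exact fun a _ => (hadj j a).fun_mul (hcomp a).differentiableAt
    · exact DifferentiableAt.fun_sum fun a _ => (hadj j a).fun_mul (hcomp a).differentiableAt
  -- By `piola`, derivatives falling on the adjugate add up to zero. In the other terms J adj(J) =
  -- det J contracts the chain rule to a divergence.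
  have hsum : ∑ j, fgrad (openFlux G (fun y => F (τ y)) j) y₀ j =
      ε * (J y₀ * ∑ a, fgrad (openFlux H F a) (τ y₀) a) := by
    simp only [hgrad]
    rw [← Finset.mul_sum, Finset.sum_comm]
    congr 1
    simp only [Finset.sum_add_distrib, ← Finset.sum_mul, piola hτ hdet, zero_mul, zero_add]
    rw [Finset.mul_sum]
    refine Finset.sum_congr rfl fun a _ => ?_
    simp only [Finset.mul_sum]
    rw [Finset.sum_comm]
    have h9 : ∀ c, ∑ j, (jac τ y₀).adjugate j a * (jac τ y₀ c j * fgrad (openFlux H F a) (τ y₀) c) =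
        (if c = a then J y₀ else 0) * fgrad (openFlux H F a) (τ y₀) c := by
      intro c
      have h10 : (jac τ y₀ * (jac τ y₀).adjugate) c a = if c = a then J y₀ else 0 := by
        rw [Matrix.mul_adjugate]
        simp [Matrix.one_apply, hJ]
      rw [← h10, Matrix.mul_apply, Finset.sum_mul]
      exact Finset.sum_congr rfl fun j _ => by ring
    simp only [h9, ite_mul, zero_mul, Finset.sum_ite_eq', Finset.mem_univ, if_true]
  have hHp := hH.self_of_nhds
  rw [openLap, openLap, hsum, hsqrt.self_of_nhds, hε.self_of_nhds]
  have h11 : √(H (τ y₀)).det ≠ 0 := (Real.sqrt_pos.2 hHp).ne'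
  have h12 : ε ≠ 0 := by
    intro h0
    have := hε.self_of_nhds
    rw [h0, zero_mul, abs_eq_zero] at this
    exact hJ0 this
  field_simp

end pullback

/-! ### Chart independence of the Laplacian up to the boundary -/

section chartLap

variable {m : ℕ} {M : Type*} [TopologicalSpace M] [ChartedSpace (EuclideanHalfSpace (m + 1)) M]

theorem pd_eq_fgrad (F : Euc (m + 1) → ℝ) {y : Euc (m + 1)}
    (hy : y ∈ interior (range (𝓡∂ (m + 1)))) : pd F y = fgrad F y := by
  funext j
  rw [pd, fgrad, fderivWithin_of_mem_nhds (mem_interior_iff_mem_nhds.1 hy)]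

theorem flux_eventuallyEq (G : Euc (m + 1) → Matrix (Fin (m + 1)) (Fin (m + 1)) ℝ)
    (F : Euc (m + 1) → ℝ) {y : Euc (m + 1)}
    (hy : y ∈ interior (range (𝓡∂ (m + 1)))) (j : Fin (m + 1)) :
    flux G F j =ᶠ[𝓝 y] openFlux G F j := by
  filter_upwards [isOpen_interior.mem_nhds hy] with z hz
  rw [flux, openFlux, pd_eq_fgrad F hz]

theorem locLap_eq_openLap (G : Euc (m + 1) → Matrix (Fin (m + 1)) (Fin (m + 1)) ℝ)
    (F : Euc (m + 1) → ℝ) {y : Euc (m + 1)} (hy : y ∈ interior (range (𝓡∂ (m + 1)))) :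
    locLap G F y = openLap G F y := by
  simp only [locLap, openLap, pd_eq_fgrad _ hy, fgrad_congr (flux_eventuallyEq G F hy _)]

theorem mem_nhds_of_interior {s : Set (Euc (m + 1))} {y : Euc (m + 1)}
    (hs : s ∈ 𝓝[range (𝓡∂ (m + 1))] y) (hy : y ∈ interior (range (𝓡∂ (m + 1)))) : s ∈ 𝓝 y := by
  rwa [nhdsWithin_eq_nhds.2 (mem_interior_iff_mem_nhds.1 hy)] at hs

variable [IsManifold (𝓡∂ (m + 1)) ∞ M]

theorem tmat_eq_jac (p q : M) {y : Euc (m + 1)} (hy : y ∈ interior (range (𝓡∂ (m + 1)))) :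
    tmat p q y = jac (tau p q) y := by
  ext i j
  simp only [tmat, jac, fderivWithin_of_mem_nhds (mem_interior_iff_mem_nhds.1 hy)]

/-- Whether a point is interior to the manifold may be tested in any chart of the atlas. -/
theorem tau_mem_interior {p q : M} {y : Euc (m + 1)} (hy : y ∈ overlap p q)
    (hi : y ∈ interior (range (𝓡∂ (m + 1)))) : tau p q y ∈ interior (range (𝓡∂ (m + 1))) := by
  have h1 : (extChartAt (𝓡∂ (m + 1)) p).symm y ∈ (chartAt (EuclideanHalfSpace (m + 1)) p).source := by
    rw [← extChartAt_source (𝓡∂ (m + 1))]; exact (extChartAt (𝓡∂ (m + 1)) p).map_target hy.1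
  have h2 : (extChartAt (𝓡∂ (m + 1)) p).symm y ∈ (chartAt (EuclideanHalfSpace (m + 1)) q).source := by
    rw [← extChartAt_source (𝓡∂ (m + 1))]; exact hy.2
  have h3 := (𝓡∂ (m + 1)).isInteriorPoint_iff_of_mem_atlas (n := ∞) (by simp)
    (chart_mem_atlas (EuclideanHalfSpace (m + 1)) p) h1
  have h4 := (𝓡∂ (m + 1)).isInteriorPoint_iff_of_mem_atlas (n := ∞) (by simp)
    (chart_mem_atlas (EuclideanHalfSpace (m + 1)) q) h2
  refine interior_mono (extChartAt_target_subset_range q) (h4.1 (h3.2 ?_))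
  have h6 : y ∈ interior (extChartAt (𝓡∂ (m + 1)) p).target := mem_interior_iff_mem_nhds.2
    (mem_nhds_of_interior (extChartAt_target_mem_nhdsWithin_of_mem hy.1) hi)
  have h5 : extChartAt (𝓡∂ (m + 1)) p ((extChartAt (𝓡∂ (m + 1)) p).symm y) = y :=
    (extChartAt (𝓡∂ (m + 1)) p).right_inv hy.1
  exact h5.symm ▸ h6

theorem contDiffOn_locLap (g : MetricBdry m M) {p : M} {F : Euc (m + 1) → ℝ}
    (hF : ContDiffOn ℝ 2 F (extChartAt (𝓡∂ (m + 1)) p).target) :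
    ContDiffOn ℝ 0 (locLap (chartGram g p) F) (extChartAt (𝓡∂ (m + 1)) p).target := by
  have h := contDiffOn_locLap_slice zero_lt_one g (k := 0) (n := 2) (by norm_num) (by simp)
    (W := fun z => F z.2) (p := p) (T := 1) (hF.comp contDiffOn_snd (fun _ hz => hz.2))
  have h2 := h.comp (f := fun y => ((0 : ℝ), y)) (s := (extChartAt (𝓡∂ (m + 1)) p).target)
    (contDiffOn_const.prodMk contDiffOn_id) (fun y hy => ⟨by simp, hy⟩)
  simpa only [Function.comp_def] using h2

theorem locLap_tau_of_interior (g : MetricBdry m M) {f : M → ℝ} (hf : CReg m 2 f) {p q : M}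
    {y : Euc (m + 1)} (hy : y ∈ overlap p q) (hi : y ∈ interior (range (𝓡∂ (m + 1)))) :
    locLap (chartGram g p) (rep p f) y = locLap (chartGram g q) (rep q f) (tau p q y) := by
  have hi' := tau_mem_interior hy hi
  have hmem := mem_nhds_of_interior (overlap_mem_nhdsWithin hy) hi
  have hint := isOpen_interior.mem_nhds hi
  rw [locLap_eq_openLap _ _ hi, locLap_eq_openLap _ _ hi']
  have h1 : rep p f =ᶠ[𝓝 y] fun z => rep q f (tau p q z) := by
    filter_upwards [hmem] with z hz
    rw [rep, rep, symm_tau hz]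
  rw [openLap_congr (Filter.EventuallyEq.refl _ _) h1]
  have htgt : ∀ z ∈ overlap p q, z ∈ interior (range (𝓡∂ (m + 1))) →
      (extChartAt (𝓡∂ (m + 1)) q).target ∈ 𝓝 (tau p q z) := fun z hz hzi =>
    mem_nhds_of_interior (extChartAt_target_mem_nhdsWithin_of_mem (tau_mem_overlap hz).1)
      (tau_mem_interior hz hzi)
  refine openLap_pullback ?_ ?_ ?_ ?_ ?_ ?_
  · exact ((contDiffWithinAt_tau hy).of_le (by norm_cast)).contDiffAt
      (mem_interior_iff_mem_nhds.1 hi)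
  · rw [← tmat_eq_jac p q hi]
    exact isUnit_tmat hy
  · filter_upwards [hmem, hint] with z hz hzi
    rw [← tmat_eq_jac p q hzi]
    exact chartGram_tau g hz
  · filter_upwards [hmem] with z hz using chartGram_det_pos g (tau_mem_overlap hz).1
  · filter_upwards [hmem, hint] with z hz hzi
    exact ((hf q).differentiableOn (by simp)).differentiableAt (htgt z hz hzi)
  · intro a
    refine DifferentiableAt.congr_of_eventuallyEq ?_ (flux_eventuallyEq _ _ hi' a).symm
    exact ((contDiffOn_flux g (k := 1) (n := 2) (by norm_num) (by norm_cast) (hf q) a).differentiableOn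
      (by simp)).differentiableAt (htgt y hy hi)

/-- At interior points this is `openLap_pullback`. Both sides are continuous on the overlap,
boundary points included, because the derivatives are taken within the half space, and interior
points are dense in it. -/
theorem locLap_tau (g : MetricBdry m M) {f : M → ℝ} (hf : CReg m 2 f) {p q : M}
    {y : Euc (m + 1)} (hy : y ∈ overlap p q) :
    locLap (chartGram g p) (rep p f) y = locLap (chartGram g q) (rep q f) (tau p q y) := by
  have h1 : EqOn (locLap (chartGram g p) (rep p f))
      (fun y => locLap (chartGram g q) (rep q f) (tau p q y))
      (overlap p q ∩ interior (range (𝓡∂ (m + 1)))) := fun z hz =>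
    locLap_tau_of_interior g hf hz.1 hz.2
  have hτc : ContinuousOn (tau (m := m) p q) (overlap p q) := fun z hz =>
    (contDiffWithinAt_tau hz).continuousWithinAt.mono
      (fun w hw => extChartAt_target_subset_range p hw.1)
  refine h1.of_subset_closure (t := overlap p q)
    ((contDiffOn_locLap g (hf p)).continuousOn.mono inter_subset_left)
    ((contDiffOn_locLap g (hf q)).continuousOn.comp hτc fun z hz => (tau_mem_overlap hz).1)
    inter_subset_left ?_ hy
  intro z hz
  obtain ⟨O, hO, hzO, hOs⟩ := mem_nhdsWithin.1 (overlap_mem_nhdsWithin hz)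
  have h2 : z ∈ closure (interior (range (𝓡∂ (m + 1)))) :=
    (𝓡∂ (m + 1)).range_subset_closure_interior (extChartAt_target_subset_range p hz.1)
  have h3 := hO.inter_closure
    (show z ∈ O ∩ closure (interior (range (𝓡∂ (m + 1)))) from ⟨hzO, h2⟩)
  have h4 : O ∩ interior (range (𝓡∂ (m + 1))) ⊆ overlap p q ∩ interior (range (𝓡∂ (m + 1))) :=
    fun w hw => ⟨hOs ⟨hw.1, interior_subset hw.2⟩, hw.2⟩
  exact closure_mono h4 h3

/-- By definition `lap` is computed at each point in a chart depending on that point. This makes one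
fixed chart usable on its whole domain, hence also continuity of `lap` and integration by parts
possible. -/
theorem lap_chart (g : MetricBdry m M) {f : M → ℝ} (hf : CReg m 2 f) {p : M}
    {y : Euc (m + 1)} (hy : y ∈ (extChartAt (𝓡∂ (m + 1)) p).target) :
    lap g f ((extChartAt (𝓡∂ (m + 1)) p).symm y) = locLap (chartGram g p) (rep p f) y :=
  (locLap_tau g hf (q := (extChartAt (𝓡∂ (m + 1)) p).symm y) ⟨hy, mem_extChartAt_source _⟩).symm

theorem JReg.lap {T : ℝ} (hT : 0 < T) (g : MetricBdry m M) {u : ℝ → M → ℝ} (hu : JReg m T 2 u) :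
    JReg m T 0 (fun t => lap g (u t)) := by
  intro p
  refine (contDiffOn_locLap_slice hT g (k := 0) (n := 2) (by norm_num) (by simp) (hu p)).congr
    fun z hz => ?_
  exact lap_chart g (hu.slice hz.1) hz.2

end chartLap

/-! ### Metrics of the form dw₀² + h on Euclidean space -/

section translation

variable {k : ℕ}

/-- No differentiability is needed: where it fails, `fderiv` has the default value zero. -/
theorem fgrad_eq_zero_of_shift {c : Euc k → ℝ} {j : Fin k} {w : Euc k}
    (h : ∀ s : ℝ, c (w + s • stdVec j) = c w) : fgrad c w j = 0 := by
  by_cases hd : DifferentiableAt ℝ c w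
  · have h1 : HasDerivAt (fun s : ℝ => w + s • (stdVec j : Euc k)) (stdVec j) 0 := by
      simpa using (((hasDerivAt_id (0 : ℝ)).smul_const (stdVec j : Euc k)).const_add w)
    have h2 := HasFDerivAt.comp_hasDerivAt_of_eq (0 : ℝ) hd.hasFDerivAt h1 (by simp)
    have h3 : HasDerivAt (fun _ : ℝ => c w) (fderiv ℝ c w (stdVec j)) 0 :=
      h2.congr_of_eventuallyEq (Filter.Eventually.of_forall fun s => (h s).symm)
    exact h3.unique (hasDerivAt_const _ _)
  · simp [fgrad, fderiv_zero_of_not_differentiableAt hd]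

theorem contDiffAt_fgrad {F : Euc k → ℝ} {y : Euc k} (hF : ContDiffAt ℝ 2 F y) (j : Fin k) :
    ContDiffAt ℝ 1 (fun z => fgrad F z j) y :=
  (hF.fderiv_right (m := 1) (by norm_num)).clm_apply contDiffAt_const

theorem fgrad_fgrad_symm {F : Euc k → ℝ} {y : Euc k} (hF : ContDiffAt ℝ 2 F y) (i j : Fin k) :
    fgrad (fun z => fgrad F z i) y j = fgrad (fun z => fgrad F z j) y i := by
  have h1 : DifferentiableAt ℝ (fderiv ℝ F) y :=
    (hF.fderiv_right (m := 1) (by norm_num)).differentiableAt (by simp)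
  have h2 : ∀ i j : Fin k, fgrad (fun z => fgrad F z i) y j =
      fderiv ℝ (fderiv ℝ F) y (stdVec j) (stdVec i) := by
    intro i j
    have h3 := h1.hasFDerivAt.clm_apply (hasFDerivAt_const (stdVec i : Euc k) y)
    have h4 : fderiv ℝ (fun z => fgrad F z i) y = _ := h3.fderiv
    rw [fgrad, h4]
    simp
  rw [h2, h2, (hF.isSymmSndFDerivAt (by simp)).eq]

theorem coPair_comm {G : Matrix (Fin k) (Fin k) ℝ} (hG : G.transpose = G) (a b : Fin k → ℝ) :
    coPair G a b = coPair G b a := by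
  rw [coPair, coPair, Matrix.dotProduct_mulVec, ← Matrix.mulVec_transpose,
    Matrix.transpose_nonsing_inv, hG, dotProduct_comm]

/-- The zeroth basis covector is fixed by H, hence by H⁻¹: the gradient of the coordinate w₀ is
∂_{w₀}. -/
theorem coPair_single {H : Matrix (Fin (k + 1)) (Fin (k + 1)) ℝ} (hH : IsUnit H.det)
    (hs : H.transpose = H) (h0 : ∀ i, H i 0 = if i = 0 then 1 else 0) (b : Fin (k + 1) → ℝ) :
    coPair H (Pi.single 0 1) b = b 0 := by
  have h1 : H.mulVec (Pi.single 0 1) = Pi.single 0 1 := by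
    ext i
    simp [h0, Pi.single_apply]
  have h2 : H⁻¹.mulVec (Pi.single 0 1) = Pi.single 0 1 := by
    conv_lhs => rw [← h1]
    rw [Matrix.mulVec_mulVec, Matrix.nonsing_inv_mul _ hH, Matrix.one_mulVec]
  rw [coPair_comm hs, coPair, h2]
  simp

variable {Φ : Euc (k + 1) → Euc (k + 1)} {y₀ : Euc (k + 1)}
  {G H : Euc (k + 1) → Matrix (Fin (k + 1)) (Fin (k + 1)) ℝ}

theorem fgrad_coord (y : Euc (k + 1)) :
    fgrad (fun w : Euc (k + 1) => w 0) y = Pi.single 0 1 := by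
  funext j
  have h1 : fderiv ℝ (fun w : Euc (k + 1) => w 0) y = EuclideanSpace.proj (𝕜 := ℝ) 0 :=
    (EuclideanSpace.proj (𝕜 := ℝ) (0 : Fin (k + 1))).fderiv
  rw [fgrad, h1]
  simp [stdVec_apply, Pi.single_apply]

/-- In coordinates where the metric is `dw₀² + h`, the coordinate `w₀` is harmonic. -/
theorem openLap_coord (hdet : ∀ᶠ w in 𝓝 y₀, IsUnit (H w).det) (hs : ∀ w, (H w).transpose = H w)
    (h0 : ∀ w i, H w i 0 = if i = 0 then 1 else 0)
    (hshift : ∀ w (s : ℝ), H (w + s • stdVec 0) = H w) :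
    openLap H (fun w => w 0) y₀ = 0 := by
  -- The flux of w₀ is √det H times the zeroth basis vector, so its divergence is the w₀-derivative
  -- of a function that does not depend on w₀.
  have h1 : ∀ j, openFlux H (fun w => w 0) j =ᶠ[𝓝 y₀]
      fun w => √(H w).det * (if j = 0 then 1 else 0) := by
    intro j
    filter_upwards [hdet] with w hw
    have h2 := coPair_single hw (hs w) (h0 w) (Pi.single j 1)
    rw [coPair_comm (hs w), coPair, single_dotProduct, one_mul] at h2
    rw [openFlux, fgrad_coord, h2]
    simp [Pi.single_apply, eq_comm]
  have h3 : ∀ j, fgrad (openFlux H (fun w => w 0) j) y₀ j = 0 := by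
    intro j
    rw [fgrad_congr (h1 j)]
    by_cases hj : j = 0
    · subst hj
      exact fgrad_eq_zero_of_shift fun s => by simp [hshift]
    · simp [hj, fgrad]
  simp [openLap, h3]

/-- In coordinates where the metric is `dw₀² + h`, the field `∂_{w₀}` is a Killing field. -/
theorem killing_pullback (hΦ : ContDiffAt ℝ 2 Φ y₀) (hdet : IsUnit (jac Φ y₀).det)
    (hG : ∀ᶠ y in 𝓝 y₀, G y = (jac Φ y).transpose * H (Φ y) * jac Φ y)
    {V : Set (Euc (k + 1))} (hV : V ∈ 𝓝 (Φ y₀)) (hHd : ∀ i j, ContDiffOn ℝ 1 (fun w => H w i j) V)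
    (hHu : ∀ w ∈ V, (H w).det ≠ 0) (hs : ∀ w, (H w).transpose = H w)
    (h0 : ∀ w i, H w i 0 = if i = 0 then 1 else 0)
    (hshift : ∀ w (s : ℝ), H (w + s • stdVec 0) = H w)
    {F : Euc (k + 1) → ℝ} (hF : ContDiffAt ℝ 2 F y₀) :
    coPair (G y₀) (fgrad (fun y => Φ y 0) y₀)
        (fgrad (fun y => coPair (G y) (fgrad F y) (fgrad F y)) y₀) =
      2 * coPair (G y₀)
        (fgrad (fun y => coPair (G y) (fgrad (fun y => Φ y 0) y) (fgrad F y)) y₀)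
        (fgrad F y₀) := by
  -- the inverse of `Φ`
  have hL : ∃ e : Euc (k + 1) ≃L[ℝ] Euc (k + 1), (e : Euc (k + 1) →L[ℝ] Euc (k + 1)) = fderiv ℝ Φ y₀ := by
    have h1 : IsUnit (LinearMap.det (fderiv ℝ Φ y₀ : Euc (k + 1) →ₗ[ℝ] Euc (k + 1))) := by
      have h2 : LinearMap.toMatrix (EuclideanSpace.basisFun (Fin (k + 1)) ℝ).toBasis
          (EuclideanSpace.basisFun (Fin (k + 1)) ℝ).toBasis
          (fderiv ℝ Φ y₀ : Euc (k + 1) →ₗ[ℝ] Euc (k + 1)) = jac Φ y₀ := by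
        ext i j
        simp [LinearMap.toMatrix_apply, jac, stdVec]
      rw [← LinearMap.det_toMatrix (EuclideanSpace.basisFun (Fin (k + 1)) ℝ).toBasis, h2]
      exact hdet
    refine ⟨(LinearEquiv.ofIsUnitDet (v := (EuclideanSpace.basisFun (Fin (k + 1)) ℝ).toBasis)
      (v' := (EuclideanSpace.basisFun (Fin (k + 1)) ℝ).toBasis)
      (f := (fderiv ℝ Φ y₀ : Euc (k + 1) →ₗ[ℝ] Euc (k + 1))) ?_).toContinuousLinearEquiv, ?_⟩
    · rwa [LinearMap.det_toMatrix]
    · ext v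
      rfl
  obtain ⟨e, he⟩ := hL
  have hΦ' : HasFDerivAt Φ (e : Euc (k + 1) →L[ℝ] Euc (k + 1)) y₀ := by
    rw [he]; exact (hΦ.differentiableAt (by simp)).hasFDerivAt
  set P := hΦ.toOpenPartialHomeomorph Φ hΦ' (by simp) with hP
  set σ := hΦ.localInverse hΦ' (by simp) with hσ
  have hσC : ContDiffAt ℝ 2 σ (Φ y₀) := hΦ.to_localInverse hΦ' (by simp)
  have hσ0 : σ (Φ y₀) = y₀ := hΦ.localInverse_apply_image hΦ' (by simp)
  have hσΦ : ∀ᶠ y in 𝓝 y₀, σ (Φ y) = y := P.eventually_left_inverse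
    (hΦ.mem_toOpenPartialHomeomorph_source hΦ' (by simp))
  -- Pushed forward by the local inverse of Φ, the claim becomes ∂₀(H^{ij} ∂_i f ∂_j f) = 2 H^{ij}
  -- ∂_i(∂₀ f) ∂_j f.
  set f : Euc (k + 1) → ℝ := fun w => F (σ w) with hf
  have hfC : ContDiffAt ℝ 2 f (Φ y₀) := by
    refine ContDiffAt.comp (Φ y₀) ?_ hσC
    rw [hσ0]; exact hF
  have hFf : F =ᶠ[𝓝 y₀] fun y => f (Φ y) := by
    filter_upwards [hσΦ] with y hy
    simp only [hf, hy]
  have hΦc : ContinuousAt Φ y₀ := hΦ.continuousAt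
  have hΦd : ∀ᶠ y in 𝓝 y₀, DifferentiableAt ℝ Φ y := by
    filter_upwards [hΦ.eventually (by simp)] with y hy using hy.differentiableAt (by simp)
  have hfd : ∀ᶠ y in 𝓝 y₀, DifferentiableAt ℝ f (Φ y) := by
    refine hΦc.eventually ?_
    filter_upwards [hfC.eventually (by simp)] with y hy using hy.differentiableAt (by simp)
  have hju : ∀ᶠ y in 𝓝 y₀, IsUnit (jac Φ y).det := by
    filter_upwards [(differentiableAt_det (differentiableAt_jac hΦ)).continuousAt.eventually_ne
      hdet.ne_zero] with y hy using isUnit_iff_ne_zero.2 hy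
  have hVe : ∀ᶠ y in 𝓝 y₀, Φ y ∈ V := hΦc.eventually hV
  have hgF : ∀ᶠ y in 𝓝 y₀, fgrad F y = (jac Φ y).transpose.mulVec (fgrad f (Φ y)) := by
    filter_upwards [hFf.eventuallyEq_nhds, hΦd, hfd] with y h1 h2 h3
    rw [fgrad_congr h1, fgrad_comp h2 h3]
  have hcd : ∀ w : Euc (k + 1), DifferentiableAt ℝ (fun w : Euc (k + 1) => w 0) w := fun w =>
    (EuclideanSpace.proj (𝕜 := ℝ) (0 : Fin (k + 1))).differentiableAt
  have hg0 : ∀ᶠ y in 𝓝 y₀, fgrad (fun y => Φ y 0) y =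
      (jac Φ y).transpose.mulVec (Pi.single 0 1) := by
    filter_upwards [hΦd] with y h2
    rw [← fgrad_coord (Φ y), ← fgrad_comp h2 (hcd _)]
  set Q : Euc (k + 1) → ℝ := fun w => coPair (H w) (fgrad f w) (fgrad f w) with hQ
  have hQe : (fun y => coPair (G y) (fgrad F y) (fgrad F y)) =ᶠ[𝓝 y₀] fun y => Q (Φ y) := by
    filter_upwards [hG, hgF, hju] with y h1 h2 h3
    rw [h1, h2, coPair_frame _ _ h3]
  have hXe : (fun y => coPair (G y) (fgrad (fun y => Φ y 0) y) (fgrad F y)) =ᶠ[𝓝 y₀]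
      fun y => (fun w => fgrad f w 0) (Φ y) := by
    filter_upwards [hG, hgF, hju, hg0, hVe] with y h1 h2 h3 h4 h5
    rw [h1, h2, h4, coPair_frame _ _ h3,
      coPair_single (isUnit_iff_ne_zero.2 (hHu _ h5)) (hs _) (h0 _)]
  have hinv : ∀ i j, DifferentiableAt ℝ (fun w => (H w)⁻¹ i j) (Φ y₀) := fun i j =>
    ((ContDiffOn.matrix_inv hHd hHu i j).differentiableOn (by simp)).differentiableAt hV
  have hfg : ∀ i, DifferentiableAt ℝ (fun w => fgrad f w i) (Φ y₀) := fun i =>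
    (contDiffAt_fgrad hfC i).differentiableAt (by simp)
  have hterm : ∀ i j, DifferentiableAt ℝ
      (fun w => fgrad f w i * ((H w)⁻¹ i j * fgrad f w j)) (Φ y₀) := fun i j =>
    (hfg i).fun_mul ((hinv i j).fun_mul (hfg j))
  have hQs : Q = fun w => ∑ i, ∑ j, fgrad f w i * ((H w)⁻¹ i j * fgrad f w j) := by
    funext w
    simp [hQ, coPair, dotProduct, Matrix.mulVec, Finset.mul_sum]
  have hQd : DifferentiableAt ℝ Q (Φ y₀) := by
    rw [hQs]
    exact DifferentiableAt.fun_sum fun i _ => DifferentiableAt.fun_sum fun j _ => hterm i j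
  have hΦ0 := hΦd.self_of_nhds
  rw [fgrad_congr hQe, fgrad_congr hXe, fgrad_comp hΦ0 hQd, fgrad_comp hΦ0 (hfg 0),
    hg0.self_of_nhds, hgF.self_of_nhds, hG.self_of_nhds, coPair_frame _ _ hdet,
    coPair_frame _ _ hdet,
    coPair_single (isUnit_iff_ne_zero.2 (hHu _ (mem_of_mem_nhds hV))) (hs _) (h0 _)]
  set w := Φ y₀
  have hsym : ∀ i, fgrad (fun z => fgrad f z i) w 0 = fgrad (fun z => fgrad f z 0) w i :=
    fun i => fgrad_fgrad_symm hfC i 0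
  -- The coefficients H^{ij} are invariant under translation in w₀. This is the only place where the
  -- Killing property arises; the rest is the product rule and the symmetry of second derivatives.
  have hz : ∀ i j, fgrad (fun w => (H w)⁻¹ i j) w 0 = 0 := fun i j =>
    fgrad_eq_zero_of_shift fun s => by rw [hshift]
  have hd : fgrad Q w 0 = ∑ i, ∑ j,
      (fgrad (fun z => fgrad f z 0) w i * ((H w)⁻¹ i j * fgrad f w j) +
        fgrad f w i * ((H w)⁻¹ i j * fgrad (fun z => fgrad f z 0) w j)) := by
    rw [fgrad, hQs, fderiv_fun_sum fun i _ => DifferentiableAt.fun_sum fun j _ => hterm i j, sum_apply]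
    refine Finset.sum_congr rfl fun i _ => ?_
    rw [fderiv_fun_sum fun j _ => hterm i j, sum_apply]
    refine Finset.sum_congr rfl fun j _ => ?_
    rw [fderiv_fun_mul (hfg i) ((hinv i j).fun_mul (hfg j)), fderiv_fun_mul (hinv i j) (hfg j)]
    have h1 := hsym i
    have h2 := hsym j
    have h3 := hz i j
    rw [fgrad] at h1 h2 h3
    simp only [add_apply, smul_apply, smul_eq_mul, h1, h2, h3]
    ring
  have e1 : ∑ i, ∑ j, fgrad (fun z => fgrad f z 0) w i * ((H w)⁻¹ i j * fgrad f w j) =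
      coPair (H w) (fgrad (fun z => fgrad f z 0) w) (fgrad f w) := by
    simp [coPair, dotProduct, Matrix.mulVec, Finset.mul_sum]
  have e2 : ∑ i, ∑ j, fgrad f w i * ((H w)⁻¹ i j * fgrad (fun z => fgrad f z 0) w j) =
      coPair (H w) (fgrad f w) (fgrad (fun z => fgrad f z 0) w) := by
    simp [coPair, dotProduct, Matrix.mulVec, Finset.mul_sum]
  rw [hd]
  simp only [Finset.sum_add_distrib]
  rw [e1, e2, coPair_comm (hs w) (fgrad f w)]
  ring

end translation

/-! ### Product coordinates on M and the three properties of x₁ -/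

section product

variable {m : ℕ}

/-- The first coordinate. -/
def headL (m : ℕ) : Euc (m + 1) →L[ℝ] ℝ := EuclideanSpace.proj (𝕜 := ℝ) 0

/-- The remaining coordinates. -/
def tailL (m : ℕ) : Euc (m + 1) →L[ℝ] Euc m :=
  LinearMap.toContinuousLinearMap
    { toFun := fun w => WithLp.toLp 2 fun i => w i.succ
      map_add' := fun v w => by ext i; simp
      map_smul' := fun c v => by ext i; simp }

theorem tailL_apply (w : Euc (m + 1)) (i : Fin m) : tailL m w i = w i.succ := rfl

variable {N : Type*} [TopologicalSpace N] [ChartedSpace (Euc m) N] [IsManifold (𝓡 m) ∞ N]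

instance isManifoldOneBdryless : IsManifold (𝓡 m) 1 N := IsManifold.of_le (n := ∞) (by simp)

/-- The derivative of the inverse chart around `b`. -/
def symmDeriv (b : N) (z : Euc m) : Euc m →L[ℝ] Euc m :=
  mfderivWithin 𝓘(ℝ, Euc m) (𝓡 m) (extChartAt (𝓡 m) b).symm (range (𝓡 m)) z

/-- The metric of `N` in the chart around `b`, as a bilinear form. -/
def chartForm (h : MetricNoBdry m N) (b : N) (z : Euc m) : Euc m →L[ℝ] Euc m →L[ℝ] ℝ :=
  ContinuousLinearMap.bilinearComp (h.inner ((extChartAt (𝓡 m) b).symm z)) (symmDeriv b z)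
    (symmDeriv b z)

theorem chartForm_apply (h : MetricNoBdry m N) (b : N) (z v w : Euc m) :
    chartForm h b z v w = h.inner ((extChartAt (𝓡 m) b).symm z) (symmDeriv b z v)
      (symmDeriv b z w) := rfl

theorem chartForm_symm (h : MetricNoBdry m N) (b : N) (z v w : Euc m) :
    chartForm h b z v w = chartForm h b z w v := h.symm _ _ _

/-- The product metric `dw₀² + h` in coordinates. -/
def prodForm (h : MetricNoBdry m N) (b : N) (w : Euc (m + 1)) :
    Euc (m + 1) →L[ℝ] Euc (m + 1) →L[ℝ] ℝ :=
  (headL m).smulRight (headL m) +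
    (chartForm h b (tailL m w)).bilinearComp (tailL m) (tailL m)

theorem prodForm_apply (h : MetricNoBdry m N) (b : N) (w v v' : Euc (m + 1)) :
    prodForm h b w v v' = v 0 * v' 0 + chartForm h b (tailL m w) (tailL m v) (tailL m v') := rfl

/-- The matrix of the product metric. -/
def prodGram (h : MetricNoBdry m N) (b : N) (w : Euc (m + 1)) :
    Matrix (Fin (m + 1)) (Fin (m + 1)) ℝ :=
  Matrix.of fun i j => prodForm h b w (stdVec i) (stdVec j)

theorem tailL_stdVec_zero : tailL m (stdVec 0) = 0 := by
  ext i
  rw [tailL_apply, stdVec_apply]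
  simp [Fin.succ_ne_zero, eq_comm]

theorem prodForm_symm (h : MetricNoBdry m N) (b : N) (w v v' : Euc (m + 1)) :
    prodForm h b w v v' = prodForm h b w v' v := by
  rw [prodForm_apply, prodForm_apply, chartForm_symm, mul_comm]

theorem prodGram_transpose (h : MetricNoBdry m N) (b : N) (w : Euc (m + 1)) :
    (prodGram h b w).transpose = prodGram h b w := by
  ext i j
  simp only [prodGram, Matrix.transpose_apply, Matrix.of_apply]
  exact prodForm_symm h b w _ _

theorem prodGram_zero (h : MetricNoBdry m N) (b : N) (w : Euc (m + 1)) (i : Fin (m + 1)) :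
    prodGram h b w i 0 = if i = 0 then 1 else 0 := by
  simp [prodGram, prodForm_apply, tailL_stdVec_zero, stdVec_apply]

theorem prodGram_shift (h : MetricNoBdry m N) (b : N) (w : Euc (m + 1)) (s : ℝ) :
    prodGram h b (w + s • stdVec 0) = prodGram h b w := by
  ext i j
  simp [prodGram, prodForm_apply, tailL_stdVec_zero]

theorem prodGram_det_pos (h : MetricNoBdry m N) (b : N) {w : Euc (m + 1)}
    (hw : tailL m w ∈ (extChartAt (𝓡 m) b).target) : 0 < (prodGram h b w).det := by
  refine (posDef_bilin (prodForm h b w) (prodForm_symm h b w) fun v hv => ?_).det_pos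
  rw [prodForm_apply]
  obtain ⟨e, he⟩ := isInvertible_mfderivWithin_extChartAt_symm hw
  by_cases h0 : tailL m v = 0
  · have hv0 : v 0 ≠ 0 := by
      intro h1
      apply hv
      ext i
      refine Fin.cases (by simpa using h1) (fun i => ?_) i
      have := congrArg (fun z : Euc m => z i) h0
      simpa [tailL_apply] using this
    rw [h0, map_zero, add_zero]
    exact mul_self_pos.2 hv0
  · have h1 : symmDeriv b (tailL m w) (tailL m v) ≠ 0 := by
      intro h2
      apply h0
      have h3 : e (tailL m v) = 0 :=
        (congrArg (fun L : Euc m →L[ℝ] Euc m => L (tailL m v)) he).trans h2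
      exact (e.map_eq_zero_iff).1 h3
    have h2 : 0 < chartForm h b (tailL m w) (tailL m v) (tailL m v) :=
      h.pos ((extChartAt (𝓡 m) b).symm (tailL m w)) _ h1
    have h3 := mul_self_nonneg (v 0)
    linarith

theorem contDiffOn_prodGram (h : MetricNoBdry m N) (b : N) (i j : Fin (m + 1)) :
    ContDiffOn ℝ ∞ (fun w => prodGram h b w i j) (tailL m ⁻¹' (extChartAt (𝓡 m) b).target) := by
  have h1 := (contDiffOn_metric_chart h b (tailL m (stdVec i)) (tailL m (stdVec j))).comp
    (tailL m).contDiff.contDiffOn (s := tailL m ⁻¹' (extChartAt (𝓡 m) b).target) (fun _ hw => hw)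
  exact contDiffOn_const.add h1

variable {M : Type*} [TopologicalSpace M] [ChartedSpace (EuclideanHalfSpace (m + 1)) M]
  [IsManifold (𝓡∂ (m + 1)) ∞ M]

/-- The product coordinates `(x₁, ψ_b ∘ x')` in the chart around `p`. -/
def prodCoord (x₁ : M → ℝ) (x' : M → N) (p : M) (b : N) (y : Euc (m + 1)) : Euc (m + 1) :=
  WithLp.toLp 2 (Fin.cons (rep p x₁ y) (fun i => extChartAt (𝓡 m) b (rep p x' y) i) :
    Fin (m + 1) → ℝ)

theorem tailL_prodCoord (x₁ : M → ℝ) (x' : M → N) (p : M) (b : N) (y : Euc (m + 1)) :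
    tailL m (prodCoord x₁ x' p b y) = extChartAt (𝓡 m) b (rep p x' y) := by
  ext i
  simp [tailL_apply, prodCoord]

variable {g : MetricBdry m M} {h : MetricNoBdry m N} {x₁ : M → ℝ} {x' : M → N}

theorem contDiffAt_prodCoord (hx : IsProductEmbedding g h x₁ x') {p : M} {b : N} {y : Euc (m + 1)}
    (hy : y ∈ (extChartAt (𝓡∂ (m + 1)) p).target) (hi : y ∈ interior (range (𝓡∂ (m + 1))))
    (hb : rep p x' y ∈ (extChartAt (𝓡 m) b).source) :
    ContDiffAt ℝ ∞ (prodCoord x₁ x' p b) y := by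
  have htgt := mem_nhds_of_interior (extChartAt_target_mem_nhdsWithin_of_mem hy) hi
  have hsymm : ContMDiffAt 𝓘(ℝ, Euc (m + 1)) (𝓡∂ (m + 1)) ∞ (extChartAt (𝓡∂ (m + 1)) p).symm y :=
    (contMDiffOn_extChartAt_symm p).contMDiffAt htgt
  have h1 : ContDiffAt ℝ ∞ (rep p x₁) y := by
    rw [← contMDiffAt_iff_contDiffAt]
    exact (hx.smooth_fst _).comp y hsymm
  have h2 : ContDiffAt ℝ ∞ (fun y => extChartAt (𝓡 m) b (rep p x' y)) y := by
    rw [← contMDiffAt_iff_contDiffAt]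
    have h3 : ContMDiffAt (𝓡 m) 𝓘(ℝ, Euc m) ∞ (extChartAt (𝓡 m) b) (rep p x' y) :=
      contMDiffAt_extChartAt' (by rwa [← extChartAt_source (𝓡 m)])
    have h4 : ContMDiffAt 𝓘(ℝ, Euc (m + 1)) (𝓡 m) ∞ (rep p x') y := (hx.smooth_snd _).comp y hsymm
    exact h3.comp y h4
  rw [contDiffAt_euclidean]
  intro i
  refine Fin.cases ?_ (fun i => ?_) i
  · exact h1
  · exact (contDiffAt_euclidean.1 h2) i

/-- The isometry condition in coordinates: dx₁ is the head of dΦ, and dx' is its tail pushed forward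
by the inverse chart of N. The point is interior, so derivatives within the half space are ordinary
ones. -/
theorem chartGram_prodCoord (hx : IsProductEmbedding g h x₁ x') {p : M} {b : N} {y : Euc (m + 1)}
    (hy : y ∈ (extChartAt (𝓡∂ (m + 1)) p).target) (hi : y ∈ interior (range (𝓡∂ (m + 1))))
    (hb : rep p x' y ∈ (extChartAt (𝓡 m) b).source) :
    chartGram g p y = (jac (prodCoord x₁ x' p b) y).transpose *
      prodGram h b (prodCoord x₁ x' p b y) * jac (prodCoord x₁ x' p b) y := by
  have hrange := mem_interior_iff_mem_nhds.1 hi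
  set Φ : Euc (m + 1) → Euc (m + 1) := prodCoord (m := m) x₁ x' p b with hΦ
  have hΦd : DifferentiableAt ℝ Φ y :=
    (contDiffAt_prodCoord hx hy hi hb).differentiableAt (by simp)
  refine Eq.trans ?_ (bilin_frame (prodForm h b (Φ y)) (fderiv ℝ Φ y))
  have hsymm := mdifferentiableWithinAt_extChartAt_symm (I := 𝓡∂ (m + 1)) hy
  have hU : UniqueMDiffWithinAt 𝓘(ℝ, Euc (m + 1)) (range (𝓡∂ (m + 1))) y :=
    (uniqueDiffOn_halfSpace y (extChartAt_target_subset_range p hy)).uniqueMDiffWithinAt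
  have hf1 : ∀ j, dR x₁ ((extChartAt (𝓡∂ (m + 1)) p).symm y) (coordVec p y j) =
      (fderiv ℝ Φ y (stdVec j)) 0 := by
    intro j
    refine (mfderivWithin_comp_symm hy ((hx.smooth_fst _).mdifferentiableAt (by simp)) j).trans ?_
    have h1 : fderiv ℝ (fun z => headL m (Φ z)) y = _ :=
      ((headL m).hasFDerivAt.comp y hΦd.hasFDerivAt).fderiv
    rw [fderivWithin_of_mem_nhds hrange]
    exact congrArg (fun L : Euc (m + 1) →L[ℝ] ℝ => L (stdVec j)) h1
  have hf2 : ∀ j, mfderiv (𝓡∂ (m + 1)) (𝓡 m) x' ((extChartAt (𝓡∂ (m + 1)) p).symm y)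
      (coordVec p y j) = symmDeriv b (extChartAt (𝓡 m) b (rep p x' y))
        (tailL m (fderiv ℝ Φ y (stdVec j))) := by
    intro j
    have h1 := mfderiv_comp_mfderivWithin y ((hx.smooth_snd _).mdifferentiableAt (by simp)) hsymm hU
    have hzd : MDifferentiableWithinAt 𝓘(ℝ, Euc (m + 1)) 𝓘(ℝ, Euc m) (fun z => tailL m (Φ z))
        (range (𝓡∂ (m + 1))) y := by
      apply DifferentiableWithinAt.mdifferentiableWithinAt
      exact ((tailL m).differentiableAt.comp y hΦd).differentiableWithinAt
    have hby : tailL m (Φ y) ∈ (extChartAt (𝓡 m) b).target := by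
      rw [hΦ, tailL_prodCoord]; exact (extChartAt (𝓡 m) b).map_source hb
    have h2 := mfderivWithin_comp y (mdifferentiableWithinAt_extChartAt_symm (I := 𝓡 m) hby)
      hzd (fun z _ => by simp) hU
    have h3 : mfderivWithin 𝓘(ℝ, Euc (m + 1)) (𝓡 m)
        ((extChartAt (𝓡 m) b).symm ∘ fun z => tailL m (Φ z)) (range (𝓡∂ (m + 1))) y =
        mfderivWithin 𝓘(ℝ, Euc (m + 1)) (𝓡 m)
        (x' ∘ (extChartAt (𝓡∂ (m + 1)) p).symm) (range (𝓡∂ (m + 1))) y := by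
      have hcont : ContinuousWithinAt (rep p x') (range (𝓡∂ (m + 1))) y :=
        hx.smooth_snd.continuous.continuousAt.comp_continuousWithinAt hsymm.continuousWithinAt
      have hev : ∀ z, rep p x' z ∈ (extChartAt (𝓡 m) b).source →
          ((extChartAt (𝓡 m) b).symm ∘ fun z => tailL m (Φ z)) z =
            (x' ∘ (extChartAt (𝓡∂ (m + 1)) p).symm) z := by
        intro z hz
        simp only [Function.comp]
        rw [hΦ, tailL_prodCoord, (extChartAt (𝓡 m) b).left_inv hz]
        rfl
      apply Filter.EventuallyEq.mfderivWithin_eq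
      · filter_upwards [hcont ((isOpen_extChartAt_source b).mem_nhds hb)] with z hz using hev z hz
      · exact hev y hb
    rw [← h3, h2, mfderivWithin_eq_fderivWithin, fderivWithin_of_mem_nhds hrange] at h1
    have h4 : fderiv ℝ (fun z => tailL m (Φ z)) y = _ :=
      ((tailL m).hasFDerivAt.comp y hΦd.hasFDerivAt).fderiv
    rw [h4] at h1
    have h5 := congrArg (fun L : Euc (m + 1) →L[ℝ] Euc m => L (stdVec j)) h1
    refine h5.symm.trans ?_
    rw [← tailL_prodCoord x₁]
    rfl
  have hbx : (extChartAt (𝓡 m) b).symm (tailL m (Φ y)) =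
      x' ((extChartAt (𝓡∂ (m + 1)) p).symm y) := by
    rw [hΦ, tailL_prodCoord, (extChartAt (𝓡 m) b).left_inv hb]
    rfl
  ext i j
  simp only [chartGram, Matrix.of_apply]
  rw [hx.isometric, hf1, hf1, hf2, hf2, prodForm_apply, chartForm_apply, hbx, hΦ, tailL_prodCoord]

variable {f : M → ℝ} {x : M}

/-- Near an interior point, the metric is a product in the product coordinates. -/
theorem eventually_chartGram_prodCoord (hx : IsProductEmbedding g h x₁ x')
    (hi : (𝓡∂ (m + 1)).IsInteriorPoint x) :
    ∀ᶠ y in 𝓝 (extChartAt (𝓡∂ (m + 1)) x x), y ∈ (extChartAt (𝓡∂ (m + 1)) x).target ∧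
      y ∈ interior (range (𝓡∂ (m + 1))) ∧ rep x x' y ∈ (extChartAt (𝓡 m) (x' x)).source ∧
      chartGram g x y = (jac (prodCoord x₁ x' x (x' x)) y).transpose *
        prodGram h (x' x) (prodCoord x₁ x' x (x' x) y) * jac (prodCoord x₁ x' x (x' x)) y := by
  have hmem := mem_extChartAt_target (I := 𝓡∂ (m + 1)) x
  have hcont : ContinuousAt (rep x x') (extChartAt (𝓡∂ (m + 1)) x x) :=
    hx.smooth_snd.continuous.continuousAt.comp (continuousAt_extChartAt_symm x)
  have hsrc : (extChartAt (𝓡 m) (x' x)).source ∈ 𝓝 (rep x x' (extChartAt (𝓡∂ (m + 1)) x x)) := by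
    rw [rep, extChartAt_to_inv]
    exact extChartAt_source_mem_nhds _
  filter_upwards [mem_nhds_of_interior (extChartAt_target_mem_nhdsWithin x) hi,
    isOpen_interior.mem_nhds hi, hcont hsrc] with y h1 h2 h3
  exact ⟨h1, h2, h3, chartGram_prodCoord hx h1 h2 h3⟩

/-- The metric matrix is JᵀHJ and is nondegenerate, so J is invertible: the isometry condition alone
makes the product coordinates a local diffeomorphism. -/
theorem isUnit_jac_prodCoord (hx : IsProductEmbedding g h x₁ x')
    (hi : (𝓡∂ (m + 1)).IsInteriorPoint x) :
    IsUnit (jac (prodCoord x₁ x' x (x' x)) (extChartAt (𝓡∂ (m + 1)) x x)).det := by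
  obtain ⟨h1, h2, h3, h4⟩ := (eventually_chartGram_prodCoord hx hi).self_of_nhds
  have h5 := (chartGram_det_pos g h1).ne'
  rw [h4, Matrix.det_mul] at h5
  exact isUnit_iff_ne_zero.2 (right_ne_zero_of_mul h5)

theorem tail_preimage_mem_nhds (x₁ : M → ℝ) (x' : M → N) (x : M) :
    tailL m ⁻¹' (extChartAt (𝓡 m) (x' x)).target ∈
      𝓝 (prodCoord x₁ x' x (x' x) (extChartAt (𝓡∂ (m + 1)) x x)) := by
  refine (tailL m).continuous.continuousAt ?_
  rw [tailL_prodCoord, rep, extChartAt_to_inv]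
  exact (isOpen_extChartAt_target (I := 𝓡 m) (x' x)).mem_nhds (mem_extChartAt_target _)

/-- In product coordinates x₁ is w₀, whose differential has length one for dw₀² + h. -/
theorem gam_self_eq_one (hx : IsProductEmbedding g h x₁ x')
    (hi : (𝓡∂ (m + 1)).IsInteriorPoint x) : gam g x₁ x₁ x = 1 := by
  obtain ⟨h1, h2, h3, h4⟩ := (eventually_chartGram_prodCoord hx hi).self_of_nhds
  have hd : ∀ z, MDifferentiableAt (𝓡∂ (m + 1)) 𝓘(ℝ, ℝ) x₁ z := fun z =>
    (hx.smooth_fst z).mdifferentiableAt (by simp)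
  have h5 := gam_chart g h1 (hd _) (hd _)
  have hΦd := (contDiffAt_prodCoord hx h1 h2 h3).differentiableAt (by simp)
  rw [extChartAt_to_inv] at h5
  have h6 : pd (rep x x₁) (extChartAt (𝓡∂ (m + 1)) x x) =
      (jac (prodCoord x₁ x' x (x' x)) (extChartAt (𝓡∂ (m + 1)) x x)).transpose.mulVec
        (Pi.single 0 1) := by
    have hcd : ∀ w : Euc (m + 1), DifferentiableAt ℝ (fun w : Euc (m + 1) => w 0) w := fun w =>
      (EuclideanSpace.proj (𝕜 := ℝ) (0 : Fin (m + 1))).differentiableAt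
    rw [pd_eq_fgrad _ h2, ← fgrad_coord (prodCoord x₁ x' x (x' x) (extChartAt (𝓡∂ (m + 1)) x x)),
      ← fgrad_comp hΦd (hcd _)]
    rfl
  rw [h5, h6, h4, coPair_frame _ _ (isUnit_jac_prodCoord hx hi), coPair_single _
    (prodGram_transpose h _ _) (prodGram_zero h _ _)]
  · simp
  · exact isUnit_iff_ne_zero.2 (prodGram_det_pos h _
      (mem_of_mem_nhds (tail_preimage_mem_nhds (m := m) x₁ x' x) : _)).ne'

/-- The coordinate w₀ is harmonic for dw₀² + h by `openLap_coord`, and the Laplacian is invariant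
under the change to product coordinates. -/
theorem lap_fst_eq_zero (hx : IsProductEmbedding g h x₁ x')
    (hi : (𝓡∂ (m + 1)).IsInteriorPoint x) : lap g x₁ x = 0 := by
  have hev := eventually_chartGram_prodCoord hx hi
  obtain ⟨h1, h2, h3, h4⟩ := hev.self_of_nhds
  have hV := tail_preimage_mem_nhds (m := m) x₁ x' x
  have hΦ := contDiffAt_prodCoord hx h1 h2 h3
  have hcd : ∀ w : Euc (m + 1), DifferentiableAt ℝ (fun w : Euc (m + 1) => w 0) w := fun w =>
    (EuclideanSpace.proj (𝕜 := ℝ) (0 : Fin (m + 1))).differentiableAt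
  rw [lap, locLap_eq_openLap _ _ h2]
  have h5 := openLap_pullback (hΦ.of_le (by norm_cast)) (isUnit_jac_prodCoord hx hi)
    (G := chartGram g x) (H := prodGram h (x' x))
    (F := fun w => w 0) (by filter_upwards [hev] with y hy using hy.2.2.2) ?_
    (Filter.Eventually.of_forall fun y => hcd _) ?_
  · refine h5.trans (openLap_coord ?_ (prodGram_transpose h _) (prodGram_zero h _)
      (prodGram_shift h _))
    filter_upwards [hV] with w hw using isUnit_iff_ne_zero.2 (prodGram_det_pos h _ hw).ne'
  · filter_upwards [hΦ.continuousAt hV] with y hy using prodGram_det_pos h _ hy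
  · intro a
    have h0 : ∀ w ∈ tailL m ⁻¹' (extChartAt (𝓡 m) (x' x)).target, (prodGram h (x' x) w).det ≠ 0 :=
      fun w hw => (prodGram_det_pos h _ hw).ne'
    have h6 : ∀ w, openFlux (prodGram h (x' x)) (fun w => w 0) a w =
        √(prodGram h (x' x) w).det * (prodGram h (x' x) w)⁻¹ a 0 := by
      intro w
      simp [openFlux, fgrad_coord]
    have h7 := (ContDiffOn.matrix_sqrt_det (contDiffOn_prodGram h (x' x)) h0).mul
      (ContDiffOn.matrix_inv (contDiffOn_prodGram h (x' x)) h0 a 0)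
    have h8 := (h7.differentiableOn (by simp)).differentiableAt hV
    exact h8.congr_of_eventuallyEq (Filter.Eventually.of_forall h6)

/-- `∇ x₁` is a Killing field. -/
theorem gam_fst_gam (hx : IsProductEmbedding g h x₁ x')
    (hi : (𝓡∂ (m + 1)).IsInteriorPoint x) (hf : CReg m 2 f) :
    gam g x₁ (gam g f f) x = 2 * gam g (gam g x₁ f) f x := by
  have hev := eventually_chartGram_prodCoord hx hi
  obtain ⟨h1, h2, h3, h4⟩ := hev.self_of_nhds
  have hΦ := contDiffAt_prodCoord hx h1 h2 h3
  have hx₁ : CReg m 2 x₁ := (creg_of_contMDiff hx.smooth_fst).of_le (by norm_cast)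
  have hff : CReg m 1 (gam g f f) := CReg.gam g (by norm_num) (by norm_cast) hf hf
  have hxf : CReg m 1 (gam g x₁ f) := CReg.gam g (by norm_num) (by norm_cast) hx₁ hf
  have hfd := fun z => hf.mdifferentiableAt (by norm_num) z
  have hxd := fun z => hx₁.mdifferentiableAt (by norm_num) z
  have hFC : ContDiffAt ℝ 2 (rep x f) (extChartAt (𝓡∂ (m + 1)) x x) :=
    (hf x).contDiffAt (mem_nhds_of_interior (extChartAt_target_mem_nhdsWithin x) hi)
  have key := killing_pullback (hΦ.of_le (by norm_cast)) (isUnit_jac_prodCoord hx hi)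
    (G := chartGram g x) (H := prodGram h (x' x))
    (by filter_upwards [hev] with y hy using hy.2.2.2)
    (tail_preimage_mem_nhds (m := m) x₁ x' x)
    (fun i j => (contDiffOn_prodGram h (x' x) i j).of_le (by norm_cast))
    (fun w hw => (prodGram_det_pos h _ hw).ne') (prodGram_transpose h _) (prodGram_zero h _)
    (prodGram_shift h _) hFC
  have e1 := gam_chart g h1 (hxd _) (hff.mdifferentiableAt le_rfl _)
  have e2 := gam_chart g h1 (hxf.mdifferentiableAt le_rfl _) (hfd _)
  rw [extChartAt_to_inv, pd_eq_fgrad _ h2, pd_eq_fgrad _ h2] at e1 e2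
  have c1 : rep x (gam g f f) =ᶠ[𝓝 (extChartAt (𝓡∂ (m + 1)) x x)]
      fun y => coPair (chartGram g x y) (fgrad (rep x f) y) (fgrad (rep x f) y) := by
    filter_upwards [hev] with y hy
    rw [rep, gam_chart g hy.1 (hfd _) (hfd _), pd_eq_fgrad _ hy.2.1]
  have c2 : rep x (gam g x₁ f) =ᶠ[𝓝 (extChartAt (𝓡∂ (m + 1)) x x)]
      fun y => coPair (chartGram g x y) (fgrad (rep x x₁) y) (fgrad (rep x f) y) := by
    filter_upwards [hev] with y hy
    rw [rep, gam_chart g hy.1 (hxd _) (hfd _), pd_eq_fgrad _ hy.2.1, pd_eq_fgrad _ hy.2.1]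
  rw [e1, e2, fgrad_congr c1, fgrad_congr c2]
  exact key

end product

/-! ### Riemannian volume and surface measure as suprema of chart measures -/

section supMeasure

variable {X ι : Type*} [MeasurableSpace X]

/-- If the measures `μ i`, carried by sets `O i`, agree on overlaps, then their supremum restricts
to each of them. -/
theorem iSup_restrict_eq {μ : ι → Measure X} {O : ι → Set X} (hO : ∀ i, MeasurableSet (O i))
    (hsupp : ∀ i, μ i (O i)ᶜ = 0)
    (hag : ∀ i j s, MeasurableSet s → s ⊆ O i ∩ O j → μ i s = μ j s) (i : ι) :
    (⨆ j, μ j).restrict (O i) = μ i := by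
  have hle : ∀ j s, MeasurableSet s → s ⊆ O i → μ j s ≤ μ i s := by
    intro j s hs hsi
    have h1 : μ j (s \ O j) = 0 := measure_mono_null (fun x hx => hx.2) (hsupp j)
    rw [← measure_inter_add_sdiff s (hO j), h1, add_zero,
      ← hag i j _ (hs.inter (hO j)) (inter_subset_inter_left _ hsi)]
    exact measure_mono inter_subset_left
  -- The measure equal to μ i on O i and to the supremum elsewhere dominates every μ j, by agreement
  -- on overlaps. It therefore dominates the supremum, which cannot exceed μ i on O i.
  have hbd : (⨆ j, μ j) ≤ (μ i).restrict (O i) + (⨆ j, μ j).restrict (O i)ᶜ := by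
    refine iSup_le fun j => Measure.le_iff.2 fun s hs => ?_
    rw [Measure.add_apply, Measure.restrict_apply hs, Measure.restrict_apply hs,
      ← measure_inter_add_sdiff s (hO i)]
    exact add_le_add (hle j _ (hs.inter (hO i)) inter_subset_right) (le_iSup μ j _)
  refine le_antisymm (Measure.le_iff.2 fun s hs => ?_) (Measure.le_iff.2 fun s hs => ?_)
  · rw [Measure.restrict_apply hs]
    refine (hbd _).trans ?_
    rw [Measure.add_apply, Measure.restrict_apply (hs.inter (hO i)),
      Measure.restrict_apply (hs.inter (hO i))]
    have h1 : s ∩ O i ∩ (O i)ᶜ = ∅ := by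
      ext x; simp
    rw [h1, measure_empty, add_zero]
    exact measure_mono fun x hx => hx.1.1
  · have h1 : μ i (s \ O i) = 0 := measure_mono_null (fun x hx => hx.2) (hsupp i)
    rw [Measure.restrict_apply hs, ← measure_inter_add_sdiff s (hO i), h1, add_zero]
    exact le_iSup μ i _

end supMeasure

section patch

variable {d : ℕ} {M : Type*} [TopologicalSpace M] [MeasurableSpace M] [BorelSpace M]

/-- The image under a parametrization `σ` of the measure with density `ρ` on `S`. -/
def patch (σ : Euc d → M) (S : Set (Euc d)) (ρ : Euc d → ℝ) : Measure M :=
  Measure.map σ ((volume.restrict S).withDensity fun z => ENNReal.ofReal (ρ z))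

variable {σ : Euc d → M} {S : Set (Euc d)} {ρ : Euc d → ℝ}

theorem patch_aemeasurable (hS : MeasurableSet S) (hσ : ContinuousOn σ S) :
    AEMeasurable σ ((volume.restrict S).withDensity fun z => ENNReal.ofReal (ρ z)) :=
  (hσ.aemeasurable hS).mono_ac (withDensity_absolutelyContinuous _ _)

theorem patch_apply (hS : MeasurableSet S) (hσ : ContinuousOn σ S) {s : Set M}
    (hs : MeasurableSet s) :
    patch σ S ρ s = ∫⁻ z in S ∩ σ ⁻¹' s, ENNReal.ofReal (ρ z) := by
  rw [patch, Measure.map_apply_of_aemeasurable (patch_aemeasurable hS hσ) hs, withDensity_apply',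
    Measure.restrict_restrict' hS, inter_comm]

/-- The parametrization is continuous on S only, so measurability is obtained in the subtype and
transported. -/
theorem measurableSet_inter_preimage (hS : MeasurableSet S) (hσ : ContinuousOn σ S) {s : Set M}
    (hs : MeasurableSet s) : MeasurableSet (S ∩ σ ⁻¹' s) := by
  have h1 : Measurable (S.domRestrict σ) :=
    (continuousOn_iff_continuous_domRestrict.1 hσ).measurable
  convert hS.subtype_image (h1 hs) using 1
  ext z
  constructor
  · exact fun hz => ⟨⟨z, hz.1⟩, hz.2, rfl⟩
  · rintro ⟨w, hw, rfl⟩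
    exact ⟨w.2, hw⟩

/-- The change of variables formula for the transition map θ; the hypothesis on densities says
exactly that the Jacobian factor is accounted for. -/
theorem patch_agree {σ' : Euc d → M} {S' : Set (Euc d)} {ρ' : Euc d → ℝ}
    (hS : MeasurableSet S) (hσ : ContinuousOn σ S) (hS' : MeasurableSet S')
    (hσ' : ContinuousOn σ' S') {s : Set M} (hs : MeasurableSet s) {θ : Euc d → Euc d}
    {θ' : Euc d → Euc d →L[ℝ] Euc d} (himg : θ '' (S ∩ σ ⁻¹' s) = S' ∩ σ' ⁻¹' s)
    (hinj : InjOn θ (S ∩ σ ⁻¹' s)) (hd : ∀ z ∈ S ∩ σ ⁻¹' s, HasFDerivWithinAt θ (θ' z) (S ∩ σ ⁻¹' s) z)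
    (hρ : ∀ z ∈ S ∩ σ ⁻¹' s, ρ z = |(θ' z).det| * ρ' (θ z)) :
    patch σ S ρ s = patch σ' S' ρ' s := by
  have hA := measurableSet_inter_preimage hS hσ hs
  rw [patch_apply hS hσ hs, patch_apply hS' hσ' hs, ← himg,
    lintegral_image_eq_lintegral_abs_det_fderiv_mul volume hA hd hinj]
  refine setLIntegral_congr_fun hA fun z hz => ?_
  simp only [hρ z hz, ENNReal.ofReal_mul (abs_nonneg _)]

theorem patch_compl (hS : MeasurableSet S) (hσ : ContinuousOn σ S) {O : Set M}
    (hO : MeasurableSet O) (hmaps : MapsTo σ S O) : patch σ S ρ Oᶜ = 0 := by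
  rw [patch_apply hS hσ hO.compl]
  have h1 : S ∩ σ ⁻¹' Oᶜ = ∅ := by
    ext z
    simp only [mem_inter_iff, mem_preimage, mem_compl_iff, mem_empty_iff_false, iff_false, not_and,
      not_not]
    exact fun hz => hmaps hz
  rw [h1]
  simp

theorem integral_patch (hS : MeasurableSet S) (hσ : ContinuousOn σ S) (hρ : ContinuousOn ρ S)
    (hρ0 : ∀ z ∈ S, 0 ≤ ρ z) {f : M → ℝ} (hf : AEStronglyMeasurable f (patch σ S ρ)) :
    ∫ x, f x ∂(patch σ S ρ) = ∫ z in S, ρ z * f (σ z) := by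
  rw [patch, integral_map (patch_aemeasurable hS hσ) hf,
    integral_withDensity_eq_integral_toReal_smul₀ (hρ.aemeasurable hS).ennreal_ofReal
      (Filter.Eventually.of_forall fun _ => ENNReal.ofReal_lt_top)]
  refine setIntegral_congr_fun hS fun z hz => ?_
  simp only [ENNReal.toReal_ofReal (hρ0 z hz), smul_eq_mul]

end patch

section riemannianMeasures

variable {m : ℕ} {M : Type*} [TopologicalSpace M] [ChartedSpace (EuclideanHalfSpace (m + 1)) M]

theorem mem_range_iff (y : Euc (m + 1)) : y ∈ range (𝓡∂ (m + 1)) ↔ 0 ≤ y 0 := by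
  rw [range_modelWithCornersEuclideanHalfSpace]; rfl

theorem mem_interior_range_iff (y : Euc (m + 1)) :
    y ∈ interior (range (𝓡∂ (m + 1))) ↔ 0 < y 0 := by
  rw [interior_range_modelWithCornersEuclideanHalfSpace]; rfl

theorem measurableSet_target (p : M) : MeasurableSet (extChartAt (𝓡∂ (m + 1)) p).target := by
  rw [extChartAt_target]
  exact ((𝓡∂ (m + 1)).continuous_symm.isOpen_preimage _ (chartAt _ p).open_target).measurableSet.inter
    (𝓡∂ (m + 1)).isClosed_range.measurableSet

/-- The inclusion of the hyperplane, as a linear map. -/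
def hyperL (m : ℕ) : Euc m →L[ℝ] Euc (m + 1) :=
  LinearMap.toContinuousLinearMap
    { toFun := hyperplanePt
      map_add' := fun v w => by
        ext i; refine Fin.cases ?_ (fun i => ?_) i <;> simp [hyperplanePt]
      map_smul' := fun c v => by
        ext i; refine Fin.cases ?_ (fun i => ?_) i <;> simp [hyperplanePt] }

theorem hyperL_apply (z : Euc m) : hyperL m z = hyperplanePt z := rfl

theorem hyperplanePt_zero (z : Euc m) : hyperplanePt z 0 = 0 := rfl

theorem hyperplanePt_succ (z : Euc m) (i : Fin m) : hyperplanePt z i.succ = z i := rfl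

theorem continuous_hyperplanePt : Continuous (hyperplanePt (m := m)) := (hyperL m).continuous

theorem tailL_hyperplanePt (z : Euc m) : tailL m (hyperplanePt z) = z := by
  ext i; rfl

theorem hyperplanePt_tailL {y : Euc (m + 1)} (hy : y 0 = 0) : hyperplanePt (tailL m y) = y := by
  ext i
  refine Fin.cases ?_ (fun i => ?_) i
  · rw [hyperplanePt_zero, hy]
  · rfl

theorem hyperplanePt_stdVec (j : Fin m) : hyperplanePt (stdVec j) = stdVec j.succ := by
  ext i
  refine Fin.cases ?_ (fun i => ?_) i
  · rw [hyperplanePt_zero, stdVec_apply, if_neg (Fin.succ_ne_zero j)]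
  · rw [hyperplanePt_succ, stdVec_apply, stdVec_apply]
    simp

theorem hyperplanePt_mem_range (z : Euc m) : hyperplanePt z ∈ range (𝓡∂ (m + 1)) := by
  rw [mem_range_iff, hyperplanePt_zero]

/-- The part of the hyperplane in the target of the chart around `p`. -/
def hyperTarget (p : M) : Set (Euc m) := {z | hyperplanePt z ∈ (extChartAt (𝓡∂ (m + 1)) p).target}

theorem measurableSet_hyperTarget (p : M) : MeasurableSet (hyperTarget (m := m) p) :=
  continuous_hyperplanePt.measurable (measurableSet_target p)

theorem continuousOn_hyperSymm (p : M) : ContinuousOn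
    (fun z : Euc m => (extChartAt (𝓡∂ (m + 1)) p).symm (hyperplanePt z)) (hyperTarget p) :=
  (continuousOn_extChartAt_symm p).comp continuous_hyperplanePt.continuousOn fun _ hz => hz

variable [IsManifold (𝓡∂ (m + 1)) ∞ M]

/-- The density of the volume in the chart around `p`. -/
def volDens (g : MetricBdry m M) (p : M) (y : Euc (m + 1)) : ℝ := √(chartGram g p y).det

/-- The density of the surface measure in the chart around `p`. -/
def surfDens (g : MetricBdry m M) (p : M) (z : Euc m) : ℝ :=
  √((chartGram g p (hyperplanePt z)).submatrix Fin.succ Fin.succ).det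

theorem continuousOn_volDens (g : MetricBdry m M) (p : M) :
    ContinuousOn (volDens g p) (extChartAt (𝓡∂ (m + 1)) p).target :=
  (ContDiffOn.matrix_sqrt_det (contDiffOn_chartGram g p)
    (fun _ hy => (chartGram_det_pos g hy).ne')).continuousOn

theorem continuousOn_surfDens (g : MetricBdry m M) (p : M) :
    ContinuousOn (surfDens g p) (hyperTarget p) := by
  refine ContinuousOn.sqrt ?_
  refine (ContDiffOn.matrix_det (n := ∞) (G := fun y => (chartGram g p y).submatrix Fin.succ Fin.succ)
    (fun i j => contDiffOn_chartGram g p i.succ j.succ)).continuousOn.comp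
    continuous_hyperplanePt.continuousOn fun _ hz => hz

section

variable [MeasurableSpace M]

theorem chartVolume_eq_patch (g : MetricBdry m M) (p : M) : chartVolume g p =
    patch (extChartAt (𝓡∂ (m + 1)) p).symm (extChartAt (𝓡∂ (m + 1)) p).target (volDens g p) := rfl

theorem chartSurface_eq_patch (g : MetricBdry m M) (p : M) : chartSurface g p =
    patch (fun z : Euc m => (extChartAt (𝓡∂ (m + 1)) p).symm (hyperplanePt z)) (hyperTarget p)
      (surfDens g p) := rfl

end

theorem tau_image {p q : M} {s : Set M}
    (hs : s ⊆ (extChartAt (𝓡∂ (m + 1)) p).source ∩ (extChartAt (𝓡∂ (m + 1)) q).source) :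
    tau p q '' ((extChartAt (𝓡∂ (m + 1)) p).target ∩ (extChartAt (𝓡∂ (m + 1)) p).symm ⁻¹' s) =
      (extChartAt (𝓡∂ (m + 1)) q).target ∩ (extChartAt (𝓡∂ (m + 1)) q).symm ⁻¹' s := by
  ext w
  constructor
  · rintro ⟨y, ⟨hy, hys⟩, rfl⟩
    have ho : y ∈ overlap p q := ⟨hy, (hs hys).2⟩
    refine ⟨(tau_mem_overlap ho).1, ?_⟩
    rw [mem_preimage, symm_tau ho]
    exact hys
  · rintro ⟨hw, hws⟩
    have ho : w ∈ overlap q p := ⟨hw, (hs hws).1⟩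
    refine ⟨tau q p w, ⟨(tau_mem_overlap ho).1, ?_⟩, tau_tau ho⟩
    rw [mem_preimage, symm_tau ho]
    exact hws

theorem det_eq_det_matrix {k : ℕ} (L : Euc k →L[ℝ] Euc k) :
    L.det = (Matrix.of fun i j => (L (stdVec j)) i).det := by
  have h2 : LinearMap.toMatrix (EuclideanSpace.basisFun (Fin k) ℝ).toBasis
      (EuclideanSpace.basisFun (Fin k) ℝ).toBasis
      (L : Euc k →ₗ[ℝ] Euc k) = Matrix.of fun i j => (L (stdVec j)) i := by
    ext i j
    simp [LinearMap.toMatrix_apply, stdVec]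
  rw [ContinuousLinearMap.det, ← LinearMap.det_toMatrix (EuclideanSpace.basisFun (Fin k) ℝ).toBasis, h2]

/-- Coordinate changes preserve the interior of the half space in both directions, hence also its
boundary hyperplane. -/
theorem tau_zero_iff {p q : M} {y : Euc (m + 1)} (hy : y ∈ overlap p q) :
    tau p q y 0 = 0 ↔ y 0 = 0 := by
  have key : ∀ {p q : M} {y : Euc (m + 1)}, y ∈ overlap p q → tau p q y 0 = 0 → y 0 = 0 := by
    intro p q y hy h0
    by_contra hne
    have h1 : 0 < y 0 := lt_of_le_of_ne
      ((mem_range_iff y).1 (extChartAt_target_subset_range p hy.1)) (Ne.symm hne)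
    have h2 := (mem_interior_range_iff _).1
      (tau_mem_interior hy ((mem_interior_range_iff y).2 h1))
    exact h2.ne' h0
  refine ⟨key hy, fun h0 => key (tau_mem_overlap hy) ?_⟩
  rw [tau_tau hy, h0]

/-- The zeroth component of the coordinate change vanishes along the hyperplane, so its tangential
derivatives vanish there. On the boundary the Jacobian is thus block triangular, which separates
tangential and normal directions below. -/
theorem tmat_zero_succ {p q : M} {z : Euc m} (hz : hyperplanePt z ∈ overlap p q) (j : Fin m) :
    tmat p q (hyperplanePt z) 0 j.succ = 0 := by
  set c : ℝ → Euc (m + 1) := fun s => hyperplanePt (z + s • stdVec j) with hc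
  have hcc : ∀ s, c s = hyperplanePt z + s • stdVec j.succ := by
    intro s
    change hyperplanePt (z + s • stdVec j) = _
    rw [← hyperplanePt_stdVec, ← hyperL_apply, map_add, map_smul]
    rfl
  have h1 : HasDerivAt c (stdVec j.succ) 0 := by
    have h2 : HasDerivAt (fun s : ℝ => hyperplanePt z + s • (stdVec j.succ : Euc (m + 1)))
        (stdVec j.succ) 0 := by
      simpa using (((hasDerivAt_id (0 : ℝ)).smul_const (stdVec j.succ : Euc (m + 1))).const_add
        (hyperplanePt z))
    exact h2.congr_of_eventuallyEq (Filter.Eventually.of_forall hcc)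
  have hc0 : c 0 = hyperplanePt z := by simp [hc]
  have hmaps : MapsTo c univ (range (𝓡∂ (m + 1))) := fun s _ => hyperplanePt_mem_range _
  have h3 : HasFDerivWithinAt (tau p q) (fderivWithin ℝ (tau p q) (range (𝓡∂ (m + 1)))
      (hyperplanePt z)) (range (𝓡∂ (m + 1))) (c 0) := by
    rw [hc0]; exact (differentiableWithinAt_tau hz).hasFDerivWithinAt
  have h4 := h3.comp_hasDerivWithinAt (0 : ℝ) h1.hasDerivWithinAt hmaps
  rw [hasDerivWithinAt_univ] at h4
  have h5 : HasDerivAt (fun s => tau p q (c s) 0) (tmat p q (hyperplanePt z) 0 j.succ) 0 :=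
    ((EuclideanSpace.proj (𝕜 := ℝ) (0 : Fin (m + 1))).hasFDerivAt.comp_hasDerivAt (0 : ℝ) h4)
  have h6 : ∀ᶠ s in 𝓝 (0 : ℝ), tau p q (c s) 0 = 0 := by
    have h7 : Filter.Tendsto c (𝓝 0) (𝓝[range (𝓡∂ (m + 1))] (hyperplanePt z)) := by
      rw [tendsto_nhdsWithin_iff]
      refine ⟨hc0 ▸ h1.continuousAt, Filter.Eventually.of_forall fun s => hmaps (mem_univ s)⟩
    filter_upwards [h7 (overlap_mem_nhdsWithin hz)] with s hs
    exact (tau_zero_iff hs).2 (hyperplanePt_zero _)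
  have h8 : HasDerivAt (fun _ : ℝ => (0 : ℝ)) (tmat p q (hyperplanePt z) 0 j.succ) 0 :=
    h5.congr_of_eventuallyEq (by filter_upwards [h6] with s hs using hs.symm)
  exact h8.unique (hasDerivAt_const _ _)

variable [MeasurableSpace M] [BorelSpace M]

/-- Since the metric changes by TᵀGT, the density √det changes by |det T|, the Jacobian of the
coordinate change. -/
theorem chartVolume_agree (g : MetricBdry m M) (p q : M) (s : Set M) (hs : MeasurableSet s)
    (hsub : s ⊆ (extChartAt (𝓡∂ (m + 1)) p).source ∩ (extChartAt (𝓡∂ (m + 1)) q).source) :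
    chartVolume g p s = chartVolume g q s := by
  rw [chartVolume_eq_patch, chartVolume_eq_patch]
  have ho : ∀ y ∈ (extChartAt (𝓡∂ (m + 1)) p).target ∩ (extChartAt (𝓡∂ (m + 1)) p).symm ⁻¹' s,
      y ∈ overlap p q := fun y hy => ⟨hy.1, (hsub hy.2).2⟩
  refine patch_agree (measurableSet_target p) (continuousOn_extChartAt_symm p)
    (measurableSet_target q) (continuousOn_extChartAt_symm q) hs (tau_image hsub)
    (θ' := fun y => fderivWithin ℝ (tau p q) (range (𝓡∂ (m + 1))) y) ?_ ?_ ?_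
  · intro y hy z hz hyz
    rw [← tau_tau (ho y hy), hyz, tau_tau (ho z hz)]
  · intro y hy
    exact (differentiableWithinAt_tau (ho y hy)).hasFDerivWithinAt.mono
      fun z hz => extChartAt_target_subset_range p hz.1
  · intro y hy
    rw [det_eq_det_matrix]
    change √(chartGram g p y).det = |(tmat p q y).det| * √(chartGram g q (tau p q y)).det
    rw [chartGram_tau g (ho y hy), Matrix.det_mul, Matrix.det_mul, Matrix.det_transpose,
      mul_comm (tmat p q y).det, mul_assoc, mul_comm, ← sq, Real.sqrt_mul (sq_nonneg _),
      Real.sqrt_sq_eq_abs]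

theorem submatrix_congr_of_zero {k : ℕ} (G T : Matrix (Fin (k + 1)) (Fin (k + 1)) ℝ)
    (h : ∀ j : Fin k, T 0 j.succ = 0) :
    (T.transpose * G * T).submatrix Fin.succ Fin.succ =
      (T.submatrix Fin.succ Fin.succ).transpose * G.submatrix Fin.succ Fin.succ *
        T.submatrix Fin.succ Fin.succ := by
  ext i j
  simp only [Matrix.submatrix_apply, Matrix.mul_apply, Matrix.transpose_apply, Fin.sum_univ_succ, h]
  simp

/-- As for the volume, applied to the coordinate change restricted to the hyperplane. Its Jacobian
is the tangential block of T, and by block triangularity the tangential block of TᵀGT involves no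
other entries of G and T. -/
theorem chartSurface_agree (g : MetricBdry m M) (p q : M) (s : Set M) (hs : MeasurableSet s)
    (hsub : s ⊆ (extChartAt (𝓡∂ (m + 1)) p).source ∩ (extChartAt (𝓡∂ (m + 1)) q).source) :
    chartSurface g p s = chartSurface g q s := by
  rw [chartSurface_eq_patch, chartSurface_eq_patch]
  set A := hyperTarget (m := m) p ∩
    (fun z : Euc m => (extChartAt (𝓡∂ (m + 1)) p).symm (hyperplanePt z)) ⁻¹' s with hA
  have ho : ∀ z ∈ A, hyperplanePt z ∈ overlap p q := fun y hy => ⟨hy.1, (hsub hy.2).2⟩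
  have hback : ∀ {p q : M} {z : Euc m}, hyperplanePt z ∈ overlap p q →
      hyperplanePt (tailL m (tau p q (hyperplanePt z))) = tau p q (hyperplanePt z) := by
    intro p q z hz
    exact hyperplanePt_tailL ((tau_zero_iff hz).2 (hyperplanePt_zero _))
  have hinv : ∀ {p q : M} {z : Euc m}, hyperplanePt z ∈ overlap p q →
      tailL m (tau q p (hyperplanePt (tailL m (tau p q (hyperplanePt z))))) = z := by
    intro p q z hz
    rw [hback hz, tau_tau hz, tailL_hyperplanePt]
  refine patch_agree (measurableSet_hyperTarget p) (continuousOn_hyperSymm p)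
    (measurableSet_hyperTarget q) (continuousOn_hyperSymm q) hs
    (θ := fun z => tailL m (tau p q (hyperplanePt z)))
    (θ' := fun z => (tailL m).comp
      ((fderivWithin ℝ (tau p q) (range (𝓡∂ (m + 1))) (hyperplanePt z)).comp (hyperL m))) ?_ ?_ ?_ ?_
  · ext w
    constructor
    · rintro ⟨z, hz, rfl⟩
      refine ⟨?_, ?_⟩
      · change hyperplanePt (tailL m (tau p q (hyperplanePt z))) ∈
          (extChartAt (𝓡∂ (m + 1)) q).target
        rw [hback (ho z hz)]
        exact (tau_mem_overlap (ho z hz)).1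
      · simp only [mem_preimage]
        rw [hback (ho z hz), symm_tau (ho z hz)]
        exact hz.2
    · rintro ⟨hw, hws⟩
      have hwo : hyperplanePt w ∈ overlap q p := ⟨hw, (hsub hws).1⟩
      refine ⟨tailL m (tau q p (hyperplanePt w)), ⟨?_, ?_⟩, hinv hwo⟩
      · change hyperplanePt (tailL m (tau q p (hyperplanePt w))) ∈
          (extChartAt (𝓡∂ (m + 1)) p).target
        rw [hback hwo]
        exact (tau_mem_overlap hwo).1
      · simp only [mem_preimage]
        rw [hback hwo, symm_tau hwo]
        exact hws
  · intro z hz w hw hzw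
    simp only at hzw
    rw [← hinv (ho z hz), hzw, hinv (ho w hw)]
  · intro z hz
    refine HasFDerivAt.hasFDerivWithinAt ?_
    have h1 : HasFDerivWithinAt (fun z : Euc m => tau p q (hyperplanePt z))
        ((fderivWithin ℝ (tau p q) (range (𝓡∂ (m + 1))) (hyperplanePt z)).comp (hyperL m)) univ z :=
      (differentiableWithinAt_tau (ho z hz)).hasFDerivWithinAt.comp z
        (hyperL m).hasFDerivAt.hasFDerivWithinAt fun w _ => hyperplanePt_mem_range w
    rw [hasFDerivWithinAt_univ] at h1
    exact (tailL m).hasFDerivAt.comp z h1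
  · intro z hz
    rw [det_eq_det_matrix]
    have h1 : (Matrix.of fun i j => (((tailL m).comp ((fderivWithin ℝ (tau p q)
        (range (𝓡∂ (m + 1))) (hyperplanePt z)).comp (hyperL m))) (stdVec j)) i) =
        (tmat p q (hyperplanePt z)).submatrix Fin.succ Fin.succ := by
      ext i j
      simp only [Matrix.of_apply, ContinuousLinearMap.comp_apply, hyperL_apply,
        hyperplanePt_stdVec, tailL_apply, Matrix.submatrix_apply, tmat]
    rw [h1, surfDens, surfDens, hback (ho z hz), chartGram_tau g (ho z hz),
      submatrix_congr_of_zero _ _ (tmat_zero_succ (ho z hz)), Matrix.det_mul, Matrix.det_mul,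
      Matrix.det_transpose, mul_comm ((tmat p q (hyperplanePt z)).submatrix Fin.succ Fin.succ).det,
      mul_assoc, mul_comm, ← sq, Real.sqrt_mul (sq_nonneg _), Real.sqrt_sq_eq_abs]

theorem volumeMeasure_restrict (g : MetricBdry m M) (p : M) :
    (volumeMeasure g).restrict (extChartAt (𝓡∂ (m + 1)) p).source = chartVolume g p :=
  iSup_restrict_eq (fun p => (isOpen_extChartAt_source p).measurableSet)
    (fun p => patch_compl (measurableSet_target p) (continuousOn_extChartAt_symm p)
      (isOpen_extChartAt_source p).measurableSet fun _ hy => (extChartAt (𝓡∂ (m + 1)) p).map_target hy)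
    (chartVolume_agree g) p

theorem surfaceMeasure_restrict (g : MetricBdry m M) (p : M) :
    (surfaceMeasure g).restrict (extChartAt (𝓡∂ (m + 1)) p).source = chartSurface g p :=
  iSup_restrict_eq (fun p => (isOpen_extChartAt_source p).measurableSet)
    (fun p => patch_compl (measurableSet_hyperTarget p) (continuousOn_hyperSymm p)
      (isOpen_extChartAt_source p).measurableSet fun _ hy => (extChartAt (𝓡∂ (m + 1)) p).map_target hy)
    (chartSurface_agree g) p

end riemannianMeasures

section globalMeasures

variable {m : ℕ} {M : Type*} [TopologicalSpace M] [ChartedSpace (EuclideanHalfSpace (m + 1)) M]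
  [IsManifold (𝓡∂ (m + 1)) ∞ M]

theorem mem_boundary_iff {p x : M} (hx : x ∈ (extChartAt (𝓡∂ (m + 1)) p).source) :
    x ∈ (𝓡∂ (m + 1)).boundary M ↔ extChartAt (𝓡∂ (m + 1)) p x 0 = 0 := by
  have ho : extChartAt (𝓡∂ (m + 1)) p x ∈ overlap p x :=
    ⟨(extChartAt (𝓡∂ (m + 1)) p).map_source hx, by
      rw [mem_preimage, (extChartAt (𝓡∂ (m + 1)) p).left_inv hx]; exact mem_extChartAt_source x⟩
  rw [← tau_zero_iff ho, tau, (extChartAt (𝓡∂ (m + 1)) p).left_inv hx]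
  change extChartAt (𝓡∂ (m + 1)) x x ∈ frontier (range (𝓡∂ (m + 1))) ↔ _
  rw [frontier_range_modelWithCornersEuclideanHalfSpace]
  exact eq_comm

theorem symm_mem_boundary_iff {p : M} {y : Euc (m + 1)}
    (hy : y ∈ (extChartAt (𝓡∂ (m + 1)) p).target) :
    (extChartAt (𝓡∂ (m + 1)) p).symm y ∈ (𝓡∂ (m + 1)).boundary M ↔ y 0 = 0 := by
  rw [mem_boundary_iff ((extChartAt (𝓡∂ (m + 1)) p).map_target hy),
    (extChartAt (𝓡∂ (m + 1)) p).right_inv hy]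

theorem isClosed_bdry : IsClosed ((𝓡∂ (m + 1)).boundary M) :=
  (𝓡∂ (m + 1)).isClosed_boundary (M := M) (n := ∞) (by simp)

theorem secondCountable_of_compact (m : ℕ) (M : Type*) [TopologicalSpace M]
    [ChartedSpace (EuclideanHalfSpace (m + 1)) M] [CompactSpace M] : SecondCountableTopology M :=
  have : SecondCountableTopology (EuclideanHalfSpace (m + 1)) :=
    (𝓡∂ (m + 1)).secondCountableTopology
  ChartedSpace.secondCountable_of_sigmaCompact (EuclideanHalfSpace (m + 1)) M

variable [MeasurableSpace M] [BorelSpace M]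

theorem volumeMeasure_apply_of_subset (g : MetricBdry m M) {p : M} {s : Set M}
    (hs : s ⊆ (extChartAt (𝓡∂ (m + 1)) p).source) : volumeMeasure g s = chartVolume g p s := by
  rw [← volumeMeasure_restrict, Measure.restrict_eq_self _ hs]

theorem surfaceMeasure_apply_of_subset (g : MetricBdry m M) {p : M} {s : Set M}
    (hs : s ⊆ (extChartAt (𝓡∂ (m + 1)) p).source) : surfaceMeasure g s = chartSurface g p s := by
  rw [← surfaceMeasure_restrict, Measure.restrict_eq_self _ hs]

theorem patch_lt_top {d : ℕ} {σ : Euc d → M} {S : Set (Euc d)} {ρ : Euc d → ℝ}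
    (hS : MeasurableSet S) (hσ : ContinuousOn σ S) {s : Set M} (hs : MeasurableSet s)
    {B : Set (Euc d)} (hB : IsCompact B) {c : ℝ} (hsB : S ∩ σ ⁻¹' s ⊆ B)
    (hc : ∀ z ∈ S ∩ σ ⁻¹' s, ρ z ≤ c) : patch σ S ρ s < ⊤ := by
  rw [patch_apply hS hσ hs]
  have hm := measurableSet_inter_preimage hS hσ hs
  calc ∫⁻ z in S ∩ σ ⁻¹' s, ENNReal.ofReal (ρ z)
      ≤ ∫⁻ z in S ∩ σ ⁻¹' s, ENNReal.ofReal c :=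
        setLIntegral_mono' hm fun z hz => ENNReal.ofReal_le_ofReal (hc z hz)
    _ = ENNReal.ofReal c * volume (S ∩ σ ⁻¹' s) := setLIntegral_const _ _
    _ < ⊤ := ENNReal.mul_lt_top ENNReal.ofReal_lt_top
        ((measure_mono hsB).trans_lt hB.measure_lt_top)

/-- Near each point there is a neighbourhood, seen in a small coordinate ball, on which a given
function continuous in the chart is bounded. -/
theorem exists_coordinate_ball (x : M) {D : Euc (m + 1) → ℝ}
    (hD : ContinuousOn D (extChartAt (𝓡∂ (m + 1)) x).target) :
    ∃ (U : Set M) (B : Set (Euc (m + 1))) (c : ℝ), IsOpen U ∧ x ∈ U ∧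
      U ⊆ (extChartAt (𝓡∂ (m + 1)) x).source ∧ IsCompact B ∧
      ∀ y ∈ (extChartAt (𝓡∂ (m + 1)) x).target,
        (extChartAt (𝓡∂ (m + 1)) x).symm y ∈ U → y ∈ B ∧ D y ≤ c := by
  set e := extChartAt (𝓡∂ (m + 1)) x with he
  have h1 : ContinuousWithinAt D e.target (e x) := hD _ (mem_extChartAt_target x)
  have h2 : ∀ᶠ y in 𝓝[e.target] (e x), D y < D (e x) + 1 :=
    h1.eventually (gt_mem_nhds (by linarith))
  obtain ⟨ε, hε, hball⟩ := Metric.mem_nhdsWithin_iff.1 h2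
  refine ⟨e.source ∩ e ⁻¹' Metric.ball (e x) ε, Metric.closedBall (e x) ε, D (e x) + 1,
    (continuousOn_extChartAt x).isOpen_inter_preimage (isOpen_extChartAt_source x)
      Metric.isOpen_ball, ⟨mem_extChartAt_source x, Metric.mem_ball_self hε⟩, inter_subset_left,
    isCompact_closedBall _ _, fun y hy hyU => ?_⟩
  have h3 : y ∈ Metric.ball (e x) ε := by
    have := hyU.2
    rwa [mem_preimage, e.right_inv hy] at this
  exact ⟨Metric.ball_subset_closedBall h3, (hball ⟨h3, hy⟩).le⟩

theorem isFiniteMeasure_volumeMeasure [CompactSpace M] (g : MetricBdry m M) :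
    IsFiniteMeasure (volumeMeasure g) := by
  refine ⟨isCompact_univ.measure_lt_top_of_nhdsWithin fun x _ => ?_⟩
  obtain ⟨U, B, c, hU, hxU, hsub, hB, h⟩ := exists_coordinate_ball x (continuousOn_volDens g x)
  refine ⟨U, mem_nhdsWithin_of_mem_nhds (hU.mem_nhds hxU), ?_⟩
  rw [volumeMeasure_apply_of_subset g hsub]
  exact patch_lt_top (measurableSet_target x) (continuousOn_extChartAt_symm x) hU.measurableSet hB
    (fun y hy => (h y hy.1 hy.2).1) (fun y hy => (h y hy.1 hy.2).2)

theorem isFiniteMeasure_surfaceMeasure [CompactSpace M] (g : MetricBdry m M) :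
    IsFiniteMeasure (surfaceMeasure g) := by
  refine ⟨isCompact_univ.measure_lt_top_of_nhdsWithin fun x _ => ?_⟩
  have hD : ContinuousOn (fun y => √((chartGram g x y).submatrix Fin.succ Fin.succ).det)
      (extChartAt (𝓡∂ (m + 1)) x).target :=
    ContinuousOn.sqrt (ContDiffOn.matrix_det (n := ∞)
      (G := fun y => (chartGram g x y).submatrix Fin.succ Fin.succ)
      (fun i j => contDiffOn_chartGram g x i.succ j.succ)).continuousOn
  obtain ⟨U, B, c, hU, hxU, hsub, hB, h⟩ := exists_coordinate_ball x hD
  refine ⟨U, mem_nhdsWithin_of_mem_nhds (hU.mem_nhds hxU), ?_⟩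
  rw [surfaceMeasure_apply_of_subset g hsub]
  refine patch_lt_top (measurableSet_hyperTarget x) (continuousOn_hyperSymm x) hU.measurableSet
    (hB.image (tailL m).continuous) (c := c)
    (fun y hy => ⟨_, (h (hyperplanePt y) hy.1 hy.2).1, tailL_hyperplanePt y⟩)
    (fun y hy => (h (hyperplanePt y) hy.1 hy.2).2)

theorem volume_zero_coord : volume {y : Euc (m + 1) | y 0 = 0} = 0 := by
  have h1 : {y : Euc (m + 1) | y 0 = 0} =
      ((LinearMap.ker (EuclideanSpace.proj (𝕜 := ℝ) (0 : Fin (m + 1)) :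
        Euc (m + 1) →L[ℝ] ℝ).toLinearMap : Submodule ℝ (Euc (m + 1))) : Set (Euc (m + 1))) := by
    ext y; simp
  rw [h1]
  refine Measure.addHaar_submodule _ _ fun htop => ?_
  have h2 : (stdVec 0 : Euc (m + 1)) ∈
      LinearMap.ker (EuclideanSpace.proj (𝕜 := ℝ) (0 : Fin (m + 1)) :
        Euc (m + 1) →L[ℝ] ℝ).toLinearMap := by
    rw [htop]; trivial
  simp [stdVec] at h2

/-- In a chart the boundary lies in a hyperplane, which is Lebesgue null. It lets identities known
only at interior points be used under volume integrals. -/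
theorem volumeMeasure_boundary [CompactSpace M] (g : MetricBdry m M) :
    volumeMeasure g ((𝓡∂ (m + 1)).boundary M) = 0 := by
  have := secondCountable_of_compact m M
  refine measure_null_of_locally_null _ fun x _ =>
    ⟨(𝓡∂ (m + 1)).boundary M ∩ (extChartAt (𝓡∂ (m + 1)) x).source,
      Filter.inter_mem self_mem_nhdsWithin
        (mem_nhdsWithin_of_mem_nhds (extChartAt_source_mem_nhds x)), ?_⟩
  rw [volumeMeasure_apply_of_subset g inter_subset_right, chartVolume_eq_patch,
    patch_apply (measurableSet_target x) (continuousOn_extChartAt_symm x)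
      (isClosed_bdry.measurableSet.inter (isOpen_extChartAt_source x).measurableSet)]
  refine setLIntegral_measure_zero _ _ (measure_mono_null (fun y hy => ?_) volume_zero_coord)
  exact (symm_mem_boundary_iff hy.1).1 hy.2.1

theorem surfaceMeasure_interior [CompactSpace M] (g : MetricBdry m M) :
    surfaceMeasure g ((𝓡∂ (m + 1)).boundary M)ᶜ = 0 := by
  have := secondCountable_of_compact m M
  refine measure_null_of_locally_null _ fun x _ =>
    ⟨((𝓡∂ (m + 1)).boundary M)ᶜ ∩ (extChartAt (𝓡∂ (m + 1)) x).source,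
      Filter.inter_mem self_mem_nhdsWithin
        (mem_nhdsWithin_of_mem_nhds (extChartAt_source_mem_nhds x)), ?_⟩
  rw [surfaceMeasure_apply_of_subset g inter_subset_right, chartSurface_eq_patch,
    patch_apply (measurableSet_hyperTarget x) (continuousOn_hyperSymm x)
      (isClosed_bdry.measurableSet.compl.inter (isOpen_extChartAt_source x).measurableSet)]
  refine setLIntegral_measure_zero _ _ (measure_mono_null (fun y hy => ?_) measure_empty)
  exact hy.2.1 ((symm_mem_boundary_iff hy.1).2 (hyperplanePt_zero y))

theorem ae_interior [CompactSpace M] (g : MetricBdry m M) :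
    ∀ᵐ x ∂(volumeMeasure g), x ∈ (𝓡∂ (m + 1)).interior M := by
  have h := volumeMeasure_boundary g
  rw [← ModelWithCorners.compl_interior] at h
  exact h

theorem ae_boundary [CompactSpace M] (g : MetricBdry m M) :
    ∀ᵐ x ∂(surfaceMeasure g), x ∈ (𝓡∂ (m + 1)).boundary M :=
  surfaceMeasure_interior g

theorem integral_volumeMeasure_chart (g : MetricBdry m M) (p : M) {f : M → ℝ}
    (hf : AEStronglyMeasurable f (volumeMeasure g))
    (h0 : ∀ x, x ∉ (extChartAt (𝓡∂ (m + 1)) p).source → f x = 0) :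
    ∫ x, f x ∂(volumeMeasure g) =
      ∫ y in (extChartAt (𝓡∂ (m + 1)) p).target, volDens g p y * rep p f y := by
  rw [← setIntegral_eq_integral_of_forall_compl_eq_zero h0, volumeMeasure_restrict,
    chartVolume_eq_patch]
  refine integral_patch (measurableSet_target p) (continuousOn_extChartAt_symm p)
    (continuousOn_volDens g p) (fun _ _ => Real.sqrt_nonneg _) ?_
  rw [← chartVolume_eq_patch, ← volumeMeasure_restrict]
  exact hf.restrict

theorem integral_surfaceMeasure_chart (g : MetricBdry m M) (p : M) {f : M → ℝ}
    (hf : AEStronglyMeasurable f (surfaceMeasure g))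
    (h0 : ∀ x, x ∉ (extChartAt (𝓡∂ (m + 1)) p).source → f x = 0) :
    ∫ x, f x ∂(surfaceMeasure g) =
      ∫ z in hyperTarget (m := m) p, surfDens g p z * rep p f (hyperplanePt z) := by
  rw [← setIntegral_eq_integral_of_forall_compl_eq_zero h0, surfaceMeasure_restrict,
    chartSurface_eq_patch]
  refine integral_patch (measurableSet_hyperTarget p) (continuousOn_hyperSymm p)
    (continuousOn_surfDens g p) (fun _ _ => Real.sqrt_nonneg _) ?_
  rw [← chartSurface_eq_patch, ← surfaceMeasure_restrict]
  exact hf.restrict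

end globalMeasures

/-! ### The divergence theorem on a half space -/

section halfSpaceDivergence

variable {m : ℕ}

theorem pd_eq_zero_of_eventually {F : Euc (m + 1) → ℝ} {y : Euc (m + 1)}
    (h : F =ᶠ[𝓝[range (𝓡∂ (m + 1))] y] 0) (hy : y ∈ range (𝓡∂ (m + 1))) (j : Fin (m + 1)) :
    pd F y j = 0 := by
  rw [pd, Filter.EventuallyEq.fderivWithin_eq h (h.self_of_nhdsWithin hy)]
  simp

/-- The divergence theorem for compactly supported vector fields of class `C¹` on the closed half
space. -/
theorem integral_divergence_halfSpace {X : Fin (m + 1) → Euc (m + 1) → ℝ} {K : Set (Euc (m + 1))}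
    (hK : IsCompact K) (hX : ∀ i, ContDiffOn ℝ 1 (X i) (range (𝓡∂ (m + 1))))
    (h0 : ∀ i, ∀ y ∈ range (𝓡∂ (m + 1)), y ∉ K → X i y = 0) :
    ∫ y in range (𝓡∂ (m + 1)), ∑ i, pd (X i) y i = -∫ z : Euc m, X 0 (hyperplanePt z) := by
  obtain ⟨R, hR⟩ := hK.isBounded.subset_ball (0 : Euc (m + 1))
  have hRpos : 0 < R ∨ R ≤ 0 := lt_or_ge 0 R
  wlog hRp : 0 < R generalizing R
  · exact this (max R 1) (hR.trans (Metric.ball_subset_ball (le_max_left _ _)))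
      (Or.inl (lt_max_of_lt_right one_pos)) (lt_max_of_lt_right one_pos)
  have hcoord : ∀ y ∈ K, ∀ i, |y i| < R := fun y hy i => by
    have h1 := hR hy
    rw [mem_ball_zero_iff] at h1
    exact (PiLp.norm_apply_le y i).trans_lt h1
  have hdiv0 : ∀ y ∈ range (𝓡∂ (m + 1)), y ∉ K → ∀ i, pd (X i) y i = 0 := fun y hy hyK i =>
    pd_eq_zero_of_eventually (by
      filter_upwards [self_mem_nhdsWithin, mem_nhdsWithin_of_mem_nhds
        (hK.isClosed.isOpen_compl.mem_nhds hyK)] with w hw hwK using h0 i w hw hwK) hy i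
  have hdivc : ∀ i, ContinuousOn (fun y => pd (X i) y i) (range (𝓡∂ (m + 1))) := fun i =>
    ((hX i).continuousOn_fderivWithin uniqueDiffOn_halfSpace le_rfl).clm_apply continuousOn_const
  -- The box [0, R] × [-R, R]^m contains the part of the support in the half space, and its lower
  -- face in the zeroth coordinate lies on the hyperplane.
  set a : Fin (m + 1) → ℝ := Fin.cons 0 fun _ => -R with ha
  set b : Fin (m + 1) → ℝ := fun _ => R with hb
  have hab : a ≤ b := by
    intro i
    refine Fin.cases ?_ (fun i => ?_) i
    · simp [ha, hb, hRp.le]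
    · simp only [ha, hb, Fin.cons_succ]; linarith
  set L : (Fin (m + 1) → ℝ) → Euc (m + 1) := fun v => WithLp.toLp 2 v with hL
  have hLc : Continuous L := PiLp.continuous_toLp 2 _
  have hbox : ∀ v ∈ Icc a b, L v ∈ range (𝓡∂ (m + 1)) := fun v hv => by
    rw [mem_range_iff]
    have := hv.1 0
    simpa [ha] using this
  set Lc : (Fin (m + 1) → ℝ) →L[ℝ] Euc (m + 1) :=
    (EuclideanSpace.equiv (Fin (m + 1)) ℝ).symm.toContinuousLinearMap with hLcdef
  have hLL : ∀ v, Lc v = L v := fun v => rfl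
  have hsingle : ∀ i : Fin (m + 1), Lc (Pi.single i 1) = stdVec i := by
    intro i; ext j; simp [hLL, hL, stdVec_apply, eq_comm]
  -- Differentiability is required only in the open box, which lies inside the half space; there the
  -- derivative within the half space is the full derivative, so no exceptional set is needed.
  have key := integral_divergence_of_hasFDerivAt_off_countable' a b hab (fun i v => X i (L v))
    (fun i v => (fderivWithin ℝ (X i) (range (𝓡∂ (m + 1))) (L v)).comp Lc) ∅ countable_empty
    (fun i => (hX i).continuousOn.comp hLc.continuousOn hbox)
    (fun v hv i => by
      have hint : L v ∈ interior (range (𝓡∂ (m + 1))) := by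
        rw [mem_interior_range_iff]
        have := (hv.1 0 (mem_univ _)).1
        simpa [ha] using this
      have h1 : HasFDerivAt (X i) (fderivWithin ℝ (X i) (range (𝓡∂ (m + 1))) (L v)) (L v) :=
        ((hX i).differentiableOn one_ne_zero _ (interior_subset hint)).hasFDerivWithinAt.hasFDerivAt
          (mem_interior_iff_mem_nhds.1 hint)
      exact h1.comp v Lc.hasFDerivAt)
    (ContinuousOn.integrableOn_Icc (by
      refine continuousOn_finsetSum _ fun i _ => ?_
      have h1 := (hdivc i).comp hLc.continuousOn hbox
      refine h1.congr fun v _ => ?_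
      simp only [ContinuousLinearMap.comp_apply, Function.comp_apply, pd, hsingle]))
  simp only [ContinuousLinearMap.comp_apply, hsingle] at key
  have hvol : MeasurePreserving L volume volume := PiLp.volume_preserving_toLp (Fin (m + 1))
  have hemb : MeasurableEmbedding L :=
    (MeasurableEquiv.toLp 2 (Fin (m + 1) → ℝ)).measurableEmbedding
  have hlhs : ∫ y in range (𝓡∂ (m + 1)), ∑ i, pd (X i) y i =
      ∫ v in Icc a b, ∑ i, fderivWithin ℝ (X i) (range (𝓡∂ (m + 1))) (L v) (stdVec i) := by
    rw [← hvol.setIntegral_preimage_emb hemb]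
    refine setIntegral_eq_of_subset_of_forall_sdiff_eq_zero
      (hLc.measurable (𝓡∂ (m + 1)).isClosed_range.measurableSet) hbox fun v hv => ?_
    refine Finset.sum_eq_zero fun i _ => hdiv0 _ hv.1 (fun hK' => hv.2 ?_) i
    refine ⟨fun j => ?_, fun j => ?_⟩
    · refine Fin.cases ?_ (fun j => ?_) j
      · simpa [ha] using (mem_range_iff _).1 hv.1
      · simpa [ha] using (abs_lt.1 (hcoord _ hK' j.succ)).1.le
    · exact (abs_lt.1 (hcoord _ hK' j)).2.le
  rw [hlhs, key, Fin.sum_univ_succ]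
  -- A face on which some coordinate has absolute value at least R misses the support. Only the
  -- lower zeroth face survives, and its opposite orientation gives the minus sign.
  have hface : ∀ (i : Fin (m + 1)) (c : ℝ) (w : Fin m → ℝ), R ≤ |c| →
      w ∈ Icc (a ∘ i.succAbove) (b ∘ i.succAbove) → 0 ≤ i.insertNth (α := fun _ => ℝ) c w 0 →
      X i (L (i.insertNth (α := fun _ => ℝ) c w)) = 0 := by
    intro i c w hc hw hpos
    refine h0 i _ ((mem_range_iff _).2 hpos) fun hKm => ?_
    have h1 := hcoord _ hKm i
    simp only [hL, Fin.insertNth_apply_same] at h1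
    linarith
  have hrest : ∀ j : Fin m, ((∫ x in Icc (a ∘ j.succ.succAbove) (b ∘ j.succ.succAbove),
        X j.succ (L (j.succ.insertNth (α := fun _ => ℝ) (b j.succ) x))) -
      ∫ x in Icc (a ∘ j.succ.succAbove) (b ∘ j.succ.succAbove),
        X j.succ (L (j.succ.insertNth (α := fun _ => ℝ) (a j.succ) x))) = 0 := by
    intro j
    have hz : ∀ c : ℝ, R ≤ |c| → ∫ x in Icc (a ∘ j.succ.succAbove) (b ∘ j.succ.succAbove),
        X j.succ (L (j.succ.insertNth (α := fun _ => ℝ) c x)) = 0 := by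
      intro c hc
      refine setIntegral_eq_zero_of_forall_eq_zero fun w hw => hface _ c w hc hw ?_
      obtain ⟨k, hk⟩ := Fin.exists_succAbove_eq (x := 0) (y := j.succ) (Fin.succ_ne_zero j).symm
      have h2 : j.succ.insertNth (α := fun _ => ℝ) c w 0 = w k := by
        conv_lhs => rw [← hk]
        exact Fin.insertNth_apply_succAbove (α := fun _ => ℝ) j.succ c w k
      rw [h2]
      have := hw.1 k
      simpa [hk, ha] using this
    rw [hz _ (by simp [hb, le_abs_self]), hz _ (by simp [ha, le_abs_self]), sub_zero]
  rw [Finset.sum_congr rfl fun j _ => hrest j, Finset.sum_const_zero, add_zero]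
  have hfront : ∫ x in Icc (a ∘ (0 : Fin (m + 1)).succAbove) (b ∘ (0 : Fin (m + 1)).succAbove),
      X 0 (L ((0 : Fin (m + 1)).insertNth (α := fun _ => ℝ) (b 0) x)) = 0 :=
    setIntegral_eq_zero_of_forall_eq_zero fun w hw =>
      hface 0 _ w (by simp [hb, le_abs_self]) hw (by simp [hb, hRp.le])
  rw [hfront, zero_sub]
  have hvol' : MeasurePreserving (fun v : Fin m → ℝ => (WithLp.toLp 2 v : Euc m)) volume volume :=
    PiLp.volume_preserving_toLp (Fin m)
  have hemb' : MeasurableEmbedding (fun v : Fin m → ℝ => (WithLp.toLp 2 v : Euc m)) :=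
    (MeasurableEquiv.toLp 2 (Fin m → ℝ)).measurableEmbedding
  have hpt : ∀ w : Fin m → ℝ, L ((0 : Fin (m + 1)).insertNth (α := fun _ => ℝ) (a 0) w) =
      hyperplanePt (WithLp.toLp 2 w) := by
    intro w
    ext i
    refine Fin.cases ?_ (fun i => ?_) i
    · simp [hL, ha, hyperplanePt]
    · simp [hL, hyperplanePt]
  rw [← hvol'.integral_comp hemb', ← setIntegral_univ (μ := (volume : Measure (Fin m → ℝ)))]
  simp only [hpt]
  congr 1
  refine (setIntegral_eq_of_subset_of_forall_sdiff_eq_zero MeasurableSet.univ (subset_univ _)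
    fun w hw => ?_).symm
  refine h0 0 _ (hyperplanePt_mem_range _) fun hKm => hw.2 ?_
  refine ⟨fun j => ?_, fun j => ?_⟩
  · simpa [ha, hyperplanePt_succ] using (abs_lt.1 (hcoord _ hKm j.succ)).1.le
  · simpa [hb, hyperplanePt_succ] using (abs_lt.1 (hcoord _ hKm j.succ)).2.le

end halfSpaceDivergence

/-! ### The outward normal derivative in charts -/

section normalAlgebra

variable {k : ℕ}

theorem mulVec_zero_of_row (T : Matrix (Fin (k + 1)) (Fin (k + 1)) ℝ)
    (h : ∀ j : Fin k, T 0 j.succ = 0) (w : Fin (k + 1) → ℝ) : T.mulVec w 0 = T 0 0 * w 0 := by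
  simp [Matrix.mulVec, dotProduct, Fin.sum_univ_succ, h]

/-- When the zeroth row of T has only its diagonal entry, T multiplies the zeroth component of a
vector by T₀₀ and does not mix it with the others. -/
theorem frame_inv_zero (H T : Matrix (Fin (k + 1)) (Fin (k + 1)) ℝ) (hT : IsUnit T.det)
    (h : ∀ j : Fin k, T 0 j.succ = 0) (b : Fin (k + 1) → ℝ) :
    T 0 0 * (T.transpose * H * T)⁻¹.mulVec (T.transpose.mulVec b) 0 = H⁻¹.mulVec b 0 := by
  rw [inv_mulVec_frame H T hT, ← mulVec_zero_of_row T h, Matrix.mulVec_mulVec,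
    Matrix.mul_nonsing_inv _ hT, Matrix.one_mulVec]

theorem frame_inv_zero_zero (H T : Matrix (Fin (k + 1)) (Fin (k + 1)) ℝ) (hT : IsUnit T.det)
    (h : ∀ j : Fin k, T 0 j.succ = 0) :
    T 0 0 ^ 2 * (T.transpose * H * T)⁻¹ 0 0 = H⁻¹ 0 0 := by
  have h1 : T.transpose.mulVec (Pi.single 0 1) = T 0 0 • (Pi.single 0 1 : Fin (k + 1) → ℝ) := by
    ext i
    refine Fin.cases ?_ (fun i => ?_) i <;> simp [h]
  have h2 := frame_inv_zero H T hT h (Pi.single 0 1)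
  rw [h1, Matrix.mulVec_smul] at h2
  simp only [Pi.smul_apply, smul_eq_mul, Matrix.mulVec_single_one, Matrix.col_apply] at h2
  rw [← h2]; ring

/-- Cramer's rule. It relates the volume density, the length of dy₀ and the surface density, and so
identifies the boundary term of Green's formula. -/
theorem inv_zero_zero_mul_det (G : Matrix (Fin (k + 1)) (Fin (k + 1)) ℝ) (hG : G.det ≠ 0) :
    G.det * G⁻¹ 0 0 = (G.submatrix Fin.succ Fin.succ).det := by
  rw [Matrix.inv_def, Ring.inverse_eq_inv', Matrix.smul_apply, smul_eq_mul,
    Matrix.adjugate_fin_succ_eq_det_submatrix, mul_inv_cancel_left₀ hG]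
  simp [Fin.succAbove_zero]

theorem inv_zero_zero_pos {G : Matrix (Fin (k + 1)) (Fin (k + 1)) ℝ} (hG : G.PosDef) :
    0 < G⁻¹ 0 0 := hG.inv.diag_pos

end normalAlgebra

section normalDerivative

variable {m : ℕ} {M : Type*} [TopologicalSpace M] [ChartedSpace (EuclideanHalfSpace (m + 1)) M]
  [IsManifold (𝓡∂ (m + 1)) ∞ M]

/-- The outward normal derivative in coordinates, at points of the hyperplane. -/
def locNormal (G : Euc (m + 1) → Matrix (Fin (m + 1)) (Fin (m + 1)) ℝ) (F : Euc (m + 1) → ℝ)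
    (y : Euc (m + 1)) : ℝ := -((G y)⁻¹.mulVec (pd F y) 0 / √((G y)⁻¹ 0 0))

theorem normalDerivReal_eq (g : MetricBdry m M) (f : M → ℝ) (x : M) :
    normalDerivReal g f x = -((gram g x)⁻¹.mulVec (fun j => dR f x (stdVec j)) 0 /
      √((gram g x)⁻¹ 0 0)) := by
  have h : ∀ L : Euc (m + 1) →L[ℝ] ℝ,
      L ((-(1 / √((gram g x)⁻¹ 0 0))) • ∑ j, (gram g x)⁻¹ 0 j • stdVec j : Euc (m + 1)) =
      -((gram g x)⁻¹.mulVec (fun j => L (stdVec j)) 0 / √((gram g x)⁻¹ 0 0)) := by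
    intro L
    simp only [map_smul, map_sum, smul_eq_mul, Matrix.mulVec, dotProduct]
    ring
  exact h _

/-- The zeroth component of the coordinate change is zero on the hyperplane and nonnegative inside,
so its inward derivative is nonnegative; it is nonzero since the Jacobian is invertible. The sign
ensures that all charts agree on which normal is outward. -/
theorem tmat_zero_zero_pos {p q : M} {y : Euc (m + 1)} (hy : y ∈ overlap p q) (h0 : y 0 = 0) :
    0 < tmat p q y 0 0 := by
  have hz : hyperplanePt (tailL m y) = y := hyperplanePt_tailL h0
  have hrow : ∀ j : Fin m, tmat p q y 0 j.succ = 0 := by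
    intro j
    have := tmat_zero_succ (z := tailL m y) (p := p) (q := q) (by rwa [hz]) j
    rwa [hz] at this
  have hne : tmat p q y 0 0 ≠ 0 := by
    intro hc
    have hdet : (tmat p q y).det = 0 := by
      refine Matrix.det_eq_zero_of_row_eq_zero 0 fun j => ?_
      exact Fin.cases hc hrow j
    exact (isUnit_tmat hy).ne_zero hdet
  refine lt_of_le_of_ne ?_ hne.symm
  set c : ℝ → Euc (m + 1) := fun s => y + s • stdVec 0 with hc
  have h1 : HasDerivWithinAt c (stdVec 0) (Ici 0) 0 := by
    have h2 : HasDerivAt (fun s : ℝ => y + s • (stdVec 0 : Euc (m + 1))) (stdVec 0) 0 := by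
      simpa using (((hasDerivAt_id (0 : ℝ)).smul_const (stdVec 0 : Euc (m + 1))).const_add y)
    exact h2.hasDerivWithinAt
  have hc0 : c 0 = y := by simp [hc]
  have hmaps : MapsTo c (Ici 0) (range (𝓡∂ (m + 1))) := fun s hs => by
    rw [mem_range_iff]
    simpa [hc, h0, stdVec_apply] using hs
  have h3 : HasFDerivWithinAt (tau p q) (fderivWithin ℝ (tau p q) (range (𝓡∂ (m + 1))) y)
      (range (𝓡∂ (m + 1))) (c 0) := by
    rw [hc0]; exact (differentiableWithinAt_tau hy).hasFDerivWithinAt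
  have h4 := h3.comp_hasDerivWithinAt (0 : ℝ) h1 hmaps
  have h5 : HasDerivWithinAt (fun s => tau p q (c s) 0) (tmat p q y 0 0) (Ici 0) 0 :=
    ((EuclideanSpace.proj (𝕜 := ℝ) (0 : Fin (m + 1))).hasFDerivAt.comp_hasDerivWithinAt (0 : ℝ) h4)
  have h6 : tau p q (c 0) 0 = 0 := by rw [hc0]; exact (tau_zero_iff hy).2 h0
  rw [hasDerivWithinAt_iff_tendsto_slope] at h5
  have hne : (𝓝[Ici (0 : ℝ) \ {0}] 0).NeBot := by
    rw [Ici_sdiff_left]; infer_instance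
  refine ge_of_tendsto h5 ?_
  filter_upwards [self_mem_nhdsWithin] with s hs
  rw [slope_def_field, h6, sub_zero, sub_zero]
  exact div_nonneg ((mem_range_iff _).1 (mapsTo_tau p q (mem_univ _))) hs.1

/-- Numerator and denominator are both multiplied by T₀₀. For the denominator, a square root, this
uses T₀₀ > 0. -/
theorem normalDerivReal_chart (g : MetricBdry m M) {f : M → ℝ} {p : M} {y : Euc (m + 1)}
    (hy : y ∈ (extChartAt (𝓡∂ (m + 1)) p).target) (h0 : y 0 = 0)
    (hf : MDifferentiableAt (𝓡∂ (m + 1)) 𝓘(ℝ, ℝ) f ((extChartAt (𝓡∂ (m + 1)) p).symm y)) :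
    normalDerivReal g f ((extChartAt (𝓡∂ (m + 1)) p).symm y) =
      locNormal (chartGram g p) (rep p f) y := by
  set x := (extChartAt (𝓡∂ (m + 1)) p).symm y with hx
  have ho : y ∈ overlap p x := ⟨hy, mem_extChartAt_source x⟩
  have hz : hyperplanePt (tailL m y) = y := hyperplanePt_tailL h0
  have hrow : ∀ j : Fin m, tmat p x y 0 j.succ = 0 := by
    intro j
    have := tmat_zero_succ (z := tailL m y) (p := p) (q := x) (by rwa [hz]) j
    rwa [hz] at this
  have hpos := tmat_zero_zero_pos ho h0
  have hframe : frm p y = tmat p x y := by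
    have h := frm_eq_mul_tmat ho
    have h1 : tau p x y = extChartAt (𝓡∂ (m + 1)) x x := rfl
    rw [h1, frm_self, Matrix.one_mul] at h
    exact h
  rw [normalDerivReal_eq, locNormal, pd_rep hy hf, chartGram_eq_frm, hframe,
    ← frame_inv_zero (gram g x) (tmat p x y) (isUnit_tmat ho) hrow,
    ← frame_inv_zero_zero (gram g x) (tmat p x y) (isUnit_tmat ho) hrow,
    Real.sqrt_mul (sq_nonneg _), Real.sqrt_sq hpos.le, mul_div_mul_left _ _ hpos.ne']

/-- Here √det G g^{0j} ∂_j F is minus √(det G g^{00}) times the outward derivative, and det G g^{00}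
is the tangential minor whose root is the surface density. -/
theorem flux_zero_eq (g : MetricBdry m M) {p : M} {z : Euc m} (hz : z ∈ hyperTarget (m := m) p)
    (F : Euc (m + 1) → ℝ) : flux (chartGram g p) F 0 (hyperplanePt z) =
      -(surfDens g p z * locNormal (chartGram g p) F (hyperplanePt z)) := by
  have hd := chartGram_det_pos g (p := p) hz
  have hi := inv_zero_zero_pos (chartGram_posDef g (p := p) hz)
  rw [surfDens, ← inv_zero_zero_mul_det _ hd.ne', Real.sqrt_mul hd.le, flux, locNormal]
  have := (Real.sqrt_pos.2 hi).ne'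
  field_simp

theorem contDiffOn_locNormal_slice {T : ℝ} (hT : 0 < T) (g : MetricBdry m M) {p : M}
    {W : ℝ × Euc (m + 1) → ℝ} (hW : ContDiffOn ℝ 1 W (cdom m T p)) :
    ContinuousOn (fun z => locNormal (chartGram g p) (fun y => W (z.1, y)) z.2) (cdom m T p) := by
  have h0 : ∀ z ∈ cdom m T p, (chartGram g p z.2).det ≠ 0 :=
    fun z hz => (chartGram_det_pos g hz.2).ne'
  have hinv := fun i j => ContDiffOn.matrix_inv (contDiffOn_chartGram_cdom g T p (n := 0)
    (by simp)) h0 i j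
  simp only [locNormal, Matrix.mulVec, dotProduct]
  refine (ContinuousOn.div (continuousOn_finsetSum _ fun i _ => (hinv 0 i).continuousOn.mul
    (contDiffOn_pd_slice hT (k := 0) (n := 1) (by simp) hW i).continuousOn)
    (hinv 0 0).continuousOn.sqrt fun z hz => ?_).neg
  exact (Real.sqrt_pos.2 (inv_zero_zero_pos (chartGram_posDef g hz.2))).ne'

/-- Continuity on a cylinder over a subset of `M` may be checked in charts. -/
theorem continuousOn_cylinder_of_chart {T : ℝ} {B : Set M} {w : ℝ → M → ℝ}
    (h : ∀ p : M, ∃ W : ℝ × Euc (m + 1) → ℝ, ContinuousOn W (cdom m T p) ∧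
      ∀ t ∈ Icc 0 T, ∀ y ∈ (extChartAt (𝓡∂ (m + 1)) p).target,
        (extChartAt (𝓡∂ (m + 1)) p).symm y ∈ B →
        w t ((extChartAt (𝓡∂ (m + 1)) p).symm y) = W (t, y)) :
    ContinuousOn (fun z : ℝ × M => w z.1 z.2) (Icc 0 T ×ˢ B) := by
  intro z hz
  obtain ⟨W, hW, hwW⟩ := h z.2
  set φ := extChartAt (𝓡∂ (m + 1)) z.2 with hφ
  have h1 : ContinuousWithinAt W (cdom m T z.2) (z.1, φ z.2) :=
    hW _ ⟨hz.1, mem_extChartAt_target _⟩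
  have h2 : ContinuousWithinAt (fun w : ℝ × M => (w.1, φ w.2)) (Icc 0 T ×ˢ (B ∩ φ.source)) z := by
    apply ContinuousAt.continuousWithinAt
    exact continuousAt_fst.prodMk ((continuousAt_extChartAt z.2).comp continuousAt_snd)
  have h3 := h1.comp_of_eq (x := z) h2 (fun w hw => ⟨hw.1, φ.map_source hw.2.2⟩) rfl
  have hval : ∀ a ∈ Icc 0 T ×ˢ (B ∩ φ.source), w a.1 a.2 = W (a.1, φ a.2) := by
    intro a ha
    rw [← hwW a.1 ha.1 (φ a.2) (φ.map_source ha.2.2) (by rw [φ.left_inv ha.2.2]; exact ha.2.1),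
      φ.left_inv ha.2.2]
  have h4 : ContinuousWithinAt (fun a : ℝ × M => w a.1 a.2) (Icc 0 T ×ˢ (B ∩ φ.source)) z :=
    h3.congr hval (hval z ⟨hz.1, hz.2, mem_extChartAt_source _⟩)
  refine h4.mono_of_mem_nhdsWithin ?_
  rw [mem_nhdsWithin]
  refine ⟨univ ×ˢ φ.source, isOpen_univ.prod (isOpen_extChartAt_source _),
    ⟨mem_univ _, mem_extChartAt_source _⟩, ?_⟩
  rintro a ⟨⟨_, h5⟩, h6, h7⟩
  exact ⟨h6, h7, h5⟩

theorem JReg.continuousOn_normalDerivReal {T : ℝ} (hT : 0 < T) (g : MetricBdry m M)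
    {u : ℝ → M → ℝ} (hu : JReg m T 1 u) :
    ContinuousOn (fun z : ℝ × M => normalDerivReal g (u z.1) z.2)
      (Icc 0 T ×ˢ (𝓡∂ (m + 1)).boundary M) :=
  continuousOn_cylinder_of_chart (w := fun t => normalDerivReal g (u t)) fun p =>
    ⟨_, contDiffOn_locNormal_slice hT g (hu p), fun _ ht _ hy hyB =>
      normalDerivReal_chart g hy ((symm_mem_boundary_iff hy).1 hyB)
        ((hu.slice ht).mdifferentiableAt le_rfl _)⟩

theorem CReg.continuousOn_normalDerivReal (g : MetricBdry m M) {u : M → ℝ} (hu : CReg m 1 u) :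
    ContinuousOn (normalDerivReal g u) ((𝓡∂ (m + 1)).boundary M) := by
  have h := (hu.jreg 1).continuousOn_normalDerivReal one_pos g
  exact h.comp (f := fun x : M => ((0 : ℝ), x)) (by fun_prop) fun x hx => ⟨by simp, hx⟩

end normalDerivative

/-! ### Green's formula -/

section green

variable {m : ℕ} {M : Type*} [TopologicalSpace M] [ChartedSpace (EuclideanHalfSpace (m + 1)) M]
  [IsManifold (𝓡∂ (m + 1)) ∞ M]

/-- Extension by zero is smooth: at a point outside the target, the closed set K is avoided in a
whole neighbourhood. -/
theorem contDiffOn_indicator_target {n : WithTop ℕ∞} {p : M} {F : Euc (m + 1) → ℝ}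
    {K : Set (Euc (m + 1))} (hK : IsClosed K) (hKt : K ⊆ (extChartAt (𝓡∂ (m + 1)) p).target)
    (hF : ContDiffOn ℝ n F (extChartAt (𝓡∂ (m + 1)) p).target)
    (h0 : ∀ y ∈ (extChartAt (𝓡∂ (m + 1)) p).target, y ∉ K → F y = 0) :
    ContDiffOn ℝ n ((extChartAt (𝓡∂ (m + 1)) p).target.indicator F) (range (𝓡∂ (m + 1))) := by
  intro y hy
  by_cases hyt : y ∈ (extChartAt (𝓡∂ (m + 1)) p).target
  · have h1 : ContDiffWithinAt ℝ n ((extChartAt (𝓡∂ (m + 1)) p).target.indicator F)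
        (extChartAt (𝓡∂ (m + 1)) p).target y :=
      (hF y hyt).congr (fun z hz => indicator_of_mem hz F) (indicator_of_mem hyt F)
    exact h1.mono_of_mem_nhdsWithin (extChartAt_target_mem_nhdsWithin_of_mem hyt)
  · have h2 : ∀ z ∉ K, (extChartAt (𝓡∂ (m + 1)) p).target.indicator F z = 0 := fun z hz => by
      by_cases hzt : z ∈ (extChartAt (𝓡∂ (m + 1)) p).target
      · rw [indicator_of_mem hzt, h0 z hzt hz]
      · exact indicator_of_notMem hzt F
    have h3 : ContDiffAt ℝ n ((extChartAt (𝓡∂ (m + 1)) p).target.indicator F) y := by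
      refine contDiffAt_const (c := (0 : ℝ)) |>.congr_of_eventuallyEq ?_
      filter_upwards [hK.isOpen_compl.mem_nhds fun h => hyt (hKt h)] with z hz using h2 z hz
    exact h3.contDiffWithinAt

/-- The Laplacian is in divergence form, so the product rule for F times the flux of V gives FΔV +
⟨dF, dV⟩ against the volume density. -/
theorem sum_pd_mul_flux (G : Euc (m + 1) → Matrix (Fin (m + 1)) (Fin (m + 1)) ℝ)
    {F V : Euc (m + 1) → ℝ} {y : Euc (m + 1)} (hy : y ∈ range (𝓡∂ (m + 1))) (hG : 0 < (G y).det)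
    (hF : DifferentiableWithinAt ℝ F (range (𝓡∂ (m + 1))) y)
    (hV : ∀ i, DifferentiableWithinAt ℝ (flux G V i) (range (𝓡∂ (m + 1))) y) :
    ∑ i, pd (fun y => F y * flux G V i y) y i =
      √(G y).det * (F y * locLap G V y + coPair (G y) (pd F y) (pd V y)) := by
  have h1 : ∀ i, pd (fun y => F y * flux G V i y) y i =
      F y * pd (flux G V i) y i + √(G y).det * (pd F y i * ((G y)⁻¹.mulVec (pd V y)) i) := by
    intro i
    have h2 := fderivWithin_mul (uniqueDiffOn_halfSpace y hy) hF (hV i)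
    have h3 := congrArg (fun L : Euc (m + 1) →L[ℝ] ℝ => L (stdVec i)) h2
    simp only [add_apply, smul_apply, smul_eq_mul] at h3
    refine Eq.trans h3 ?_
    simp only [pd, flux]
    ring
  rw [Finset.sum_congr rfl fun i _ => h1 i, Finset.sum_add_distrib, ← Finset.mul_sum,
    ← Finset.mul_sum, locLap, coPair, dotProduct]
  have := (Real.sqrt_pos.2 hG).ne'
  field_simp

variable [CompactSpace M] [MeasurableSpace M] [BorelSpace M]

theorem surfaceMeasure_restrict_boundary (g : MetricBdry m M) :
    (surfaceMeasure g).restrict ((𝓡∂ (m + 1)).boundary M) = surfaceMeasure g :=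
  Measure.restrict_eq_self_of_ae_mem (ae_boundary g)

theorem aestronglyMeasurable_surface (g : MetricBdry m M) {f : M → ℝ}
    (hf : ContinuousOn f ((𝓡∂ (m + 1)).boundary M)) : AEStronglyMeasurable f (surfaceMeasure g) := by
  have := secondCountable_of_compact m M
  rw [← surfaceMeasure_restrict_boundary]
  exact hf.aestronglyMeasurable isClosed_bdry.measurableSet

theorem integrable_surface (g : MetricBdry m M) {f : M → ℝ}
    (hf : ContinuousOn f ((𝓡∂ (m + 1)).boundary M)) : Integrable f (surfaceMeasure g) := by
  have := secondCountable_of_compact m M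
  have := isFiniteMeasure_surfaceMeasure g
  rw [← surfaceMeasure_restrict_boundary]
  exact hf.integrableOn_of_subset_isCompact isClosed_bdry.isCompact
    isClosed_bdry.measurableSet subset_rfl (measure_ne_top _ _)

theorem integrable_volume (g : MetricBdry m M) {f : M → ℝ} (hf : Continuous f) :
    Integrable f (volumeMeasure g) := by
  have := secondCountable_of_compact m M
  have := isFiniteMeasure_volumeMeasure g
  exact hf.integrable_of_hasCompactSupport (HasCompactSupport.of_compactSpace f)

/-- The field f √|g| ∇v, written in the chart and extended by zero, is C¹ with compact support in
the half space. Its divergence is the left integrand, and by `flux_zero_eq` its boundary flux is the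
right one. -/
theorem green_of_tsupport_subset (g : MetricBdry m M) {f v : M → ℝ} (hf : CReg m 1 f)
    (hv : CReg m 2 v) {p : M} (hfp : tsupport f ⊆ (extChartAt (𝓡∂ (m + 1)) p).source) :
    ∫ x, (f x * lap g v x + gam g f v x) ∂(volumeMeasure g) =
      ∫ x, f x * normalDerivReal g v x ∂(surfaceMeasure g) := by
  have := secondCountable_of_compact m M
  set φ := extChartAt (𝓡∂ (m + 1)) p with hφ
  set K := φ '' tsupport f with hK
  have hKc : IsCompact K := (isClosed_tsupport f).isCompact.image_of_continuousOn
    ((continuousOn_extChartAt p).mono hfp)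
  have hKt : K ⊆ φ.target := by
    rintro _ ⟨x, hx, rfl⟩
    exact φ.map_source (hfp hx)
  have hrep0 : ∀ y ∈ φ.target, y ∉ K → rep p f y = 0 := by
    intro y hy hyK
    exact image_eq_zero_of_notMem_tsupport (f := f) fun hmem => hyK ⟨_, hmem, φ.right_inv hy⟩
  have hf0 : ∀ x, x ∉ φ.source → f x = 0 :=
    fun x hx => image_eq_zero_of_notMem_tsupport fun h => hx (hfp h)
  have hv1 : CReg m 1 v := hv.of_le (by norm_num)
  set Y : Fin (m + 1) → Euc (m + 1) → ℝ :=
    fun i y => rep p f y * flux (chartGram g p) (rep p v) i y with hY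
  have hYc : ∀ i, ContDiffOn ℝ 1 (Y i) φ.target := fun i =>
    (hf p).mul (contDiffOn_flux g (k := 1) (n := 2) (by norm_num) (by simp) (hv p) i)
  have key := integral_divergence_halfSpace (X := fun i => φ.target.indicator (Y i)) hKc
    (fun i => contDiffOn_indicator_target hKc.isClosed hKt (hYc i) fun y hy hyK => by
      simp only [hY, hrep0 y hy hyK, zero_mul])
    (fun i y _ hyK => by
      by_cases hyt : y ∈ φ.target
      · rw [indicator_of_mem hyt]; simp only [hY, hrep0 y hyt hyK, zero_mul]
      · exact indicator_of_notMem hyt _)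
  have hmeasT : MeasurableSet (range (𝓡∂ (m + 1))) := (𝓡∂ (m + 1)).isClosed_range.measurableSet
  have hgam0 : ∀ x, x ∉ φ.source → gam g f v x = 0 := by
    intro x hx
    have hev : f =ᶠ[𝓝 x] fun _ => 0 := notMem_tsupport_iff_eventuallyEq.1 fun h => hx (hfp h)
    have hd : dR (m := m) f x = 0 := by
      rw [dR, hev.mfderiv_eq]
      exact mfderiv_const
    have hd' : (fun j => dR (m := m) f x (stdVec j)) = 0 := by rw [hd]; rfl
    rw [gam, hd', coPair, zero_dotProduct]
  have hlhs : ∫ x, (f x * lap g v x + gam g f v x) ∂(volumeMeasure g) =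
      ∫ y in range (𝓡∂ (m + 1)), ∑ i, pd (φ.target.indicator (Y i)) y i := by
    have hcont : Continuous fun x => f x * lap g v x + gam g f v x := by
      have h1 : CReg m 0 (lap g v) :=
        (JReg.lap zero_lt_one g (hv.jreg 1)).slice (t := 0) (by simp)
      have h2 : CReg m 0 (gam g f v) := CReg.gam g (n := 1) (by simp) (by simp) hf hv1
      exact (hf.continuous.mul h1.continuous).add h2.continuous
    rw [integral_volumeMeasure_chart g p hcont.aestronglyMeasurable fun x hx => by
      rw [hf0 x hx, hgam0 x hx]; ring]
    rw [setIntegral_eq_of_subset_of_forall_sdiff_eq_zero hmeasT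
      (extChartAt_target_subset_range p) fun y hy => ?_]
    · refine setIntegral_congr_fun (measurableSet_target p) fun y hy => ?_
      have hyr := extChartAt_target_subset_range p hy
      have h1 : ∀ i, pd (φ.target.indicator (Y i)) y i = pd (Y i) y i := fun i =>
        congrFun (pd_congr (fun z hz => indicator_of_mem hz _) hy) i
      have hnt : φ.target ∈ 𝓝[range (𝓡∂ (m + 1))] y := extChartAt_target_mem_nhdsWithin_of_mem hy
      rw [Finset.sum_congr rfl fun i _ => h1 i, sum_pd_mul_flux (chartGram g p) hyr (chartGram_det_pos g hy)
        (((hf p y hy).differentiableWithinAt one_ne_zero).mono_of_mem_nhdsWithin hnt)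
        fun i => ((contDiffOn_flux g (k := 1) (n := 2) (by norm_num) (by simp) (hv p) i y
          hy).differentiableWithinAt one_ne_zero).mono_of_mem_nhdsWithin hnt]
      simp only [rep, volDens]
      rw [lap_chart g hv hy, gam_chart g hy (hf.mdifferentiableAt le_rfl _)
        (hv1.mdifferentiableAt le_rfl _)]
    · refine Finset.sum_eq_zero fun i _ => pd_eq_zero_of_eventually ?_ hy.1 i
      filter_upwards [mem_nhdsWithin_of_mem_nhds
        (hKc.isClosed.isOpen_compl.mem_nhds fun h => hy.2 (hKt h))] with z hz
      by_cases hzt : z ∈ φ.target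
      · rw [indicator_of_mem hzt]; simp [hY, hrep0 z hzt hz]
      · exact indicator_of_notMem hzt _
  rw [hlhs, key, integral_surfaceMeasure_chart g p (f := fun x => f x * normalDerivReal g v x) (aestronglyMeasurable_surface g
    (hf.continuous.continuousOn.mul (hv1.continuousOn_normalDerivReal g)))
    (fun x hx => by rw [hf0 x hx, zero_mul]), ← integral_indicator (measurableSet_hyperTarget p),
    ← integral_neg]
  refine integral_congr_ae (Filter.Eventually.of_forall fun z => ?_)
  by_cases hz : z ∈ hyperTarget (m := m) p
  · simp only [indicator_of_mem hz, indicator_of_mem (show hyperplanePt z ∈ φ.target from hz), hY]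
    rw [flux_zero_eq g hz]
    simp only [rep]
    rw [normalDerivReal_chart g hz (hyperplanePt_zero z) (hv1.mdifferentiableAt le_rfl _)]
    ring_nf
  · simp only [indicator_of_notMem hz,
      indicator_of_notMem (show hyperplanePt z ∉ φ.target from hz), neg_zero]

theorem gam_add_left (g : MetricBdry m M) {f k v : M → ℝ} {x : M}
    (hf : MDifferentiableAt (𝓡∂ (m + 1)) 𝓘(ℝ, ℝ) f x)
    (hk : MDifferentiableAt (𝓡∂ (m + 1)) 𝓘(ℝ, ℝ) k x) :
    gam g (fun x => f x + k x) v x = gam g f v x + gam g k v x := by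
  have h1 : dR (m := m) (fun x => f x + k x) x = dR f x + dR k x := mfderiv_add hf hk
  have h2 : (fun j => dR (m := m) (fun x => f x + k x) x (stdVec j)) =
      (fun j => dR (m := m) f x (stdVec j)) + fun j => dR (m := m) k x (stdVec j) := by
    rw [h1]; rfl
  rw [gam, h2, coPair, add_dotProduct]
  rfl

/-- The terms of Green's formula. -/
theorem integrable_green (g : MetricBdry m M) {f v : M → ℝ} (hf : CReg m 1 f)
    (hv : CReg m 2 v) : Continuous (fun x => f x * lap g v x + gam g f v x) ∧
      ContinuousOn (fun x => f x * normalDerivReal g v x) ((𝓡∂ (m + 1)).boundary M) := by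
  have hv1 : CReg m 1 v := hv.of_le (by norm_num)
  have h1 : CReg m 0 (lap g v) := (JReg.lap zero_lt_one g (hv.jreg 1)).slice (t := 0) (by simp)
  have h2 : CReg m 0 (gam g f v) := CReg.gam g (n := 1) (by simp) (by simp) hf hv1
  exact ⟨(hf.continuous.mul h1.continuous).add h2.continuous,
    hf.continuous.continuousOn.mul (hv1.continuousOn_normalDerivReal g)⟩

/-- Green's formula. -/
theorem green [T2Space M] (g : MetricBdry m M) {f v : M → ℝ} (hf : CReg m 1 f) (hv : CReg m 2 v) :
    ∫ x, (f x * lap g v x + gam g f v x) ∂(volumeMeasure g) =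
      ∫ x, f x * normalDerivReal g v x ∂(surfaceMeasure g) := by
  obtain ⟨ρ, hρ⟩ := SmoothPartitionOfUnity.exists_isSubordinate_chartAt_source (𝓡∂ (m + 1)) M
  have hfin : {i | (Function.support (ρ i)).Nonempty}.Finite :=
    ρ.locallyFinite.finite_nonempty_of_compact
  have hreg : ∀ i, CReg m 1 fun x => ρ i x * f x := fun i =>
    CReg.mul (creg_of_contMDiff ((ρ i).contMDiff.of_le (by simp))) hf
  -- Regularity of the partial sums is carried through the induction because additivity of the
  -- differential and of the integrals requires it.
  have hsum : ∀ S : Finset M, CReg m 1 (fun x => ∑ i ∈ S, ρ i x * f x) ∧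
      ∫ x, ((∑ i ∈ S, ρ i x * f x) * lap g v x + gam g (fun x => ∑ i ∈ S, ρ i x * f x) v x)
        ∂(volumeMeasure g) =
      ∫ x, (∑ i ∈ S, ρ i x * f x) * normalDerivReal g v x ∂(surfaceMeasure g) := by
    classical
    intro S
    induction S using Finset.induction_on with
    | empty =>
      refine ⟨by simpa using creg_const 0, ?_⟩
      have h0 : ∀ x, gam g (fun _ => (0 : ℝ)) v x = 0 := by
        intro x
        have hd : dR (m := m) (fun _ : M => (0 : ℝ)) x = 0 := mfderiv_const
        have hd' : (fun j => dR (m := m) (fun _ : M => (0 : ℝ)) x (stdVec j)) = 0 := by rw [hd]; rfl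
        rw [gam, hd', coPair, zero_dotProduct]
      simp [h0]
    | insert i S hi ih =>
      simp only [Finset.sum_insert hi]
      refine ⟨(hreg i).add ih.1, ?_⟩
      have hsupp : tsupport (fun x => ρ i x * f x) ⊆ (extChartAt (𝓡∂ (m + 1)) i).source := by
        rw [extChartAt_source]
        exact (tsupport_mul_subset_left (f := ρ i) (g := f)).trans (hρ i)
      have h1 := green_of_tsupport_subset g (hreg i) hv hsupp
      have hi1 := integrable_green g (hreg i) hv
      have hi2 := integrable_green g ih.1 hv
      simp only [gam_add_left g ((hreg i).mdifferentiableAt le_rfl _)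
        (ih.1.mdifferentiableAt le_rfl _), add_mul]
      rw [integral_add (integrable_surface g hi1.2) (integrable_surface g hi2.2), ← h1, ← ih.2,
        ← integral_add (integrable_volume g hi1.1) (integrable_volume g hi2.1)]
      refine integral_congr_ae (Filter.Eventually.of_forall fun x => ?_)
      simp only
      ring
  have hall : (fun x => ∑ i ∈ hfin.toFinset, ρ i x * f x) = f := by
    funext x
    have h1 : ∑ᶠ i, ρ i x = 1 := ρ.sum_eq_one (mem_univ x)
    rw [finsum_eq_sum_of_support_subset (s := hfin.toFinset) _ fun i hi => by
      simp only [Finite.coe_toFinset, mem_ofPred_eq]; exact ⟨x, hi⟩] at h1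
    rw [← Finset.sum_mul, h1, one_mul]
  have := (hsum hfin.toFinset).2
  rw [hall] at this
  simpa only [← Finset.sum_mul, congrFun hall] using this

end green

/-! ### Cauchy-Schwarz, Leibniz rules and gradients on the boundary -/

section coPairAlgebra

variable {k : ℕ} (G : Matrix (Fin k) (Fin k) ℝ)

theorem coPair_add_left (a b c : Fin k → ℝ) : coPair G (a + b) c = coPair G a c + coPair G b c :=
  add_dotProduct _ _ _

theorem coPair_smul_left (r : ℝ) (a c : Fin k → ℝ) : coPair G (r • a) c = r * coPair G a c :=
  smul_dotProduct _ _ _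

theorem coPair_add_right (a b c : Fin k → ℝ) : coPair G c (a + b) = coPair G c a + coPair G c b := by
  rw [coPair, Matrix.mulVec_add, dotProduct_add]; rfl

theorem coPair_smul_right (r : ℝ) (a c : Fin k → ℝ) : coPair G c (r • a) = r * coPair G c a := by
  rw [coPair, Matrix.mulVec_smul, dotProduct_smul]; rfl

variable {G}

theorem transpose_of_posDef (hG : G.PosDef) : G.transpose = G := by
  have h := hG.isHermitian.eq
  rwa [Matrix.conjTranspose_eq_transpose_of_trivial] at h

theorem coPair_self_nonneg (hG : G.PosDef) (a : Fin k → ℝ) : 0 ≤ coPair G a a := by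
  simpa [coPair] using hG.inv.posSemidef.dotProduct_mulVec_nonneg a

/-- The quadratic polynomial r ↦ |a + r b|² is nonnegative, so its discriminant is nonpositive. -/
theorem coPair_sq_le (hG : G.PosDef) (a b : Fin k → ℝ) :
    coPair G a b ^ 2 ≤ coPair G a a * coPair G b b := by
  have hs := transpose_of_posDef hG
  have h : ∀ r : ℝ, 0 ≤ coPair G b b * (r * r) + 2 * coPair G a b * r + coPair G a a := by
    intro r
    have h1 := coPair_self_nonneg hG (a + r • b)
    rw [coPair_add_left, coPair_add_right, coPair_add_right, coPair_smul_left, coPair_smul_left,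
      coPair_smul_right, coPair_smul_right, coPair_comm hs b a] at h1
    nlinarith [h1]
  have := discrim_le_zero h
  rw [discrim] at this
  nlinarith [this]

end coPairAlgebra

section pointwiseCalculus

variable {m : ℕ} {M : Type*} [TopologicalSpace M] [ChartedSpace (EuclideanHalfSpace (m + 1)) M]
  {f k l : M → ℝ} {x : M}

theorem dR_mul (hf : MDifferentiableAt (𝓡∂ (m + 1)) 𝓘(ℝ, ℝ) f x)
    (hk : MDifferentiableAt (𝓡∂ (m + 1)) 𝓘(ℝ, ℝ) k x) :
    dR (m := m) (fun x => f x * k x) x = f x • dR (m := m) k x + k x • dR (m := m) f x :=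
  (hf.hasMFDerivAt.mul hk.hasMFDerivAt).mfderiv

theorem dR_comp {χ : ℝ → ℝ} {χ' : ℝ} (hχ : HasDerivAt χ χ' (f x))
    (hf : MDifferentiableAt (𝓡∂ (m + 1)) 𝓘(ℝ, ℝ) f x) :
    dR (m := m) (fun x => χ (f x)) x = χ' • dR (m := m) f x := by
  have h1 := (hχ.hasFDerivAt.hasMFDerivAt.comp x hf.hasMFDerivAt).mfderiv
  refine Eq.trans h1 ?_
  ext v
  change (ContinuousLinearMap.toSpanSingleton ℝ χ') (dR (m := m) f x v) = χ' * dR (m := m) f x v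
  simp [mul_comm]

variable [IsManifold (𝓡∂ (m + 1)) ∞ M] (g : MetricBdry m M)

theorem gam_comm (f k : M → ℝ) (x : M) : gam g f k x = gam g k f x :=
  coPair_comm (transpose_of_posDef (gram_posDef g x)) _ _

theorem gam_self_nonneg (f : M → ℝ) (x : M) : 0 ≤ gam g f f x :=
  coPair_self_nonneg (gram_posDef g x) _

theorem gam_mul_left (hf : MDifferentiableAt (𝓡∂ (m + 1)) 𝓘(ℝ, ℝ) f x)
    (hk : MDifferentiableAt (𝓡∂ (m + 1)) 𝓘(ℝ, ℝ) k x) :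
    gam g (fun x => f x * k x) l x = f x * gam g k l x + k x * gam g f l x := by
  have h : (fun j => dR (m := m) (fun x => f x * k x) x (stdVec j)) =
      f x • (fun j => dR (m := m) k x (stdVec j)) + k x • fun j => dR (m := m) f x (stdVec j) := by
    rw [dR_mul hf hk]; rfl
  rw [gam, h, coPair_add_left, coPair_smul_left, coPair_smul_left]
  rfl

theorem gam_comp_left {χ : ℝ → ℝ} {χ' : ℝ} (hχ : HasDerivAt χ χ' (f x))
    (hf : MDifferentiableAt (𝓡∂ (m + 1)) 𝓘(ℝ, ℝ) f x) :
    gam g (fun x => χ (f x)) l x = χ' * gam g f l x := by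
  have h : (fun j => dR (m := m) (fun x => χ (f x)) x (stdVec j)) =
      χ' • fun j => dR (m := m) f x (stdVec j) := by
    rw [dR_comp hχ hf]; rfl
  rw [gam, h, coPair_smul_left]
  rfl

theorem normalDerivReal_mul_of_zero (hf : MDifferentiableAt (𝓡∂ (m + 1)) 𝓘(ℝ, ℝ) f x)
    (hk : MDifferentiableAt (𝓡∂ (m + 1)) 𝓘(ℝ, ℝ) k x) (h0 : k x = 0) :
    normalDerivReal g (fun x => f x * k x) x = f x * normalDerivReal g k x := by
  rw [normalDerivReal, dR_mul hf hk, h0, zero_smul, add_zero]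
  rfl

section chartRules

variable {p : M} {F K : Euc (m + 1) → ℝ} {G : Euc (m + 1) → Matrix (Fin (m + 1)) (Fin (m + 1)) ℝ}
  {y : Euc (m + 1)}

theorem pd_mul (hy : y ∈ range (𝓡∂ (m + 1)))
    (hF : DifferentiableWithinAt ℝ F (range (𝓡∂ (m + 1))) y)
    (hK : DifferentiableWithinAt ℝ K (range (𝓡∂ (m + 1))) y) :
    pd (fun y => F y * K y) y = F y • pd K y + K y • pd F y := by
  funext i
  have h := fderivWithin_mul (uniqueDiffOn_halfSpace y hy) hF hK
  exact congrArg (fun L : Euc (m + 1) →L[ℝ] ℝ => L (stdVec i)) h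

theorem pd_comp {χ : ℝ → ℝ} {χ' : ℝ} (hy : y ∈ range (𝓡∂ (m + 1))) (hχ : HasDerivAt χ χ' (F y))
    (hF : DifferentiableWithinAt ℝ F (range (𝓡∂ (m + 1))) y) :
    pd (fun y => χ (F y)) y = χ' • pd F y := by
  funext i
  have h := (hχ.comp_hasFDerivWithinAt y hF.hasFDerivWithinAt).fderivWithin
    (uniqueDiffOn_halfSpace y hy)
  exact congrArg (fun L : Euc (m + 1) →L[ℝ] ℝ => L (stdVec i)) h

theorem locLap_eq_of_sum {F : Euc (m + 1) → ℝ} {r : ℝ} (hG : 0 < (G y).det)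
    (h : ∑ j, pd (flux G F j) y j = √(G y).det * r) : locLap G F y = r := by
  rw [locLap, h]
  have := (Real.sqrt_pos.2 hG).ne'
  field_simp

theorem differentiableWithinAt_range {n : WithTop ℕ∞} (hn : n ≠ 0)
    (hF : ContDiffOn ℝ n F (extChartAt (𝓡∂ (m + 1)) p).target)
    (hy : y ∈ (extChartAt (𝓡∂ (m + 1)) p).target) :
    DifferentiableWithinAt ℝ F (range (𝓡∂ (m + 1))) y :=
  ((hF y hy).differentiableWithinAt hn).mono_of_mem_nhdsWithin
    (extChartAt_target_mem_nhdsWithin_of_mem hy)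

theorem pd_add (hy : y ∈ range (𝓡∂ (m + 1)))
    (hF : DifferentiableWithinAt ℝ F (range (𝓡∂ (m + 1))) y)
    (hK : DifferentiableWithinAt ℝ K (range (𝓡∂ (m + 1))) y) :
    pd (fun y => F y + K y) y = pd F y + pd K y := by
  funext i
  have h := fderivWithin_fun_add (uniqueDiffOn_halfSpace y hy) hF hK
  exact congrArg (fun L : Euc (m + 1) →L[ℝ] ℝ => L (stdVec i)) h

/-- The flux of FK is F times the flux of K plus K times the flux of F; each summand is handled by
`sum_pd_mul_flux` and contributes one copy of ⟨dF, dK⟩. -/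
theorem locLap_mul (hF : ContDiffOn ℝ 2 F (extChartAt (𝓡∂ (m + 1)) p).target)
    (hK : ContDiffOn ℝ 2 K (extChartAt (𝓡∂ (m + 1)) p).target)
    (hy : y ∈ (extChartAt (𝓡∂ (m + 1)) p).target) :
    locLap (chartGram g p) (fun y => F y * K y) y = F y * locLap (chartGram g p) K y +
      K y * locLap (chartGram g p) F y + 2 * coPair (chartGram g p y) (pd F y) (pd K y) := by
  have hyr := extChartAt_target_subset_range p hy
  have hG := chartGram_det_pos g hy
  have hfl : ∀ {L : Euc (m + 1) → ℝ}, ContDiffOn ℝ 2 L (extChartAt (𝓡∂ (m + 1)) p).target →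
      ∀ i, DifferentiableWithinAt ℝ (flux (chartGram g p) L i) (range (𝓡∂ (m + 1))) y :=
    fun hL i => differentiableWithinAt_range one_ne_zero
      (contDiffOn_flux g (k := 1) (n := 2) (by norm_num) (by simp) hL i) hy
  have hFd := fun z hz => differentiableWithinAt_range (y := z) two_ne_zero hF hz
  have hKd := fun z hz => differentiableWithinAt_range (y := z) two_ne_zero hK hz
  refine locLap_eq_of_sum hG ?_
  have h1 : ∀ j, pd (flux (chartGram g p) (fun y => F y * K y) j) y j =
      pd (fun y => F y * flux (chartGram g p) K j y) y j +
        pd (fun y => K y * flux (chartGram g p) F j y) y j := by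
    intro j
    rw [pd_congr (K := fun y => F y * flux (chartGram g p) K j y + K y * flux (chartGram g p) F j y)
      (fun z hz => ?_) hy, pd_add (F := fun y => F y * flux (chartGram g p) K j y)
      (K := fun y => K y * flux (chartGram g p) F j y) hyr ((hFd y hy).mul (hfl hK j))
      ((hKd y hy).mul (hfl hF j))]
    · rfl
    · simp only [flux]
      rw [pd_mul (extChartAt_target_subset_range p hz) (hFd z hz) (hKd z hz), Matrix.mulVec_add,
        Matrix.mulVec_smul, Matrix.mulVec_smul]
      simp only [Pi.add_apply, Pi.smul_apply, smul_eq_mul]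
      ring
  rw [Finset.sum_congr rfl fun j _ => h1 j, Finset.sum_add_distrib,
    sum_pd_mul_flux _ hyr hG (hFd y hy) (hfl hK), sum_pd_mul_flux _ hyr hG (hKd y hy) (hfl hF),
    coPair_comm (transpose_of_posDef (chartGram_posDef g hy)) (pd K y)]
  ring

theorem locLap_comp {χ χ' χ'' : ℝ → ℝ} (hχ : ∀ r, HasDerivAt χ (χ' r) r)
    (hχ' : ∀ r, HasDerivAt χ' (χ'' r) r)
    (hF : ContDiffOn ℝ 2 F (extChartAt (𝓡∂ (m + 1)) p).target)
    (hy : y ∈ (extChartAt (𝓡∂ (m + 1)) p).target) :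
    locLap (chartGram g p) (fun y => χ (F y)) y = χ' (F y) * locLap (chartGram g p) F y +
      χ'' (F y) * coPair (chartGram g p y) (pd F y) (pd F y) := by
  have hyr := extChartAt_target_subset_range p hy
  have hG := chartGram_det_pos g hy
  have hFd := fun z hz => differentiableWithinAt_range (y := z) two_ne_zero hF hz
  refine locLap_eq_of_sum hG ?_
  have h1 : ∀ j, pd (flux (chartGram g p) (fun y => χ (F y)) j) y j =
      pd (fun y => χ' (F y) * flux (chartGram g p) F j y) y j := by
    intro j
    rw [pd_congr (K := fun y => χ' (F y) * flux (chartGram g p) F j y) (fun z hz => ?_) hy]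
    simp only [flux]
    rw [pd_comp (extChartAt_target_subset_range p hz) (hχ _) (hFd z hz), Matrix.mulVec_smul]
    simp only [Pi.smul_apply, smul_eq_mul]
    ring
  rw [Finset.sum_congr rfl fun j _ => h1 j, sum_pd_mul_flux (F := fun y => χ' (F y)) _ hyr hG
    ((hχ' (F y)).comp_hasFDerivWithinAt y (hFd y hy).hasFDerivWithinAt).differentiableWithinAt
    fun i => differentiableWithinAt_range one_ne_zero
      (contDiffOn_flux g (k := 1) (n := 2) (by norm_num) (by simp) hF i) hy,
    pd_comp hyr (hχ' _) (hFd y hy), coPair_smul_left]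

end chartRules

theorem gam_self_chart (hf : MDifferentiableAt (𝓡∂ (m + 1)) 𝓘(ℝ, ℝ) f x)
    (hk : MDifferentiableAt (𝓡∂ (m + 1)) 𝓘(ℝ, ℝ) k x) :
    gam g f k x = coPair (chartGram g x (extChartAt (𝓡∂ (m + 1)) x x))
      (pd (rep x f) (extChartAt (𝓡∂ (m + 1)) x x)) (pd (rep x k) (extChartAt (𝓡∂ (m + 1)) x x)) := by
  have h := gam_chart g (f := f) (k := k) (mem_extChartAt_target (I := 𝓡∂ (m + 1)) x)
    (by rwa [extChartAt_to_inv]) (by rwa [extChartAt_to_inv])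
  rwa [extChartAt_to_inv] at h

theorem rep_self (f : M → ℝ) (x : M) : rep x f (extChartAt (𝓡∂ (m + 1)) x x) = f x := by
  rw [rep, extChartAt_to_inv]

theorem lap_mul (hf : CReg m 2 f) (hk : CReg m 2 k) (x : M) :
    lap g (fun x => f x * k x) x = f x * lap g k x + k x * lap g f x + 2 * gam g f k x := by
  have h := locLap_mul g (hf x) (hk x) (mem_extChartAt_target (I := 𝓡∂ (m + 1)) x)
  rw [rep_self, rep_self, ← gam_self_chart g (hf.mdifferentiableAt (by norm_num) x)
    (hk.mdifferentiableAt (by norm_num) x)] at h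
  exact h

theorem lap_comp {χ χ' χ'' : ℝ → ℝ} (hχ : ∀ r, HasDerivAt χ (χ' r) r)
    (hχ' : ∀ r, HasDerivAt χ' (χ'' r) r) (hf : CReg m 2 f) (x : M) :
    lap g (fun x => χ (f x)) x = χ' (f x) * lap g f x + χ'' (f x) * gam g f f x := by
  have h := locLap_comp g hχ hχ' (hf x) (mem_extChartAt_target (I := 𝓡∂ (m + 1)) x)
  rw [rep_self, ← gam_self_chart g (hf.mdifferentiableAt (by norm_num) x)
    (hf.mdifferentiableAt (by norm_num) x)] at h
  exact h

/-- If `f` vanishes on the boundary, its differential there is conormal. -/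
theorem dR_stdVec_succ_of_zero (hf : MDifferentiableAt (𝓡∂ (m + 1)) 𝓘(ℝ, ℝ) f x)
    (hx : x ∈ (𝓡∂ (m + 1)).boundary M) (h0 : ∀ z ∈ (𝓡∂ (m + 1)).boundary M, f z = 0) (j : Fin m) :
    dR (m := m) f x (stdVec j.succ) = 0 := by
  set y := extChartAt (𝓡∂ (m + 1)) x x with hy
  have hyt : y ∈ (extChartAt (𝓡∂ (m + 1)) x).target := mem_extChartAt_target x
  have hy0 : y 0 = 0 := (mem_boundary_iff (mem_extChartAt_source x)).1 hx
  have hrep : (fun j => dR (m := m) f x (stdVec j)) = pd (rep x f) y := by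
    have h := pd_rep (f := f) hyt (by rwa [extChartAt_to_inv])
    rw [frm_self, Matrix.transpose_one, Matrix.one_mulVec, extChartAt_to_inv] at h
    exact h.symm
  rw [congrFun hrep j.succ]
  set c : ℝ → Euc (m + 1) := fun s => y + s • stdVec j.succ with hc
  have h1 : HasDerivAt c (stdVec j.succ) 0 := by
    have h2 : HasDerivAt (fun s : ℝ => y + s • (stdVec j.succ : Euc (m + 1))) (stdVec j.succ) 0 := by
      simpa using (((hasDerivAt_id (0 : ℝ)).smul_const (stdVec j.succ : Euc (m + 1))).const_add y)
    exact h2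
  have hc0 : c 0 = y := by simp [hc]
  have hcz : ∀ s, c s 0 = 0 := fun s => by
    simp [hc, hy0, stdVec_apply]
  have hmaps : MapsTo c univ (range (𝓡∂ (m + 1))) := fun s _ => by
    rw [mem_range_iff, hcz]
  have hd : DifferentiableWithinAt ℝ (rep x f) (range (𝓡∂ (m + 1))) (c 0) := by
    rw [hc0]
    exact hf.differentiableWithinAt_writtenInExtChartAt
  have h4 := hd.hasFDerivWithinAt.comp_hasDerivWithinAt (0 : ℝ) h1.hasDerivWithinAt hmaps
  rw [hasDerivWithinAt_univ] at h4
  have h6 : ∀ᶠ s in 𝓝 (0 : ℝ), rep x f (c s) = 0 := by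
    have h7 : Filter.Tendsto c (𝓝 0) (𝓝[range (𝓡∂ (m + 1))] y) := by
      rw [tendsto_nhdsWithin_iff]
      exact ⟨hc0 ▸ h1.continuousAt, Filter.Eventually.of_forall fun s => hmaps (mem_univ s)⟩
    filter_upwards [h7 (extChartAt_target_mem_nhdsWithin_of_mem hyt)] with s hs
    exact h0 _ ((symm_mem_boundary_iff hs).2 (hcz s))
  have h8 : HasDerivAt (fun _ : ℝ => (0 : ℝ)) _ 0 :=
    h4.congr_of_eventuallyEq (by filter_upwards [h6] with s hs using hs.symm)
  have h9 := h8.unique (hasDerivAt_const _ _)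
  rw [hc0] at h9
  exact h9

/-- On the boundary df is a multiple of dy₀. Pairing dy₀ with dk gives g^{0j}∂_j k, which is
-√g^{00} times the normal derivative, and df contributes the same factor. -/
theorem gam_boundary (hf : MDifferentiableAt (𝓡∂ (m + 1)) 𝓘(ℝ, ℝ) f x)
    (hx : x ∈ (𝓡∂ (m + 1)).boundary M) (h0 : ∀ z ∈ (𝓡∂ (m + 1)).boundary M, f z = 0)
    (k : M → ℝ) : gam g f k x = normalDerivReal g f x * normalDerivReal g k x := by
  have hd : (fun j => dR (m := m) f x (stdVec j)) =
      dR (m := m) f x (stdVec 0) • (Pi.single 0 1 : Fin (m + 1) → ℝ) := by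
    funext j
    refine Fin.cases ?_ (fun j => ?_) j
    · simp
    · rw [dR_stdVec_succ_of_zero hf hx h0]; simp
  have hpos := inv_zero_zero_pos (gram_posDef g x)
  rw [gam, normalDerivReal_eq, normalDerivReal_eq, hd, coPair_smul_left, Matrix.mulVec_smul, coPair,
    single_dotProduct]
  simp only [Pi.smul_apply, smul_eq_mul, Matrix.mulVec_single_one, Matrix.col_apply]
  have h2 := Real.sq_sqrt hpos.le
  have h3 := (Real.sqrt_pos.2 hpos).ne'
  field_simp
  rw [h2]

end pointwiseCalculus

theorem integrable_comb {X : Type*} [MeasurableSpace X] {μ : Measure X} {f k l : X → ℝ}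
    (hf : Integrable f μ) (hk : Integrable k μ) (hl : Integrable l μ) (a b c : ℝ) :
    Integrable (fun x => a * f x + b * k x + c * l x) μ :=
  ((hf.const_mul a).add (hk.const_mul b)).add (hl.const_mul c)

theorem integral_comb {X : Type*} [MeasurableSpace X] {μ : Measure X} {f k l : X → ℝ}
    (hf : Integrable f μ) (hk : Integrable k μ) (hl : Integrable l μ) (a b c : ℝ) :
    ∫ x, (a * f x + b * k x + c * l x) ∂μ = a * ∫ x, f x ∂μ + b * ∫ x, k x ∂μ + c * ∫ x, l x ∂μ := by
  have h1 : Integrable (fun x => a * f x + b * k x) μ := (hf.const_mul a).add (hk.const_mul b)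
  rw [integral_add h1 (hl.const_mul c), integral_add (hf.const_mul a) (hk.const_mul b)]
  simp only [integral_const_mul]

/-! ### The commutator in the space variables -/

section spatial

variable {m : ℕ} {M : Type*} [TopologicalSpace M] [ChartedSpace (EuclideanHalfSpace (m + 1)) M]
  [IsManifold (𝓡∂ (m + 1)) ∞ M]
  {N : Type*} [TopologicalSpace N] [ChartedSpace (Euc m) N] [IsManifold (𝓡 m) ∞ N]
  {g : MetricBdry m M} {h : MetricNoBdry m N} {x₁ : M → ℝ} {x' : M → N} {w : M → ℝ}

theorem IsProductEmbedding.creg_fst (hx : IsProductEmbedding g h x₁ x') : CReg m 2 x₁ :=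
  (creg_of_contMDiff hx.smooth_fst).of_le (by norm_cast)

variable [CompactSpace M] [MeasurableSpace M] [BorelSpace M] [T2Space M]

theorem green_of_zero (g : MetricBdry m M) {f v : M → ℝ} (hf : CReg m 1 f) (hv : CReg m 2 v)
    (h0 : ∀ z ∈ (𝓡∂ (m + 1)).boundary M, f z = 0) :
    ∫ x, (f x * lap g v x + gam g f v x) ∂(volumeMeasure g) = 0 := by
  rw [green g hf hv]
  refine integral_eq_zero_of_ae ?_
  filter_upwards [ae_boundary g] with z hz
  simp [h0 z hz]

theorem integral_green_comb (g : MetricBdry m M) {f₁ f₂ f₃ v₁ v₂ v₃ : M → ℝ}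
    (hf₁ : CReg m 1 f₁) (hf₂ : CReg m 1 f₂) (hf₃ : CReg m 1 f₃)
    (hv₁ : CReg m 2 v₁) (hv₂ : CReg m 2 v₂) (hv₃ : CReg m 2 v₃) (a b c : ℝ) :
    ∫ x, (a * (f₁ x * lap g v₁ x + gam g f₁ v₁ x) + b * (f₂ x * lap g v₂ x + gam g f₂ v₂ x) +
        c * (f₃ x * lap g v₃ x + gam g f₃ v₃ x)) ∂(volumeMeasure g) =
      ∫ x, (a * (f₁ x * normalDerivReal g v₁ x) + b * (f₂ x * normalDerivReal g v₂ x) +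
        c * (f₃ x * normalDerivReal g v₃ x)) ∂(surfaceMeasure g) := by
  have i1 := integrable_green g hf₁ hv₁
  have i2 := integrable_green g hf₂ hv₂
  have i3 := integrable_green g hf₃ hv₃
  rw [integral_comb (integrable_volume g i1.1) (integrable_volume g i2.1) (integrable_volume g i3.1),
    integral_comb (integrable_surface g i1.2) (integrable_surface g i2.2)
      (integrable_surface g i3.2), green g hf₁ hv₁, green g hf₂ hv₂, green g hf₃ hv₃]

theorem creg_affine (hx : IsProductEmbedding g h x₁ x') (lam s : ℝ) :
    CReg m 2 fun x => lam - s * x₁ x :=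
  hx.creg_fst.comp (χ := fun r => lam - s * r) (by fun_prop)

theorem gam_affine (hx : IsProductEmbedding g h x₁ x') (lam s : ℝ) (k : M → ℝ) (x : M) :
    gam g (fun x => lam - s * x₁ x) k x = -s * gam g x₁ k x :=
  gam_comp_left g (χ := fun r => lam - s * r)
    (by simpa using ((hasDerivAt_id (x₁ x)).const_mul s).const_sub lam)
    (hx.creg_fst.mdifferentiableAt (by norm_num) x)

/-- The commutator identity in the space variables. -/
theorem integral_commutator_space (hx : IsProductEmbedding g h x₁ x') (hw : CReg m 2 w)
    (h0 : ∀ z ∈ (𝓡∂ (m + 1)).boundary M, w z = 0) (lam s a : ℝ) :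
    ∫ x, (2 * (-lap g w x + (a - (lam - s * x₁ x) ^ 2) * w x) *
        (-2 * (lam - s * x₁ x) * gam g x₁ w x + s * w x) -
        (4 * s * gam g x₁ w x ^ 2 + 4 * s * (lam - s * x₁ x) ^ 2 * w x ^ 2)) ∂(volumeMeasure g) =
      ∫ x, 2 * ((lam - s * x₁ x) * normalDerivReal g w x ^ 2 * normalDerivReal g x₁ x)
        ∂(surfaceMeasure g) := by
  have hx2 := hx.creg_fst
  have hF := creg_affine hx lam s
  have hF1 : CReg m 1 fun x => lam - s * x₁ x := hF.of_le (by norm_num)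
  have hw1 : CReg m 1 w := hw.of_le (by norm_num)
  have hX : CReg m 1 (gam g x₁ w) := CReg.gam g (by norm_num) (by norm_cast) hx2 hw
  have hE : CReg m 1 (gam g w w) := CReg.gam g (by norm_num) (by norm_cast) hw hw
  -- With F = lam - s x₁ and ψ = F(a - F²), the product 2(a - F²)w · (-2F X) is -2ψ times the
  -- derivative of w² along ∇x₁, which can be integrated by parts.
  have hψ : CReg m 1 fun x => (lam - s * x₁ x) * (a - (lam - s * x₁ x) ^ 2) :=
    (hx2.comp (χ := fun r => (lam - s * r) * (a - (lam - s * r) ^ 2)) (by fun_prop)).of_le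
      (by norm_num)
  have hf1 := hF1.mul hX
  have hf2 := hF1.mul hE
  have hf4 := hψ.mul (hw1.mul hw1)
  -- Three instances of Green's formula: F X against Δw, F|∇w|² against Δx₁, and w against Δw. The
  -- factors 4 and -2 make 4F⟨∇X, ∇w⟩ and -2F⟨∇x₁, ∇|∇w|²⟩ cancel by the Killing identity. The
  -- factor -2s cancels the |∇w|² that appears when F is differentiated, and leaves -4sX².
  have key := integral_green_comb g hf1 hf2 hw1 hw hx2 hw 4 (-2) (-(2 * s))
  have key4 := green_of_zero g hf4 hx2 fun z hz => by simp [h0 z hz]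
  have i4 := (integrable_volume g (integrable_green g hf4 hx2).1).const_mul 2
  have ic := integrable_comb (integrable_volume g (integrable_green g hf1 hw).1)
    (integrable_volume g (integrable_green g hf2 hx2).1)
    (integrable_volume g (integrable_green g hw1 hw).1) 4 (-2) (-(2 * s))
  have hlhs : ∫ x, (2 * (-lap g w x + (a - (lam - s * x₁ x) ^ 2) * w x) *
        (-2 * (lam - s * x₁ x) * gam g x₁ w x + s * w x) -
        (4 * s * gam g x₁ w x ^ 2 + 4 * s * (lam - s * x₁ x) ^ 2 * w x ^ 2)) ∂(volumeMeasure g) =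
      ∫ x, ((4 * ((lam - s * x₁ x) * gam g x₁ w x * lap g w x +
          gam g (fun x => (lam - s * x₁ x) * gam g x₁ w x) w x) +
        -2 * ((lam - s * x₁ x) * gam g w w x * lap g x₁ x +
          gam g (fun x => (lam - s * x₁ x) * gam g w w x) x₁ x) +
        -(2 * s) * (w x * lap g w x + gam g w w x)) -
        2 * ((lam - s * x₁ x) * (a - (lam - s * x₁ x) ^ 2) * (w x * w x) * lap g x₁ x +
          gam g (fun x => (lam - s * x₁ x) * (a - (lam - s * x₁ x) ^ 2) * (w x * w x)) x₁ x))
        ∂(volumeMeasure g) := by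
    refine integral_congr_ae ?_
    filter_upwards [ae_interior g] with x hxi
    have d1 := hF1.mdifferentiableAt le_rfl x
    have dw := hw1.mdifferentiableAt le_rfl x
    have e1 := gam_mul_left g (l := w) d1 (hX.mdifferentiableAt le_rfl x)
    have e2 := gam_mul_left g (l := x₁) d1 (hE.mdifferentiableAt le_rfl x)
    have e4 := gam_mul_left g (l := x₁) (hψ.mdifferentiableAt le_rfl x)
      ((hw1.mul hw1).mdifferentiableAt le_rfl x)
    have e5 := gam_mul_left g (l := x₁) dw dw
    have e6 : gam g (fun x => (lam - s * x₁ x) * (a - (lam - s * x₁ x) ^ 2)) x₁ x =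
        (-s * (a - (lam - s * x₁ x) ^ 2) + (lam - s * x₁ x) * (2 * s * (lam - s * x₁ x))) *
          gam g x₁ x₁ x := by
      refine gam_comp_left g (χ := fun r => (lam - s * r) * (a - (lam - s * r) ^ 2)) ?_
        (hx2.mdifferentiableAt (by norm_num) x)
      have a1 : HasDerivAt (fun r => lam - s * r) (-s) (x₁ x) := by
        simpa using ((hasDerivAt_id (x₁ x)).const_mul s).const_sub lam
      have a2 := a1.mul ((a1.pow 2).const_sub a)
      refine a2.congr_deriv ?_
      simp only [Pi.pow_apply]
      push_cast
      ring
    rw [e1, e2, e4, e5, e6, gam_affine hx, gam_affine hx, gam_self_eq_one hx hxi,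
      lap_fst_eq_zero hx hxi, gam_comm g (gam g w w) x₁, gam_fst_gam hx hxi hw, gam_comm g w x₁]
    ring
  rw [hlhs, integral_sub ic i4, integral_const_mul, key4, mul_zero, sub_zero, key]
  refine integral_congr_ae ?_
  filter_upwards [ae_boundary g] with x hxb
  have dw := hw1.mdifferentiableAt le_rfl x
  -- Since w vanishes on the boundary, X is ∂_ν w ∂_ν x₁ and |∇w|² is (∂_ν w)², so 4F - 2F = 2F
  -- remains.
  rw [h0 x hxb, gam_boundary g dw hxb h0, gam_comm g x₁ w, gam_boundary g dw hxb h0]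
  ring

/-- The energy identity. -/
theorem integral_energy (g : MetricBdry m M) (hw : CReg m 2 w)
    (h0 : ∀ z ∈ (𝓡∂ (m + 1)).boundary M, w z = 0) :
    ∫ x, (w x * lap g w x + gam g w w x) ∂(volumeMeasure g) = 0 :=
  green_of_zero g (hw.of_le (by norm_num)) hw h0

end spatial

/-! ### Integrability over the cylinder and over its lateral boundary -/

theorem integrable_cyl_of_continuousOn {M : Type*} [TopologicalSpace M] [CompactSpace M]
    [SecondCountableTopology M] [MeasurableSpace M] [BorelSpace M] {T : ℝ} {w : ℝ → M → ℝ}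
    (μ : Measure M) [IsFiniteMeasure μ] {B : Set M}
    (hB : IsClosed B) (hμ : ∀ᵐ x ∂μ, x ∈ B)
    (hw : ContinuousOn (fun z : ℝ × M => w z.1 z.2) (Icc 0 T ×ˢ B)) :
    Integrable (fun z : ℝ × M => w z.1 z.2) (((volume : Measure ℝ).restrict (Ioo 0 T)).prod μ) := by
  have hK : IsCompact (Icc 0 T ×ˢ B) := isCompact_Icc.prod hB.isCompact
  have h1 : IntegrableOn (fun z : ℝ × M => w z.1 z.2) (Icc 0 T ×ˢ B)
      ((volume : Measure ℝ).prod μ) :=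
    hw.integrableOn_of_subset_isCompact hK (isClosed_Icc.prod hB).measurableSet subset_rfl (by
      rw [Measure.prod_prod]
      exact ENNReal.mul_ne_top isCompact_Icc.measure_lt_top.ne (measure_ne_top _ _))
  have h2 : ((volume : Measure ℝ).restrict (Ioo 0 T)).prod μ ≤
      ((volume : Measure ℝ).prod μ).restrict (Icc 0 T ×ˢ B) := by
    rw [← Measure.prod_restrict, Measure.restrict_eq_self_of_ae_mem hμ]
    exact Measure.prod_mono (Measure.restrict_mono Ioo_subset_Icc_self le_rfl) le_rfl
  exact Integrable.mono_measure h1 h2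

section cylinder

variable {m : ℕ} {M : Type*} [TopologicalSpace M] [ChartedSpace (EuclideanHalfSpace (m + 1)) M]
  [IsManifold (𝓡∂ (m + 1)) ∞ M] [CompactSpace M] [MeasurableSpace M] [BorelSpace M]
  {T : ℝ} {w : ℝ → M → ℝ}

theorem integrable_cyl (g : MetricBdry m M)
    (hw : ContinuousOn (fun z : ℝ × M => w z.1 z.2) (Icc 0 T ×ˢ univ)) :
    Integrable (fun z : ℝ × M => w z.1 z.2) (cylMeasure g T) := by
  have := isFiniteMeasure_volumeMeasure g
  have := secondCountable_of_compact m M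
  exact integrable_cyl_of_continuousOn _ isClosed_univ (by simp) hw

theorem integrable_lateral (g : MetricBdry m M)
    (hw : ContinuousOn (fun z : ℝ × M => w z.1 z.2) (Icc 0 T ×ˢ (𝓡∂ (m + 1)).boundary M)) :
    Integrable (fun z : ℝ × M => w z.1 z.2)
      (((volume : Measure ℝ).restrict (Ioo 0 T)).prod (surfaceMeasure g)) := by
  have := isFiniteMeasure_surfaceMeasure g
  have := secondCountable_of_compact m M
  exact integrable_cyl_of_continuousOn _ isClosed_bdry (ae_boundary g) hw

theorem ae_cyl_interior (g : MetricBdry m M) (T : ℝ) :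
    ∀ᵐ z ∂(cylMeasure g T), z.1 ∈ Ioo 0 T ∧ z.2 ∈ (𝓡∂ (m + 1)).interior M := by
  have := isFiniteMeasure_volumeMeasure g
  have h1 : ∀ᵐ t ∂((volume : Measure ℝ).restrict (Ioo 0 T)), t ∈ Ioo 0 T :=
    ae_restrict_mem measurableSet_Ioo
  have a1 := (Measure.quasiMeasurePreserving_fst (μ := (volume : Measure ℝ).restrict (Ioo 0 T))
    (ν := volumeMeasure g)).ae h1
  have a2 := (Measure.quasiMeasurePreserving_snd (μ := (volume : Measure ℝ).restrict (Ioo 0 T))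
    (ν := volumeMeasure g)).ae (ae_interior g)
  filter_upwards [a1, a2] with z hz1 hz2 using ⟨hz1, hz2⟩

theorem ae_lateral (g : MetricBdry m M) (T : ℝ) :
    ∀ᵐ z ∂(((volume : Measure ℝ).restrict (Ioo 0 T)).prod (surfaceMeasure g)),
      z.1 ∈ Ioo 0 T ∧ z.2 ∈ (𝓡∂ (m + 1)).boundary M := by
  have := isFiniteMeasure_surfaceMeasure g
  have h1 : ∀ᵐ t ∂((volume : Measure ℝ).restrict (Ioo 0 T)), t ∈ Ioo 0 T :=
    ae_restrict_mem measurableSet_Ioo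
  have a1 := (Measure.quasiMeasurePreserving_fst (μ := (volume : Measure ℝ).restrict (Ioo 0 T))
    (ν := surfaceMeasure g)).ae h1
  have a2 := (Measure.quasiMeasurePreserving_snd (μ := (volume : Measure ℝ).restrict (Ioo 0 T))
    (ν := surfaceMeasure g)).ae (ae_boundary g)
  filter_upwards [a1, a2] with z hz1 hz2 using ⟨hz1, hz2⟩

end cylinder

/-! ### The commutator in the time variable -/

theorem hasDerivAt_fderiv_slice {E : Type*} [NormedAddCommGroup E] [NormedSpace ℝ E]
    {W : ℝ × E → ℝ} {z : ℝ × E} (hW : ContDiffAt ℝ 2 W z) (e : E) :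
    HasDerivAt (fun s => fderiv ℝ W (s, z.2) (0, e))
      (fderiv ℝ (fun y => fderiv ℝ W (z.1, y) (1, 0)) z.2 e) z.1 := by
  have hd : DifferentiableAt ℝ (fderiv ℝ W) z :=
    (hW.fderiv_right (m := 1) (by norm_num)).differentiableAt (by norm_num)
  have hsymm : IsSymmSndFDerivAt ℝ W z := hW.isSymmSndFDerivAt (by simp)
  have h1 : HasFDerivAt (fun s : ℝ => (s, z.2)) (ContinuousLinearMap.inl ℝ ℝ E) z.1 :=
    hasFDerivAt_prodMk_left z.1 z.2
  have h2 : HasFDerivAt (fun y : E => (z.1, y)) (ContinuousLinearMap.inr ℝ ℝ E) z.2 :=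
    hasFDerivAt_prodMk_right z.1 z.2
  have h3 : HasFDerivAt (fderiv ℝ W) (fderiv ℝ (fderiv ℝ W) z) (z.1, z.2) := hd.hasFDerivAt
  have h4 := ((h3.comp z.1 h1).clm_apply (hasFDerivAt_const ((0, e) : ℝ × E) z.1)).hasDerivAt
  have h5 := ((h3.comp z.2 h2).clm_apply (hasFDerivAt_const ((1, 0) : ℝ × E) z.2)).fderiv
  simp only [Function.comp_def] at h4 h5
  rw [h5]
  refine h4.congr_deriv ?_
  simpa using hsymm (1, 0) (0, e)

section time

variable {m : ℕ} {M : Type*} [TopologicalSpace M] [ChartedSpace (EuclideanHalfSpace (m + 1)) M]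
  [IsManifold (𝓡∂ (m + 1)) ∞ M] {T : ℝ} {v : ℝ → M → ℝ}

theorem gam_zero_left (g : MetricBdry m M) (k : M → ℝ) (x : M) : gam g (fun _ => 0) k x = 0 := by
  have hd : dR (m := m) (fun _ : M => (0 : ℝ)) x = 0 := mfderiv_const
  have hd' : (fun j => dR (m := m) (fun _ : M => (0 : ℝ)) x (stdVec j)) = 0 := by rw [hd]; rfl
  rw [gam, hd', coPair, zero_dotProduct]

theorem dtd_eq_zero {x : M} (h : ∀ t ∈ Icc 0 T, v t x = 0) {t : ℝ} (ht : t ∈ Icc 0 T) :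
    dtd T v t x = 0 := by
  rw [dtd, derivWithin_congr (f := fun _ => (0 : ℝ)) (fun s hs => h s hs) (h t ht)]
  simp

/-- Mixed second derivatives are symmetric. Time and point are interior, so that all derivatives
involved are two-sided. -/
theorem hasDerivAt_pd_rep (hT : 0 < T) (hv : JReg m T 2 v) {x : M}
    (hx : x ∈ (𝓡∂ (m + 1)).interior M) {t : ℝ} (ht : t ∈ Ioo 0 T) (i : Fin (m + 1)) :
    HasDerivAt (fun s => pd (rep x (v s)) (extChartAt (𝓡∂ (m + 1)) x x) i)
      (pd (rep x (dtd T v t)) (extChartAt (𝓡∂ (m + 1)) x x) i) t := by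
  set y := extChartAt (𝓡∂ (m + 1)) x x with hy
  have hyt : y ∈ (extChartAt (𝓡∂ (m + 1)) x).target := mem_extChartAt_target x
  have hyi : y ∈ interior (range (𝓡∂ (m + 1))) := hx
  set W : ℝ × Euc (m + 1) → ℝ := fun z => rep x (v z.1) z.2 with hWdef
  have hW : ContDiffOn ℝ 2 W (cdom m T x) := hv x
  have hdom : ∀ {s : ℝ} {w : Euc (m + 1)}, s ∈ Ioo 0 T →
      w ∈ (extChartAt (𝓡∂ (m + 1)) x).target → w ∈ interior (range (𝓡∂ (m + 1))) →
      cdom m T x ∈ 𝓝 (s, w) := by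
    intro s w hs hw hwi
    refine prod_mem_nhds (Icc_mem_nhds hs.1 hs.2) ?_
    have h1 := extChartAt_target_mem_nhdsWithin_of_mem hw
    rwa [nhdsWithin_eq_nhds.2 (mem_interior_iff_mem_nhds.1 hwi)] at h1
  have hWat : ContDiffAt ℝ 2 W (t, y) := hW.contDiffAt (hdom ht hyt hyi)
  have h1 := hasDerivAt_fderiv_slice hWat (stdVec i : Euc (m + 1))
  have h2 : ∀ s ∈ Ioo 0 T, pd (rep x (v s)) y i = fderiv ℝ W (s, y) (0, stdVec i) := by
    intro s hs
    have hz : ((s, y) : ℝ × Euc (m + 1)) ∈ cdom m T x := ⟨Ioo_subset_Icc_self hs, hyt⟩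
    have h3 := pd_slice ((hW _ hz).differentiableWithinAt two_ne_zero) hz i
    rw [fderivWithin_of_mem_nhds (hdom hs hyt hyi)] at h3
    exact h3
  have h4 : pd (rep x (dtd T v t)) y i = fderiv ℝ (fun w => fderiv ℝ W (t, w) (1, 0)) y (stdVec i) := by
    rw [pd, fderivWithin_of_mem_nhds (mem_interior_iff_mem_nhds.1 hyi)]
    congr 1
    refine Filter.EventuallyEq.fderiv_eq ?_
    have hyn : (extChartAt (𝓡∂ (m + 1)) x).target ∈ 𝓝 y := by
      have h1 := extChartAt_target_mem_nhdsWithin_of_mem hyt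
      rwa [nhdsWithin_eq_nhds.2 (mem_interior_iff_mem_nhds.1 hyi)] at h1
    filter_upwards [hyn, isOpen_interior.mem_nhds hyi] with w hw hwi
    have hz : ((t, w) : ℝ × Euc (m + 1)) ∈ cdom m T x := ⟨Ioo_subset_Icc_self ht, hw⟩
    have h5 := derivWithin_slice ((hW _ hz).differentiableWithinAt two_ne_zero) hz
    rw [fderivWithin_of_mem_nhds (hdom ht hw hwi)] at h5
    exact h5.derivWithin (uniqueDiffOn_Icc hT _ hz.1)
  rw [h4]
  refine h1.congr_of_eventuallyEq ?_
  filter_upwards [Ioo_mem_nhds ht.1 ht.2] with s hs using h2 s hs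

theorem hasDerivAt_coPair {k : ℕ} {G : Matrix (Fin k) (Fin k) ℝ} {a : ℝ → Fin k → ℝ}
    {a' : Fin k → ℝ} {t : ℝ} (hG : G.transpose = G)
    (ha : ∀ i, HasDerivAt (fun s => a s i) (a' i) t) :
    HasDerivAt (fun s => coPair G (a s) (a s)) (2 * coPair G a' (a t)) t := by
  have h1 : HasDerivAt (fun s => ∑ i, a s i * ∑ j, G⁻¹ i j * a s j)
      (∑ i, (a' i * (∑ j, G⁻¹ i j * a t j) + a t i * ∑ j, G⁻¹ i j * a' j)) t :=
    HasDerivAt.fun_sum fun i _ => (ha i).mul (HasDerivAt.fun_sum fun j _ => (ha j).const_mul _)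
  have h2 : 2 * coPair G a' (a t) = coPair G a' (a t) + coPair G (a t) a' := by
    rw [coPair_comm hG (a t)]; ring
  rw [h2]
  refine h1.congr_deriv ?_
  rw [Finset.sum_add_distrib]
  rfl

theorem hasDerivAt_gam (hT : 0 < T) (g : MetricBdry m M) (hv : JReg m T 2 v) {x : M}
    (hx : x ∈ (𝓡∂ (m + 1)).interior M) {t : ℝ} (ht : t ∈ Ioo 0 T) :
    HasDerivAt (fun s => gam g (v s) (v s) x) (2 * gam g (dtd T v t) (v t) x) t := by
  have hvt : ∀ s ∈ Icc 0 T, MDifferentiableAt (𝓡∂ (m + 1)) 𝓘(ℝ, ℝ) (v s) x := fun s hs =>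
    (hv.slice hs).mdifferentiableAt (by norm_num) x
  have hd : MDifferentiableAt (𝓡∂ (m + 1)) 𝓘(ℝ, ℝ) (dtd T v t) x :=
    ((hv.dtd hT (k := 1) (by norm_num)).slice (Ioo_subset_Icc_self ht)).mdifferentiableAt le_rfl x
  have h1 := hasDerivAt_coPair
    (transpose_of_posDef (chartGram_posDef g (mem_extChartAt_target (I := 𝓡∂ (m + 1)) x)))
    (hasDerivAt_pd_rep hT hv hx ht)
  rw [gam_self_chart g hd (hvt t (Ioo_subset_Icc_self ht))]
  refine h1.congr_of_eventuallyEq ?_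
  filter_upwards [Ioo_mem_nhds ht.1 ht.2] with s hs
  exact gam_self_chart g (hvt s (Ioo_subset_Icc_self hs)) (hvt s (Ioo_subset_Icc_self hs))

variable [CompactSpace M] [MeasurableSpace M] [BorelSpace M] [T2Space M]

/-- The commutator identity in the time variable. -/
theorem integral_commutator_time (hT : 0 < T) (g : MetricBdry m M) (hv : JReg m T 2 v)
    (hv0 : ∀ x, v 0 x = 0)
    (hvb : ∀ t ∈ Icc 0 T, ∀ z ∈ (𝓡∂ (m + 1)).boundary M, v t z = 0)
    {V : M → ℝ} (hV : Continuous V) :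
    ∫ z, 2 * (-lap g (v z.1) z.2 + V z.2 * v z.1 z.2) * dtd T v z.1 z.2 ∂(cylMeasure g T) =
      ∫ x, (gam g (v T) (v T) x + V x * v T x ^ 2) ∂(volumeMeasure g) := by
  have := isFiniteMeasure_volumeMeasure g
  have hd := hv.dtd hT (k := 1) (by norm_num)
  have hv1 : JReg m T 1 v := hv.of_le (by norm_num)
  have cv := hv.continuousOn
  have cd := hd.continuousOn
  have cl := (hv.lap hT g).continuousOn
  have cg : ContinuousOn (fun z : ℝ × M => gam g (dtd T v z.1) (v z.1) z.2) (Icc 0 T ×ˢ univ) :=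
    (JReg.gam hT g (k := 0) (n := 1) (by simp) (by simp) hd hv1).continuousOn
  have cE : ContinuousOn (fun z : ℝ × M => gam g (v z.1) (v z.1) z.2) (Icc 0 T ×ˢ univ) :=
    (JReg.gam hT g (k := 0) (n := 1) (by simp) (by simp) hv1 hv1).continuousOn
  have cV : ContinuousOn (fun z : ℝ × M => V z.2) (Icc 0 T ×ˢ univ) :=
    (hV.comp continuous_snd).continuousOn
  -- The integrand is A - 2B, where A is the time derivative of |∇v|² + V v² and B is the Green
  -- integrand of ∂_t v against Δv.
  set A : ℝ → M → ℝ := fun t x => 2 * gam g (dtd T v t) (v t) x + V x * (2 * v t x * dtd T v t x)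
    with hA
  set B : ℝ → M → ℝ := fun t x => dtd T v t x * lap g (v t) x + gam g (dtd T v t) (v t) x with hB
  have cA : ContinuousOn (fun z : ℝ × M => A z.1 z.2) (Icc 0 T ×ˢ univ) :=
    (continuousOn_const.mul cg).add (cV.mul ((continuousOn_const.mul cv).mul cd))
  have cB : ContinuousOn (fun z : ℝ × M => B z.1 z.2) (Icc 0 T ×ˢ univ) := (cd.mul cl).add cg
  have iA := integrable_cyl g cA
  have iB := integrable_cyl g cB
  have h1 : ∫ z, 2 * (-lap g (v z.1) z.2 + V z.2 * v z.1 z.2) * dtd T v z.1 z.2 ∂(cylMeasure g T) =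
      ∫ z, A z.1 z.2 ∂(cylMeasure g T) - 2 * ∫ z, B z.1 z.2 ∂(cylMeasure g T) := by
    rw [← integral_const_mul, ← integral_sub iA (iB.const_mul 2)]
    refine integral_congr_ae (Filter.Eventually.of_forall fun z => ?_)
    simp only [hA, hB]
    ring
  -- The Dirichlet condition holds at all times, so ∂_t v also vanishes on the lateral boundary.
  have h2 : ∫ z, B z.1 z.2 ∂(cylMeasure g T) = 0 := by
    rw [cylMeasure, integral_prod _ iB]
    refine setIntegral_eq_zero_of_forall_eq_zero fun t ht => ?_
    have ht' := Ioo_subset_Icc_self ht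
    have h5 := green_of_zero g (f := dtd T v t) (v := v t) (hd.slice ht') (hv.slice ht')
      fun z hz => dtd_eq_zero (fun s hs => hvb s hs z hz) ht'
    simpa only [hB] using h5
  have h3 : ∫ z, A z.1 z.2 ∂(cylMeasure g T) =
      ∫ x, (gam g (v T) (v T) x + V x * v T x ^ 2) ∂(volumeMeasure g) := by
    -- Time is integrated first, at a fixed interior point: the fundamental theorem of calculus
    -- leaves the value at T, as v vanishes at time 0.
    rw [cylMeasure, integral_prod_symm _ iA]
    refine integral_congr_ae ?_
    filter_upwards [ae_interior g] with x hx
    have hslice : ContinuousOn (fun t : ℝ => ((t, x) : ℝ × M)) (Icc 0 T) := by fun_prop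
    have hmaps : MapsTo (fun t : ℝ => ((t, x) : ℝ × M)) (Icc 0 T) (Icc 0 T ×ˢ univ) :=
      fun t ht => ⟨ht, mem_univ _⟩
    have h4 := intervalIntegral.integral_eq_sub_of_hasDerivAt_of_le hT.le
      (f := fun t => gam g (v t) (v t) x + V x * v t x ^ 2) (f' := fun t => A t x)
      ((cE.comp hslice hmaps).add (continuousOn_const.mul ((cv.comp hslice hmaps).pow 2)))
      (fun t ht => by
        have h5 := (hv.hasDerivWithinAt two_ne_zero (Ioo_subset_Icc_self ht) x).hasDerivAt
          (Icc_mem_nhds ht.1 ht.2)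
        refine (hasDerivAt_gam hT g hv hx ht).add ((h5.fun_pow 2).const_mul (V x)) |>.congr_deriv ?_
        simp only [hA]
        push_cast
        ring)
      ((cA.comp hslice hmaps).intervalIntegrable_of_Icc hT.le)
    have h6 : v 0 = fun _ => 0 := funext hv0
    rw [intervalIntegral.integral_of_le hT.le, integral_Ioc_eq_integral_Ioo, h6, gam_zero_left] at h4
    simpa using h4
  rw [h1, h2, h3]
  ring

end time

/-! ### The estimate for the conjugated heat operator -/

section conjugated

variable {m : ℕ} {M : Type*} [TopologicalSpace M] [ChartedSpace (EuclideanHalfSpace (m + 1)) M]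
  [IsManifold (𝓡∂ (m + 1)) ∞ M] [CompactSpace M] [MeasurableSpace M] [BorelSpace M] [T2Space M]
  {N : Type*} [TopologicalSpace N] [ChartedSpace (Euc m) N] [IsManifold (𝓡 m) ∞ N]
  {g : MetricBdry m M} {h : MetricNoBdry m N} {x₁ : M → ℝ} {x' : M → N} {T : ℝ} {v : ℝ → M → ℝ}

/-- The heat operator conjugated with the weight `a t + lam x₁ - s x₁² / 2`. -/
def conjHeat (g : MetricBdry m M) (x₁ : M → ℝ) (T lam s a : ℝ) (v : ℝ → M → ℝ) (t : ℝ) (x : M) : ℝ :=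
  dtd T v t x - lap g (v t) x - 2 * (lam - s * x₁ x) * gam g x₁ (v t) x +
    (s + a - (lam - s * x₁ x) ^ 2) * v t x

/-- Write the conjugated operator as S + R with S = -L + (a - F²)v and R = vt - 2F X + s v. Then (S
+ R)² = 2SR + R² + S², with R² ≥ 0 and S² ≥ (s/8) v S - s²v²/256 from the square of S - s v/16. The
summand -(s/8) v L yields the gradient term up to the energy density v L + E, which has zero
integral, while the commutator 4sF²v² pays for the loss. -/
theorem conjugated_pointwise {lam s a F X E v vt L : ℝ} (hlam : 0 < lam) (hs : 0 < s)
    (hs4 : s ≤ 4 * lam ^ 2) (ha : 0 ≤ a) (hF : lam / 2 ≤ F) :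
    2 * (-L + (a - F ^ 2) * v) * vt +
      (2 * (-L + (a - F ^ 2) * v) * (-2 * F * X + s * v) -
        (4 * s * X ^ 2 + 4 * s * F ^ 2 * v ^ 2)) +
      (s / 8 * E + s / 4 * lam ^ 2 * v ^ 2) - s / 8 * (v * L + E) ≤
    (vt - L - 2 * F * X + (s + a - F ^ 2) * v) ^ 2 := by
  have h1 : 0 ≤ (vt + (-2 * F * X + s * v)) ^ 2 := sq_nonneg _
  have h2 : 0 ≤ (-L + (a - F ^ 2) * v - s / 16 * v) ^ 2 := sq_nonneg _
  have h3 : lam ^ 2 / 4 ≤ F ^ 2 := by nlinarith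
  have h4 : 0 ≤ s * v ^ 2 * (F ^ 2 - lam ^ 2 / 4) := by
    have := mul_nonneg hs.le (sq_nonneg v)
    exact mul_nonneg this (by linarith)
  have h5 : 0 ≤ s * v ^ 2 * (4 * lam ^ 2 - s) := by
    have := mul_nonneg hs.le (sq_nonneg v)
    exact mul_nonneg this (by linarith)
  have h6 : 0 ≤ s * v ^ 2 * a := mul_nonneg (mul_nonneg hs.le (sq_nonneg v)) ha
  have h7 : 0 ≤ s * X ^ 2 := mul_nonneg hs.le (sq_nonneg X)
  have h8 : 0 ≤ s * v ^ 2 * lam ^ 2 := mul_nonneg (mul_nonneg hs.le (sq_nonneg v)) (sq_nonneg _)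
  -- The coefficient of sF²v² is 4 - 1/8 = 31/8. With F² ≥ lam²/4 it provides (31/32) s lam² v², of
  -- which 1/4 is kept on the left and 1/64 covers s²v²/256 because s ≤ 4lam².
  have key : (vt - L - 2 * F * X + (s + a - F ^ 2) * v) ^ 2 -
      (2 * (-L + (a - F ^ 2) * v) * vt +
      (2 * (-L + (a - F ^ 2) * v) * (-2 * F * X + s * v) -
        (4 * s * X ^ 2 + 4 * s * F ^ 2 * v ^ 2)) +
      (s / 8 * E + s / 4 * lam ^ 2 * v ^ 2) - s / 8 * (v * L + E)) =
      (vt + (-2 * F * X + s * v)) ^ 2 + (-L + (a - F ^ 2) * v - s / 16 * v) ^ 2 +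
      4 * (s * X ^ 2) + (31 / 8) * (s * v ^ 2 * (F ^ 2 - lam ^ 2 / 4)) +
      1 / 8 * (s * v ^ 2 * a) + 1 / 256 * (s * v ^ 2 * (4 * lam ^ 2 - s)) +
      (31 / 32 - 1 / 4 - 1 / 64) * (s * v ^ 2 * lam ^ 2) := by
    ring
  nlinarith [key]

/-- The Carleman estimate for the conjugated heat operator. -/
theorem carleman_conjugated (hx : IsProductEmbedding g h x₁ x') (hT : 0 < T) (hv : JReg m T 2 v)
    (hv0 : ∀ x, v 0 x = 0)
    (hvb : ∀ t ∈ Icc 0 T, ∀ z ∈ (𝓡∂ (m + 1)).boundary M, v t z = 0)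
    {lam s a : ℝ} (hlam : 0 < lam) (hs : 0 < s) (hs4 : s ≤ 4 * lam ^ 2) (ha : 0 ≤ a)
    (hF : ∀ x, lam / 2 ≤ lam - s * x₁ x) (hF2 : ∀ x, lam - s * x₁ x ≤ 2 * lam) :
    ∫ x, gam g (v T) (v T) x ∂(volumeMeasure g) +
      ∫ z, 2 * ((lam - s * x₁ z.2) * normalDerivReal g (v z.1) z.2 ^ 2 * normalDerivReal g x₁ z.2)
        ∂(((volume : Measure ℝ).restrict (Ioo 0 T)).prod (surfaceMeasure g)) +
      ∫ z, (s / 8 * gam g (v z.1) (v z.1) z.2 + s / 4 * lam ^ 2 * v z.1 z.2 ^ 2) ∂(cylMeasure g T) ≤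
    ∫ z, conjHeat g x₁ T lam s a v z.1 z.2 ^ 2 ∂(cylMeasure g T) +
      4 * lam ^ 2 * ∫ x, v T x ^ 2 ∂(volumeMeasure g) := by
  have := isFiniteMeasure_volumeMeasure g
  have := isFiniteMeasure_surfaceMeasure g
  have hx2 := hx.creg_fst
  have hxc := hx2.continuous
  have hd := hv.dtd hT (k := 1) (by norm_num)
  have hv1 : JReg m T 1 v := hv.of_le (by norm_num)
  have hTm : T ∈ Icc 0 T := ⟨hT.le, le_rfl⟩
  have cv := hv.continuousOn
  have cd := hd.continuousOn
  have cl := (hv.lap hT g).continuousOn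
  have cE : ContinuousOn (fun z : ℝ × M => gam g (v z.1) (v z.1) z.2) (Icc 0 T ×ˢ univ) :=
    (JReg.gam hT g (k := 0) (n := 1) (by simp) (by simp) hv1 hv1).continuousOn
  have cX : ContinuousOn (fun z : ℝ × M => gam g x₁ (v z.1) z.2) (Icc 0 T ×ˢ univ) :=
    (JReg.gam hT g (k := 0) (n := 1) (by simp) (by simp)
      ((hx2.of_le (by norm_num)).jreg T) hv1).continuousOn
  have cF : ContinuousOn (fun z : ℝ × M => lam - s * x₁ z.2) (Icc 0 T ×ˢ univ) :=
    (continuous_const.sub (continuous_const.mul (hxc.comp continuous_snd))).continuousOn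
  set V : M → ℝ := fun x => a - (lam - s * x₁ x) ^ 2 with hV
  have hVc : Continuous V := by fun_prop
  -- The time cross term, the space cross term minus its positive commutator, the quantity to be
  -- kept, and the energy density of zero integral.
  set t1 : ℝ → M → ℝ := fun t x => 2 * (-lap g (v t) x + V x * v t x) * dtd T v t x with ht1
  set t2 : ℝ → M → ℝ := fun t x => 2 * (-lap g (v t) x + (a - (lam - s * x₁ x) ^ 2) * v t x) *
        (-2 * (lam - s * x₁ x) * gam g x₁ (v t) x + s * v t x) -
        (4 * s * gam g x₁ (v t) x ^ 2 + 4 * s * (lam - s * x₁ x) ^ 2 * v t x ^ 2) with ht2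
  set t3 : ℝ → M → ℝ := fun t x => s / 8 * gam g (v t) (v t) x + s / 4 * lam ^ 2 * v t x ^ 2 with ht3
  set t4 : ℝ → M → ℝ := fun t x => v t x * lap g (v t) x + gam g (v t) (v t) x with ht4
  have cVc : ContinuousOn (fun z : ℝ × M => V z.2) (Icc 0 T ×ˢ univ) :=
    (hVc.comp continuous_snd).continuousOn
  have i1 : Integrable (fun z : ℝ × M => t1 z.1 z.2) (cylMeasure g T) := integrable_cyl g
    ((continuousOn_const.mul (cl.neg.add (cVc.mul cv))).mul cd)
  have i2 : Integrable (fun z : ℝ × M => t2 z.1 z.2) (cylMeasure g T) := integrable_cyl g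
    (((continuousOn_const.mul (cl.neg.add (cVc.mul cv))).mul
      (((continuousOn_const.mul cF).mul cX).add (continuousOn_const.mul cv))).sub
      ((continuousOn_const.mul (cX.pow 2)).add ((continuousOn_const.mul (cF.pow 2)).mul (cv.pow 2))))
  have i3 : Integrable (fun z : ℝ × M => t3 z.1 z.2) (cylMeasure g T) := integrable_cyl g
    ((continuousOn_const.mul cE).add (continuousOn_const.mul (cv.pow 2)))
  have i4 : Integrable (fun z : ℝ × M => t4 z.1 z.2) (cylMeasure g T) := integrable_cyl g
    ((cv.mul cl).add cE)
  have iP : Integrable (fun z : ℝ × M => conjHeat g x₁ T lam s a v z.1 z.2 ^ 2) (cylMeasure g T) :=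
    integrable_cyl g (w := fun t x => conjHeat g x₁ T lam s a v t x ^ 2)
      ((((cd.sub cl).sub ((continuousOn_const.mul cF).mul cX)).add
        ((continuousOn_const.sub (cF.pow 2)).mul cv)).pow 2)
  have hmono : ∫ z, (t1 z.1 z.2 + t2 z.1 z.2 + t3 z.1 z.2 - s / 8 * t4 z.1 z.2) ∂(cylMeasure g T) ≤
      ∫ z, conjHeat g x₁ T lam s a v z.1 z.2 ^ 2 ∂(cylMeasure g T) :=
    integral_mono (((i1.add i2).add i3).sub (i4.const_mul (s / 8))) iP fun z =>
      conjugated_pointwise hlam hs hs4 ha (hF z.2)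
  have hsplit : ∫ z, (t1 z.1 z.2 + t2 z.1 z.2 + t3 z.1 z.2 - s / 8 * t4 z.1 z.2) ∂(cylMeasure g T) =
      ∫ z, t1 z.1 z.2 ∂(cylMeasure g T) + ∫ z, t2 z.1 z.2 ∂(cylMeasure g T) +
      ∫ z, t3 z.1 z.2 ∂(cylMeasure g T) - s / 8 * ∫ z, t4 z.1 z.2 ∂(cylMeasure g T) := by
    have i12 : Integrable (fun z : ℝ × M => t1 z.1 z.2 + t2 z.1 z.2) (cylMeasure g T) := i1.add i2
    have i123 : Integrable (fun z : ℝ × M => t1 z.1 z.2 + t2 z.1 z.2 + t3 z.1 z.2)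
      (cylMeasure g T) := i12.add i3
    rw [integral_sub i123 (i4.const_mul _), integral_add i12 i3, integral_add i1 i2,
      integral_const_mul]
  have e1 := integral_commutator_time hT g hv hv0 hvb hVc
  have e4 : ∫ z, t4 z.1 z.2 ∂(cylMeasure g T) = 0 := by
    rw [cylMeasure, integral_prod _ i4]
    refine setIntegral_eq_zero_of_forall_eq_zero fun t ht => ?_
    have ht' := Ioo_subset_Icc_self ht
    have h5 := integral_energy g (w := v t) (hv.slice ht') (hvb t ht')
    simpa only [ht4] using h5
  have e2 : ∫ z, t2 z.1 z.2 ∂(cylMeasure g T) =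
      ∫ z, 2 * ((lam - s * x₁ z.2) * normalDerivReal g (v z.1) z.2 ^ 2 * normalDerivReal g x₁ z.2)
        ∂(((volume : Measure ℝ).restrict (Ioo 0 T)).prod (surfaceMeasure g)) := by
    have cn := hv1.continuousOn_normalDerivReal hT g
    have cn1 := ((hx2.of_le (by norm_num)).jreg T).continuousOn_normalDerivReal hT g (u := fun _ => x₁)
    have iL : Integrable (fun z : ℝ × M => 2 * ((lam - s * x₁ z.2) *
        normalDerivReal g (v z.1) z.2 ^ 2 * normalDerivReal g x₁ z.2))
        (((volume : Measure ℝ).restrict (Ioo 0 T)).prod (surfaceMeasure g)) :=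
      integrable_lateral g (w := fun t x => 2 * ((lam - s * x₁ x) *
        normalDerivReal g (v t) x ^ 2 * normalDerivReal g x₁ x))
        (continuousOn_const.mul (((cF.mono (prod_mono_right (subset_univ _))).mul (cn.pow 2)).mul cn1))
    rw [integral_prod _ iL, cylMeasure, integral_prod _ i2]
    refine setIntegral_congr_fun measurableSet_Ioo fun t ht => ?_
    have ht' := Ioo_subset_Icc_self ht
    have h5 := integral_commutator_space hx (w := v t) (hv.slice ht') (hvb t ht') lam s a
    simpa only [ht2] using h5
  have hvT := hv.slice hTm
  have cET : Continuous (gam g (v T) (v T)) :=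
    (CReg.gam g (k := 0) (n := 1) (by simp) (by simp) (hv1.slice hTm) (hv1.slice hTm)).continuous
  have cvT : Continuous fun x => v T x ^ 2 := hvT.continuous.pow 2
  -- The potential a - F² in the energy at time T is at least -4lam², since a ≥ 0 and 0 ≤ F ≤ 2lam.
  -- Its negative part moves to the right-hand side.
  have e5 : ∫ x, gam g (v T) (v T) x ∂(volumeMeasure g) -
      4 * lam ^ 2 * ∫ x, v T x ^ 2 ∂(volumeMeasure g) ≤
      ∫ x, (gam g (v T) (v T) x + V x * v T x ^ 2) ∂(volumeMeasure g) := by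
    rw [← integral_const_mul, ← integral_sub (integrable_volume g cET)
      ((integrable_volume g cvT).const_mul _)]
    refine integral_mono ((integrable_volume g cET).sub ((integrable_volume g cvT).const_mul _))
      (integrable_volume g (cET.add (hVc.mul cvT))) fun x => ?_
    have h6 : (lam - s * x₁ x) ^ 2 ≤ 4 * lam ^ 2 := by nlinarith [hF x, hF2 x]
    have h7 : 0 ≤ (V x + 4 * lam ^ 2) * v T x ^ 2 :=
      mul_nonneg (by simp only [hV]; linarith) (sq_nonneg _)
    simp only
    linarith
  rw [hsplit, e2, e4] at hmono
  have e1' : ∫ z, t1 z.1 z.2 ∂(cylMeasure g T) =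
      ∫ x, (gam g (v T) (v T) x + V x * v T x ^ 2) ∂(volumeMeasure g) := e1
  rw [e1'] at hmono
  linarith

end conjugated

/-! ### The convexified weight and the return from v to u -/

/-- The convexified weight `exp (-(a t + lam r - s r² / 2))`. -/
def convWeight (lam s a : ℝ) (t r : ℝ) : ℝ := Real.exp (-(a * t + lam * r - s * r ^ 2 / 2))

section convWeight

variable (lam s a : ℝ)

theorem contDiff_convWeight : ContDiff ℝ ∞ fun z : ℝ × ℝ => convWeight lam s a z.1 z.2 := by
  unfold convWeight
  fun_prop

theorem hasDerivAt_convWeight_space (t r : ℝ) : HasDerivAt (convWeight lam s a t)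
    (-(lam - s * r) * convWeight lam s a t r) r := by
  have h1 : HasDerivAt (fun r => -(a * t + lam * r - s * r ^ 2 / 2)) (-(lam - s * r)) r := by
    have h2 := ((((hasDerivAt_id r).const_mul lam).const_add (a * t)).sub
      ((((hasDerivAt_id r).fun_pow 2).const_mul s).div_const 2)).neg
    refine h2.congr_deriv ?_
    simp
    ring
  refine h1.exp.congr_deriv ?_
  rw [convWeight]
  ring

theorem hasDerivAt_convWeight_space_deriv (t r : ℝ) :
    HasDerivAt (fun r => -(lam - s * r) * convWeight lam s a t r)
      (((lam - s * r) ^ 2 + s) * convWeight lam s a t r) r := by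
  have h1 : HasDerivAt (fun r => -(lam - s * r)) s r := by
    refine (((hasDerivAt_id r).const_mul s).const_sub lam).neg.congr_deriv ?_
    simp
  refine (h1.mul (hasDerivAt_convWeight_space lam s a t r)).congr_deriv ?_
  ring

theorem hasDerivAt_convWeight_time (t r : ℝ) : HasDerivAt (fun t => convWeight lam s a t r)
    (-a * convWeight lam s a t r) t := by
  have h1 : HasDerivAt (fun t => -(a * t + lam * r - s * r ^ 2 / 2)) (-a) t := by
    refine ((((hasDerivAt_id t).const_mul a).add_const (lam * r)).sub_const
      (s * r ^ 2 / 2)).neg.congr_deriv ?_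
    simp
  refine h1.exp.congr_deriv ?_
  rw [convWeight]
  ring

end convWeight

section weighted

variable {m : ℕ} {M : Type*} [TopologicalSpace M] [ChartedSpace (EuclideanHalfSpace (m + 1)) M]
  [IsManifold (𝓡∂ (m + 1)) ∞ M]
  {N : Type*} [TopologicalSpace N] [ChartedSpace (Euc m) N] [IsManifold (𝓡 m) ∞ N]
  {g : MetricBdry m M} {h : MetricNoBdry m N} {x₁ : M → ℝ} {x' : M → N} {T : ℝ} {u : ℝ → M → ℝ}
  {lam s a : ℝ}

theorem creg_convWeight (hx : IsProductEmbedding g h x₁ x') (t : ℝ) :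
    CReg m 2 fun x => convWeight lam s a t (x₁ x) :=
  hx.creg_fst.comp (((contDiff_convWeight lam s a).of_le (by norm_cast)).comp
    (contDiff_const.prodMk contDiff_id))

theorem jreg_weighted (hx : IsProductEmbedding g h x₁ x') (hu : JReg m T 2 u) :
    JReg m T 2 fun t x => convWeight lam s a t (x₁ x) * u t x := by
  have h1 : JReg m T 2 fun t x => convWeight lam s a t (x₁ x) := fun p =>
    ((contDiff_convWeight lam s a).of_le (by norm_cast)).comp_contDiffOn
      (contDiffOn_fst.prodMk ((hx.creg_fst p).comp contDiffOn_snd fun z hz => hz.2))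
  exact h1.mul hu

theorem gam_convWeight_left (hx : IsProductEmbedding g h x₁ x') (t : ℝ) (k : M → ℝ) (x : M) :
    gam g (fun x => convWeight lam s a t (x₁ x)) k x =
      -(lam - s * x₁ x) * convWeight lam s a t (x₁ x) * gam g x₁ k x :=
  gam_comp_left g (hasDerivAt_convWeight_space lam s a t (x₁ x))
    (hx.creg_fst.mdifferentiableAt (by norm_num) x)

theorem gam_weighted_left (hx : IsProductEmbedding g h x₁ x') {f : M → ℝ} (hf : CReg m 1 f)
    (t : ℝ) (k : M → ℝ) (x : M) :
    gam g (fun x => convWeight lam s a t (x₁ x) * f x) k x =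
      convWeight lam s a t (x₁ x) * (gam g f k x - (lam - s * x₁ x) * f x * gam g x₁ k x) := by
  rw [gam_mul_left g ((creg_convWeight hx t).mdifferentiableAt (by norm_num) x)
    (hf.mdifferentiableAt le_rfl x), gam_convWeight_left hx]
  ring

/-- With |∇x₁| = 1 and Δx₁ = 0 the weight satisfies ∇ρ = -Fρ∇x₁, Δρ = (F² + s)ρ and ∂_tρ = -aρ. The
drift and the potential of `conjHeat` are those that cancel every term in which a derivative falls
on ρ. -/
theorem conjHeat_weighted (hx : IsProductEmbedding g h x₁ x') (hT : 0 < T) (hu : JReg m T 2 u)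
    {t : ℝ} (ht : t ∈ Ioo 0 T) {x : M} (hxi : x ∈ (𝓡∂ (m + 1)).interior M) :
    conjHeat g x₁ T lam s a (fun t x => convWeight lam s a t (x₁ x) * u t x) t x =
      convWeight lam s a t (x₁ x) * (dtd T u t x - lap g (u t) x) := by
  have ht' := Ioo_subset_Icc_self ht
  have hut := hu.slice ht'
  have e1 : dtd T (fun t x => convWeight lam s a t (x₁ x) * u t x) t x =
      convWeight lam s a t (x₁ x) * dtd T u t x - a * (convWeight lam s a t (x₁ x) * u t x) := by
    have h1 := ((hasDerivAt_convWeight_time lam s a t (x₁ x)).hasDerivWithinAt (s := Icc 0 T)).mul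
      (hu.hasDerivWithinAt two_ne_zero ht' x)
    refine (h1.derivWithin (uniqueDiffOn_Icc hT t ht')).trans ?_
    ring
  have e2 := lap_mul g (creg_convWeight (lam := lam) (s := s) (a := a) hx t) hut x
  have e3 := lap_comp g (hasDerivAt_convWeight_space lam s a t)
    (hasDerivAt_convWeight_space_deriv lam s a t) hx.creg_fst x
  rw [lap_fst_eq_zero hx hxi, gam_self_eq_one hx hxi] at e3
  rw [conjHeat, e1, e2, e3, gam_convWeight_left hx,
    gam_comm g x₁ (fun x => convWeight lam s a t (x₁ x) * u t x),
    gam_weighted_left hx (hut.of_le (by norm_num)), gam_self_eq_one hx hxi, gam_comm g (u t) x₁]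
  ring

/-- Since ∇(ρf) = ρ(∇f - F f ∇x₁), half of |∇f|² dominates half of the squared x₁-derivative of f,
by Cauchy-Schwarz. Completing the square in this derivative and 2F f leaves an error of at most F² ≤
4lam² times (ρf)². -/
theorem gam_weighted_ge (hx : IsProductEmbedding g h x₁ x') {f : M → ℝ} (hf : CReg m 2 f)
    {x : M} (hxi : x ∈ (𝓡∂ (m + 1)).interior M) (t : ℝ) (hF0 : 0 ≤ lam - s * x₁ x)
    (hF2 : lam - s * x₁ x ≤ 2 * lam) :
    1 / 2 * (convWeight lam s a t (x₁ x) ^ 2 * gam g f f x) -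
        4 * lam ^ 2 * (convWeight lam s a t (x₁ x) * f x) ^ 2 ≤
      gam g (fun x => convWeight lam s a t (x₁ x) * f x)
        (fun x => convWeight lam s a t (x₁ x) * f x) x := by
  have hf1 : CReg m 1 f := hf.of_le (by norm_num)
  rw [gam_weighted_left hx hf1, gam_comm g f (fun x => convWeight lam s a t (x₁ x) * f x),
    gam_weighted_left hx hf1, gam_comm g x₁ (fun x => convWeight lam s a t (x₁ x) * f x),
    gam_weighted_left hx hf1, gam_self_eq_one hx hxi, gam_comm g f x₁]
  set ρ := convWeight lam s a t (x₁ x)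
  set F := lam - s * x₁ x
  have hcs : gam g x₁ f x ^ 2 ≤ gam g f f x := by
    have h1 := coPair_sq_le (gram_posDef g x) (fun j => dR (m := m) x₁ x (stdVec j))
      (fun j => dR (m := m) f x (stdVec j))
    have h2 := gam_self_eq_one hx hxi
    rw [gam] at h2
    rw [h2, one_mul] at h1
    exact h1
  have hF4 : F ^ 2 ≤ 4 * lam ^ 2 := by nlinarith
  have h3 : 0 ≤ ρ ^ 2 * (gam g f f x - gam g x₁ f x ^ 2) :=
    mul_nonneg (sq_nonneg _) (by linarith)
  have h4 : 0 ≤ ρ ^ 2 * (gam g x₁ f x - 2 * F * f x) ^ 2 := mul_nonneg (sq_nonneg _) (sq_nonneg _)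
  have h5 : 0 ≤ (ρ * f x) ^ 2 * (4 * lam ^ 2 - F ^ 2) := mul_nonneg (sq_nonneg _) (by linarith)
  nlinarith [h3, h4, h5]

variable [CompactSpace M] [MeasurableSpace M] [BorelSpace M] [T2Space M]

/-- The Carleman estimate for real solutions of the heat equation with source. -/
theorem carleman_heat (hx : IsProductEmbedding g h x₁ x') (hT : 0 < T) (hu : JReg m T 2 u)
    (hu0 : ∀ x, u 0 x = 0)
    (hub : ∀ t ∈ Icc 0 T, ∀ z ∈ (𝓡∂ (m + 1)).boundary M, u t z = 0)
    (hlam : 0 < lam) (hs : 0 < s) (hs4 : s ≤ 4 * lam ^ 2) (ha : 0 ≤ a)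
    (hF : ∀ x, lam / 2 ≤ lam - s * x₁ x) (hF2 : ∀ x, lam - s * x₁ x ≤ 2 * lam) :
    1 / 2 * ∫ x, convWeight lam s a T (x₁ x) ^ 2 * gam g (u T) (u T) x ∂(volumeMeasure g) +
      ∫ z, 2 * ((lam - s * x₁ z.2) * (convWeight lam s a z.1 (x₁ z.2) ^ 2 *
        normalDerivReal g (u z.1) z.2 ^ 2) * normalDerivReal g x₁ z.2)
        ∂(((volume : Measure ℝ).restrict (Ioo 0 T)).prod (surfaceMeasure g)) +
      s / 128 * ∫ z, convWeight lam s a z.1 (x₁ z.2) ^ 2 *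
        (gam g (u z.1) (u z.1) z.2 + lam ^ 2 * u z.1 z.2 ^ 2) ∂(cylMeasure g T) ≤
    ∫ z, convWeight lam s a z.1 (x₁ z.2) ^ 2 * (dtd T u z.1 z.2 - lap g (u z.1) z.2) ^ 2
        ∂(cylMeasure g T) +
      8 * lam ^ 2 * ∫ x, convWeight lam s a T (x₁ x) ^ 2 * u T x ^ 2 ∂(volumeMeasure g) := by
  set v : ℝ → M → ℝ := fun t x => convWeight lam s a t (x₁ x) * u t x with hvdef
  have hv : JReg m T 2 v := jreg_weighted hx hu
  have hTm : T ∈ Icc 0 T := ⟨hT.le, le_rfl⟩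
  have key := carleman_conjugated hx hT hv (fun x => by simp [hvdef, hu0 x])
    (fun t ht z hz => by simp [hvdef, hub t ht z hz]) hlam hs hs4 ha hF hF2
  have hv1 : JReg m T 1 v := hv.of_le (by norm_num)
  have hu1 : JReg m T 1 u := hu.of_le (by norm_num)
  have hF0 : ∀ x, 0 ≤ lam - s * x₁ x := fun x => by linarith [hF x]
  have cw : ∀ t, Continuous fun x => convWeight lam s a t (x₁ x) :=
    fun t => (creg_convWeight hx t).continuous
  have cwz : Continuous fun z : ℝ × M => convWeight lam s a z.1 (x₁ z.2) :=
    (contDiff_convWeight lam s a).continuous.comp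
      (continuous_fst.prodMk (hx.creg_fst.continuous.comp continuous_snd))
  have cE : ∀ {u : ℝ → M → ℝ}, JReg m T 1 u →
      ContinuousOn (fun z : ℝ × M => gam g (u z.1) (u z.1) z.2) (Icc 0 T ×ˢ univ) := fun hu =>
    (JReg.gam hT g (k := 0) (n := 1) (by simp) (by simp) hu hu).continuousOn
  have cET : ∀ {u : ℝ → M → ℝ}, JReg m T 1 u → Continuous (gam g (u T) (u T)) := fun hu =>
    (CReg.gam g (k := 0) (n := 1) (by simp) (by simp) (hu.slice hTm) (hu.slice hTm)).continuous
  -- Passing from v to u at time T costs 4lam². Together with the 4lam² already in `key` this gives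
  -- the 8lam² of the conclusion.
  have e1 : 1 / 2 * ∫ x, convWeight lam s a T (x₁ x) ^ 2 * gam g (u T) (u T) x ∂(volumeMeasure g) -
      4 * lam ^ 2 * ∫ x, v T x ^ 2 ∂(volumeMeasure g) ≤
      ∫ x, gam g (v T) (v T) x ∂(volumeMeasure g) := by
    have i1 := (integrable_volume g (f := fun x => convWeight lam s a T (x₁ x) ^ 2 * gam g (u T) (u T) x)
      (((cw T).pow 2).mul (cET hu1))).const_mul (1 / 2)
    have i2 := (integrable_volume g (f := fun x => v T x ^ 2)
      ((hv.slice hTm).continuous.pow 2)).const_mul (4 * lam ^ 2)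
    rw [← integral_const_mul, ← integral_const_mul, ← integral_sub i1 i2]
    refine integral_mono_ae (i1.sub i2) (integrable_volume g (cET hv1)) ?_
    filter_upwards [ae_interior g] with x hxi
    exact gam_weighted_ge hx (hu.slice hTm) hxi T (hF0 x) (hF2 x)
  have e2 : ∫ z, 2 * ((lam - s * x₁ z.2) * normalDerivReal g (v z.1) z.2 ^ 2 *
        normalDerivReal g x₁ z.2)
        ∂(((volume : Measure ℝ).restrict (Ioo 0 T)).prod (surfaceMeasure g)) =
      ∫ z, 2 * ((lam - s * x₁ z.2) * (convWeight lam s a z.1 (x₁ z.2) ^ 2 *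
        normalDerivReal g (u z.1) z.2 ^ 2) * normalDerivReal g x₁ z.2)
        ∂(((volume : Measure ℝ).restrict (Ioo 0 T)).prod (surfaceMeasure g)) := by
    refine integral_congr_ae ?_
    filter_upwards [ae_lateral g T] with z hz
    have ht := Ioo_subset_Icc_self hz.1
    have h1 : normalDerivReal g (v z.1) z.2 =
        convWeight lam s a z.1 (x₁ z.2) * normalDerivReal g (u z.1) z.2 :=
      normalDerivReal_mul_of_zero g ((creg_convWeight hx z.1).mdifferentiableAt (by norm_num) z.2)
        ((hu1.slice ht).mdifferentiableAt le_rfl z.2) (hub z.1 ht z.2 hz.2)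
    rw [h1]
    ring
  -- One uses s/64 of the lower bound for |∇v|². It produces (s/128)ρ²|∇u|² at the cost of
  -- (s/16)lam²v², and s/16 + s/128 is below the available s/4.
  have e3 : s / 128 * ∫ z, convWeight lam s a z.1 (x₁ z.2) ^ 2 *
        (gam g (u z.1) (u z.1) z.2 + lam ^ 2 * u z.1 z.2 ^ 2) ∂(cylMeasure g T) ≤
      ∫ z, (s / 8 * gam g (v z.1) (v z.1) z.2 + s / 4 * lam ^ 2 * v z.1 z.2 ^ 2)
        ∂(cylMeasure g T) := by
    rw [← integral_const_mul]
    refine integral_mono_ae ?_ ?_ ?_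
    · exact (integrable_cyl g (w := fun t x => convWeight lam s a t (x₁ x) ^ 2 *
        (gam g (u t) (u t) x + lam ^ 2 * u t x ^ 2)) ((cwz.continuousOn.pow 2).mul
        ((cE hu1).add (continuousOn_const.mul (hu.continuousOn.pow 2))))).const_mul _
    · exact integrable_cyl g (w := fun t x => s / 8 * gam g (v t) (v t) x +
        s / 4 * lam ^ 2 * v t x ^ 2) ((continuousOn_const.mul (cE hv1)).add
        (continuousOn_const.mul (hv.continuousOn.pow 2)))
    · filter_upwards [ae_cyl_interior g T] with z hz
      have h1 := gam_weighted_ge (a := a) hx (hu.slice (Ioo_subset_Icc_self hz.1)) hz.2 z.1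
        (hF0 z.2) (hF2 z.2)
      have h2 := gam_self_nonneg g (v z.1) z.2
      have h3 : v z.1 z.2 = convWeight lam s a z.1 (x₁ z.2) * u z.1 z.2 := rfl
      rw [← h3] at h1
      change _ ≤ gam g (v z.1) (v z.1) z.2 at h1
      have h4 : convWeight lam s a z.1 (x₁ z.2) ^ 2 *
          (gam g (u z.1) (u z.1) z.2 + lam ^ 2 * u z.1 z.2 ^ 2) =
          convWeight lam s a z.1 (x₁ z.2) ^ 2 * gam g (u z.1) (u z.1) z.2 +
          lam ^ 2 * v z.1 z.2 ^ 2 := by rw [h3]; ring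
      simp only [h4]
      have h5 := mul_le_mul_of_nonneg_left h1 hs.le
      have h6 := mul_nonneg hs.le h2
      have h7 : 0 ≤ s * (lam ^ 2 * v z.1 z.2 ^ 2) := by positivity
      linarith
  have e4 : ∫ z, conjHeat g x₁ T lam s a v z.1 z.2 ^ 2 ∂(cylMeasure g T) =
      ∫ z, convWeight lam s a z.1 (x₁ z.2) ^ 2 * (dtd T u z.1 z.2 - lap g (u z.1) z.2) ^ 2
        ∂(cylMeasure g T) := by
    refine integral_congr_ae ?_
    filter_upwards [ae_cyl_interior g T] with z hz
    rw [conjHeat_weighted hx hT hu hz.1 hz.2]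
    ring
  have e5 : ∫ x, v T x ^ 2 ∂(volumeMeasure g) =
      ∫ x, convWeight lam s a T (x₁ x) ^ 2 * u T x ^ 2 ∂(volumeMeasure g) := by
    simp only [hvdef, mul_pow]
  rw [e2, e4, e5] at key
  rw [e5] at e1
  linarith

end weighted

/-! ### Complex-valued functions in terms of real and imaginary parts -/

section complexAlgebra

variable {m : ℕ} {M : Type*} [TopologicalSpace M] [ChartedSpace (EuclideanHalfSpace (m + 1)) M]
  [IsManifold (𝓡∂ (m + 1)) ∞ M] (g : MetricBdry m M)

theorem coPair_eq_sum {k : ℕ} (G : Matrix (Fin k) (Fin k) ℝ) (a b : Fin k → ℝ) :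
    coPair G a b = ∑ i, ∑ j, G⁻¹ i j * (a i * b j) := by
  simp only [coPair, dotProduct, Matrix.mulVec, Finset.mul_sum]
  refine Finset.sum_congr rfl fun i _ => Finset.sum_congr rfl fun j _ => ?_
  ring

/-- The bilinear extension of `coPair` to complex covectors. -/
def coPairC {k : ℕ} (G : Matrix (Fin k) (Fin k) ℝ) (α β : Fin k → ℂ) : ℂ :=
  ⟨coPair G (fun j => (α j).re) (fun j => (β j).re) - coPair G (fun j => (α j).im) fun j => (β j).im,
    coPair G (fun j => (α j).re) (fun j => (β j).im) + coPair G (fun j => (α j).im) fun j => (β j).re⟩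

theorem cometric_eq (x : M) (α β : CCovector (m := m) x) :
    cometric g x α β = coPairC (gram g x) (fun j => α (stdVec j)) (fun j => β (stdVec j)) := by
  apply Complex.ext
  · simp only [cometric, coPairC, coPair_eq_sum, Complex.re_sum, Complex.mul_re, Complex.ofReal_re,
      Complex.ofReal_im, zero_mul, sub_zero, ← Finset.sum_sub_distrib, ← mul_sub]
  · simp only [cometric, coPairC, coPair_eq_sum, Complex.im_sum, Complex.mul_im, Complex.ofReal_re,
      Complex.ofReal_im, zero_mul, add_zero, ← Finset.sum_add_distrib, ← mul_add]

theorem covNormSq_eq (x : M) (α : CCovector (m := m) x) :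
    covNormSq g x α = coPair (gram g x) (fun j => (α (stdVec j)).re) (fun j => (α (stdVec j)).re) +
      coPair (gram g x) (fun j => (α (stdVec j)).im) (fun j => (α (stdVec j)).im) := by
  simp only [covNormSq, coPair_eq_sum, ← Finset.sum_add_distrib, ← mul_add]
  refine Finset.sum_congr rfl fun i _ => Finset.sum_congr rfl fun j _ => ?_
  rw [Complex.mul_re, Complex.conj_re, Complex.conj_im]
  ring

theorem covNormSq_nonneg (x : M) (α : CCovector (m := m) x) : 0 ≤ covNormSq g x α := by
  rw [covNormSq_eq]
  exact add_nonneg (coPair_self_nonneg (gram_posDef g x) _) (coPair_self_nonneg (gram_posDef g x) _)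

/-- Cauchy-Schwarz for each of the four real pairings; the factor 2 comes from bounding squares of
sums and differences of two of them. -/
theorem norm_cometric_sq_le (x : M) (α β : CCovector (m := m) x) :
    ‖cometric g x α β‖ ^ 2 ≤ 2 * (covNormSq g x α * covNormSq g x β) := by
  rw [cometric_eq, covNormSq_eq, covNormSq_eq, ← Complex.normSq_eq_norm_sq, Complex.normSq_apply,
    coPairC]
  have hG := gram_posDef g x
  set a := fun j => (α (stdVec j)).re
  set b := fun j => (α (stdVec j)).im
  set c := fun j => (β (stdVec j)).re
  set d := fun j => (β (stdVec j)).im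
  have h1 := coPair_sq_le hG a c
  have h2 := coPair_sq_le hG b d
  have h3 := coPair_sq_le hG a d
  have h4 := coPair_sq_le hG b c
  have h5 := sq_nonneg (coPair (gram g x) a c + coPair (gram g x) b d)
  have h6 := sq_nonneg (coPair (gram g x) a d - coPair (gram g x) b c)
  simp only
  nlinarith

/-- Stated for arbitrary covectors rather than differentials, because the one-form A is known to be
measurable only through its components in charts. -/
theorem coPairC_chart {p : M} {y : Euc (m + 1)}
    (hy : y ∈ (extChartAt (𝓡∂ (m + 1)) p).target)
    (α β : CCovector (m := m) ((extChartAt (𝓡∂ (m + 1)) p).symm y)) :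
    cometric g ((extChartAt (𝓡∂ (m + 1)) p).symm y) α β =
      coPairC (chartGram g p y) (fun j => α (coordVec p y j)) (fun j => β (coordVec p y j)) := by
  have key : ∀ γ : TangentSpace (𝓡∂ (m + 1)) ((extChartAt (𝓡∂ (m + 1)) p).symm y) →L[ℝ] ℝ,
      (fun j => γ (coordVec p y j)) = (frm p y).transpose.mulVec fun j => γ (stdVec j) := fun γ =>
    linform_frame (k := m + 1) γ (mfderivWithin 𝓘(ℝ, Euc (m + 1)) (𝓡∂ (m + 1))
      (extChartAt (𝓡∂ (m + 1)) p).symm (range (𝓡∂ (m + 1))) y)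
  have hre := fun γ : CCovector (m := m) ((extChartAt (𝓡∂ (m + 1)) p).symm y) =>
    key (Complex.reCLM.comp γ)
  have him := fun γ : CCovector (m := m) ((extChartAt (𝓡∂ (m + 1)) p).symm y) =>
    key (Complex.imCLM.comp γ)
  simp only [ContinuousLinearMap.comp_apply, Complex.reCLM_apply, Complex.imCLM_apply] at hre him
  rw [cometric_eq, coPairC, coPairC, hre, hre, him, him, chartGram_eq_frm,
    coPair_frame _ _ (isUnit_frm hy), coPair_frame _ _ (isUnit_frm hy),
    coPair_frame _ _ (isUnit_frm hy), coPair_frame _ _ (isUnit_frm hy)]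
  rfl

variable {f : M → ℂ} {x : M}

theorem dC_apply (hf : MDifferentiableAt (𝓡∂ (m + 1)) 𝓘(ℝ, ℂ) f x)
    (v : TangentSpace (𝓡∂ (m + 1)) x) :
    dC (m := m) f x v = ⟨dR (m := m) (fun x => (f x).re) x v, dR (m := m) (fun x => (f x).im) x v⟩ := by
  have h1 := (Complex.reCLM.hasFDerivAt (x := f x)).hasMFDerivAt.comp x hf.hasMFDerivAt
  have h2 := (Complex.imCLM.hasFDerivAt (x := f x)).hasMFDerivAt.comp x hf.hasMFDerivAt
  apply Complex.ext
  · exact (congrArg (fun L : Euc (m + 1) →L[ℝ] ℝ => L v) h1.mfderiv).symm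
  · exact (congrArg (fun L : Euc (m + 1) →L[ℝ] ℝ => L v) h2.mfderiv).symm

theorem covNormSq_dC (hf : MDifferentiableAt (𝓡∂ (m + 1)) 𝓘(ℝ, ℂ) f x) :
    covNormSq g x (dC (m := m) f x) =
      gam g (fun x => (f x).re) (fun x => (f x).re) x +
        gam g (fun x => (f x).im) (fun x => (f x).im) x := by
  have hre : (fun j => (dC (m := m) f x (stdVec j)).re) =
      fun j => dR (m := m) (fun x => (f x).re) x (stdVec j) :=
    funext fun j => congrArg Complex.re (dC_apply hf (stdVec j))
  have him : (fun j => (dC (m := m) f x (stdVec j)).im) =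
      fun j => dR (m := m) (fun x => (f x).im) x (stdVec j) :=
    funext fun j => congrArg Complex.im (dC_apply hf (stdVec j))
  rw [covNormSq_eq, hre, him]
  rfl

theorem norm_normalDeriv_sq (hf : MDifferentiableAt (𝓡∂ (m + 1)) 𝓘(ℝ, ℂ) f x) :
    ‖normalDeriv g f x‖ ^ 2 = normalDerivReal g (fun x => (f x).re) x ^ 2 +
      normalDerivReal g (fun x => (f x).im) x ^ 2 := by
  rw [normalDeriv, dC_apply hf, ← Complex.normSq_eq_norm_sq, Complex.normSq_apply, normalDerivReal,
    normalDerivReal]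
  ring

theorem fderivWithin_complex {k : ℕ} {K : Euc k → ℂ} {S : Set (Euc k)} {y : Euc k}
    (hS : UniqueDiffWithinAt ℝ S y)
    (hr : DifferentiableWithinAt ℝ (fun y => (K y).re) S y)
    (hi : DifferentiableWithinAt ℝ (fun y => (K y).im) S y) (v : Euc k) :
    fderivWithin ℝ K S y v = ⟨fderivWithin ℝ (fun y => (K y).re) S y v,
      fderivWithin ℝ (fun y => (K y).im) S y v⟩ := by
  have h1 := (Complex.equivRealProdCLM.symm.hasFDerivAt
    (x := ((K y).re, (K y).im))).comp_hasFDerivWithinAt y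
    (hr.hasFDerivWithinAt.prodMk hi.hasFDerivWithinAt)
  have h2 : HasFDerivWithinAt K ((Complex.equivRealProdCLM.symm : ℝ × ℝ →L[ℝ] ℂ).comp
      ((fderivWithin ℝ (fun y => (K y).re) S y).prod (fderivWithin ℝ (fun y => (K y).im) S y))) S y :=
    h1.congr (fun z _ => by apply Complex.ext <;> simp) (by apply Complex.ext <;> simp)
  rw [h2.fderivWithin hS]
  apply Complex.ext <;> simp

/-- The metric coefficients are real, so the flux and its divergence split. The splitting of the
flux is needed on the whole chart target, since the flux is differentiated again. -/
theorem laplaceBeltrami_eq (hr : CReg m 2 fun x => (f x).re) (hi : CReg m 2 fun x => (f x).im)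
    (x : M) : laplaceBeltrami g f x =
      ⟨lap g (fun x => (f x).re) x, lap g (fun x => (f x).im) x⟩ := by
  set y₀ := extChartAt (𝓡∂ (m + 1)) x x with hy₀
  have hy : y₀ ∈ (extChartAt (𝓡∂ (m + 1)) x).target := mem_extChartAt_target x
  set Φ : Fin (m + 1) → Euc (m + 1) → ℂ := fun j y => ((√(chartGram g x y).det : ℝ) : ℂ) *
        ∑ k, (((chartGram g x y)⁻¹ j k : ℝ) : ℂ) *
          fderivWithin ℝ (rep x f) (range (𝓡∂ (m + 1))) y (stdVec k) with hΦ
  have hfd : ∀ y ∈ (extChartAt (𝓡∂ (m + 1)) x).target, ∀ k,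
      fderivWithin ℝ (rep x f) (range (𝓡∂ (m + 1))) y (stdVec k) =
        ⟨pd (rep x fun x => (f x).re) y k, pd (rep x fun x => (f x).im) y k⟩ := fun y hy k =>
    fderivWithin_complex (uniqueDiffOn_halfSpace y (extChartAt_target_subset_range x hy))
      (differentiableWithinAt_range two_ne_zero (hr x) hy)
      (differentiableWithinAt_range two_ne_zero (hi x) hy) _
  have hΦr : ∀ j, EqOn (fun y => (Φ j y).re) (flux (chartGram g x) (rep x fun x => (f x).re) j)
      (extChartAt (𝓡∂ (m + 1)) x).target := by
    intro j y hy
    simp only [hΦ, hfd y hy, Complex.re_ofReal_mul, Complex.re_sum]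
    rfl
  have hΦi : ∀ j, EqOn (fun y => (Φ j y).im) (flux (chartGram g x) (rep x fun x => (f x).im) j)
      (extChartAt (𝓡∂ (m + 1)) x).target := by
    intro j y hy
    simp only [hΦ, hfd y hy, Complex.im_ofReal_mul, Complex.im_sum]
    rfl
  have hfl : ∀ {F : Euc (m + 1) → ℝ}, ContDiffOn ℝ 2 F (extChartAt (𝓡∂ (m + 1)) x).target →
      ∀ j, ContDiffOn ℝ 1 (flux (chartGram g x) F j) (extChartAt (𝓡∂ (m + 1)) x).target :=
    fun hF j => contDiffOn_flux g (k := 1) (n := 2) (by norm_num) (by simp) hF j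
  have hder : ∀ j, fderivWithin ℝ (Φ j) (range (𝓡∂ (m + 1))) y₀ (stdVec j) =
      ⟨pd (flux (chartGram g x) (rep x fun x => (f x).re) j) y₀ j,
        pd (flux (chartGram g x) (rep x fun x => (f x).im) j) y₀ j⟩ := by
    intro j
    have h1 := fderivWithin_complex (K := Φ j)
      (uniqueDiffOn_halfSpace y₀ (extChartAt_target_subset_range x hy))
      (differentiableWithinAt_range one_ne_zero ((hfl (hr x) j).congr (hΦr j)) hy)
      (differentiableWithinAt_range one_ne_zero ((hfl (hi x) j).congr (hΦi j)) hy) (stdVec j)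
    rw [h1]
    exact Complex.ext (congrFun (pd_congr (hΦr j) hy) j) (congrFun (pd_congr (hΦi j) hy) j)
  have h2 : laplaceBeltrami g f x = ((1 / √(chartGram g x y₀).det : ℝ) : ℂ) *
      ∑ j, fderivWithin ℝ (Φ j) (range (𝓡∂ (m + 1))) y₀ (stdVec j) := rfl
  rw [h2]
  simp only [hder]
  apply Complex.ext
  · simp only [Complex.re_ofReal_mul, Complex.re_sum]; rfl
  · simp only [Complex.im_ofReal_mul, Complex.im_sum]; rfl

end complexAlgebra

section complexRegularity

variable {m : ℕ} {M : Type*} [TopologicalSpace M] [ChartedSpace (EuclideanHalfSpace (m + 1)) M]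
  [IsManifold (𝓡∂ (m + 1)) ∞ M] {T : ℝ} {u : ℝ → M → ℂ}

instance isManifoldTwo : IsManifold (𝓡∂ (m + 1)) 2 M := IsManifold.of_le (n := ∞) (by norm_cast)

theorem jreg_re (hu : ContMDiffOn (𝓘(ℝ, ℝ).prod (𝓡∂ (m + 1))) 𝓘(ℝ, ℂ) 2
    (fun z : ℝ × M => u z.1 z.2) (Icc 0 T ×ˢ univ)) : JReg m T 2 fun t x => (u t x).re :=
  jreg_of_contMDiffOn (Complex.reCLM.contDiff.contMDiff.comp_contMDiffOn hu)

theorem jreg_im (hu : ContMDiffOn (𝓘(ℝ, ℝ).prod (𝓡∂ (m + 1))) 𝓘(ℝ, ℂ) 2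
    (fun z : ℝ × M => u z.1 z.2) (Icc 0 T ×ˢ univ)) : JReg m T 2 fun t x => (u t x).im :=
  jreg_of_contMDiffOn (Complex.imCLM.contDiff.contMDiff.comp_contMDiffOn hu)

theorem mdifferentiableAt_slice (hu : ContMDiffOn (𝓘(ℝ, ℝ).prod (𝓡∂ (m + 1))) 𝓘(ℝ, ℂ) 2
    (fun z : ℝ × M => u z.1 z.2) (Icc 0 T ×ˢ univ)) {t : ℝ} (ht : t ∈ Icc 0 T) (x : M) :
    MDifferentiableAt (𝓡∂ (m + 1)) 𝓘(ℝ, ℂ) (u t) x := by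
  have h1 : ContMDiff (𝓡∂ (m + 1)) (𝓘(ℝ, ℝ).prod (𝓡∂ (m + 1))) 2 fun x : M => (t, x) :=
    contMDiff_const.prodMk contMDiff_id
  have h2 := hu.comp_contMDiff h1 fun x => ⟨ht, mem_univ _⟩
  exact (h2 x).mdifferentiableAt (by norm_num)

theorem deriv_eq_dtd (hu : ContMDiffOn (𝓘(ℝ, ℝ).prod (𝓡∂ (m + 1))) 𝓘(ℝ, ℂ) 2
    (fun z : ℝ × M => u z.1 z.2) (Icc 0 T ×ˢ univ)) {t : ℝ} (ht : t ∈ Ioo 0 T) (x : M) :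
    deriv (fun s => u s x) t =
      ⟨dtd T (fun t x => (u t x).re) t x, dtd T (fun t x => (u t x).im) t x⟩ := by
  have hn := Icc_mem_nhds ht.1 ht.2
  have h1 := ((jreg_re hu).hasDerivWithinAt two_ne_zero (Ioo_subset_Icc_self ht) x).hasDerivAt hn
  have h2 := ((jreg_im hu).hasDerivWithinAt two_ne_zero (Ioo_subset_Icc_self ht) x).hasDerivAt hn
  have h3 := (h1.ofReal_comp).add ((h2.ofReal_comp).mul_const Complex.I)
  have h4 : (fun s => u s x) = fun s => ((u s x).re : ℂ) + ((u s x).im : ℂ) * Complex.I := by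
    funext s; exact (Complex.re_add_im _).symm
  rw [h4]
  refine h3.deriv.trans ?_
  apply Complex.ext <;> simp

end complexRegularity

/-! ### Measurability of the lower order terms -/

section measurability

variable {m : ℕ} {M : Type*} [TopologicalSpace M] [ChartedSpace (EuclideanHalfSpace (m + 1)) M]
  [IsManifold (𝓡∂ (m + 1)) ∞ M] [CompactSpace M] [MeasurableSpace M] [BorelSpace M]
  {T : ℝ}

/-- Measurability on the cylinder may be checked in charts. -/
theorem aestronglyMeasurable_cyl_of_chart {E : Type*} [TopologicalSpace E]
    [TopologicalSpace.PseudoMetrizableSpace E] (g : MetricBdry m M) {f : ℝ × M → E}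
    (h : ∀ p : M, ∃ F : ℝ × Euc (m + 1) → E,
      AEStronglyMeasurable F (((volume : Measure ℝ).restrict (Ioo 0 T)).prod
        (volume.restrict (extChartAt (𝓡∂ (m + 1)) p).target)) ∧
      ∀ t ∈ Ioo 0 T, ∀ y ∈ (extChartAt (𝓡∂ (m + 1)) p).target,
        f (t, (extChartAt (𝓡∂ (m + 1)) p).symm y) = F (t, y)) :
    AEStronglyMeasurable f (cylMeasure g T) := by
  have := isFiniteMeasure_volumeMeasure g
  obtain ⟨s, hs⟩ := CompactSpace.elim_nhds_subcover
    (fun p : M => (extChartAt (𝓡∂ (m + 1)) p).source) fun p => extChartAt_source_mem_nhds p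
  have hcov : (⋃ p : s, (univ : Set ℝ) ×ˢ (extChartAt (𝓡∂ (m + 1)) (p : M)).source) = univ := by
    refine eq_univ_of_forall fun z => ?_
    have hz : z.2 ∈ ⋃ p ∈ s, (extChartAt (𝓡∂ (m + 1)) p).source := by
      rw [hs]; trivial
    simp only [mem_iUnion] at hz
    obtain ⟨p, hp, hz⟩ := hz
    exact mem_iUnion.2 ⟨⟨p, hp⟩, mem_univ _, hz⟩
  rw [← Measure.restrict_univ (μ := cylMeasure g T), ← hcov]
  refine AEStronglyMeasurable.iUnion fun p => ?_
  obtain ⟨F, hF, hfF⟩ := h p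
  set φ := extChartAt (𝓡∂ (m + 1)) (p : M) with hφ
  have hsrc : MeasurableSet φ.source := (isOpen_extChartAt_source (p : M)).measurableSet
  classical
  -- The chart extended by zero is Borel on all of M and pulls Lebesgue null sets back to null sets.
  -- Composition with it therefore preserves almost everywhere strong measurability.
  set θ : M → Euc (m + 1) := φ.source.piecewise φ fun _ => 0 with hθ
  have hθm : Measurable θ :=
    (continuousOn_extChartAt (p : M)).measurable_piecewise continuousOn_const hsrc
  have hmeas : (cylMeasure g T).restrict (univ ×ˢ φ.source) =
      ((volume : Measure ℝ).restrict (Ioo 0 T)).prod (chartVolume g (p : M)) := by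
    rw [cylMeasure, ← Measure.prod_restrict, Measure.restrict_univ, volumeMeasure_restrict]
  have hq : Measure.QuasiMeasurePreserving θ (chartVolume g (p : M)) (volume.restrict φ.target) := by
    refine ⟨hθm, Measure.AbsolutelyContinuous.mk fun S hS h0 => ?_⟩
    rw [Measure.map_apply hθm hS, chartVolume_eq_patch, patch_apply (measurableSet_target (p : M))
      (continuousOn_extChartAt_symm (p : M)) (hθm hS)]
    refine setLIntegral_measure_zero _ _ (measure_mono_null ?_ ((Measure.restrict_apply hS).symm.trans h0))
    rintro y ⟨hy, hyS⟩
    refine ⟨?_, hy⟩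
    have h1 : θ (φ.symm y) = y := by
      rw [hθ, piecewise_eq_of_mem _ _ _ (φ.map_target hy), φ.right_inv hy]
    have h2 : θ (φ.symm y) ∈ S := hyS
    rwa [h1] at h2
  have : SFinite (chartVolume g (p : M)) := by
    rw [← volumeMeasure_restrict]; infer_instance
  have hqq := MeasureTheory.QuasiMeasurePreserving.prodMap
    (Measure.QuasiMeasurePreserving.id ((volume : Measure ℝ).restrict (Ioo 0 T))) hq
  rw [hmeas]
  refine (hF.comp_quasiMeasurePreserving hqq).congr ?_
  rw [← volumeMeasure_restrict]
  have a1 := (Measure.quasiMeasurePreserving_fst (μ := (volume : Measure ℝ).restrict (Ioo 0 T))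
    (ν := (volumeMeasure g).restrict φ.source)).ae (ae_restrict_mem measurableSet_Ioo)
  have a2 := (Measure.quasiMeasurePreserving_snd (μ := (volume : Measure ℝ).restrict (Ioo 0 T))
    (ν := (volumeMeasure g).restrict φ.source)).ae (ae_restrict_mem hsrc)
  filter_upwards [a1, a2] with z hz1 hz2
  have h1 := hfF z.1 hz1 (φ z.2) (φ.map_source hz2)
  rw [φ.left_inv hz2] at h1
  have h2 : θ z.2 = φ z.2 := piecewise_eq_of_mem _ _ _ hz2
  rw [Function.comp_apply, Prod.map, h2]
  exact h1.symm

variable {k : ℕ} {α : Type*} [MeasurableSpace α] {μ : Measure α}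

theorem aestronglyMeasurable_coPair {G : α → Matrix (Fin k) (Fin k) ℝ} {a b : α → Fin k → ℝ}
    (hG : ∀ i j, AEStronglyMeasurable (fun z => (G z)⁻¹ i j) μ)
    (ha : ∀ j, AEStronglyMeasurable (fun z => a z j) μ)
    (hb : ∀ j, AEStronglyMeasurable (fun z => b z j) μ) :
    AEStronglyMeasurable (fun z => coPair (G z) (a z) (b z)) μ := by
  simp only [coPair_eq_sum]
  exact Finset.aestronglyMeasurable_fun_sum _ fun i _ => Finset.aestronglyMeasurable_fun_sum _ fun j _ =>
    (hG i j).mul ((ha i).mul (hb j))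

theorem aestronglyMeasurable_coPairC {G : α → Matrix (Fin k) (Fin k) ℝ} {a b : α → Fin k → ℂ}
    (hG : ∀ i j, AEStronglyMeasurable (fun z => (G z)⁻¹ i j) μ)
    (ha : ∀ j, AEStronglyMeasurable (fun z => a z j) μ)
    (hb : ∀ j, AEStronglyMeasurable (fun z => b z j) μ) :
    AEStronglyMeasurable (fun z => coPairC (G z) (a z) (b z)) μ := by
  have har := fun j => Complex.continuous_re.comp_aestronglyMeasurable (ha j)
  have hai := fun j => Complex.continuous_im.comp_aestronglyMeasurable (ha j)
  have hbr := fun j => Complex.continuous_re.comp_aestronglyMeasurable (hb j)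
  have hbi := fun j => Complex.continuous_im.comp_aestronglyMeasurable (hb j)
  have h1 := (aestronglyMeasurable_coPair hG har hbr).sub (aestronglyMeasurable_coPair hG hai hbi)
  have h2 := (aestronglyMeasurable_coPair hG har hbi).add (aestronglyMeasurable_coPair hG hai hbr)
  refine (Complex.equivRealProdCLM.symm.continuous.comp_aestronglyMeasurable (h1.prodMk h2)).congr
    (Filter.Eventually.of_forall fun z => ?_)
  apply Complex.ext <;> simp [coPairC]

theorem aestronglyMeasurable_cdom {E : Type*} [TopologicalSpace E]
    [TopologicalSpace.PseudoMetrizableSpace E] {p : M} {F : ℝ × Euc (m + 1) → E}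
    (hF : ContinuousOn F (cdom m T p)) :
    AEStronglyMeasurable F (((volume : Measure ℝ).restrict (Ioo 0 T)).prod
      (volume.restrict (extChartAt (𝓡∂ (m + 1)) p).target)) := by
  rw [Measure.prod_restrict]
  refine (hF.mono ?_).aestronglyMeasurable (measurableSet_Ioo.prod (measurableSet_target p))
  exact prod_mono_left Ioo_subset_Icc_self

theorem aestronglyMeasurable_chartGram_inv (g : MetricBdry m M) (T : ℝ) (p : M)
    (i j : Fin (m + 1)) :
    AEStronglyMeasurable (fun z : ℝ × Euc (m + 1) => (chartGram g p z.2)⁻¹ i j)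
      (((volume : Measure ℝ).restrict (Ioo 0 T)).prod
        (volume.restrict (extChartAt (𝓡∂ (m + 1)) p).target)) :=
  aestronglyMeasurable_cdom (ContDiffOn.matrix_inv (n := 0) (contDiffOn_chartGram_cdom g T p (by simp))
    (fun _ hz => (chartGram_det_pos g hz.2).ne') i j).continuousOn

variable {g : MetricBdry m M} {A B : ℝ → (x : M) → CCovector (m := m) x}

theorem aestronglyMeasurable_cometric
    (hA : ∀ (p : M) (j : Fin (m + 1)), AEStronglyMeasurable
      (fun z : ℝ × Euc (m + 1) => A z.1 ((extChartAt (𝓡∂ (m + 1)) p).symm z.2) (coordVec p z.2 j))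
      ((volume.restrict (Ioo 0 T)).prod (volume.restrict (extChartAt (𝓡∂ (m + 1)) p).target)))
    (hB : ∀ (p : M) (j : Fin (m + 1)), AEStronglyMeasurable
      (fun z : ℝ × Euc (m + 1) => B z.1 ((extChartAt (𝓡∂ (m + 1)) p).symm z.2) (coordVec p z.2 j))
      ((volume.restrict (Ioo 0 T)).prod (volume.restrict (extChartAt (𝓡∂ (m + 1)) p).target))) :
    AEStronglyMeasurable (fun z : ℝ × M => cometric g z.2 (A z.1 z.2) (B z.1 z.2))
      (cylMeasure g T) :=
  aestronglyMeasurable_cyl_of_chart g fun p =>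
    ⟨_, aestronglyMeasurable_coPairC (aestronglyMeasurable_chartGram_inv g T p) (hA p) (hB p),
      fun _ _ _ hy => coPairC_chart g hy _ _⟩

theorem aestronglyMeasurable_dC_coordVec (hT : 0 < T) {u : ℝ → M → ℂ}
    (hu : ContMDiffOn (𝓘(ℝ, ℝ).prod (𝓡∂ (m + 1))) 𝓘(ℝ, ℂ) 2
      (fun z : ℝ × M => u z.1 z.2) (Icc 0 T ×ˢ univ)) (p : M) (j : Fin (m + 1)) :
    AEStronglyMeasurable (fun z : ℝ × Euc (m + 1) =>
      dC (m := m) (u z.1) ((extChartAt (𝓡∂ (m + 1)) p).symm z.2) (coordVec p z.2 j))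
      ((volume.restrict (Ioo 0 T)).prod (volume.restrict (extChartAt (𝓡∂ (m + 1)) p).target)) := by
  have hr := (contDiffOn_pd_slice hT (k := 0) (n := 2) (by simp) (jreg_re hu p) j).continuousOn
  have hi := (contDiffOn_pd_slice hT (k := 0) (n := 2) (by simp) (jreg_im hu p) j).continuousOn
  have h1 : ContinuousOn (fun z : ℝ × Euc (m + 1) =>
      dC (m := m) (u z.1) ((extChartAt (𝓡∂ (m + 1)) p).symm z.2) (coordVec p z.2 j))
      (cdom m T p) := by
    refine (Complex.equivRealProdCLM.symm.continuous.comp_continuousOn (hr.prodMk hi)).congr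
      fun z hz => ?_
    have hd := mdifferentiableAt_slice hu hz.1 ((extChartAt (𝓡∂ (m + 1)) p).symm z.2)
    rw [dC_apply hd]
    have e1 := mfderivWithin_comp_symm hz.2 (((jreg_re hu).slice hz.1).mdifferentiableAt (by norm_num) _) j
    have e2 := mfderivWithin_comp_symm hz.2 (((jreg_im hu).slice hz.1).mdifferentiableAt (by norm_num) _) j
    apply Complex.ext
    · exact e1.trans (by simp [pd]; rfl)
    · exact e2.trans (by simp [pd]; rfl)
  exact aestronglyMeasurable_cdom h1

end measurability

/-! ### The estimate for complex-valued functions -/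

section complexCarleman

variable {m : ℕ} {M : Type*} [TopologicalSpace M] [ChartedSpace (EuclideanHalfSpace (m + 1)) M]
  [IsManifold (𝓡∂ (m + 1)) ∞ M] [CompactSpace M] [MeasurableSpace M] [BorelSpace M]
  {N : Type*} [TopologicalSpace N] [ChartedSpace (Euc m) N] [IsManifold (𝓡 m) ∞ N]
  {g : MetricBdry m M} {h : MetricNoBdry m N} {x₁ : M → ℝ} {x' : M → N}
  {T lam s a : ℝ}

theorem IsProductEmbedding.continuous_weight (hx : IsProductEmbedding g h x₁ x') :
    Continuous fun z : ℝ × M => convWeight lam s a z.1 (x₁ z.2) :=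
  (contDiff_convWeight lam s a).continuous.comp
    (continuous_fst.prodMk (hx.creg_fst.continuous.comp continuous_snd))

section realIntegrable

variable {u : ℝ → M → ℝ}

theorem integrable_final_gam (hx : IsProductEmbedding g h x₁ x') (hT : 0 < T)
    (hu : JReg m T 2 u) : Integrable
      (fun x => convWeight lam s a T (x₁ x) ^ 2 * gam g (u T) (u T) x) (volumeMeasure g) := by
  have hs := hu.slice (t := T) ⟨hT.le, le_rfl⟩
  exact integrable_volume g (((creg_convWeight hx T).continuous.pow 2).mul
    (CReg.gam g (k := 0) (n := 2) (by simp) (by simp) hs hs).continuous)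

theorem integrable_final_sq (hx : IsProductEmbedding g h x₁ x') (hT : 0 < T)
    (hu : JReg m T 2 u) : Integrable
      (fun x => convWeight lam s a T (x₁ x) ^ 2 * u T x ^ 2) (volumeMeasure g) := by
  have hs := hu.slice (t := T) ⟨hT.le, le_rfl⟩
  exact integrable_volume g (((creg_convWeight hx T).continuous.pow 2).mul (hs.continuous.pow 2))

theorem integrable_cyl_gam (hx : IsProductEmbedding g h x₁ x') (hT : 0 < T)
    (hu : JReg m T 2 u) : Integrable
      (fun z : ℝ × M => convWeight lam s a z.1 (x₁ z.2) ^ 2 * gam g (u z.1) (u z.1) z.2)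
      (cylMeasure g T) :=
  integrable_cyl g (w := fun t x => convWeight lam s a t (x₁ x) ^ 2 * gam g (u t) (u t) x)
    ((hx.continuous_weight.pow 2).continuousOn.mul
      (JReg.gam hT g (k := 0) (n := 2) (by simp) (by simp) hu hu).continuousOn)

theorem integrable_cyl_sq (hx : IsProductEmbedding g h x₁ x') (hu : JReg m T 2 u) : Integrable
      (fun z : ℝ × M => convWeight lam s a z.1 (x₁ z.2) ^ 2 * u z.1 z.2 ^ 2) (cylMeasure g T) :=
  integrable_cyl g (w := fun t x => convWeight lam s a t (x₁ x) ^ 2 * u t x ^ 2)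
    ((hx.continuous_weight.pow 2).continuousOn.mul (hu.continuousOn.pow 2))

theorem integrable_cyl_heat (hx : IsProductEmbedding g h x₁ x') (hT : 0 < T)
    (hu : JReg m T 2 u) : Integrable
      (fun z : ℝ × M => convWeight lam s a z.1 (x₁ z.2) ^ 2 *
        (dtd T u z.1 z.2 - lap g (u z.1) z.2) ^ 2) (cylMeasure g T) :=
  integrable_cyl g (w := fun t x => convWeight lam s a t (x₁ x) ^ 2 *
      (dtd T u t x - lap g (u t) x) ^ 2)
    ((hx.continuous_weight.pow 2).continuousOn.mul
      (((hu.dtd hT (k := 1) (by norm_num)).continuousOn.sub (hu.lap hT g).continuousOn).pow 2))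

theorem integrable_lateral_sq (hx : IsProductEmbedding g h x₁ x') (hT : 0 < T)
    (hu : JReg m T 2 u) : Integrable
      (fun z : ℝ × M => convWeight lam s a z.1 (x₁ z.2) ^ 2 *
        normalDerivReal g (u z.1) z.2 ^ 2 * normalDerivReal g x₁ z.2)
      (((volume : Measure ℝ).restrict (Ioo 0 T)).prod (surfaceMeasure g)) :=
  integrable_lateral g (w := fun t x => convWeight lam s a t (x₁ x) ^ 2 *
        normalDerivReal g (u t) x ^ 2 * normalDerivReal g x₁ x)
    (((hx.continuous_weight.pow 2).continuousOn.mul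
      (JReg.continuousOn_normalDerivReal hT g (hu.of_le (by norm_num))|>.pow 2)).mul
      ((hx.creg_fst.of_le (by norm_num)).continuousOn_normalDerivReal g |>.comp
        continuousOn_snd fun _ hz => hz.2))

theorem integrable_lateral_conv (hx : IsProductEmbedding g h x₁ x') (hT : 0 < T)
    (hu : JReg m T 2 u) : Integrable
      (fun z : ℝ × M => 2 * ((lam - s * x₁ z.2) * (convWeight lam s a z.1 (x₁ z.2) ^ 2 *
        normalDerivReal g (u z.1) z.2 ^ 2) * normalDerivReal g x₁ z.2))
      (((volume : Measure ℝ).restrict (Ioo 0 T)).prod (surfaceMeasure g)) := by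
  have hc : Continuous fun z : ℝ × M => lam - s * x₁ z.2 :=
    continuous_const.sub (continuous_const.mul (hx.creg_fst.continuous.comp continuous_snd))
  exact integrable_lateral g (w := fun t x => 2 * ((lam - s * x₁ x) * (convWeight lam s a t (x₁ x) ^ 2 *
        normalDerivReal g (u t) x ^ 2) * normalDerivReal g x₁ x))
    (continuousOn_const.mul ((hc.continuousOn.mul ((hx.continuous_weight.pow 2).continuousOn.mul
      (JReg.continuousOn_normalDerivReal hT g (hu.of_le (by norm_num))|>.pow 2))).mul
      ((hx.creg_fst.of_le (by norm_num)).continuousOn_normalDerivReal g |>.comp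
        continuousOn_snd fun _ hz => hz.2)))

end realIntegrable

section complexIntegrable

variable {u : ℝ → M → ℂ}

theorem covNormSq_final (hu : ContMDiffOn (𝓘(ℝ, ℝ).prod (𝓡∂ (m + 1))) 𝓘(ℝ, ℂ) 2
    (fun z : ℝ × M => u z.1 z.2) (Icc 0 T ×ˢ univ))
    (hT : 0 < T) (x : M) : covNormSq g x (dC (m := m) (u T) x) =
    gam g (fun x => (u T x).re) (fun x => (u T x).re) x +
      gam g (fun x => (u T x).im) (fun x => (u T x).im) x :=
  covNormSq_dC g (mdifferentiableAt_slice hu ⟨hT.le, le_rfl⟩ x)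

theorem ae_covNormSq (hu : ContMDiffOn (𝓘(ℝ, ℝ).prod (𝓡∂ (m + 1))) 𝓘(ℝ, ℂ) 2
    (fun z : ℝ × M => u z.1 z.2) (Icc 0 T ×ˢ univ)) :
    ∀ᵐ z ∂(cylMeasure g T), covNormSq g z.2 (dC (m := m) (u z.1) z.2) =
    gam g (fun x => (u z.1 x).re) (fun x => (u z.1 x).re) z.2 +
      gam g (fun x => (u z.1 x).im) (fun x => (u z.1 x).im) z.2 := by
  filter_upwards [ae_cyl_interior g T] with z hz
  exact covNormSq_dC g (mdifferentiableAt_slice hu (Ioo_subset_Icc_self hz.1) z.2)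

theorem ae_heat (hu : ContMDiffOn (𝓘(ℝ, ℝ).prod (𝓡∂ (m + 1))) 𝓘(ℝ, ℂ) 2
    (fun z : ℝ × M => u z.1 z.2) (Icc 0 T ×ˢ univ)) :
    ∀ᵐ z ∂(cylMeasure g T),
    deriv (fun s => u s z.2) z.1 - laplaceBeltrami g (u z.1) z.2 =
    ⟨dtd T (fun t x => (u t x).re) z.1 z.2 - lap g (fun x => (u z.1 x).re) z.2,
      dtd T (fun t x => (u t x).im) z.1 z.2 - lap g (fun x => (u z.1 x).im) z.2⟩ := by
  filter_upwards [ae_cyl_interior g T] with z hz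
  rw [deriv_eq_dtd hu hz.1, laplaceBeltrami_eq g ((jreg_re hu).slice (Ioo_subset_Icc_self hz.1))
    ((jreg_im hu).slice (Ioo_subset_Icc_self hz.1))]
  rfl

theorem ae_normalDeriv (hu : ContMDiffOn (𝓘(ℝ, ℝ).prod (𝓡∂ (m + 1))) 𝓘(ℝ, ℂ) 2
    (fun z : ℝ × M => u z.1 z.2) (Icc 0 T ×ˢ univ)) :
    ∀ᵐ z ∂(((volume : Measure ℝ).restrict (Ioo 0 T)).prod (surfaceMeasure g)),
    ‖normalDeriv g (u z.1) z.2‖ ^ 2 = normalDerivReal g (fun x => (u z.1 x).re) z.2 ^ 2 +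
      normalDerivReal g (fun x => (u z.1 x).im) z.2 ^ 2 := by
  filter_upwards [ae_lateral g T] with z hz
  exact norm_normalDeriv_sq g (mdifferentiableAt_slice hu (Ioo_subset_Icc_self hz.1) z.2)

theorem integrable_final_covNormSq (hu : ContMDiffOn (𝓘(ℝ, ℝ).prod (𝓡∂ (m + 1))) 𝓘(ℝ, ℂ) 2
    (fun z : ℝ × M => u z.1 z.2) (Icc 0 T ×ˢ univ))
    (hx : IsProductEmbedding g h x₁ x') (hT : 0 < T) : Integrable
    (fun x => convWeight lam s a T (x₁ x) ^ 2 * covNormSq g x (dC (m := m) (u T) x))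
      (volumeMeasure g) := by
  refine ((integrable_final_gam (lam := lam) (s := s) (a := a) hx hT (jreg_re hu)).add
    (integrable_final_gam (lam := lam) (s := s) (a := a) hx hT (jreg_im hu))).congr
    (Filter.Eventually.of_forall fun x => ?_)
  beta_reduce
  rw [covNormSq_final hu hT, mul_add]; rfl

theorem integrable_final_norm_sq (hu : ContMDiffOn (𝓘(ℝ, ℝ).prod (𝓡∂ (m + 1))) 𝓘(ℝ, ℂ) 2
    (fun z : ℝ × M => u z.1 z.2) (Icc 0 T ×ˢ univ))
    (hx : IsProductEmbedding g h x₁ x') (hT : 0 < T) : Integrable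
    (fun x => convWeight lam s a T (x₁ x) ^ 2 * ‖u T x‖ ^ 2) (volumeMeasure g) := by
  refine ((integrable_final_sq (lam := lam) (s := s) (a := a) hx hT (jreg_re hu)).add
    (integrable_final_sq (lam := lam) (s := s) (a := a) hx hT (jreg_im hu))).congr
    (Filter.Eventually.of_forall fun x => ?_)
  beta_reduce
  rw [← Complex.normSq_eq_norm_sq, Complex.normSq_apply, mul_add, ← sq, ← sq]; rfl

theorem integrable_cyl_covNormSq (hu : ContMDiffOn (𝓘(ℝ, ℝ).prod (𝓡∂ (m + 1))) 𝓘(ℝ, ℂ) 2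
    (fun z : ℝ × M => u z.1 z.2) (Icc 0 T ×ˢ univ))
    (hx : IsProductEmbedding g h x₁ x') (hT : 0 < T) : Integrable
    (fun z : ℝ × M => convWeight lam s a z.1 (x₁ z.2) ^ 2 *
      covNormSq g z.2 (dC (m := m) (u z.1) z.2)) (cylMeasure g T) := by
  refine ((integrable_cyl_gam (lam := lam) (s := s) (a := a) hx hT (jreg_re hu)).add
    (integrable_cyl_gam (lam := lam) (s := s) (a := a) hx hT (jreg_im hu))).congr ?_
  filter_upwards [ae_covNormSq hu] with z hz
  rw [hz, mul_add]; rfl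

theorem integrable_cyl_norm_sq (hu : ContMDiffOn (𝓘(ℝ, ℝ).prod (𝓡∂ (m + 1))) 𝓘(ℝ, ℂ) 2
    (fun z : ℝ × M => u z.1 z.2) (Icc 0 T ×ˢ univ))
    (hx : IsProductEmbedding g h x₁ x') : Integrable
    (fun z : ℝ × M => convWeight lam s a z.1 (x₁ z.2) ^ 2 * ‖u z.1 z.2‖ ^ 2) (cylMeasure g T) := by
  refine ((integrable_cyl_sq (lam := lam) (s := s) (a := a) hx (jreg_re hu)).add
    (integrable_cyl_sq (lam := lam) (s := s) (a := a) hx (jreg_im hu))).congr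
    (Filter.Eventually.of_forall fun x => ?_)
  beta_reduce
  rw [← Complex.normSq_eq_norm_sq, Complex.normSq_apply, mul_add, ← sq, ← sq]; rfl

theorem integrable_cyl_norm_heat (hu : ContMDiffOn (𝓘(ℝ, ℝ).prod (𝓡∂ (m + 1))) 𝓘(ℝ, ℂ) 2
    (fun z : ℝ × M => u z.1 z.2) (Icc 0 T ×ˢ univ))
    (hx : IsProductEmbedding g h x₁ x') (hT : 0 < T) : Integrable
    (fun z : ℝ × M => convWeight lam s a z.1 (x₁ z.2) ^ 2 *
      ‖deriv (fun s => u s z.2) z.1 - laplaceBeltrami g (u z.1) z.2‖ ^ 2) (cylMeasure g T) := by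
  refine ((integrable_cyl_heat (lam := lam) (s := s) (a := a) hx hT (jreg_re hu)).add
    (integrable_cyl_heat (lam := lam) (s := s) (a := a) hx hT (jreg_im hu))).congr ?_
  filter_upwards [ae_heat (g := g) hu] with z hz
  rw [hz, ← Complex.normSq_eq_norm_sq, Complex.normSq_apply, mul_add, ← sq, ← sq]; rfl

theorem integrable_lateral_norm_sq (hu : ContMDiffOn (𝓘(ℝ, ℝ).prod (𝓡∂ (m + 1))) 𝓘(ℝ, ℂ) 2
    (fun z : ℝ × M => u z.1 z.2) (Icc 0 T ×ˢ univ))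
    (hx : IsProductEmbedding g h x₁ x') (hT : 0 < T) : Integrable
    (fun z : ℝ × M => convWeight lam s a z.1 (x₁ z.2) ^ 2 * ‖normalDeriv g (u z.1) z.2‖ ^ 2 *
      normalDerivReal g x₁ z.2)
      (((volume : Measure ℝ).restrict (Ioo 0 T)).prod (surfaceMeasure g)) := by
  refine ((integrable_lateral_sq (lam := lam) (s := s) (a := a) hx hT (jreg_re hu)).add
    (integrable_lateral_sq (lam := lam) (s := s) (a := a) hx hT (jreg_im hu))).congr ?_
  filter_upwards [ae_normalDeriv (g := g) hu] with z hz
  rw [hz, mul_add, add_mul]; rfl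

theorem integrable_lateral_norm_conv (hu : ContMDiffOn (𝓘(ℝ, ℝ).prod (𝓡∂ (m + 1))) 𝓘(ℝ, ℂ) 2
    (fun z : ℝ × M => u z.1 z.2) (Icc 0 T ×ˢ univ))
    (hx : IsProductEmbedding g h x₁ x') (hT : 0 < T) : Integrable
    (fun z : ℝ × M => 2 * ((lam - s * x₁ z.2) * (convWeight lam s a z.1 (x₁ z.2) ^ 2 *
      ‖normalDeriv g (u z.1) z.2‖ ^ 2) * normalDerivReal g x₁ z.2))
      (((volume : Measure ℝ).restrict (Ioo 0 T)).prod (surfaceMeasure g)) := by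
  refine ((integrable_lateral_conv (lam := lam) (s := s) (a := a) hx hT (jreg_re hu)).add
    (integrable_lateral_conv (lam := lam) (s := s) (a := a) hx hT (jreg_im hu))).congr ?_
  filter_upwards [ae_normalDeriv (g := g) hu] with z hz
  rw [hz, Pi.add_apply]; ring

/-- The Carleman estimate for the heat operator on complex-valued functions. -/
theorem carleman_heat_complex [T2Space M]
    (hu : ContMDiffOn (𝓘(ℝ, ℝ).prod (𝓡∂ (m + 1))) 𝓘(ℝ, ℂ) 2
    (fun z : ℝ × M => u z.1 z.2) (Icc 0 T ×ˢ univ))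
    (hx : IsProductEmbedding g h x₁ x') (hT : 0 < T)
    (hu0 : ∀ x, u 0 x = 0)
    (hub : ∀ t ∈ Icc 0 T, ∀ z ∈ (𝓡∂ (m + 1)).boundary M, u t z = 0)
    (hlam : 0 < lam) (hs : 0 < s) (hs4 : s ≤ 4 * lam ^ 2) (ha : 0 ≤ a)
    (hF : ∀ x, lam / 2 ≤ lam - s * x₁ x) (hF2 : ∀ x, lam - s * x₁ x ≤ 2 * lam) :
    1 / 2 * ∫ x, convWeight lam s a T (x₁ x) ^ 2 * covNormSq g x (dC (m := m) (u T) x)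
        ∂(volumeMeasure g) +
      ∫ z, 2 * ((lam - s * x₁ z.2) * (convWeight lam s a z.1 (x₁ z.2) ^ 2 *
        ‖normalDeriv g (u z.1) z.2‖ ^ 2) * normalDerivReal g x₁ z.2)
        ∂(((volume : Measure ℝ).restrict (Ioo 0 T)).prod (surfaceMeasure g)) +
      s / 128 * (∫ z, convWeight lam s a z.1 (x₁ z.2) ^ 2 *
        covNormSq g z.2 (dC (m := m) (u z.1) z.2) ∂(cylMeasure g T) +
        lam ^ 2 * ∫ z, convWeight lam s a z.1 (x₁ z.2) ^ 2 * ‖u z.1 z.2‖ ^ 2 ∂(cylMeasure g T)) ≤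
    ∫ z, convWeight lam s a z.1 (x₁ z.2) ^ 2 *
        ‖deriv (fun s => u s z.2) z.1 - laplaceBeltrami g (u z.1) z.2‖ ^ 2 ∂(cylMeasure g T) +
      8 * lam ^ 2 * ∫ x, convWeight lam s a T (x₁ x) ^ 2 * ‖u T x‖ ^ 2 ∂(volumeMeasure g) := by
  have hr := jreg_re hu
  have hi := jreg_im hu
  -- The heat operator has real coefficients and each squared norm is the sum of its real and
  -- imaginary contributions, so the two real estimates are added.
  have kr := carleman_heat hx hT hr (fun x => by simp [hu0 x])
    (fun t ht z hz => by simp [hub t ht z hz]) hlam hs hs4 ha hF hF2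
  have ki := carleman_heat hx hT hi (fun x => by simp [hu0 x])
    (fun t ht z hz => by simp [hub t ht z hz]) hlam hs hs4 ha hF hF2
  have split : ∀ {v : ℝ → M → ℝ}, JReg m T 2 v →
      ∫ z, convWeight lam s a z.1 (x₁ z.2) ^ 2 *
        (gam g (v z.1) (v z.1) z.2 + lam ^ 2 * v z.1 z.2 ^ 2) ∂(cylMeasure g T) =
      ∫ z, convWeight lam s a z.1 (x₁ z.2) ^ 2 * gam g (v z.1) (v z.1) z.2 ∂(cylMeasure g T) +
      lam ^ 2 * ∫ z, convWeight lam s a z.1 (x₁ z.2) ^ 2 * v z.1 z.2 ^ 2 ∂(cylMeasure g T) := by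
    intro v hv
    rw [← integral_const_mul, ← integral_add (integrable_cyl_gam (lam := lam) (s := s) (a := a) hx hT hv)
      ((integrable_cyl_sq (lam := lam) (s := s) (a := a) hx hv).const_mul _)]
    refine integral_congr_ae (Filter.Eventually.of_forall fun z => ?_)
    simp only
    ring
  rw [split hr] at kr
  rw [split hi] at ki
  have e1 := integral_add (integrable_final_gam (lam := lam) (s := s) (a := a) hx hT hr)
    (integrable_final_gam (lam := lam) (s := s) (a := a) hx hT hi)
  have e2 := integral_add (integrable_lateral_conv (lam := lam) (s := s) (a := a) hx hT hr)
    (integrable_lateral_conv (lam := lam) (s := s) (a := a) hx hT hi)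
  have e3 := integral_add (integrable_cyl_gam (lam := lam) (s := s) (a := a) hx hT hr)
    (integrable_cyl_gam (lam := lam) (s := s) (a := a) hx hT hi)
  have e4 := integral_add (integrable_cyl_sq (lam := lam) (s := s) (a := a) hx hr)
    (integrable_cyl_sq (lam := lam) (s := s) (a := a) hx hi)
  have e5 := integral_add (integrable_cyl_heat (lam := lam) (s := s) (a := a) hx hT hr)
    (integrable_cyl_heat (lam := lam) (s := s) (a := a) hx hT hi)
  have e6 := integral_add (integrable_final_sq (lam := lam) (s := s) (a := a) hx hT hr)
    (integrable_final_sq (lam := lam) (s := s) (a := a) hx hT hi)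
  have f1 : ∫ x, convWeight lam s a T (x₁ x) ^ 2 * covNormSq g x (dC (m := m) (u T) x)
        ∂(volumeMeasure g) = _ := (integral_congr_ae (Filter.Eventually.of_forall fun x => by
    simp only [covNormSq_final hu hT, mul_add])).trans e1
  have f2 : ∫ z, 2 * ((lam - s * x₁ z.2) * (convWeight lam s a z.1 (x₁ z.2) ^ 2 *
        ‖normalDeriv g (u z.1) z.2‖ ^ 2) * normalDerivReal g x₁ z.2)
        ∂(((volume : Measure ℝ).restrict (Ioo 0 T)).prod (surfaceMeasure g)) = _ :=
    (integral_congr_ae (by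
      filter_upwards [ae_normalDeriv (g := g) hu] with z hz
      rw [hz]; ring)).trans e2
  have f3 : ∫ z, convWeight lam s a z.1 (x₁ z.2) ^ 2 *
        covNormSq g z.2 (dC (m := m) (u z.1) z.2) ∂(cylMeasure g T) = _ :=
    (integral_congr_ae (by
      filter_upwards [ae_covNormSq (g := g) hu] with z hz
      rw [hz, mul_add])).trans e3
  have f4 : ∫ z, convWeight lam s a z.1 (x₁ z.2) ^ 2 * ‖u z.1 z.2‖ ^ 2 ∂(cylMeasure g T) = _ :=
    (integral_congr_ae (Filter.Eventually.of_forall fun z => by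
      simp only [← Complex.normSq_eq_norm_sq, Complex.normSq_apply]; ring)).trans e4
  have f5 : ∫ z, convWeight lam s a z.1 (x₁ z.2) ^ 2 *
        ‖deriv (fun s => u s z.2) z.1 - laplaceBeltrami g (u z.1) z.2‖ ^ 2 ∂(cylMeasure g T) = _ :=
    (integral_congr_ae (by
      filter_upwards [ae_heat (g := g) hu] with z hz
      rw [hz, ← Complex.normSq_eq_norm_sq, Complex.normSq_apply]; ring)).trans e5
  have f6 : ∫ x, convWeight lam s a T (x₁ x) ^ 2 * ‖u T x‖ ^ 2 ∂(volumeMeasure g) = _ :=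
    (integral_congr_ae (Filter.Eventually.of_forall fun z => by
      simp only [← Complex.normSq_eq_norm_sq, Complex.normSq_apply]; ring)).trans e6
  rw [f1, f2, f3, f4, f5, f6]
  linarith

end complexIntegrable

end complexCarleman

/-! ### Absorbing the lower order terms -/

section lowerOrder

variable {m : ℕ} {M : Type*} [TopologicalSpace M] [ChartedSpace (EuclideanHalfSpace (m + 1)) M]
  [IsManifold (𝓡∂ (m + 1)) ∞ M]
  {g : MetricBdry m M} {T : ℝ} {A : ℝ → (x : M) → CCovector (m := m) x} {D q u : ℝ → M → ℂ}

theorem sq_norm_add_le (w z : ℂ) : ‖w + z‖ ^ 2 ≤ 2 * (‖w‖ ^ 2 + ‖z‖ ^ 2) :=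
  (pow_le_pow_left₀ (norm_nonneg _) (norm_add_le w z) 2).trans (add_sq_le (a := ‖w‖) (b := ‖z‖))

/-- The difference is -2i⟨A, du⟩ plus a bounded multiple of u. The first has square at most 4 ·
2K|du|², the multiplier is at most KD + 2K + Kq, and the square of their sum costs another factor 2.
-/
theorem norm_lowerOrder_sq_le {K KD Kq : ℝ} {t : ℝ} {x : M} (hA : covNormSq g x (A t x) ≤ K)
    (hD : ‖D t x‖ ≤ KD) (hq : ‖q t x‖ ≤ Kq) :
    ‖convDiff g A D q u t x - (deriv (fun s => u s x) t - laplaceBeltrami g (u t) x)‖ ^ 2 ≤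
      (16 * K + 2 * (KD + 2 * K + Kq) ^ 2) *
        (covNormSq g x (dC (m := m) (u t) x) + ‖u t x‖ ^ 2) := by
  have hA0 := covNormSq_nonneg g x (A t x)
  have hE0 := covNormSq_nonneg g x (dC (m := m) (u t) x)
  set E := covNormSq g x (dC (m := m) (u t) x)
  have hK : 0 ≤ K := hA0.trans hA
  have e1 : convDiff g A D q u t x - (deriv (fun s => u s x) t - laplaceBeltrami g (u t) x) =
      -(2 * Complex.I * cometric g x (A t x) (dC (m := m) (u t) x)) +
        (-(Complex.I * D t x) + cometric g x (A t x) (A t x) + q t x) * u t x := by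
    rw [convDiff]; ring
  have h1 : ‖cometric g x (A t x) (dC (m := m) (u t) x)‖ ^ 2 ≤ 2 * (K * E) :=
    (norm_cometric_sq_le g x _ _).trans (by gcongr)
  have h2 : ‖cometric g x (A t x) (A t x)‖ ≤ 2 * K := by
    refine abs_le_of_sq_le_sq' ?_ (by positivity) |>.2
    refine (norm_cometric_sq_le g x _ _).trans ?_
    have := mul_le_mul hA hA hA0 hK
    nlinarith [sq_nonneg K]
  have h3 : ‖-(Complex.I * D t x) + cometric g x (A t x) (A t x) + q t x‖ ≤ KD + 2 * K + Kq := by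
    refine (norm_add₃_le).trans ?_
    rw [norm_neg, norm_mul, Complex.norm_I, one_mul]
    gcongr
  have h4 : ‖(-(Complex.I * D t x) + cometric g x (A t x) (A t x) + q t x) * u t x‖ ^ 2 ≤
      (KD + 2 * K + Kq) ^ 2 * ‖u t x‖ ^ 2 := by
    rw [norm_mul, mul_pow]
    gcongr
  have h5 : ‖-(2 * Complex.I * cometric g x (A t x) (dC (m := m) (u t) x))‖ ^ 2 ≤ 8 * (K * E) := by
    rw [norm_neg, norm_mul, norm_mul, Complex.norm_I, Complex.norm_ofNat, mul_one, mul_pow]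
    linarith
  rw [e1]
  refine (sq_norm_add_le _ _).trans ?_
  have h6 : 0 ≤ K * ‖u t x‖ ^ 2 := by positivity
  have h7 : 0 ≤ (KD + 2 * K + Kq) ^ 2 * E := by positivity
  linarith

variable [MeasurableSpace M]

theorem ae_norm_le_of_memLp_top {f : ℝ → M → ℂ}
    (hf : MemLp (fun z : ℝ × M => f z.1 z.2) ⊤ (cylMeasure g T)) :
    ∃ K : ℝ, ∀ᵐ z ∂(cylMeasure g T), ‖f z.1 z.2‖ ≤ K := by
  refine ⟨(eLpNormEssSup (fun z : ℝ × M => f z.1 z.2) (cylMeasure g T)).toReal, ?_⟩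
  have h2 := hf.2
  rw [eLpNorm_exponent_top] at h2
  filter_upwards [enorm_ae_le_eLpNormEssSup (fun z : ℝ × M => f z.1 z.2) (cylMeasure g T)] with z hz
  rw [← toReal_enorm]
  exact ENNReal.toReal_mono h2.ne hz

/-- The lower order terms are bounded by the energy density. -/
theorem exists_lowerOrder_bound (hA : IsLInftyOneForm g T A)
    (hD : MemLp (fun z : ℝ × M => D z.1 z.2) ⊤ (cylMeasure g T))
    (hq : MemLp (fun z : ℝ × M => q z.1 z.2) ⊤ (cylMeasure g T)) :
    ∃ K : ℝ, 0 ≤ K ∧ ∀ᵐ z ∂(cylMeasure g T), ∀ u : ℝ → M → ℂ,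
      ‖convDiff g A D q u z.1 z.2 - (deriv (fun s => u s z.2) z.1 - laplaceBeltrami g (u z.1) z.2)‖ ^ 2
        ≤ K * (covNormSq g z.2 (dC (m := m) (u z.1) z.2) + ‖u z.1 z.2‖ ^ 2) := by
  obtain ⟨K, hK⟩ := hA.bounded
  obtain ⟨KD, hKD⟩ := ae_norm_le_of_memLp_top hD
  obtain ⟨Kq, hKq⟩ := ae_norm_le_of_memLp_top hq
  -- The essential bound on |A|² comes without a sign; the maximum makes the constant nonnegative.
  refine ⟨16 * max K 0 + 2 * (KD + 2 * max K 0 + Kq) ^ 2, by positivity, ?_⟩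
  filter_upwards [hK, hKD, hKq] with z h1 h2 h3 u
  exact norm_lowerOrder_sq_le (h1.trans (le_max_left _ _)) h2 h3

end lowerOrder

section absorption

variable {m : ℕ} {M : Type*} [TopologicalSpace M] [ChartedSpace (EuclideanHalfSpace (m + 1)) M]
  [IsManifold (𝓡∂ (m + 1)) ∞ M] [CompactSpace M] [MeasurableSpace M] [BorelSpace M]
  {N : Type*} [TopologicalSpace N] [ChartedSpace (Euc m) N] [IsManifold (𝓡 m) ∞ N]
  {g : MetricBdry m M} {h : MetricNoBdry m N} {x₁ : M → ℝ} {x' : M → N}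
  {T lam s a : ℝ} {A : ℝ → (x : M) → CCovector (m := m) x} {D q u : ℝ → M → ℂ}

theorem aestronglyMeasurable_of_re_im {α : Type*} [MeasurableSpace α] {μ : Measure α} {f : α → ℂ}
    (hr : AEStronglyMeasurable (fun z => (f z).re) μ)
    (hi : AEStronglyMeasurable (fun z => (f z).im) μ) : AEStronglyMeasurable f μ := by
  refine (Complex.equivRealProdCLM.symm.continuous.comp_aestronglyMeasurable (hr.prodMk hi)).congr
    (Filter.Eventually.of_forall fun z => ?_)
  apply Complex.ext <;> simp

theorem aestronglyMeasurable_convDiff (hT : 0 < T) (hA : IsLInftyOneForm g T A)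
    (hD : MemLp (fun z : ℝ × M => D z.1 z.2) ⊤ (cylMeasure g T))
    (hq : MemLp (fun z : ℝ × M => q z.1 z.2) ⊤ (cylMeasure g T))
    (hu : ContMDiffOn (𝓘(ℝ, ℝ).prod (𝓡∂ (m + 1))) 𝓘(ℝ, ℂ) 2
      (fun z : ℝ × M => u z.1 z.2) (Icc 0 T ×ˢ univ)) :
    AEStronglyMeasurable (fun z : ℝ × M => convDiff g A D q u z.1 z.2) (cylMeasure g T) := by
  have hr := jreg_re hu
  have hi := jreg_im hu
  have mu : AEStronglyMeasurable (fun z : ℝ × M => u z.1 z.2) (cylMeasure g T) :=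
    aestronglyMeasurable_of_re_im (integrable_cyl g (w := fun t x => (u t x).re) hr.continuousOn).aestronglyMeasurable
      (integrable_cyl g (w := fun t x => (u t x).im) hi.continuousOn).aestronglyMeasurable
  have mh : AEStronglyMeasurable (fun z : ℝ × M =>
      deriv (fun s => u s z.2) z.1 - laplaceBeltrami g (u z.1) z.2) (cylMeasure g T) := by
    have hh : ∀ v : ℝ → M → ℝ, JReg m T 2 v → AEStronglyMeasurable (fun z : ℝ × M =>
        dtd T v z.1 z.2 - lap g (v z.1) z.2) (cylMeasure g T) := fun v hv =>
      (integrable_cyl g (w := fun t x => dtd T v t x - lap g (v t) x)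
        ((hv.dtd hT (k := 1) (by norm_num)).continuousOn.sub
          (hv.lap hT g).continuousOn)).aestronglyMeasurable
    refine (aestronglyMeasurable_of_re_im (f := fun z : ℝ × M =>
      (⟨dtd T (fun t x => (u t x).re) z.1 z.2 - lap g (fun x => (u z.1 x).re) z.2,
        dtd T (fun t x => (u t x).im) z.1 z.2 - lap g (fun x => (u z.1 x).im) z.2⟩ : ℂ))
      (hh _ hr) (hh _ hi)).congr ?_
    exact (ae_heat hu).mono fun z hz => hz.symm
  have mAu := aestronglyMeasurable_cometric (g := g) (B := fun t => dC (m := m) (u t)) hA.measurable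
    (aestronglyMeasurable_dC_coordVec hT hu)
  have mAA := aestronglyMeasurable_cometric (g := g) hA.measurable hA.measurable
  have m1 := (((mh.sub (mAu.const_mul (2 * Complex.I))).sub ((hD.1.const_mul Complex.I).mul mu)).add
    (mAA.mul mu)).add (hq.1.mul mu)
  refine m1.congr (Filter.Eventually.of_forall fun z => ?_)
  simp only [convDiff, Pi.add_apply, Pi.sub_apply, Pi.mul_apply]

/-- Without integrability the Bochner integral on the right-hand side would be zero by default, and
neither the splitting nor the comparison of weights would apply to it. -/
theorem integrable_cyl_convDiff (hx : IsProductEmbedding g h x₁ x') (hT : 0 < T)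
    (hA : IsLInftyOneForm g T A)
    (hD : MemLp (fun z : ℝ × M => D z.1 z.2) ⊤ (cylMeasure g T))
    (hq : MemLp (fun z : ℝ × M => q z.1 z.2) ⊤ (cylMeasure g T))
    (hu : ContMDiffOn (𝓘(ℝ, ℝ).prod (𝓡∂ (m + 1))) 𝓘(ℝ, ℂ) 2
      (fun z : ℝ × M => u z.1 z.2) (Icc 0 T ×ˢ univ)) :
    Integrable (fun z : ℝ × M => convWeight lam s a z.1 (x₁ z.2) ^ 2 *
      ‖convDiff g A D q u z.1 z.2‖ ^ 2) (cylMeasure g T) := by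
  have := secondCountable_of_compact m M
  obtain ⟨K, -, hb⟩ := exists_lowerOrder_bound hA hD hq
  refine Integrable.mono' (((integrable_cyl_norm_heat (lam := lam) (s := s) (a := a) hu hx hT).add
    (((integrable_cyl_covNormSq (lam := lam) (s := s) (a := a) hu hx hT).add
      (integrable_cyl_norm_sq (lam := lam) (s := s) (a := a) hu hx)).const_mul K)).const_mul 2)
    ((hx.continuous_weight.pow 2).aestronglyMeasurable.mul
      ((aestronglyMeasurable_convDiff hT hA hD hq hu).norm.pow 2)) ?_
  filter_upwards [hb] with z hz
  rw [Real.norm_of_nonneg (by positivity)]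
  have h1 := sq_norm_add_le (deriv (fun s => u s z.2) z.1 - laplaceBeltrami g (u z.1) z.2)
    (convDiff g A D q u z.1 z.2 - (deriv (fun s => u s z.2) z.1 - laplaceBeltrami g (u z.1) z.2))
  rw [add_sub_cancel] at h1
  have h2 := mul_le_mul_of_nonneg_left
    (h1.trans (mul_le_mul_of_nonneg_left (add_le_add_right (hz u) _) zero_le_two))
    (sq_nonneg (convWeight lam s a z.1 (x₁ z.2)))
  refine h2.trans (le_of_eq ?_)
  simp only [Pi.add_apply]
  ring

/-- Write the heat operator as the full operator minus its lower order part and use |w + z|² ≤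
2(|w|² + |z|²) under the weight. -/
theorem integral_heat_le (hx : IsProductEmbedding g h x₁ x') (hT : 0 < T)
    (hA : IsLInftyOneForm g T A)
    (hD : MemLp (fun z : ℝ × M => D z.1 z.2) ⊤ (cylMeasure g T))
    (hq : MemLp (fun z : ℝ × M => q z.1 z.2) ⊤ (cylMeasure g T))
    {K : ℝ} (hK : ∀ᵐ z ∂(cylMeasure g T), ∀ u : ℝ → M → ℂ,
      ‖convDiff g A D q u z.1 z.2 - (deriv (fun s => u s z.2) z.1 - laplaceBeltrami g (u z.1) z.2)‖ ^ 2
        ≤ K * (covNormSq g z.2 (dC (m := m) (u z.1) z.2) + ‖u z.1 z.2‖ ^ 2))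
    (hu : ContMDiffOn (𝓘(ℝ, ℝ).prod (𝓡∂ (m + 1))) 𝓘(ℝ, ℂ) 2
      (fun z : ℝ × M => u z.1 z.2) (Icc 0 T ×ˢ univ)) :
    ∫ z, convWeight lam s a z.1 (x₁ z.2) ^ 2 *
        ‖deriv (fun s => u s z.2) z.1 - laplaceBeltrami g (u z.1) z.2‖ ^ 2 ∂(cylMeasure g T) ≤
      2 * ∫ z, convWeight lam s a z.1 (x₁ z.2) ^ 2 * ‖convDiff g A D q u z.1 z.2‖ ^ 2
        ∂(cylMeasure g T) +
      2 * K * (∫ z, convWeight lam s a z.1 (x₁ z.2) ^ 2 *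
        covNormSq g z.2 (dC (m := m) (u z.1) z.2) ∂(cylMeasure g T) +
        ∫ z, convWeight lam s a z.1 (x₁ z.2) ^ 2 * ‖u z.1 z.2‖ ^ 2 ∂(cylMeasure g T)) := by
  have i1 := (integrable_cyl_convDiff (lam := lam) (s := s) (a := a) hx hT hA hD hq hu).const_mul 2
  have i2 := integrable_cyl_covNormSq (lam := lam) (s := s) (a := a) hu hx hT
  have i3 := integrable_cyl_norm_sq (lam := lam) (s := s) (a := a) (g := g) hu hx
  have i4 : Integrable (fun z : ℝ × M => 2 * K * (convWeight lam s a z.1 (x₁ z.2) ^ 2 *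
      covNormSq g z.2 (dC (m := m) (u z.1) z.2) + convWeight lam s a z.1 (x₁ z.2) ^ 2 *
      ‖u z.1 z.2‖ ^ 2)) (cylMeasure g T) := (i2.add i3).const_mul (2 * K)
  rw [← integral_add i2 i3, ← integral_const_mul, ← integral_const_mul, ← integral_add i1 i4]
  refine integral_mono_ae (integrable_cyl_norm_heat hu hx hT) (i1.add i4) ?_
  filter_upwards [hK] with z hz
  have h1 := sq_norm_add_le (convDiff g A D q u z.1 z.2)
    (-(convDiff g A D q u z.1 z.2 - (deriv (fun s => u s z.2) z.1 - laplaceBeltrami g (u z.1) z.2)))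
  rw [norm_neg, neg_sub, add_sub_cancel] at h1
  have h2 := mul_le_mul_of_nonneg_left
    (h1.trans (mul_le_mul_of_nonneg_left (add_le_add_right (hz u) _) zero_le_two))
    (sq_nonneg (convWeight lam s a z.1 (x₁ z.2)))
  refine h2.trans (le_of_eq ?_)
  ring

end absorption

/-! ### Splitting the lateral boundary by the sign of ∂_ν x₁ -/

section lateral

variable {m : ℕ} {M : Type*} [TopologicalSpace M] [ChartedSpace (EuclideanHalfSpace (m + 1)) M]
  [IsManifold (𝓡∂ (m + 1)) ∞ M] [CompactSpace M] [MeasurableSpace M] [BorelSpace M]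
  {N : Type*} [TopologicalSpace N] [ChartedSpace (Euc m) N] [IsManifold (𝓡 m) ∞ N]
  {g : MetricBdry m M} {h : MetricNoBdry m N} {x₁ : M → ℝ} {x' : M → N}
  {T lam s a : ℝ} {u : ℝ → M → ℂ}

theorem IsProductEmbedding.continuousOn_normal (hx : IsProductEmbedding g h x₁ x') :
    ContinuousOn (normalDerivReal g x₁) ((𝓡∂ (m + 1)).boundary M) :=
  (hx.creg_fst.of_le (by norm_num)).continuousOn_normalDerivReal g

theorem IsProductEmbedding.measurableSet_bdryPlus (hx : IsProductEmbedding g h x₁ x') :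
    MeasurableSet (bdryPlus g x₁) :=
  (hx.continuousOn_normal.preimage_isClosed_of_isClosed isClosed_bdry isClosed_Ici).measurableSet

theorem IsProductEmbedding.measurableSet_bdryMinus (hx : IsProductEmbedding g h x₁ x') :
    MeasurableSet (bdryMinus g x₁) :=
  (hx.continuousOn_normal.preimage_isClosed_of_isClosed isClosed_bdry isClosed_Iic).measurableSet

theorem lateralMeasure_eq_restrict (g : MetricBdry m M) (T : ℝ) (B : Set M) :
    lateralMeasure g T B = (((volume : Measure ℝ).restrict (Ioo 0 T)).prod
      (surfaceMeasure g)).restrict (univ ×ˢ B) := by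
  have := isFiniteMeasure_surfaceMeasure g
  rw [lateralMeasure, ← Measure.prod_restrict, Measure.restrict_univ]

theorem integrable_lateral_abs
    (hu : ContMDiffOn (𝓘(ℝ, ℝ).prod (𝓡∂ (m + 1))) 𝓘(ℝ, ℂ) 2
      (fun z : ℝ × M => u z.1 z.2) (Icc 0 T ×ˢ univ))
    (hx : IsProductEmbedding g h x₁ x') (hT : 0 < T) : Integrable
    (fun z : ℝ × M => convWeight lam s a z.1 (x₁ z.2) ^ 2 * ‖normalDeriv g (u z.1) z.2‖ ^ 2 *
      |normalDerivReal g x₁ z.2|)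
      (((volume : Measure ℝ).restrict (Ioo 0 T)).prod (surfaceMeasure g)) := by
  refine (integrable_lateral_norm_sq (lam := lam) (s := s) (a := a) hu hx hT).abs.congr
    (Filter.Eventually.of_forall fun z => ?_)
  beta_reduce
  rw [abs_mul, abs_of_nonneg (by positivity)]

/-- The factor 2(lam - s x₁) lies between lam and 4lam. The lower bound is used where ∂_ν x₁ > 0 and
the upper one where ∂_ν x₁ < 0; where it vanishes the integrands are zero, so the overlap of the two
pieces is harmless. -/
theorem lateral_lower_bound
    (hu : ContMDiffOn (𝓘(ℝ, ℝ).prod (𝓡∂ (m + 1))) 𝓘(ℝ, ℂ) 2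
      (fun z : ℝ × M => u z.1 z.2) (Icc 0 T ×ˢ univ))
    (hx : IsProductEmbedding g h x₁ x') (hT : 0 < T)
    (hF : ∀ x, lam / 2 ≤ lam - s * x₁ x) (hF2 : ∀ x, lam - s * x₁ x ≤ 2 * lam) :
    lam * ∫ z, convWeight lam s a z.1 (x₁ z.2) ^ 2 * ‖normalDeriv g (u z.1) z.2‖ ^ 2
        * normalDerivReal g x₁ z.2 ∂(lateralMeasure g T (bdryPlus g x₁)) -
      4 * lam * ∫ z, convWeight lam s a z.1 (x₁ z.2) ^ 2 * ‖normalDeriv g (u z.1) z.2‖ ^ 2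
        * |normalDerivReal g x₁ z.2| ∂(lateralMeasure g T (bdryMinus g x₁)) ≤
      ∫ z, 2 * ((lam - s * x₁ z.2) * (convWeight lam s a z.1 (x₁ z.2) ^ 2 *
        ‖normalDeriv g (u z.1) z.2‖ ^ 2) * normalDerivReal g x₁ z.2)
        ∂(((volume : Measure ℝ).restrict (Ioo 0 T)).prod (surfaceMeasure g)) := by
  have mP : MeasurableSet ((univ : Set ℝ) ×ˢ bdryPlus g x₁) :=
    MeasurableSet.univ.prod hx.measurableSet_bdryPlus
  have mM : MeasurableSet ((univ : Set ℝ) ×ˢ bdryMinus g x₁) :=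
    MeasurableSet.univ.prod hx.measurableSet_bdryMinus
  have i1 := ((integrable_lateral_norm_sq (lam := lam) (s := s) (a := a) hu hx hT).indicator
    mP).const_mul lam
  have i2 := ((integrable_lateral_abs (lam := lam) (s := s) (a := a) hu hx hT).indicator
    mM).const_mul (4 * lam)
  rw [lateralMeasure_eq_restrict, lateralMeasure_eq_restrict, ← integral_indicator mP,
    ← integral_indicator mM, ← integral_const_mul, ← integral_const_mul, ← integral_sub i1 i2]
  refine integral_mono_ae (i1.sub i2) (integrable_lateral_norm_conv hu hx hT) ?_
  filter_upwards [ae_lateral g T] with z hz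
  have hw : 0 ≤ convWeight lam s a z.1 (x₁ z.2) ^ 2 * ‖normalDeriv g (u z.1) z.2‖ ^ 2 := by
    positivity
  set w := convWeight lam s a z.1 (x₁ z.2) ^ 2 * ‖normalDeriv g (u z.1) z.2‖ ^ 2 with hwdef
  set ν := normalDerivReal g x₁ z.2 with hν
  have h1 := hF z.2
  have h2 := hF2 z.2
  rcases lt_trichotomy ν 0 with h0 | h0 | h0
  · have nP : z ∉ (univ : Set ℝ) ×ˢ bdryPlus g x₁ := fun hh => absurd hh.2.2 (not_le.2 h0)
    have nM : z ∈ (univ : Set ℝ) ×ˢ bdryMinus g x₁ := ⟨mem_univ _, hz.2, h0.le⟩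
    simp only [indicator_of_notMem nP, indicator_of_mem nM, ← hwdef, ← hν]
    rw [abs_of_neg h0]
    have h3 : 0 ≤ w * -ν := mul_nonneg hw (by linarith)
    nlinarith
  · have nP : z ∈ (univ : Set ℝ) ×ˢ bdryPlus g x₁ := ⟨mem_univ _, hz.2, h0.ge⟩
    have nM : z ∈ (univ : Set ℝ) ×ˢ bdryMinus g x₁ := ⟨mem_univ _, hz.2, h0.le⟩
    simp only [indicator_of_mem nP, indicator_of_mem nM, ← hν, h0, abs_zero, mul_zero, sub_zero,
      le_refl]
  · have nP : z ∈ (univ : Set ℝ) ×ˢ bdryPlus g x₁ := ⟨mem_univ _, hz.2, h0.le⟩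
    have nM : z ∉ (univ : Set ℝ) ×ˢ bdryMinus g x₁ := fun hh => absurd hh.2.2 (not_le.2 h0)
    simp only [indicator_of_mem nP, indicator_of_notMem nM, ← hwdef, ← hν]
    have h3 : 0 ≤ w * ν := mul_nonneg hw h0.le
    nlinarith

end lateral

/-! ### Comparison of the convexified weight with the original one -/

section weightComparison

variable {lam s a : ℝ}

theorem convWeight_sq_eq (t r : ℝ) :
    convWeight lam s a t r ^ 2 = convWeight lam 0 a t r ^ 2 * Real.exp (s * r ^ 2) := by
  rw [convWeight, convWeight, ← Real.exp_nat_mul, ← Real.exp_nat_mul, ← Real.exp_add]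
  congr 1
  push_cast
  ring

theorem convWeight_sq_ge (hs : 0 ≤ s) (t r : ℝ) :
    convWeight lam 0 a t r ^ 2 ≤ convWeight lam s a t r ^ 2 := by
  rw [convWeight_sq_eq (s := s)]
  exact le_mul_of_one_le_right (sq_nonneg _) (Real.one_le_exp (by positivity))

/-- The two squared weights differ by the factor exp(s r²), which involves neither lam nor t; this
keeps the final constant independent of lam. -/
theorem convWeight_sq_le (hs : 0 ≤ s) {r B : ℝ} (hr : |r| ≤ B) (t : ℝ) :
    convWeight lam s a t r ^ 2 ≤ Real.exp (s * B ^ 2) * convWeight lam 0 a t r ^ 2 := by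
  rw [convWeight_sq_eq (s := s), mul_comm]
  have h1 : r ^ 2 ≤ B ^ 2 := sq_le_sq' (abs_le.1 hr).1 (abs_le.1 hr).2
  gcongr

theorem integral_weight_mono {α : Type*} [MeasurableSpace α] {μ : Measure α} {w w' f : α → ℝ}
    (hw : Integrable (fun z => w z * f z) μ) (hw' : Integrable (fun z => w' z * f z) μ)
    (hf : ∀ᵐ z ∂μ, 0 ≤ f z) (h : ∀ z, w z ≤ w' z) : ∫ z, w z * f z ∂μ ≤ ∫ z, w' z * f z ∂μ := by
  refine integral_mono_ae hw hw' ?_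
  filter_upwards [hf] with z hz
  exact mul_le_mul_of_nonneg_right (h z) hz

theorem integral_weight_mono_const {α : Type*} [MeasurableSpace α] {μ : Measure α} {w w' f : α → ℝ}
    {c : ℝ} (hw : Integrable (fun z => w z * f z) μ) (hw' : Integrable (fun z => w' z * f z) μ)
    (hf : ∀ z, 0 ≤ f z) (h : ∀ z, w z ≤ c * w' z) :
    ∫ z, w z * f z ∂μ ≤ c * ∫ z, w' z * f z ∂μ := by
  rw [← integral_const_mul]
  refine integral_mono hw (hw'.const_mul c) fun z => ?_
  exact (mul_le_mul_of_nonneg_right (h z) (hf z)).trans_eq (mul_assoc _ _ _)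

theorem expWeight_eq {M : Type*} (lam β : ℝ) (x₁ : M → ℝ) (t : ℝ) (x : M) :
    expWeight lam β x₁ t x = convWeight lam 0 (lam ^ 2 * β ^ 2) t (x₁ x) := by
  rw [expWeight, convWeight]
  congr 1
  ring

end weightComparison

/-! ### Absorption and conclusion -/

section main

variable {m : ℕ} {M : Type*} [TopologicalSpace M] [ChartedSpace (EuclideanHalfSpace (m + 1)) M]
  [IsManifold (𝓡∂ (m + 1)) ∞ M] [CompactSpace M] [MeasurableSpace M] [BorelSpace M]
  {N : Type*} [TopologicalSpace N] [ChartedSpace (Euc m) N] [IsManifold (𝓡 m) ∞ N]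
  {g : MetricBdry m M} {h : MetricNoBdry m N} {x₁ : M → ℝ} {x' : M → N}
  {T lam s a : ℝ} {A : ℝ → (x : M) → CCovector (m := m) x} {D q u : ℝ → M → ℂ}

/-- A function vanishing on the open lateral boundary vanishes on its closure. -/
theorem eq_zero_boundary_of_Ioo
    (hu : ContMDiffOn (𝓘(ℝ, ℝ).prod (𝓡∂ (m + 1))) 𝓘(ℝ, ℂ) 2
      (fun z : ℝ × M => u z.1 z.2) (Icc 0 T ×ˢ univ)) (hT : 0 < T)
    (hub : ∀ t ∈ Ioo 0 T, ∀ x ∈ (𝓡∂ (m + 1)).boundary M, u t x = 0) :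
    ∀ t ∈ Icc 0 T, ∀ x ∈ (𝓡∂ (m + 1)).boundary M, u t x = 0 := by
  intro t ht x hx
  have h1 : ContinuousOn (fun t => u t x) (Icc 0 T) :=
    hu.continuousOn.comp (f := fun t => (t, x)) (by fun_prop) fun t ht => ⟨ht, mem_univ _⟩
  have h2 : EqOn (fun t => u t x) (fun _ => 0) (closure (Ioo 0 T)) :=
    EqOn.of_subset_closure (s := Ioo 0 T) (fun t ht => hub t ht x hx)
      (by rwa [closure_Ioo hT.ne]) continuousOn_const subset_closure subset_rfl
  rw [closure_Ioo hT.ne] at h2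
  exact h2 ht

/-- The Carleman estimate for the convection-diffusion operator with the convexified weight. -/
theorem carleman_convDiff [T2Space M] (hx : IsProductEmbedding g h x₁ x') (hT : 0 < T)
    (hA : IsLInftyOneForm g T A)
    (hD : MemLp (fun z : ℝ × M => D z.1 z.2) ⊤ (cylMeasure g T))
    (hq : MemLp (fun z : ℝ × M => q z.1 z.2) ⊤ (cylMeasure g T))
    {K : ℝ} (hK0 : 0 ≤ K) (hK : ∀ᵐ z ∂(cylMeasure g T), ∀ u : ℝ → M → ℂ,
      ‖convDiff g A D q u z.1 z.2 - (deriv (fun s => u s z.2) z.1 - laplaceBeltrami g (u z.1) z.2)‖ ^ 2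
        ≤ K * (covNormSq g z.2 (dC (m := m) (u z.1) z.2) + ‖u z.1 z.2‖ ^ 2))
    (hu : ContMDiffOn (𝓘(ℝ, ℝ).prod (𝓡∂ (m + 1))) 𝓘(ℝ, ℂ) 2
      (fun z : ℝ × M => u z.1 z.2) (Icc 0 T ×ˢ univ))
    (hu0 : ∀ x, u 0 x = 0)
    (hub : ∀ t ∈ Ioo 0 T, ∀ x ∈ (𝓡∂ (m + 1)).boundary M, u t x = 0)
    (hlam : 1 ≤ lam) (hs : s = 128 * (2 * K + 1)) (hs4 : s ≤ 4 * lam ^ 2) (ha : 0 ≤ a)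
    (hF : ∀ x, lam / 2 ≤ lam - s * x₁ x) (hF2 : ∀ x, lam - s * x₁ x ≤ 2 * lam) :
    ∫ x, convWeight lam s a T (x₁ x) ^ 2 * covNormSq g x (dC (m := m) (u T) x)
        ∂(volumeMeasure g) +
      2 * (∫ z, convWeight lam s a z.1 (x₁ z.2) ^ 2 *
        covNormSq g z.2 (dC (m := m) (u z.1) z.2) ∂(cylMeasure g T)) +
      2 * lam ^ 2 * (∫ z, convWeight lam s a z.1 (x₁ z.2) ^ 2 * ‖u z.1 z.2‖ ^ 2 ∂(cylMeasure g T)) +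
      2 * lam * (∫ z, convWeight lam s a z.1 (x₁ z.2) ^ 2 * ‖normalDeriv g (u z.1) z.2‖ ^ 2
        * normalDerivReal g x₁ z.2 ∂(lateralMeasure g T (bdryPlus g x₁))) ≤
    4 * (∫ z, convWeight lam s a z.1 (x₁ z.2) ^ 2 * ‖convDiff g A D q u z.1 z.2‖ ^ 2
        ∂(cylMeasure g T)) +
      16 * lam ^ 2 * (∫ x, convWeight lam s a T (x₁ x) ^ 2 * ‖u T x‖ ^ 2 ∂(volumeMeasure g)) +
      8 * lam * (∫ z, convWeight lam s a z.1 (x₁ z.2) ^ 2 * ‖normalDeriv g (u z.1) z.2‖ ^ 2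
        * |normalDerivReal g x₁ z.2| ∂(lateralMeasure g T (bdryMinus g x₁))) := by
  have k1 := carleman_heat_complex hu hx hT hu0 (eq_zero_boundary_of_Ioo hu hT hub)
    (zero_lt_one.trans_le hlam) (by rw [hs]; positivity) hs4 ha hF hF2
  have k2 := integral_heat_le (lam := lam) (s := s) (a := a) hx hT hA hD hq hK hu
  have k3 := lateral_lower_bound (a := a) hu hx hT hF hF2
  have k4 : 0 ≤ ∫ z, convWeight lam s a z.1 (x₁ z.2) ^ 2 * ‖u z.1 z.2‖ ^ 2 ∂(cylMeasure g T) :=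
    integral_nonneg fun z => by positivity
  -- The value of s is chosen for this. Against the loss 2K, the gradient keeps coefficient (2K + 1)
  -- - 2K = 1, and |u|² keeps (2K + 1)lam² - 2K ≥ lam² because lam ≥ 1.
  have k5 : s / 128 = 2 * K + 1 := by rw [hs]; ring
  rw [k5] at k1
  have k6 : 1 ≤ lam ^ 2 := one_le_pow₀ hlam
  have k7 := mul_nonneg (mul_nonneg hK0 (sub_nonneg.2 k6)) k4
  linarith

theorem exists_abs_le_of_continuous {f : M → ℝ} (hf : Continuous f) :
    ∃ B : ℝ, 0 ≤ B ∧ ∀ x, |f x| ≤ B := by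
  obtain ⟨B, hB⟩ := isCompact_univ.exists_bound_of_continuousOn hf.continuousOn
  exact ⟨max B 0, le_max_right _ _, fun x => (hB x (mem_univ x)).trans (le_max_left _ _)⟩

end main

end CarlemanParabolic
end

open CarlemanParabolic in
theorem theorem2p1 {m : ℕ} (hm : 1 ≤ m)
    {M : Type*} [TopologicalSpace M] [ChartedSpace (EuclideanHalfSpace (m + 1)) M]
    [IsManifold (𝓡∂ (m + 1)) ∞ M] [CompactSpace M] [T2Space M]
    [MeasurableSpace M] [BorelSpace M]
    {N : Type*} [TopologicalSpace N] [ChartedSpace (Euc m) N] [IsManifold (𝓡 m) ∞ N]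
    [T2Space N] [SecondCountableTopology N]
    (g : MetricBdry m M) (h : MetricNoBdry m N) (x₁ : M → ℝ) (x' : M → N)
    (hx : IsProductEmbedding g h x₁ x')
    (T : ℝ) (hT : 0 < T)
    (A : ℝ → (x : M) → CCovector (m := m) x) (hA : IsLInftyOneForm g T A)
    (D : ℝ → M → ℂ) (hD : MemLp (fun z : ℝ × M => D z.1 z.2) ⊤ (cylMeasure g T))
    (hAD : IsWeakDivergence g T A D)
    (q : ℝ → M → ℂ) (hq : MemLp (fun z : ℝ × M => q z.1 z.2) ⊤ (cylMeasure g T)) :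
    ∃ C : ℝ, 0 < C ∧ ∀ β ∈ Ioo (1 / √3) (1 : ℝ), ∃ lam₀ : ℝ, 0 < lam₀ ∧ ∀ lam ≥ lam₀,
      ∀ u : ℝ → M → ℂ,
        ContMDiffOn (𝓘(ℝ, ℝ).prod (𝓡∂ (m + 1))) 𝓘(ℝ, ℂ) 2 (fun z : ℝ × M => u z.1 z.2)
          (Icc 0 T ×ˢ univ) →
        (∀ x, u 0 x = 0) →
        (∀ t ∈ Ioo 0 T, ∀ x ∈ (𝓡∂ (m + 1)).boundary M, u t x = 0) →
        lam ^ 2 * (∫ z, expWeight lam β x₁ z.1 z.2 ^ 2 * ‖u z.1 z.2‖ ^ 2 ∂(cylMeasure g T))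
          + (∫ x, expWeight lam β x₁ T x ^ 2 * covNormSq g x (dC (u T) x) ∂(volumeMeasure g))
          + (∫ z, expWeight lam β x₁ z.1 z.2 ^ 2 * covNormSq g z.2 (dC (u z.1) z.2)
              ∂(cylMeasure g T))
          + lam * (∫ z, expWeight lam β x₁ z.1 z.2 ^ 2 * ‖normalDeriv g (u z.1) z.2‖ ^ 2
              * normalDerivReal g x₁ z.2 ∂(lateralMeasure g T (bdryPlus g x₁)))
        ≤ C * ((∫ z, expWeight lam β x₁ z.1 z.2 ^ 2 * ‖convDiff g A D q u z.1 z.2‖ ^ 2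
              ∂(cylMeasure g T))
          + lam ^ 2 * C * (∫ x, expWeight lam β x₁ T x ^ 2 * ‖u T x‖ ^ 2 ∂(volumeMeasure g))
          + lam * (∫ z, expWeight lam β x₁ z.1 z.2 ^ 2 * ‖normalDeriv g (u z.1) z.2‖ ^ 2
              * |normalDerivReal g x₁ z.2| ∂(lateralMeasure g T (bdryMinus g x₁)))) := by
  obtain ⟨B, hB0, hB⟩ := exists_abs_le_of_continuous hx.creg_fst.continuous
  obtain ⟨K, hK0, hK⟩ := exists_lowerOrder_bound hA hD hq
  obtain ⟨s, hs⟩ : ∃ s, s = 128 * (2 * K + 1) := ⟨_, rfl⟩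
  have hs0 : 0 < s := by rw [hs]; positivity
  obtain ⟨Θ, hΘ⟩ : ∃ Θ, Θ = Real.exp (s * B ^ 2) := ⟨_, rfl⟩
  have hΘ1 : 1 ≤ Θ := by rw [hΘ]; exact Real.one_le_exp (by positivity)
  have hsB : 0 ≤ s * B := by positivity
  -- The factor 16 is the largest of the constants 4, 16 and 8 in `carleman_convDiff`. The threshold
  -- gives at once lam ≥ 1, s ≤ 4lam² and |s x₁| ≤ lam/2, so that lam - s x₁ lies between lam/2 and
  -- 2lam.
  refine ⟨16 * Θ, by positivity, fun β _ => ⟨1 + s + 2 * (s * B), by positivity, ?_⟩⟩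
  intro lam hlam u hu hu0 hub
  have hl1 : 1 ≤ lam := by linarith
  have hsx : ∀ x, |s * x₁ x| ≤ lam / 2 := fun x => by
    rw [abs_mul, abs_of_pos hs0]
    have := mul_le_mul_of_nonneg_left (hB x) hs0.le
    linarith
  have key := carleman_convDiff (a := lam ^ 2 * β ^ 2) hx hT hA hD hq hK0 hK hu hu0 hub hl1 hs
    (by nlinarith) (by positivity) (fun x => by linarith [(abs_le.1 (hsx x)).2])
    (fun x => by linarith [(abs_le.1 (hsx x)).1])
  -- The original weight is the member s = 0 of the family, so the same integrability lemmas serve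
  -- both weights.
  simp only [expWeight_eq]
  have wge := fun t r => convWeight_sq_ge (lam := lam) (a := lam ^ 2 * β ^ 2) hs0.le t r
  have wle : ∀ t x, convWeight lam s (lam ^ 2 * β ^ 2) t (x₁ x) ^ 2 ≤
      Θ * convWeight lam 0 (lam ^ 2 * β ^ 2) t (x₁ x) ^ 2 := fun t x => by
    rw [hΘ]; exact convWeight_sq_le hs0.le (hB x) t
  -- Terms on the left-hand side only decrease when the convexified weight is replaced by the
  -- original one. Terms on the right (`c5`, `c6`, `c7`) increase at most by the factor Θ.
  have c1 := integral_weight_mono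
    (integrable_final_covNormSq (lam := lam) (s := 0) (a := lam ^ 2 * β ^ 2) hu hx hT)
    (integrable_final_covNormSq (lam := lam) (s := s) (a := lam ^ 2 * β ^ 2) hu hx hT)
    (Filter.Eventually.of_forall fun x => covNormSq_nonneg g x _) fun x => wge T (x₁ x)
  have c2 := integral_weight_mono
    (integrable_cyl_covNormSq (lam := lam) (s := 0) (a := lam ^ 2 * β ^ 2) hu hx hT)
    (integrable_cyl_covNormSq (lam := lam) (s := s) (a := lam ^ 2 * β ^ 2) hu hx hT)
    (Filter.Eventually.of_forall fun z => covNormSq_nonneg g z.2 _) fun z => wge z.1 (x₁ z.2)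
  have c3 := integral_weight_mono
    (integrable_cyl_norm_sq (g := g) (lam := lam) (s := 0) (a := lam ^ 2 * β ^ 2) hu hx)
    (integrable_cyl_norm_sq (g := g) (lam := lam) (s := s) (a := lam ^ 2 * β ^ 2) hu hx)
    (Filter.Eventually.of_forall fun z => sq_nonneg _) fun z => wge z.1 (x₁ z.2)
  have iP := fun s => (integrable_lateral_norm_sq (lam := lam) (s := s) (a := lam ^ 2 * β ^ 2)
    hu hx hT).mono_measure (Measure.restrict_le_self (s := univ ×ˢ bdryPlus g x₁))
  have iN := fun s => (integrable_lateral_abs (lam := lam) (s := s) (a := lam ^ 2 * β ^ 2)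
    hu hx hT).mono_measure (Measure.restrict_le_self (s := univ ×ˢ bdryMinus g x₁))
  simp only [← lateralMeasure_eq_restrict, mul_assoc] at iP iN
  have hP : ∀ᵐ z ∂(lateralMeasure g T (bdryPlus g x₁)), 0 ≤ normalDerivReal g x₁ z.2 := by
    rw [lateralMeasure_eq_restrict]
    filter_upwards [ae_restrict_mem (MeasurableSet.univ.prod hx.measurableSet_bdryPlus)] with z hz
    exact hz.2.2
  have c4 := integral_weight_mono (iP 0) (iP s)
    (hP.mono fun z hz => mul_nonneg (sq_nonneg _) hz) fun z => wge z.1 (x₁ z.2)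
  have c5 := integral_weight_mono_const
    (integrable_cyl_convDiff (lam := lam) (s := s) (a := lam ^ 2 * β ^ 2) hx hT hA hD hq hu)
    (integrable_cyl_convDiff (lam := lam) (s := 0) (a := lam ^ 2 * β ^ 2) hx hT hA hD hq hu)
    (fun z => sq_nonneg _) fun z => wle z.1 z.2
  have c6 := integral_weight_mono_const
    (integrable_final_norm_sq (g := g) (lam := lam) (s := s) (a := lam ^ 2 * β ^ 2) hu hx hT)
    (integrable_final_norm_sq (g := g) (lam := lam) (s := 0) (a := lam ^ 2 * β ^ 2) hu hx hT)
    (fun z => sq_nonneg _) fun x => wle T x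
  have c7 := integral_weight_mono_const (iN s) (iN 0)
    (fun z => mul_nonneg (sq_nonneg _) (abs_nonneg _)) fun z => wle z.1 z.2
  have n1 : 0 ≤ ∫ z, convWeight lam 0 (lam ^ 2 * β ^ 2) z.1 (x₁ z.2) ^ 2 *
      ‖convDiff g A D q u z.1 z.2‖ ^ 2 ∂(cylMeasure g T) :=
    integral_nonneg fun z => by positivity
  have n2 : 0 ≤ ∫ x, convWeight lam 0 (lam ^ 2 * β ^ 2) T (x₁ x) ^ 2 * ‖u T x‖ ^ 2
      ∂(volumeMeasure g) := integral_nonneg fun z => by positivity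
  have n3 : 0 ≤ ∫ z, convWeight lam 0 (lam ^ 2 * β ^ 2) z.1 (x₁ z.2) ^ 2 *
      (‖normalDeriv g (u z.1) z.2‖ ^ 2 * |normalDerivReal g x₁ z.2|)
      ∂(lateralMeasure g T (bdryMinus g x₁)) := integral_nonneg fun z => by positivity
  have n4 : 0 ≤ ∫ z, convWeight lam 0 (lam ^ 2 * β ^ 2) z.1 (x₁ z.2) ^ 2 *
      covNormSq g z.2 (dC (m := m) (u z.1) z.2) ∂(cylMeasure g T) :=
    integral_nonneg fun z => mul_nonneg (sq_nonneg _) (covNormSq_nonneg g z.2 _)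
  have n5 : 0 ≤ ∫ z, convWeight lam 0 (lam ^ 2 * β ^ 2) z.1 (x₁ z.2) ^ 2 * ‖u z.1 z.2‖ ^ 2
      ∂(cylMeasure g T) := integral_nonneg fun z => by positivity
  have n6 : 0 ≤ ∫ z, convWeight lam 0 (lam ^ 2 * β ^ 2) z.1 (x₁ z.2) ^ 2 *
      (‖normalDeriv g (u z.1) z.2‖ ^ 2 * normalDerivReal g x₁ z.2)
      ∂(lateralMeasure g T (bdryPlus g x₁)) := integral_nonneg_of_ae
    (hP.mono fun z hz => mul_nonneg (sq_nonneg _) (mul_nonneg (sq_nonneg _) hz))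
  simp only [mul_assoc] at key ⊢
  generalize ∫ z, convWeight lam 0 (lam ^ 2 * β ^ 2) z.1 (x₁ z.2) ^ 2 *
      ‖convDiff g A D q u z.1 z.2‖ ^ 2 ∂(cylMeasure g T) = L at *
  generalize ∫ x, convWeight lam 0 (lam ^ 2 * β ^ 2) T (x₁ x) ^ 2 * ‖u T x‖ ^ 2
      ∂(volumeMeasure g) = U at *
  generalize ∫ z, convWeight lam 0 (lam ^ 2 * β ^ 2) z.1 (x₁ z.2) ^ 2 *
      (‖normalDeriv g (u z.1) z.2‖ ^ 2 * |normalDerivReal g x₁ z.2|)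
      ∂(lateralMeasure g T (bdryMinus g x₁)) = J at *
  have hl0 : 0 < lam := by linarith
  have d1 := mul_le_mul_of_nonneg_left c6 (sq_nonneg lam)
  have d2 := mul_le_mul_of_nonneg_left c7 hl0.le
  have d3 := mul_le_mul_of_nonneg_left c3 (sq_nonneg lam)
  have d4 := mul_le_mul_of_nonneg_left c4 hl0.le
  have d5 := mul_nonneg (sq_nonneg lam) n5
  have d6 := mul_nonneg hl0.le n6
  have d7 : 0 ≤ Θ * L := by positivity
  have d8 : 0 ≤ Θ * (lam * J) := by positivity
  -- The constant enters squared in front of the final-time term, and Θ ≥ 1 gives Θ ≤ Θ².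
  have d9 : Θ * (lam ^ 2 * U) ≤ Θ * (Θ * (lam ^ 2 * U)) := by
    have : 0 ≤ Θ * (lam ^ 2 * U) := by positivity
    nlinarith
  have d10 : 0 ≤ Θ * (lam ^ 2 * U) := by positivity
  nlinarith
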